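/- Let $(d;\omega)\in\{(5;1,1,1,1,1),\ (6;2,1,1,1,1),\ (8;4,1,1,1,1),\ (10;5,2,1,1,1)\}$; these are the data of the mirror Calabi–Yau families $Y(d)$, $Y(5)$ being the mirror quintic. Let $a\in\mathbb C$ be a parameter and write $\partial_{\tilde\rho}=\frac1{2\pi i}\frac{\partial}{\partial\rho}$. For $d=5,6,8,10$ respectively put $K_d=5,3,2,1$, $C_d=50,42,44,34$, conifold point $x_c=\frac1{5^5},\frac1{2^43^6},\frac1{2^{16}},\frac1{2^85^5}$, $\mu=5,9,16,80$ and $J=\{1,2,3,4\},\{1,2,4,5\},\{1,3,5,7\},\{1,3,7,9\}$. **Periods.** For $|x|<x_c$ let $w(x,\rho)=\sum_{n\ge0}\frac{\Gamma(1+d(n+\rho))}{\prod_{i=1}^5\Gamma(1+\omega_i(n+\rho))}x^{n+\rho}$ and let $\Pi(x)=(\Pi_{\gamma_1},\dots,\Pi_{\gamma_4})$ be the row vector $$\Big(w,\ \partial_{\tilde\rho}w,\ \big(\tfrac{K_d}{2}\partial_{\tilde\rho}^2+a\,\partial_{\tilde\rho}\big)w,\ \big(-\tfrac{K_d}{3!}\partial_{\tilde\rho}^3-\tfrac{C_d}{12}\partial_{\tilde\rho}\big)w\Big)\Big|_{\rho=0},$$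 with $\log x$ real on $(0,x_c)$. Let $M_0$ and $M_{Con}$ be its monodromy matrices: for any base point $x_0\in(0,x_c)$, analytic continuation along the counter-clockwise circle through $x_0$ about $0$ (respectively about $x_c$) turns $\Pi$ into $\Pi M_0$ (respectively $\Pi M_{Con}$). **Formal solutions.** Consider, on the universal cover of $\mathbb C^*$, the Laplace-transformed Picard–Fuchs equation $\{z(\theta_z+1)^3+\mu\prod_{j\in J}(d\,\theta_z+j)\}F(z)=0$, $\theta_z=z\frac{d}{dz}$. With $G(z,\rho)=\sum_{n\ge0}\frac{\Gamma(1+d(n+\rho))}{\prod_{i=1}^4\Gamma(1+\omega_i(n+\rho))}z^{-(n+\rho+1)}$, let $\Psi=(g_1,g_2,g_3,g_4)$ be the row of formal solutions at $z=\infty$ given by $g_1=G$, $g_2=\partial_{\tilde\rho}G$, $g_3=(\frac{K_d}2\partial_{\tilde\rho}^2+a\,\partial_{\tilde\rho})G$ at $\rho=0$ and by the unique formal solution $g_4=\frac{\sqrt{K_d}}{2\pi i\,x_c}e^{-x_cz}z^{-2}(1+\frac{C_1}{z}+\frac{C_2}{z^2}+\cdots)$. Let $L$ be the matrix with $\Psi(e^{-2\pi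 i}z)=\Psi(z)L$. Explicitly, with $b=\frac52,\frac32,1,\frac12$ for $d=5,6,8,10$, $$L=\begin{pmatrix}1&1&a+b&0\\0&1&K_d&0\\0&0&1&0\\0&0&0&1\end{pmatrix}.$$ **Holomorphic solutions.** Put $\alpha=e^{2\pi i/d}$, $\alpha^s=e^{2\pi is/d}$, $\rho_k=-k/d$ and $\phi_k(z)=\sum_{n\ge0}c(n+\rho_k)(-1)^nz^{n+\rho_k}$, where $c(s)$ is, for $d=5,6,8,10$ respectively, $$\tfrac{\Gamma(1+s)^3\Gamma(2+s)}{\Gamma(6+5s)},\quad \tfrac{\Gamma(1+s)^3\Gamma(3+2s)}{\Gamma(7+6s)},\quad \tfrac{\Gamma(1+s)^3\Gamma(5+4s)}{\Gamma(9+8s)},\quad \tfrac{\Gamma(1+s)^2\Gamma(2+2s)\Gamma(6+5s)}{\Gamma(11+10s)}.$$ Let $\hat w_m(z)=(1-\alpha)\sum_{k=1}^{d-1}\prod_{i=1}^3(1-\alpha^{\omega_ik})\,\alpha^{km+\frac12(k-1)}\phi_{d-k}(z)$ and $(f_1,f_2,f_3,f_4)=c_N(\hat w_0,\hat w_1,\hat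 w_2,\hat w_{d-1})N$ with a constant $c_N$ and $N$ equal, for $d=5,6,8,10$ respectively, to $$\begin{pmatrix}1&-\frac25&-\frac{2a}5-2&1\\0&\frac25&\frac{2a}5-2&-1\\0&\frac15&\frac a5-\frac12&0\\0&-\frac15&-\frac a5-\frac12&0\end{pmatrix},\ \begin{pmatrix}1&-\frac13&-\frac a3-\frac32&1\\0&\frac13&\frac a3-\frac32&-1\\0&\frac13&\frac a3-\frac12&0\\0&-\frac13&-\frac a3-\frac12&0\end{pmatrix},\ \begin{pmatrix}1&-\frac12&-\frac{a+3}2&1\\0&\frac12&\frac{a-3}2&-1\\0&\frac12&\frac{a-1}2&0\\0&-\frac12&-\frac{a+1}2&0\end{pmatrix},\ \begin{pmatrix}1&0&-1&1\\0&0&-1&-1\\0&1&a-\frac12&0\\0&-1&-a-\frac12&0\end{pmatrix}.$$ With $z_s=e^{-s\pi i}z$ let $\Phi_{l+m\pi}(z)=(f_1(z_m),f_2(z_m),f_3(z_m),f_4(z_m))L^{-m/2}$ for even $m\in\mathbb Z$ and $\Phi_{l+m\pi}(z)=(f_1(z_{m-1}),f_2(z_{m-1}),f_3(z_{m-1}),f_4(e^{-2\pi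 i}z_{m-1}))L^{-(m-1)/2}$ for odd $m$. Let $\Xi_{l+m\pi}=\{-\frac\pi2+m\pi<\arg z<\frac{3\pi}2+m\pi\}$. **Proposition.** There is a constant $c_N$ such that, for every $m\in\mathbb Z$, the entries of $\Phi_{l+m\pi}$ are holomorphic solutions of the Laplace-transformed equation and $\Phi_{l+m\pi}(z)\sim\Psi(z)$ as $z\to\infty$ in $\Xi_{l+m\pi}$ (uniformly on closed subsectors, to all orders). The Stokes matrices, that is, the matrices $K_{\overline R},K_R$ with $$\Phi_{l+(2k+1)\pi}=\Phi_{l+2k\pi}\,L^kK_{\overline R}L^{-k},\qquad \Phi_{l+(2k+2)\pi}=\Phi_{l+(2k+1)\pi}\,L^{k+1}K_RL^{-k-1}\qquad(k\in\mathbb Z)$$ on $\Xi_{l+(2k+1)\pi}\cap\Xi_{l+2k\pi}$ and $\Xi_{l+(2k+2)\pi}\cap\Xi_{l+(2k+1)\pi}$ respectively, exist and are unique; they are, with $e=5,4,4,3$ for $d=5,6,8,10$, $$K_{\overline R}=\begin{pmatrix}1&0&0&-e\\0&1&0&a-b\\0&0&1&-1\\0&0&0&1\end{pmatrix},\qquad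 K_R=\begin{pmatrix}1&0&0&0\\0&1&0&0\\0&0&1&0\\1&0&0&1\end{pmatrix}.$$ The monodromy matrices $M_0$ and $M_{Con}$ exist, are unique and do not depend on $x_0$, and $$K_R=M_{Con},\qquad K_{\overline R}\,L=M_0 .$$ -/

import Mathlib

open Filter Topology Asymptotics
open scoped Matrix

noncomputable section

/-- The four one-parameter families `Y(d)`, `d = 5, 6, 8, 10`, of mirror Calabi-Yau
hypersurfaces; `Y(5)` is the mirror quintic. -/
inductive CYFamily
  | Y5
  | Y6
  | Y8
  | Y10

namespace CYFamily

/-! ### Numerical data -/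

/-- The degree `d`. -/
def degree : CYFamily → ℕ
  | Y5 => 5
  | Y6 => 6
  | Y8 => 8
  | Y10 => 10

/-- The weights `ω₁, …, ω₅`. -/
def weight : CYFamily → Fin 5 → ℕ
  | Y5 => ![1, 1, 1, 1, 1]
  | Y6 => ![2, 1, 1, 1, 1]
  | Y8 => ![4, 1, 1, 1, 1]
  | Y10 => ![5, 2, 1, 1, 1]

/-- The number `K_d`. -/
def cubic : CYFamily → ℕ
  | Y5 => 5
  | Y6 => 3
  | Y8 => 2
  | Y10 => 1

/-- The number `C_d`. -/
def chern : CYFamily → ℕ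
  | Y5 => 50
  | Y6 => 42
  | Y8 => 44
  | Y10 => 34

/-- The conifold point `x_c`. -/
def conifold : CYFamily → ℝ
  | Y5 => 1 / 5 ^ 5
  | Y6 => 1 / (2 ^ 4 * 3 ^ 6)
  | Y8 => 1 / 2 ^ 16
  | Y10 => 1 / (2 ^ 8 * 5 ^ 5)

/-- The constant `μ` in the Laplace-transformed equation
`{ z (θ + 1) ^ 3 + μ ∏ⱼ (d θ + j) } F = 0`. -/
def prefactor : CYFamily → ℕ
  | Y5 => 5
  | Y6 => 9
  | Y8 => 16
  | Y10 => 80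

/-- The numbers `j` in the Laplace-transformed equation
`{ z (θ + 1) ^ 3 + μ ∏ⱼ (d θ + j) } F = 0`. -/
def residues : CYFamily → List ℕ
  | Y5 => [1, 2, 3, 4]
  | Y6 => [1, 2, 4, 5]
  | Y8 => [1, 3, 5, 7]
  | Y10 => [1, 3, 7, 9]

/-! ### The period vector `Π(x)`

A function on the universal cover of `ℂ \ {0}` is written as a function of the logarithm of the
variable: `ξ = log x`, `ζ = log z`. -/

/-- `(∂ / ∂ρ̃) ^ j f` at `ρ = 0`, where `∂ / ∂ρ̃ = (2πi)⁻¹ ∂ / ∂ρ`. -/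
def dRho (j : ℕ) (f : ℂ → ℂ) : ℂ :=
  iteratedDeriv j f 0 / (2 * Real.pi * Complex.I) ^ j

/-- `w(x, ρ) = ∑ₙ Γ(1 + d(n+ρ)) / ∏ᵢ Γ(1 + ωᵢ(n+ρ)) x ^ (n+ρ)`, with `x = exp ξ`. -/
def hyperW (Y : CYFamily) (ξ ρ : ℂ) : ℂ :=
  ∑' n : ℕ, Complex.Gamma (1 + Y.degree * (n + ρ)) /
    (∏ i : Fin 5, Complex.Gamma (1 + Y.weight i * (n + ρ))) * Complex.exp ((n + ρ) * ξ)

/-- The row vector `Π(x) = (Π_γ₁(x), …, Π_γ₄(x))`, with `x = exp ξ` and `|x| < x_c`. -/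
def periodsLog (Y : CYFamily) (a : ℂ) (ξ : ℂ) : Fin 4 → ℂ :=
  ![Y.hyperW ξ 0,
    dRho 1 (Y.hyperW ξ),
    (Y.cubic : ℂ) / 2 * dRho 2 (Y.hyperW ξ) + a * dRho 1 (Y.hyperW ξ),
    -((Y.cubic : ℂ) / 6) * dRho 3 (Y.hyperW ξ) - (Y.chern : ℂ) / 12 * dRho 1 (Y.hyperW ξ)]

/-- The branch of `Π(x)` with the principal logarithm (real on `0 < x < x_c`). -/
def periods (Y : CYFamily) (a : ℂ) (x : ℂ) : Fin 4 → ℂ :=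
  Y.periodsLog a (Complex.log x)

/-! ### The Laplace-transformed equation and its formal solutions at `z = ∞` -/

/-- The operator `p θ_z + q` in the coordinate `ζ = log z`, where `θ_z = d / dζ`. -/
def eulerOp (p q : ℂ) (F : ℂ → ℂ) : ℂ → ℂ :=
  fun ζ => p * deriv F ζ + q * F ζ

/-- `F` is a holomorphic solution of `{ z (θ + 1) ^ 3 + μ ∏ⱼ (d θ + j) } F = 0` on the universal
cover of `ℂ \ {0}`. -/
def IsLaplaceSolution (Y : CYFamily) (F : ℂ → ℂ) : Prop :=
  Differentiable ℂ F ∧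
  ∀ ζ : ℂ, Complex.exp ζ * ((eulerOp 1 1)^[3] F) ζ +
    Y.prefactor * (Y.residues.foldr (fun (j : ℕ) G => eulerOp Y.degree j G) F) ζ = 0

/-- The operator `p θ_z + q` conjugated by `exp (-x_c z)`, that is `p θ_z - p x_c z + q`, acting on
a formal series `∑ₑ h(e) z ^ e`. -/
def conjOp (Y : CYFamily) (p q : ℂ) (h : ℤ → ℂ) : ℤ → ℂ :=
  fun e => (p * e + q) * h e - p * Y.conifold * h (e - 1)

/-- The coefficients of `z ^ (-2) (C₀ + C₁ / z + C₂ / z ^ 2 + ⋯)`. -/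
def tailSeries (C : ℕ → ℂ) : ℤ → ℂ :=
  fun e => if e ≤ -2 then C (-2 - e).toNat else 0

/-- `exp (-x_c z) z ^ (-2) (1 + C₁ / z + C₂ / z ^ 2 + ⋯)` is a formal solution of the
Laplace-transformed equation. -/
def IsConifoldSeries (Y : CYFamily) (C : ℕ → ℂ) : Prop :=
  C 0 = 1 ∧
  ∀ e : ℤ, ((Y.conjOp 1 1)^[3] (tailSeries C)) (e - 1) +
    Y.prefactor * (Y.residues.foldr (fun (j : ℕ) G => Y.conjOp Y.degree j G) (tailSeries C)) e = 0

/-- The `n`-th term of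
`G(z, ρ) = ∑ₙ Γ(1 + d(n+ρ)) / ∏_{i ≤ 4} Γ(1 + ωᵢ(n+ρ)) z ^ (-(n+ρ+1))`, with `z = exp ζ`. -/
def hyperGTerm (Y : CYFamily) (n : ℕ) (ζ ρ : ℂ) : ℂ :=
  Complex.Gamma (1 + Y.degree * (n + ρ)) /
    (∏ i : Fin 4, Complex.Gamma (1 + Y.weight i.castSucc * (n + ρ))) *
    Complex.exp (-(n + ρ + 1) * ζ)

/-- The `n`-th terms of the formal solutions `Ψ(z) = (g₁(z), g₂(z), g₃(z), g₄(z))`, with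
`z = exp ζ`; here `g₄ = √K_d / (2πi x_c) exp (-x_c z) z ^ (-2) (1 + C₁ / z + ⋯)`. -/
def psiTerm (Y : CYFamily) (a : ℂ) (C : ℕ → ℂ) (n : ℕ) (ζ : ℂ) : Fin 4 → ℂ :=
  ![Y.hyperGTerm n ζ 0,
    dRho 1 (Y.hyperGTerm n ζ),
    (Y.cubic : ℂ) / 2 * dRho 2 (Y.hyperGTerm n ζ) + a * dRho 1 (Y.hyperGTerm n ζ),
    (Real.sqrt Y.cubic : ℂ) / (2 * Real.pi * Complex.I * Y.conifold) *
      Complex.exp (-Y.conifold * Complex.exp ζ) * (C n * Complex.exp (-(2 + n) * ζ))]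

/-- `L` is the monodromy of the formal solutions: `Ψ(e^{-2πi} z) = Ψ(z) L`, term by term. -/
def IsFormalMonodromy (Y : CYFamily) (a : ℂ) (C : ℕ → ℂ) (L : Matrix (Fin 4) (Fin 4) ℂ) : Prop :=
  ∀ (n : ℕ) (ζ : ℂ),
    Y.psiTerm a C n (ζ - 2 * Real.pi * Complex.I) = Y.psiTerm a C n ζ ᵥ* L

/-- The angular region `Ξ_{l+mπ} = Ξ(-π/2 + mπ, 3π/2 + mπ)` on the universal cover. -/
def angularRegion (m : ℤ) : Set ℂ :=
  {ζ | -(Real.pi / 2) + m * Real.pi < ζ.im ∧ ζ.im < 3 * Real.pi / 2 + m * Real.pi}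

/-- The filter `z → ∞` in the closed sector `α ≤ arg z ≤ β`. -/
def sectorAtInfinity (α β : ℝ) : Filter ℂ :=
  comap Complex.re atTop ⊓ 𝓟 {ζ | α ≤ ζ.im ∧ ζ.im ≤ β}

/-- `F(z) ∼ Ψ(z)` as `z → ∞` in `Ξ_{l+mπ}`: on every closed subsector, for each `N`, the error of
the first `N` terms is `o(z ^ (-N))` for `g₁, g₂, g₃` (whose `n`-th terms are `z ^ (-n-1)` times a
polynomial in `log z`) and `o(exp (-x_c z) z ^ (-N-1))` for `g₄`. -/
def IsAsymptoticTo (Y : CYFamily) (a : ℂ) (C : ℕ → ℂ) (m : ℤ) (F : ℂ → Fin 4 → ℂ) : Prop :=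
  ∀ α β : ℝ, -(Real.pi / 2) + m * Real.pi < α → α ≤ β → β < 3 * Real.pi / 2 + m * Real.pi →
    ∀ N : ℕ,
      (∀ k : Fin 4, k ≠ 3 →
        (fun ζ => F ζ k - ∑ n ∈ Finset.range N, Y.psiTerm a C n ζ k)
          =o[sectorAtInfinity α β] fun ζ => Complex.exp (-N * ζ)) ∧
      (fun ζ => F ζ 3 - ∑ n ∈ Finset.range N, Y.psiTerm a C n ζ 3)
        =o[sectorAtInfinity α β]
          fun ζ => Complex.exp (-Y.conifold * Complex.exp ζ) * Complex.exp (-(N + 1) * ζ)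

/-! ### The holomorphic solutions -/

/-- Coefficients of the power series solutions about `z = 0`. -/
def phiCoeff (Y : CYFamily) (s : ℂ) : ℂ :=
  match Y with
  | Y5 => Complex.Gamma (1 + s) ^ 3 * Complex.Gamma (2 + s) / Complex.Gamma (6 + 5 * s)
  | Y6 => Complex.Gamma (1 + s) ^ 3 * Complex.Gamma (3 + 2 * s) / Complex.Gamma (7 + 6 * s)
  | Y8 => Complex.Gamma (1 + s) ^ 3 * Complex.Gamma (5 + 4 * s) / Complex.Gamma (9 + 8 * s)
  | Y10 => Complex.Gamma (1 + s) ^ 2 * Complex.Gamma (2 + 2 * s) * Complex.Gamma (6 + 5 * s) /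
      Complex.Gamma (11 + 10 * s)

/-- `φ_k(z) = ∑ₙ c(n + ρ_k) (-1) ^ n z ^ (n + ρ_k)`, `ρ_k = -k / d`, with `z = exp ζ`. -/
def phi (Y : CYFamily) (k : ℕ) (ζ : ℂ) : ℂ :=
  ∑' n : ℕ, Y.phiCoeff (n - k / Y.degree) * (-1) ^ n * Complex.exp ((n - k / Y.degree) * ζ)

/-- `α ^ s = exp (2πi s / d)`. -/
def alphaPow (Y : CYFamily) (s : ℂ) : ℂ :=
  Complex.exp (2 * Real.pi * Complex.I / Y.degree * s)

/-- `ŵ^∞_m(z) = (1-α) ∑ₖ (1-α^{ω₁k})(1-α^{ω₂k})(1-α^{ω₃k}) α^{km + (k-1)/2} φ_{d-k}(z)`,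
the sum being over `1 ≤ k ≤ d - 1`. -/
def wInf (Y : CYFamily) (m : ℕ) (ζ : ℂ) : ℂ :=
  (1 - Y.alphaPow 1) * ∑ k ∈ Finset.Ico 1 Y.degree,
    (1 - Y.alphaPow (Y.weight 0 * k)) * (1 - Y.alphaPow (Y.weight 1 * k)) *
      (1 - Y.alphaPow (Y.weight 2 * k)) * Y.alphaPow (k * m + ((k : ℂ) - 1) / 2) *
      Y.phi (Y.degree - k) ζ

/-- The matrix `N`. -/
def matN (Y : CYFamily) (a : ℂ) : Matrix (Fin 4) (Fin 4) ℂ :=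
  match Y with
  | Y5 => !![1, -2 / 5, -2 * a / 5 - 2, 1;
             0, 2 / 5, 2 * a / 5 - 2, -1;
             0, 1 / 5, a / 5 - 1 / 2, 0;
             0, -1 / 5, -a / 5 - 1 / 2, 0]
  | Y6 => !![1, -1 / 3, -a / 3 - 3 / 2, 1;
             0, 1 / 3, a / 3 - 3 / 2, -1;
             0, 1 / 3, a / 3 - 1 / 2, 0;
             0, -1 / 3, -a / 3 - 1 / 2, 0]
  | Y8 => !![1, -1 / 2, -(a + 3) / 2, 1;
             0, 1 / 2, (a - 3) / 2, -1;
             0, 1 / 2, (a - 1) / 2, 0;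
             0, -1 / 2, -(a + 1) / 2, 0]
  | Y10 => !![1, 0, -1, 1;
              0, 0, -1, -1;
              0, 1, a - 1 / 2, 0;
              0, -1, -a - 1 / 2, 0]

/-- The matrix `L`. -/
def matL (Y : CYFamily) (a : ℂ) : Matrix (Fin 4) (Fin 4) ℂ :=
  match Y with
  | Y5 => !![1, 1, a + 5 / 2, 0; 0, 1, 5, 0; 0, 0, 1, 0; 0, 0, 0, 1]
  | Y6 => !![1, 1, a + 3 / 2, 0; 0, 1, 3, 0; 0, 0, 1, 0; 0, 0, 0, 1]
  | Y8 => !![1, 1, a + 1, 0; 0, 1, 2, 0; 0, 0, 1, 0; 0, 0, 0, 1]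
  | Y10 => !![1, 1, a + 1 / 2, 0; 0, 1, 1, 0; 0, 0, 1, 0; 0, 0, 0, 1]

/-- The matrix `K_R̄`. -/
def matKRbar (Y : CYFamily) (a : ℂ) : Matrix (Fin 4) (Fin 4) ℂ :=
  match Y with
  | Y5 => !![1, 0, 0, -5; 0, 1, 0, a - 5 / 2; 0, 0, 1, -1; 0, 0, 0, 1]
  | Y6 => !![1, 0, 0, -4; 0, 1, 0, a - 3 / 2; 0, 0, 1, -1; 0, 0, 0, 1]
  | Y8 => !![1, 0, 0, -4; 0, 1, 0, a - 1; 0, 0, 1, -1; 0, 0, 0, 1]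
  | Y10 => !![1, 0, 0, -3; 0, 1, 0, a - 1 / 2; 0, 0, 1, -1; 0, 0, 0, 1]

/-- The row vector `(f₁, f₂, f₃, f₄) = c_N (ŵ_0, ŵ_1, ŵ_2, ŵ_{d-1}) N`. -/
def holF (Y : CYFamily) (a cN : ℂ) (ζ : ℂ) : Fin 4 → ℂ :=
  cN • (![Y.wInf 0 ζ, Y.wInf 1 ζ, Y.wInf 2 ζ, Y.wInf (Y.degree - 1) ζ] ᵥ* Y.matN a)

/-- The holomorphic solutions `Φ_{l+mπ}(z)`: with `z_s = e^{-sπi} z`, it is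
`(f₁(z_m), f₂(z_m), f₃(z_m), f₄(z_m)) L ^ (-m/2)` for even `m` and
`(f₁(z_{m-1}), f₂(z_{m-1}), f₃(z_{m-1}), f₄(e^{-2πi} z_{m-1})) L ^ (-(m-1)/2)` for odd `m`. -/
def holPhi (Y : CYFamily) (a cN : ℂ) (m : ℤ) (ζ : ℂ) : Fin 4 → ℂ :=
  if Even m then
    Y.holF a cN (ζ - m * Real.pi * Complex.I) ᵥ* Y.matL a ^ (-(m / 2))
  else
    ![Y.holF a cN (ζ - (m - 1) * Real.pi * Complex.I) 0,
      Y.holF a cN (ζ - (m - 1) * Real.pi * Complex.I) 1,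
      Y.holF a cN (ζ - (m - 1) * Real.pi * Complex.I) 2,
      Y.holF a cN (ζ - (m - 1) * Real.pi * Complex.I - 2 * Real.pi * Complex.I) 3] ᵥ*
      Y.matL a ^ (-((m - 1) / 2))

end CYFamily

/-- The matrix `K_R`, common to the four families. -/
def matKR : Matrix (Fin 4) (Fin 4) ℂ :=
  !![1, 0, 0, 0; 0, 1, 0, 0; 0, 0, 1, 0; 1, 0, 0, 1]

/-- `Kbar`, `K` are the Stokes matrices of the family of solutions `Φ_{l+mπ}`, where `L` is the
monodromy of the formal solutions:
`Φ_{l+(2k+1)π} = Φ_{l+2kπ} L^k Kbar L^{-k}` and `Φ_{l+(2k+2)π} = Φ_{l+(2k+1)π} L^{k+1} K L^{-k-1}`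
on the intersections of the respective angular regions. -/
def AreStokesMatrices (Φ : ℤ → ℂ → Fin 4 → ℂ) (L Kbar K : Matrix (Fin 4) (Fin 4) ℂ) : Prop :=
  ∀ k : ℤ,
    (∀ ζ ∈ CYFamily.angularRegion (2 * k + 1) ∩ CYFamily.angularRegion (2 * k),
      Φ (2 * k + 1) ζ = Φ (2 * k) ζ ᵥ* (L ^ k * Kbar * L ^ (-k))) ∧
    (∀ ζ ∈ CYFamily.angularRegion (2 * k + 2) ∩ CYFamily.angularRegion (2 * k + 1),
      Φ (2 * k + 2) ζ = Φ (2 * k + 1) ζ ᵥ* (L ^ (k + 1) * K * L ^ (-k - 1)))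

/-! ### Monodromy -/

/-- `F t`, `t ∈ [0, 1]`, is an analytic continuation along the path `γ`. -/
def IsContinuationAlong (γ : ℝ → ℂ) (F : ℝ → ℂ → Fin 4 → ℂ) : Prop :=
  ∀ t ∈ Set.Icc (0 : ℝ) 1,
    AnalyticAt ℂ (F t) (γ t) ∧ ∀ᶠ s in 𝓝[Set.Icc (0 : ℝ) 1] t, F s =ᶠ[𝓝 (γ s)] F t

/-- Analytic continuation along the loop `γ` turns the germ at `γ 0` of the row vector `f` into the
germ of `f M`. -/
def HasMonodromy (γ : ℝ → ℂ) (f : ℂ → Fin 4 → ℂ) (M : Matrix (Fin 4) (Fin 4) ℂ) : Prop :=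
  ∃ F : ℝ → ℂ → Fin 4 → ℂ, IsContinuationAlong γ F ∧
    F 0 =ᶠ[𝓝 (γ 0)] f ∧ F 1 =ᶠ[𝓝 (γ 1)] fun x => f x ᵥ* M

/-- The counter-clockwise circle about `p` starting and ending at `x₀`. -/
def circleLoop (p x₀ : ℂ) (t : ℝ) : ℂ :=
  p + (x₀ - p) * Complex.exp (2 * Real.pi * Complex.I * t)

end

/-! Put `A(s) = Γ(1+ds) / ∏_{i≤5} Γ(1+ω_i s)` and `B(s) = A(s) Γ(1+s)` (`hypA`, `hypB`). Both
satisfy a first-order recurrence `x_c (s+1)^m g(s+1) = g(s) ∏_i (s+1-π_i)`, with `m = 4` and `m = 3`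
respectively and `π_i = 1 - j/d` for `j ∈ J`. The `ρ`-derivatives of `w` and `G` at `0` are (formal)
sums of residues at `0, 1, 2, …` of Barnes integrals, whose integrand is `A` or `B` times an
exponential times a `1`-periodic kernel `kern j` with principal part `j!/s^(j+1)` at the integers.
Moving the line to the right produces the series at `x = 0`, or the formal series at `z = ∞`. Moving
it to the left produces `∑_i κ(π_i) P_i`, where `P_i` is the local solution (`piece`) at the other
end: a periodic kernel has the same value at all the poles `π_i - 1 - n`. Every connection
coefficient is therefore a rational function of `q` evaluated at `q_i = exp(2πi π_i)`, and both
halves of the theorem become algebra modulo the quartic with roots `q_i` (`qroot_charpoly`).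

Periods. `kern 0` decays in the upper half-plane and tends to `2πi` in the lower one, so `kern 0`
represents `w` for `-2π < arg x < 0` and `kern 0 - 2πi` represents it for `0 < arg x < 2π`. The
quartic states that the kernel of the fourth period takes the value `2πi` at every `π_i`
(`kern_three_pole`). Hence for `|x| > x_c` the two continuations of `w` differ by the fourth period,
while the other periods are Barnes integrals holomorphic for `|arg x| < 2π`; this is `M_Con`. The
matrix `M_0` is the binomial theorem applied to `∂_ρ^j (e^{2πiρ} w)`.

Laplace side. The factor `Γ(1+s)` adds a decay `exp(-π|Im s|/2)`, which widens every sector by `π/2`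
on each side. The solutions `f₁, f₂, f₃` have the kernels of `g₁, g₂, g₃`, and `f₄` has the constant
kernel `2πi`; the matrix `N` rewrites this in the basis `ŵ_m` (`holF_eq`). The rotation `z ↦
e^{-2πi} z` multiplies the `i`-th local solution by `q_i`, so the Stokes relations are again
identities in `q_i` (`qroot_cubic_identities`).

The solution `f₄`. The inverse Mellin transform of `A` (`cutPeriod`) vanishes for `x < x_c` and is
the fourth period for `x > x_c`. So `f₄` is the Laplace transform of the fourth period over `[x_c,
∞)` (`holF_three_eq_integral`). That period is holomorphic at `x_c`, vanishes there and is bounded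
on closed sectors inside `|arg(x - x_c)| < π`; Watson's lemma on rotated rays gives the expansion of
`f₄` for `|arg z| < 3π/2`. Its leading coefficient follows by comparing the Laplace integral for
`A(n)` with Stirling's formula. The coefficients `C_n` solve the formal equation because they are
the asymptotic expansion of a true solution.

All uniqueness statements rest on linear independence of the periods, of the formal solutions and of
the `f_k`. -/

noncomputable section

/-! ### Parameter integrals, residues in a vertical strip, termwise differentiation -/

section AnalysisTools

open MeasureTheory Complex Set

/-- Holomorphy of an integral depending on a complex parameter, under local domination. -/
theorem differentiableOn_integral_of_dominated {α : Type*} [MeasurableSpace α] {μ : Measure α}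
    {U : Set ℂ} {f : ℂ → α → ℂ} (hmeas : ∀ z ∈ U, AEStronglyMeasurable (f z) μ)
    (hd : ∀ t, DifferentiableOn ℂ (fun z => f z t) U)
    (hb : ∀ z ∈ U, ∃ r > 0, Metric.ball z r ⊆ U ∧
      ∃ g : α → ℝ, Integrable g μ ∧ ∀ᵐ t ∂μ, ∀ w ∈ Metric.ball z r, ‖f w t‖ ≤ g t) :
    DifferentiableOn ℂ (fun z => ∫ t, f z t ∂μ) U := by
  intro z hz
  obtain ⟨r, hr, hU, g, hg, hfg⟩ := hb z hz
  have hdt : ∀ t, ∀ w ∈ Metric.ball z (r / 2), HasDerivAt (fun z => f z t)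
      (deriv (fun z => f z t) w) w := fun t w hw =>
    ((hd t).mono hU |>.differentiableAt (Metric.isOpen_ball.mem_nhds
      (Metric.ball_subset_ball (by linarith) hw))).hasDerivAt
  have hzm : z ∈ Metric.ball z (r / 2) := Metric.mem_ball_self (by positivity)
  refine (hasDerivAt_integral_of_dominated_loc_of_deriv_le (F := f)
    (F' := fun w t => deriv (fun z => f z t) w) (bound := fun t => g t / (r / 4)) (x₀ := z)
    (s := Metric.ball z (r / 2))
    (Metric.ball_mem_nhds z (by positivity)) ?_ ?_ ?_ ?_ (hg.div_const _)
    (Eventually.of_forall fun t w hw => hdt t w hw)).2.differentiableAt.differentiableWithinAt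
  · filter_upwards [Metric.ball_mem_nhds z hr] with w hw using hmeas w (hU hw)
  · exact hg.mono' (hmeas z hz) (hfg.mono fun t ht => ht z (Metric.mem_ball_self hr))
  · let h : ℕ → ℂ := fun n => ((r / 2 * (1 / ((n : ℝ) + 1)) : ℝ) : ℂ)
    have hpos : ∀ n : ℕ, 0 < r / 2 * (1 / ((n : ℝ) + 1)) := fun n => by positivity
    have h0 : Tendsto h atTop (𝓝[≠] 0) := by
      refine tendsto_nhdsWithin_iff.2 ⟨?_, Eventually.of_forall fun n => ?_⟩
      · have := (tendsto_one_div_add_atTop_nhds_zero_nat (𝕜 := ℝ)).const_mul (r / 2)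
        rw [mul_zero] at this
        exact (Complex.continuous_ofReal.tendsto' 0 0 rfl).comp this
      · exact ofReal_ne_zero.2 (hpos n).ne'
    refine aestronglyMeasurable_of_tendsto_ae atTop
      (f := fun n t => (h n)⁻¹ • (f (z + h n) t - f z t)) (fun n => ?_)
      (Eventually.of_forall fun t => ?_)
    · have h1 : z + h n ∈ U := hU ?_
      · exact ((hmeas _ h1).sub (hmeas z hz)).const_smul (h n)⁻¹
      simp only [Metric.mem_ball, dist_eq_norm, add_sub_cancel_left, h, norm_real, Real.norm_eq_abs,
        abs_of_pos (hpos n)]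
      have : (1 : ℝ) / (n + 1) ≤ 1 := by
        rw [div_le_one (by positivity)]; linarith [n.cast_nonneg (α := ℝ)]
      nlinarith
    · exact (hasDerivAt_iff_tendsto_slope_zero.1 (hdt t z hzm)).comp h0
  -- Cauchy's estimate on the circle of radius `r / 4` about `w`: it stays in the ball of radius `r`
  -- because `w` lies within `r / 2` of `z`.
  · filter_upwards [hfg] with t ht w hw
    have hsub : Metric.closedBall w (r / 4) ⊆ Metric.ball z (3 * r / 4 + r / 8) := fun v hv => by
      have h1 := Metric.mem_closedBall.1 hv
      have h2 := Metric.mem_ball.1 hw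
      have := dist_triangle v w z
      exact Metric.mem_ball.2 (by linarith)
    have hsub' : Metric.closedBall w (r / 4) ⊆ Metric.ball z r :=
      hsub.trans (Metric.ball_subset_ball (by linarith))
    have hle := norm_deriv_le_of_forall_mem_sphere_norm_le (f := fun z => f z t) (c := w)
      (R := r / 4) (C := g t) (by positivity)
      ((((hd t).mono hU).mono hsub').diffContOnCl_ball subset_rfl)
      (fun v hv => ht v (hsub' (Metric.sphere_subset_closedBall hv)))
    exact hle

/-- The integral of `f` with respect to `dτ` over the vertical line `c + iτ`. -/
def lineInt (c : ℝ) (f : ℂ → ℂ) : ℂ := ∫ τ : ℝ, f (c + τ * I)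

theorem integrable_of_continuous_of_inv_sq_bound {g : ℝ → ℂ} (hg : Continuous g) {C : ℝ}
    (h : ∀ τ, 1 ≤ |τ| → ‖g τ‖ ≤ C / τ ^ 2) : Integrable g := by
  obtain ⟨M, hM⟩ := (isCompact_Icc (a := (-1 : ℝ)) (b := 1)).exists_bound_of_continuousOn
    hg.continuousOn
  refine (integrable_inv_one_add_sq.const_mul (2 * |M| + 2 * |C|)).mono' hg.aestronglyMeasurable
    (Eventually.of_forall fun τ => ?_)
  rw [← div_eq_mul_inv, le_div_iff₀ (by positivity)]
  rcases le_total |τ| 1 with h1 | h1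
  · have h2 : ‖g τ‖ ≤ |M| := (hM τ (abs_le.1 h1)).trans (le_abs_self M)
    have h3 : τ ^ 2 ≤ 1 := by rw [← sq_abs]; nlinarith [abs_nonneg τ]
    nlinarith [abs_nonneg C, norm_nonneg (g τ), abs_nonneg M]
  · have h3 : 1 ≤ τ ^ 2 := by rw [← sq_abs]; nlinarith [abs_nonneg τ]
    have h2 : ‖g τ‖ ≤ |C| / τ ^ 2 := (h τ h1).trans (by gcongr; exact le_abs_self C)
    rw [le_div_iff₀ (by positivity)] at h2
    nlinarith [abs_nonneg M, norm_nonneg (g τ)]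

/-- An antiderivative is `arctan (y / A) - (i / 2) log (A² + y²)`. The logarithm is even and cancels
over `[-T, T]`, so only the symmetric limit exists, and it is `π`. -/
theorem tendsto_intervalIntegral_inv_vertical {A : ℝ} (hA : 0 < A) :
    Tendsto (fun T : ℝ => ∫ y in (-T)..T, 1 / ((A : ℂ) + y * I)) atTop (𝓝 (Real.pi : ℂ)) := by
  have hne : ∀ y : ℝ, (A : ℂ) + y * I ≠ 0 := fun y h => by
    have := congrArg re h; simp at this; exact hA.ne' this
  have hval : ∀ T : ℝ, ∫ y in (-T)..T, 1 / ((A : ℂ) + y * I) =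
      ((2 * Real.arctan (T / A) : ℝ) : ℂ) := fun T => by
    have hder : ∀ y : ℝ, HasDerivAt (fun y : ℝ => ((Real.arctan (y / A) : ℝ) : ℂ) -
        I / 2 * ((Real.log (A ^ 2 + y ^ 2) : ℝ) : ℂ)) (1 / ((A : ℂ) + y * I)) y := fun y => by
      have h1 : HasDerivAt (fun y : ℝ => Real.arctan (y / A)) (1 / (1 + (y / A) ^ 2) * (1 / A)) y :=
        ((hasDerivAt_id y).div_const A).arctan
      have h2 : HasDerivAt (fun y : ℝ => Real.log (A ^ 2 + y ^ 2))
          ((2 * y) / (A ^ 2 + y ^ 2)) y := by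
        have := (((hasDerivAt_id y).pow 2).const_add (A ^ 2)).log
          (by have : 0 < A ^ 2 + y ^ 2 := by positivity
              exact this.ne')
        simpa using! this
      convert! h1.ofReal_comp.sub (h2.ofReal_comp.const_mul (I / 2)) using 1
      have hA' : (A : ℂ) ≠ 0 := ofReal_ne_zero.2 hA.ne'
      have h3 : (A : ℂ) ^ 2 + (y : ℂ) ^ 2 ≠ 0 := by
        have : A ^ 2 + y ^ 2 ≠ 0 := by positivity
        exact_mod_cast this
      have h4 : (1 : ℂ) + (y / A) ^ 2 ≠ 0 := by
        have : (1 : ℝ) + (y / A) ^ 2 ≠ 0 := by positivity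
        exact_mod_cast this
      push_cast
      have h5 : (1 : ℂ) / (1 + (y / A) ^ 2) * (1 / A) = A / (A ^ 2 + y ^ 2) := by
        rw [div_mul_div_comm, div_eq_div_iff (mul_ne_zero h4 hA') h3]
        field_simp
      rw [h5, eq_comm, eq_div_iff (hne y)]
      have h6 : ((A : ℂ) / (A ^ 2 + y ^ 2) - I / 2 * (2 * y / (A ^ 2 + y ^ 2))) =
        (A - I * y) / (A ^ 2 + y ^ 2) := by ring
      rw [h6, div_mul_eq_mul_div, div_eq_one_iff_eq h3]
      ring_nf
      rw [I_sq]; ring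
    have hcont : Continuous fun y : ℝ => 1 / ((A : ℂ) + y * I) :=
      continuous_const.div (by fun_prop) hne
    rw [intervalIntegral.integral_eq_sub_of_hasDerivAt (fun y _ => hder y)
      (hcont.intervalIntegrable _ _)]
    rw [neg_div, Real.arctan_neg, neg_sq]
    push_cast
    ring
  simp_rw [hval]
  have h1 : Tendsto (fun T : ℝ => 2 * Real.arctan (T / A)) atTop (𝓝 (2 * (Real.pi / 2))) :=
    ((Real.tendsto_arctan_atTop.mono_right nhdsWithin_le_nhds).comp
      (tendsto_id.atTop_div_const hA)).const_mul 2
  rw [mul_div_cancel₀ _ two_ne_zero] at h1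
  exact (Complex.continuous_ofReal.tendsto _).comp h1

/-- Powers beyond the first have an antiderivative that tends to `0` at both ends, so the higher
parts of a multiple pole contribute nothing on either line. -/
theorem tendsto_intervalIntegral_inv_pow_vertical {B : ℝ} (hB : B ≠ 0) (k : ℕ) :
    Tendsto (fun T : ℝ => ∫ y in (-T)..T, 1 / ((B : ℂ) + y * I) ^ (k + 2)) atTop (𝓝 0) := by
  have hne : ∀ y : ℝ, (B : ℂ) + y * I ≠ 0 := fun y h => by
    have := congrArg re h; simp at this; exact hB this
  have hlim : ∀ σ : ℝ, |σ| = 1 → Tendsto (fun T : ℝ => ((B : ℂ) + (σ * T : ℝ) * I)⁻¹ ^ (k + 1))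
      atTop (𝓝 0) := fun σ hσ => by
    have : Tendsto (fun T : ℝ => ((B : ℂ) + (σ * T : ℝ) * I)⁻¹) atTop (𝓝 0) := by
      refine tendsto_inv₀_cobounded.comp ?_
      rw [← tendsto_norm_atTop_iff_cobounded]
      refine tendsto_atTop_mono (fun T => ?_) tendsto_id
      calc T ≤ |T| := le_abs_self T
        _ = |((B : ℂ) + (σ * T : ℝ) * I).im| := by simp [abs_mul, hσ]
        _ ≤ _ := abs_im_le_norm _
    simpa using this.pow (k + 1)
  have hval : ∀ T : ℝ, ∫ y in (-T)..T, 1 / ((B : ℂ) + y * I) ^ (k + 2) =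
      I / (k + 1) * ((B : ℂ) + (1 * T : ℝ) * I)⁻¹ ^ (k + 1) -
        I / (k + 1) * ((B : ℂ) + (-1 * T : ℝ) * I)⁻¹ ^ (k + 1) := fun T => by
    have hder : ∀ y : ℝ, HasDerivAt (fun y : ℝ => I / (k + 1) * ((B : ℂ) + y * I)⁻¹ ^ (k + 1))
        (1 / ((B : ℂ) + y * I) ^ (k + 2)) y := fun y => by
      have h1 : HasDerivAt (fun y : ℝ => (B : ℂ) + y * I) I y := by
        simpa using ((hasDerivAt_id (y : ℂ)).mul_const I).const_add (B : ℂ) |>.comp_ofReal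
      convert! ((h1.inv (hne y)).pow (k + 1)).const_mul (I / (k + 1) : ℂ) using 1
      have := hne y
      have hk : (k : ℂ) + 1 ≠ 0 := by exact_mod_cast k.succ_ne_zero
      simp only [Pi.inv_apply, add_tsub_cancel_right, inv_pow]
      push_cast
      field_simp
      rw [I_sq]; ring
    have hcont : Continuous fun y : ℝ => 1 / ((B : ℂ) + y * I) ^ (k + 2) :=
      continuous_const.div (by fun_prop) fun y => pow_ne_zero _ (hne y)
    rw [intervalIntegral.integral_eq_sub_of_hasDerivAt (fun y _ => hder y)
      (hcont.intervalIntegrable _ _)]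
    simp
  simp_rw [hval]
  simpa using ((hlim 1 (by simp)).const_mul (I / (k + 1) : ℂ)).sub
    ((hlim (-1) (by simp)).const_mul (I / (k + 1) : ℂ))

theorem tendsto_intervalIntegral_zero_of_bound {c₁ c₂ : ℝ} {g : ℝ → ℝ → ℂ} {b : ℝ → ℝ}
    (hb : Tendsto b atTop (𝓝 0))
    (hg : ∀ᶠ T in atTop, ∀ x ∈ Set.uIoc c₁ c₂, ‖g T x‖ ≤ b T) :
    Tendsto (fun T => ∫ x in c₁..c₂, g T x) atTop (𝓝 0) := by
  refine squeeze_zero_norm' (a := fun T => b T * |c₂ - c₁|) ?_ (by simpa using hb.mul_const _)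
  filter_upwards [hg] with T hT using intervalIntegral.norm_integral_le_of_norm_le_const hT

/-- The residue theorem for a vertical strip containing simple poles `q i` and a multiple pole
`p`, for a function which decays like `1 / |Im s| ^ 2`. -/
theorem lineInt_sub_lineInt {ι : Type*} [Fintype ι] {c₁ c₂ p : ℝ} (h₁ : c₁ < p) (h₂ : p < c₂)
    {q : ι → ℝ} (hq₁ : ∀ i, c₁ < q i) (hq₂ : ∀ i, q i < c₂) {f hol : ℂ → ℂ} {a₀ : ι → ℂ}
    {m : ℕ} {a : ℕ → ℂ} (hhol : DifferentiableOn ℂ hol (re ⁻¹' Icc c₁ c₂))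
    (hf : ∀ s : ℂ, s.re ∈ Icc c₁ c₂ → (∀ i, s ≠ q i) → s ≠ p →
      f s = hol s + ∑ i, a₀ i / (s - q i) + ∑ k ∈ Finset.range m, a k / (s - p) ^ (k + 2))
    (hdec : ∃ C : ℝ, ∀ s : ℂ, s.re ∈ Icc c₁ c₂ → 1 ≤ |s.im| → ‖f s‖ ≤ C / s.im ^ 2) :
    Integrable (fun τ : ℝ => f (c₁ + τ * I)) ∧ Integrable (fun τ : ℝ => f (c₂ + τ * I)) ∧
      lineInt c₂ f - lineInt c₁ f = 2 * Real.pi * ∑ i, a₀ i := by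
  obtain ⟨C, hC⟩ := hdec
  have h12 : c₁ ≤ c₂ := (h₁.trans h₂).le
  have hne : ∀ c p : ℝ, c ≠ p → ∀ τ : ℝ, (c : ℂ) + τ * I - p ≠ 0 := fun c p hc τ h => by
    have := congrArg re h
    simp [sub_eq_zero] at this
    exact hc this
  have hline : ∀ c : ℝ, c ∈ Icc c₁ c₂ → c ≠ p → (∀ i, c ≠ q i) → ∀ τ : ℝ, f (c + τ * I) =
      hol (c + τ * I) + ∑ i, a₀ i * (1 / (((c - q i : ℝ) : ℂ) + τ * I)) +
      ∑ k ∈ Finset.range m, a k * (1 / (((c - p : ℝ) : ℂ) + τ * I) ^ (k + 2)) := by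
    intro c hc hcp hcq τ
    have e : ∀ p : ℝ, (c : ℂ) + τ * I - p = ((c - p : ℝ) : ℂ) + τ * I := fun p => by
      push_cast; ring
    rw [hf _ (by simpa using hc) (fun i => sub_ne_zero.1 (hne c _ (hcq i) τ))
      (sub_ne_zero.1 (hne c p hcp τ))]
    simp only [e, mul_one_div]
  have hcH : ∀ c : ℝ, c ∈ Icc c₁ c₂ → Continuous fun τ : ℝ => hol (c + τ * I) := fun c hc =>
    hhol.continuousOn.comp_continuous (by fun_prop) fun τ => by simpa using hc
  have hne' : ∀ c p : ℝ, c ≠ p → ∀ τ : ℝ, ((c - p : ℝ) : ℂ) + τ * I ≠ 0 := fun c p hc τ h =>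
    hne c p hc τ (by rw [← h]; push_cast; ring)
  have hcP : ∀ c p : ℝ, c ≠ p → ∀ k : ℕ,
      Continuous fun τ : ℝ => 1 / (((c - p : ℝ) : ℂ) + τ * I) ^ k := fun c p hc k =>
    continuous_const.div (by fun_prop) fun τ => pow_ne_zero _ (hne' c p hc τ)
  have hcP1 : ∀ c p : ℝ, c ≠ p → Continuous fun τ : ℝ => 1 / (((c - p : ℝ) : ℂ) + τ * I) :=
    fun c p hc => by simpa using hcP c p hc 1
  have hcS : ∀ c : ℝ, (∀ i, c ≠ q i) → Continuous fun τ : ℝ =>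
      ∑ i, a₀ i * (1 / (((c - q i : ℝ) : ℂ) + τ * I)) := fun c hc =>
    continuous_finsetSum _ fun i _ => (hcP1 c _ (hc i)).const_mul _
  have hcf : ∀ c : ℝ, c ∈ Icc c₁ c₂ → c ≠ p → (∀ i, c ≠ q i) →
      Continuous fun τ : ℝ => f (c + τ * I) := by
    intro c hc hcp hcq
    simp only [hline c hc hcp hcq]
    exact ((hcH c hc).add (hcS c hcq)).add
      (continuous_finsetSum _ fun k _ => (hcP c p hcp _).const_mul _)
  have hint : ∀ c : ℝ, c ∈ Icc c₁ c₂ → c ≠ p → (∀ i, c ≠ q i) →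
      Integrable fun τ : ℝ => f (c + τ * I) := fun c hc hcp hcq =>
    integrable_of_continuous_of_inv_sq_bound (C := C) (hcf c hc hcp hcq) fun τ hτ => by
      simpa using hC (c + τ * I) (by simpa using hc) (by simpa using hτ)
  have hm1 : c₁ ∈ Icc c₁ c₂ := ⟨le_rfl, h12⟩
  have hm2 : c₂ ∈ Icc c₁ c₂ := ⟨h12, le_rfl⟩
  have hq₁' : ∀ i, c₁ ≠ q i := fun i => (hq₁ i).ne
  have hq₂' : ∀ i, c₂ ≠ q i := fun i => (hq₂ i).ne'
  refine ⟨hint c₁ hm1 h₁.ne hq₁', hint c₂ hm2 h₂.ne' hq₂', ?_⟩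
  -- the vertical integrals of the holomorphic part
  have hvert : Tendsto (fun T : ℝ => (∫ y in (-T)..T, hol (c₂ + y * I)) -
      ∫ y in (-T)..T, hol (c₁ + y * I)) atTop (𝓝 0) := by
    have hbd : ∀ σ : ℝ, |σ| = 1 → Tendsto (fun T : ℝ => ∫ x in c₁..c₂,
        hol (x + ((σ * T : ℝ) : ℂ) * I)) atTop (𝓝 0) := fun σ hσ => by
      -- At height `±T` the holomorphic part is `f` minus the principal parts: `f` is `O(T⁻²)` and
      -- every principal part is `O(T⁻¹)`, so the horizontal sides of the rectangle vanish in the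
      -- limit.
      have hlim : Tendsto (fun T : ℝ => |C| * T⁻¹ ^ 2 + ∑ i, ‖a₀ i‖ * T⁻¹ +
          ∑ k ∈ Finset.range m, ‖a k‖ * T⁻¹ ^ (k + 2)) atTop (𝓝 0) := by
        have h0 : Tendsto (fun T : ℝ => T⁻¹) atTop (𝓝 0) := tendsto_inv_atTop_zero
        have := (((h0.pow 2).const_mul |C|).add (tendsto_finsetSum Finset.univ fun i _ =>
          h0.const_mul ‖a₀ i‖)).add
          (tendsto_finsetSum (Finset.range m) fun k _ => (h0.pow (k + 2)).const_mul ‖a k‖)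
        simpa using this
      refine tendsto_intervalIntegral_zero_of_bound hlim ?_
      filter_upwards [eventually_ge_atTop 1] with T hT x hx
      rw [uIoc_of_le h12] at hx
      have hT0 : 0 < T := by linarith
      have habs : |σ * T| = T := by rw [abs_mul, hσ, one_mul, abs_of_pos hT0]
      have hre : ((x : ℂ) + ((σ * T : ℝ) : ℂ) * I).re = x := by simp
      have him : ((x : ℂ) + ((σ * T : ℝ) : ℂ) * I).im = σ * T := by simp
      set s := (x : ℂ) + ((σ * T : ℝ) : ℂ) * I with hs
      have hTn : ∀ p : ℝ, T ≤ ‖s - p‖ := fun p => by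
        calc T = |(s - p).im| := by rw [sub_im, him, ofReal_im, sub_zero, habs]
          _ ≤ _ := abs_im_le_norm _
      have hsp : ∀ p : ℝ, s ≠ p := fun p h => by
        have := hTn p
        rw [h, sub_self, norm_zero] at this; linarith
      have hxs : s.re ∈ Icc c₁ c₂ := by rw [hre]; exact Ioc_subset_Icc_self hx
      have hval : hol s = f s - ∑ i, a₀ i / (s - q i) -
          ∑ k ∈ Finset.range m, a k / (s - p) ^ (k + 2) := by
        rw [hf s hxs (fun i => hsp (q i)) (hsp p)]; ring
      rw [hval]
      refine (norm_sub_le _ _).trans (add_le_add ((norm_sub_le _ _).trans (add_le_add ?_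
        ((norm_sum_le _ _).trans (Finset.sum_le_sum fun i _ => ?_))))
        ((norm_sum_le _ _).trans (Finset.sum_le_sum fun k _ => ?_)))
      · refine (hC s hxs (by rw [him, habs]; exact hT)).trans ?_
        rw [him, ← sq_abs, habs, div_eq_mul_inv, inv_pow]
        gcongr
        exact le_abs_self C
      · rw [norm_div, div_eq_mul_inv]; gcongr; exact hTn _
      · rw [norm_div, norm_pow, div_eq_mul_inv, inv_pow]; gcongr; exact hTn _
    have hbox : ∀ T : ℝ, (∫ y in (-T)..T, hol (c₂ + y * I)) - ∫ y in (-T)..T, hol (c₁ + y * I) =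
        I * ((∫ x in c₁..c₂, hol (x + ((-1 * T : ℝ) : ℂ) * I)) -
          ∫ x in c₁..c₂, hol (x + ((1 * T : ℝ) : ℂ) * I)) := fun T => by
      have := integral_boundary_rect_eq_zero_of_differentiableOn hol
        ((c₁ : ℂ) + ((-1 * T : ℝ) : ℂ) * I) ((c₂ : ℂ) + ((1 * T : ℝ) : ℂ) * I)
        (hhol.mono fun s hs => by
          have := hs.1
          simp only [add_re, ofReal_re, re_ofReal_mul, I_re, mul_zero, add_zero, mem_preimage,
            uIcc_of_le h12] at this
          exact this)
      simp only [add_re, ofReal_re, re_ofReal_mul, I_re, mul_zero, add_zero, add_im, ofReal_im,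
        im_ofReal_mul, I_im, mul_one, zero_add, smul_eq_mul] at this
      simp only [neg_mul, one_mul] at this ⊢
      linear_combination (-I) * this + ((∫ y in (-T)..T, hol (c₂ + y * I)) -
        ∫ y in (-T)..T, hol (c₁ + y * I)) * I_sq
    simp_rw [hbox]
    simpa using ((hbd (-1) (by simp)).sub (hbd 1 (by simp))).const_mul I
  have hsplit : ∀ c : ℝ, c ∈ Icc c₁ c₂ → c ≠ p → (∀ i, c ≠ q i) → ∀ T : ℝ,
      ∫ y in (-T)..T, f (c + y * I) =
      (∫ y in (-T)..T, hol (c + y * I)) +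
      ∑ i, a₀ i * (∫ y in (-T)..T, 1 / (((c - q i : ℝ) : ℂ) + y * I)) +
      ∑ k ∈ Finset.range m, a k * ∫ y in (-T)..T, 1 / (((c - p : ℝ) : ℂ) + y * I) ^ (k + 2) := by
    intro c hc hcp hcq T
    simp only [hline c hc hcp hcq]
    rw [intervalIntegral.integral_add, intervalIntegral.integral_add,
      intervalIntegral.integral_finsetSum, intervalIntegral.integral_finsetSum]
    · simp only [intervalIntegral.integral_const_mul]
    · exact fun k _ => ((hcP c p hcp _).const_mul _).intervalIntegrable _ _
    · exact fun i _ => ((hcP1 c _ (hcq i)).const_mul _).intervalIntegrable _ _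
    · exact (hcH c hc).intervalIntegrable _ _
    · exact (hcS c hcq).intervalIntegrable _ _
    · exact ((hcH c hc).add (hcS c hcq)).intervalIntegrable _ _
    · exact (continuous_finsetSum _ fun k _ => (hcP c p hcp _).const_mul _).intervalIntegrable _ _
  -- A simple pole contributes `π` on the line to its right and `-π` on the line to its left. The
  -- integration is with respect to `dτ`, so the factor is `2π` and not `2πi`.
  have hinv₂ := fun i => tendsto_intervalIntegral_inv_vertical (A := c₂ - q i)
    (by linarith [hq₂ i])
  have hinv₁ : ∀ i, Tendsto (fun T : ℝ => ∫ y in (-T)..T, 1 / (((c₁ - q i : ℝ) : ℂ) + y * I))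
      atTop (𝓝 (-Real.pi : ℂ)) := by
    intro i
    refine (tendsto_intervalIntegral_inv_vertical (A := q i - c₁)
      (by linarith [hq₁ i])).neg.congr fun T => ?_
    have := intervalIntegral.integral_comp_neg (a := -T) (b := T)
      (fun y : ℝ => 1 / (((q i - c₁ : ℝ) : ℂ) + y * I))
    rw [neg_neg] at this
    rw [← this, ← intervalIntegral.integral_neg]
    congr 1; ext y
    rw [← one_div_neg_eq_neg_one_div]
    congr 1; push_cast; ring
  have hpow : ∀ c : ℝ, c ≠ p → Tendsto (fun T : ℝ => ∑ k ∈ Finset.range m, a k *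
      ∫ y in (-T)..T, 1 / (((c - p : ℝ) : ℂ) + y * I) ^ (k + 2)) atTop (𝓝 0) := fun c hc => by
    have := tendsto_finsetSum (Finset.range m) fun k _ =>
      (tendsto_intervalIntegral_inv_pow_vertical (sub_ne_zero.2 hc) k).const_mul (a k)
    simpa using this
  have hL : ∀ c : ℝ, c ∈ Icc c₁ c₂ → c ≠ p → (∀ i, c ≠ q i) →
      Tendsto (fun T : ℝ => ∫ y in (-T)..T, f (c + y * I)) atTop (𝓝 (lineInt c f)) :=
    fun c hc hcp hcq => intervalIntegral_tendsto_integral (hint c hc hcp hcq)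
      tendsto_neg_atTop_atBot tendsto_id
  refine tendsto_nhds_unique ((hL c₂ hm2 h₂.ne' hq₂').sub (hL c₁ hm1 h₁.ne hq₁')) ?_
  have := (hvert.add ((tendsto_finsetSum Finset.univ fun i _ => (hinv₂ i).const_mul (a₀ i)).sub
    (tendsto_finsetSum Finset.univ fun i _ => (hinv₁ i).const_mul (a₀ i)))).add
    ((hpow c₂ h₂.ne').sub (hpow c₁ h₁.ne))
  convert! this using 1
  · ext T
    rw [hsplit c₂ hm2 h₂.ne' hq₂', hsplit c₁ hm1 h₁.ne hq₁']
    ring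
  · congr 1
    rw [← Finset.sum_sub_distrib, Finset.mul_sum, zero_add, sub_zero, add_zero]
    exact Finset.sum_congr rfl fun i _ => by ring

theorem tendstoLocallyUniformlyOn_iteratedDeriv {ι : Type*} {φ : Filter ι} {F : ι → ℂ → ℂ}
    {f : ℂ → ℂ} {U : Set ℂ} (hU : IsOpen U) (hf : TendstoLocallyUniformlyOn F f φ U)
    (hF : ∀ᶠ n in φ, DifferentiableOn ℂ (F n) U) (j : ℕ) :
    TendstoLocallyUniformlyOn (fun n => iteratedDeriv j (F n)) (iteratedDeriv j f) φ U ∧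
      ∀ᶠ n in φ, DifferentiableOn ℂ (iteratedDeriv j (F n)) U := by
  induction j with
  | zero => simpa [iteratedDeriv_zero] using ⟨hf, hF⟩
  | succ j ih =>
    simp only [iteratedDeriv_succ]
    exact ⟨ih.1.deriv ih.2 hU, ih.2.mono fun n hn => hn.deriv hU⟩

/-- Termwise iterated differentiation of a uniformly convergent series of holomorphic functions. -/
theorem hasSum_iteratedDeriv_of_summable_norm {F : ℕ → ℂ → ℂ} {U : Set ℂ} {u : ℕ → ℝ}
    (hu : Summable u) (hF : ∀ n, DifferentiableOn ℂ (F n) U) (hU : IsOpen U)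
    (hle : ∀ n, ∀ w ∈ U, ‖F n w‖ ≤ u n) {z : ℂ} (hz : z ∈ U) (j : ℕ) :
    HasSum (fun n => iteratedDeriv j (F n) z) (iteratedDeriv j (fun w => ∑' n, F n w) z) := by
  rw [HasSum]
  have hc := (tendstoUniformlyOn_tsum hu hle).tendstoLocallyUniformlyOn
  refine ((tendstoLocallyUniformlyOn_iteratedDeriv hU hc (Eventually.of_forall fun s =>
    DifferentiableOn.fun_sum fun i _ => hF i) j).1.tendsto_at hz).congr fun s => ?_
  exact iteratedDeriv_fun_sum fun i _ => ((hF i).analyticAt (hU.mem_nhds hz)).contDiffAt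

end AnalysisTools

/-! ### Exponential bounds for the Gamma function on vertical strips -/

section GammaBounds

open MeasureTheory Complex Set

theorem norm_cpow_mul_exp_neg {a r : ℂ} {t : ℝ} (ht : 0 < t) :
    ‖(t : ℂ) ^ (a - 1) * exp (-(r * t))‖ = t ^ (a.re - 1) * Real.exp (-(r.re * t)) := by
  rw [norm_mul, norm_cpow_eq_rpow_re_of_pos ht, norm_exp]
  simp

theorem integrableOn_rpow_mul_exp_neg {σ b : ℝ} (hσ : 0 < σ) (hb : 0 < b) :
    IntegrableOn (fun t : ℝ => t ^ (σ - 1) * Real.exp (-(b * t))) (Ioi 0) := by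
  have := integrableOn_rpow_mul_exp_neg_mul_rpow (s := σ - 1) (p := 1) (b := b) (by linarith)
    one_pos hb
  simpa using this

/-- The formula is known for real `r > 0`. Both sides are holomorphic in `r` on the right
half-plane, and the real points `1 + 1 / (n + 1)` accumulate at `1`. -/
theorem integral_cpow_mul_exp_neg_mul_Ioi_of_re_pos {a r : ℂ} (ha : 0 < a.re) (hr : 0 < r.re) :
    ∫ t : ℝ in Ioi 0, (t : ℂ) ^ (a - 1) * exp (-(r * t)) = exp (-(a * log r)) * Gamma a := by
  have hU : IsOpen {r : ℂ | 0 < r.re} := isOpen_lt continuous_const continuous_re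
  have hd : DifferentiableOn ℂ
      (fun r : ℂ => ∫ t : ℝ in Ioi 0, (t : ℂ) ^ (a - 1) * exp (-(r * t))) {r : ℂ | 0 < r.re} := by
    refine differentiableOn_integral_of_dominated (fun z hz => ?_) (fun t => by fun_prop) ?_
    · refine ContinuousOn.aestronglyMeasurable (fun t ht => ?_) measurableSet_Ioi
      exact ((continuousAt_ofReal_cpow_const _ _ (Or.inr (ne_of_gt ht))).mul
        (by fun_prop)).continuousWithinAt
    · intro z hz
      refine ⟨z.re / 2, half_pos hz, fun w hw => ?_, _,
        integrableOn_rpow_mul_exp_neg ha (half_pos hz), ?_⟩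
      · have := (abs_re_le_norm (w - z)).trans_lt (mem_ball_iff_norm.1 hw)
        rw [sub_re, abs_lt] at this
        simp only [mem_ofPred_eq] at hz ⊢
        linarith
      · filter_upwards [self_mem_ae_restrict measurableSet_Ioi] with t ht w hw
        rw [norm_cpow_mul_exp_neg ht]
        have := (abs_re_le_norm (w - z)).trans_lt (mem_ball_iff_norm.1 hw)
        rw [sub_re, abs_lt] at this
        have ht' : (0 : ℝ) < t := ht
        gcongr
        linarith
  have hd2 : DifferentiableOn ℂ (fun r : ℂ => exp (-(a * log r)) * Gamma a) {r : ℂ | 0 < r.re} :=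
    fun z hz => ((((differentiableAt_log (Or.inl hz)).const_mul a).neg.cexp).mul_const
      _).differentiableWithinAt
  refine (hd.analyticOnNhd hU).eqOn_of_preconnected_of_frequently_eq (hd2.analyticOnNhd hU)
    (convex_halfSpace_re_gt 0).isPreconnected (z₀ := 1) (by simp) ?_ hr
  have h1 : Tendsto (fun n : ℕ => ((1 + 1 / ((n : ℝ) + 1) : ℝ) : ℂ)) atTop (𝓝[≠] 1) := by
    refine tendsto_nhdsWithin_iff.2 ⟨?_, Eventually.of_forall fun n => ?_⟩
    · have := (tendsto_one_div_add_atTop_nhds_zero_nat (𝕜 := ℝ)).const_add 1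
      exact (Complex.continuous_ofReal.tendsto' _ _ (by simp)).comp this
    · have : 0 < 1 / ((n : ℝ) + 1) := by positivity
      have h : (1 + 1 / ((n : ℝ) + 1)) ≠ 1 := by linarith
      simpa using (by exact_mod_cast h : ((1 + 1 / ((n : ℝ) + 1) : ℝ) : ℂ) ≠ 1)
  refine h1.frequently (Frequently.of_forall fun n => ?_)
  have hpos : 0 < 1 + 1 / ((n : ℝ) + 1) := by positivity
  rw [integral_cpow_mul_exp_neg_mul_Ioi ha hpos]
  congr 1
  rw [one_div, ← ofReal_inv, cpow_def_of_ne_zero (by exact_mod_cast (inv_pos.2 hpos).ne'),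
    ← ofReal_log (inv_pos.2 hpos).le, Real.log_inv, ← ofReal_log hpos.le]
  congr 1; push_cast; ring

/-- Rotate Euler's integral to the ray of argument `θ = ±(π/2 - ε)`, with the sign of `Im s`. The
prefactor `exp (iθs)` supplies the decay, and what remains is at most `Γ(Re s) / δ^(Re s)` with `δ =
cos θ`, which is bounded for `Re s` in a compact interval. -/
theorem norm_Gamma_le {σ₀ M ε : ℝ} (hσ : 0 < σ₀) (hε : 0 < ε) (hε' : ε < Real.pi / 2) :
    ∃ C : ℝ, ∀ s : ℂ, σ₀ ≤ s.re → s.re ≤ M →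
      ‖Gamma s‖ ≤ C * Real.exp (-(Real.pi / 2 - ε) * |s.im|) := by
  set δ := Real.cos (Real.pi / 2 - ε) with hδ
  have hδ0 : 0 < δ := Real.cos_pos_of_mem_Ioo ⟨by linarith [Real.pi_pos], by linarith⟩
  have hcont : ContinuousOn (fun σ : ℝ => (1 / δ) ^ σ * Real.Gamma σ) (Icc σ₀ M) := by
    intro σ hs
    have hs0 : 0 < σ := hσ.trans_le hs.1
    refine ContinuousAt.continuousWithinAt (ContinuousAt.mul ?_ ?_)
    · exact (Real.continuous_const_rpow (by positivity)).continuousAt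
    · exact (Real.differentiableAt_Gamma fun m => by
        have : (0 : ℝ) ≤ m := m.cast_nonneg
        linarith).continuousAt
  obtain ⟨C, hC⟩ := isCompact_Icc.exists_bound_of_continuousOn hcont
  refine ⟨C, fun s h1 h2 => ?_⟩
  have hs0 : 0 < s.re := hσ.trans_le h1
  obtain ⟨θ, hθ, hθa⟩ : ∃ θ : ℝ, θ * s.im = (Real.pi / 2 - ε) * |s.im| ∧
      |θ| = Real.pi / 2 - ε := by
    rcases le_total 0 s.im with h | h
    · exact ⟨Real.pi / 2 - ε, by rw [abs_of_nonneg h], abs_of_pos (by linarith)⟩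
    · exact ⟨-(Real.pi / 2 - ε), by rw [abs_of_nonpos h]; ring, by
        rw [abs_neg, abs_of_pos (by linarith)]⟩
  have hcosθ : Real.cos θ = δ := by rw [← Real.cos_abs, hθa]
  have hlog : log (exp (θ * I)) = θ * I := by
    rw [log_exp] <;> simp
    · linarith [neg_abs_le θ, Real.pi_pos]
    · linarith [le_abs_self θ, Real.pi_pos]
  have hre : (exp (θ * I)).re = δ := by rw [exp_ofReal_mul_I_re, hcosθ]
  have key := integral_cpow_mul_exp_neg_mul_Ioi_of_re_pos hs0 (hre ▸ hδ0)
  rw [hlog] at key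
  have hG : Gamma s = exp (s * (θ * I)) *
      ∫ t : ℝ in Ioi 0, (t : ℂ) ^ (s - 1) * exp (-(exp (θ * I) * t)) := by
    rw [key, ← mul_assoc, ← Complex.exp_add]; simp
  have hnorm : ‖∫ t : ℝ in Ioi 0, (t : ℂ) ^ (s - 1) * exp (-(exp (θ * I) * t))‖ ≤
      (1 / δ) ^ s.re * Real.Gamma s.re := by
    rw [← Real.integral_rpow_mul_exp_neg_mul_Ioi hs0 hδ0]
    refine (norm_integral_le_integral_norm _).trans_eq ?_
    refine setIntegral_congr_fun measurableSet_Ioi fun t ht => ?_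
    rw [← hre]
    exact norm_cpow_mul_exp_neg ht
  have hexp : ‖exp (s * (θ * I))‖ = Real.exp (-(Real.pi / 2 - ε) * |s.im|) := by
    rw [norm_exp]
    congr 1
    simp only [mul_re, ofReal_re, I_re, mul_zero, ofReal_im, I_im, mul_one, sub_self, mul_im,
      add_zero, zero_sub]
    linarith
  rw [hG, norm_mul, hexp, mul_comm]
  gcongr
  exact hnorm.trans ((le_abs_self _).trans (hC s.re ⟨h1, h2⟩))

theorem norm_Gamma_le_norm_Gamma_add_nat {s : ℂ} (hs : 1 ≤ |s.im|) (n : ℕ) :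
    ‖Gamma s‖ ≤ ‖Gamma (s + n)‖ := by
  induction n with
  | zero => simp
  | succ n ih =>
    have him : (s + n).im = s.im := by simp
    have h1 : 1 ≤ ‖s + n‖ := by
      have := abs_im_le_norm (s + n)
      rw [him] at this; linarith
    have h0 : s + n ≠ 0 := norm_pos_iff.1 (by linarith)
    rw [Nat.cast_succ, ← add_assoc, Gamma_add_one _ h0, norm_mul]
    exact ih.trans (le_mul_of_one_le_left (norm_nonneg _) h1)

theorem norm_sin_le (z : ℂ) : ‖sin z‖ ≤ Real.exp |z.im| := by
  rw [Complex.sin, norm_div, norm_mul, norm_I, mul_one, norm_ofNat, div_le_iff₀ (by norm_num)]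
  refine (norm_sub_le _ _).trans ?_
  rw [norm_exp, norm_exp]
  have h1 : (-z * I).re ≤ |z.im| := by simpa using le_abs_self z.im
  have h2 : (z * I).re ≤ |z.im| := by simpa using neg_le_abs z.im
  linarith [Real.exp_le_exp.2 h1, Real.exp_le_exp.2 h2]

/-- Reflection gives `1/Γ(s) = Γ(1-s) sin(πs) / π`: the growth `exp(π|Im s|)` of the sine against
the decay of `Γ(1-s)` leaves the rate `π/2 + ε`. Adding `n ≥ M` moves `1 - s` into `Re ≥ 1` without
decreasing the modulus of `Γ`. For `|Im s| ≤ 1` compactness suffices, `1/Γ` being entire. -/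
theorem norm_inv_Gamma_le {M ε : ℝ} (hε : 0 < ε) (hε' : ε < Real.pi / 2) :
    ∃ C : ℝ, ∀ s : ℂ, |s.re| ≤ M →
      ‖(Gamma s)⁻¹‖ ≤ C * Real.exp ((Real.pi / 2 + ε) * |s.im|) := by
  obtain ⟨n, hn⟩ := exists_nat_ge M
  obtain ⟨C₁, hC₁⟩ := norm_Gamma_le (σ₀ := 1) (M := 1 + 2 * n) one_pos hε hε'
  obtain ⟨C₂, hC₂⟩ := ((isCompact_Icc (a := -M) (b := M)).reProdIm
    (isCompact_Icc (a := (-1 : ℝ)) (b := 1))).exists_bound_of_continuousOn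
    differentiable_one_div_Gamma.continuous.continuousOn
  refine ⟨|C₁| + |C₂|, fun s hs => ?_⟩
  have he : 1 ≤ Real.exp ((Real.pi / 2 + ε) * |s.im|) := Real.one_le_exp (by positivity)
  rcases le_total |s.im| 1 with h | h
  · have := (hC₂ s ⟨abs_le.1 hs, abs_le.1 h⟩).trans (le_abs_self _)
    calc _ ≤ (|C₁| + |C₂|) * 1 := by linarith [abs_nonneg C₁]
      _ ≤ _ := by gcongr
  · have hsin : sin (Real.pi * s) ≠ 0 := fun h0 => by
      obtain ⟨k, hk⟩ := Complex.sin_eq_zero_iff.1 h0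
      have hk' : s = k := mul_left_cancel₀ (ofReal_ne_zero.2 Real.pi_ne_zero)
        (by rw [hk]; ring)
      rw [hk'] at h
      simp at h
      linarith
    have hrefl := Gamma_mul_Gamma_one_sub s
    have hG0 : Gamma s ≠ 0 := fun h0 => by
      rw [h0, zero_mul, eq_comm, div_eq_zero_iff] at hrefl
      rcases hrefl with h2 | h2
      · exact Real.pi_ne_zero (ofReal_eq_zero.1 h2)
      · exact hsin h2
    have hval : (Gamma s)⁻¹ = Gamma (1 - s) * sin (Real.pi * s) / Real.pi := by
      have hpi : (Real.pi : ℂ) ≠ 0 := ofReal_ne_zero.2 Real.pi_ne_zero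
      rw [← one_div, div_eq_div_iff hG0 hpi]
      rw [eq_div_iff hsin] at hrefl
      linear_combination -hrefl
    have him1 : (1 - s).im = -s.im := by simp
    have h1 := norm_Gamma_le_norm_Gamma_add_nat (s := 1 - s) (by simpa using h) n
    have hre := abs_le.1 hs
    have h2 := hC₁ (1 - s + n) (by simp; linarith) (by simp; linarith)
    have h3 : (1 - s + n).im = -s.im := by simp
    rw [h3, abs_neg] at h2
    have h4 := norm_sin_le (Real.pi * s)
    have h5 : |((Real.pi : ℂ) * s).im| = Real.pi * |s.im| := by
      simp [abs_mul, abs_of_pos Real.pi_pos]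
    rw [h5] at h4
    rw [hval, norm_div, norm_mul, norm_real, Real.norm_eq_abs, abs_of_pos Real.pi_pos,
      div_le_iff₀ Real.pi_pos]
    calc ‖Gamma (1 - s)‖ * ‖sin (Real.pi * s)‖
        ≤ (|C₁| * Real.exp (-(Real.pi / 2 - ε) * |s.im|)) * Real.exp (Real.pi * |s.im|) := by
          gcongr
          exact h1.trans (h2.trans (by gcongr; exact le_abs_self _))
      _ = |C₁| * Real.exp ((Real.pi / 2 + ε) * |s.im|) := by
          rw [mul_assoc, ← Real.exp_add]; congr 2; ring
      _ ≤ (|C₁| + |C₂|) * Real.exp ((Real.pi / 2 + ε) * |s.im|) * 1 := by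
          rw [mul_one]; gcongr; linarith [abs_nonneg C₂]
      _ ≤ _ := by
          gcongr
          linarith [Real.pi_gt_three]

end GammaBounds

/-! ### Periodic kernels for the Barnes integrals -/

section Kernels

open MeasureTheory Complex Set

/-- The rational functions of `q = exp (2πis)` underlying the kernels. -/
def kernRat : ℕ → ℂ → ℂ
  | 0, q => q / (q - 1)
  | 1, q => q / (q - 1) ^ 2
  | 2, q => q * (q + 1) / (q - 1) ^ 3
  | _, q => q * (q ^ 2 + 4 * q + 1) / (q - 1) ^ 4

/-- The Barnes kernels: periodic functions with principal part `j! / (s - n) ^ (j + 1)` at the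
integers. -/
def kern (j : ℕ) (s : ℂ) : ℂ :=
  (2 * Real.pi * I) ^ (j + 1) * kernRat j (exp (2 * Real.pi * I * s))

/-- `κ` is a `1`-periodic kernel with principal part `j! / s ^ (j + 1)` at the integers, decaying
like `exp (-p |Im s|)` in the upper and like `exp (-p' |Im s|)` in the lower half-plane. -/
structure IsKernel (κ : ℂ → ℂ) (j : ℕ) (p p' : ℝ) : Prop where
  periodic : ∀ s, κ (s + 1) = κ s
  exists_reg : ∃ a : ℂ → ℂ, DifferentiableOn ℂ a {s | |s.re| < 1} ∧
    ∀ s : ℂ, |s.re| < 1 → s ≠ 0 → κ s = j.factorial / s ^ (j + 1) + a s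
  bound : ∃ C : ℝ, ∀ s : ℂ, (1 ≤ s.im → ‖κ s‖ ≤ C * Real.exp (-p * s.im)) ∧
    (s.im ≤ -1 → ‖κ s‖ ≤ C * Real.exp (p' * s.im))

theorem exp_two_pi_mul_I_mul_ne_one {s : ℂ} (hs : |s.re| < 1) (h0 : s ≠ 0) :
    exp (2 * Real.pi * I * s) ≠ 1 := fun h => by
  obtain ⟨n, hn⟩ := exp_eq_one_iff.1 h
  have hsn : s = n := by
    have : (2 * Real.pi * I : ℂ) ≠ 0 := two_pi_I_ne_zero
    exact mul_left_cancel₀ this (by rw [hn]; ring)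
  rw [hsn, intCast_re] at hs
  have hn0 : n = 0 := by
    have : |n| < 1 := by exact_mod_cast hs
    exact Int.abs_lt_one_iff.1 this
  exact h0 (by rw [hsn, hn0]; simp)

theorem isOpen_abs_re_lt_one : IsOpen {s : ℂ | |s.re| < 1} :=
  isOpen_lt (continuous_abs.comp continuous_re) continuous_const

theorem exp_two_pi_mul_I_mul_add_one (s : ℂ) :
    exp (2 * Real.pi * I * (s + 1)) = exp (2 * Real.pi * I * s) := by
  rw [mul_add, Complex.exp_add, mul_one, exp_two_pi_mul_I, mul_one]

theorem kern_periodic (j : ℕ) (s : ℂ) : kern j (s + 1) = kern j s := by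
  rw [kern, exp_two_pi_mul_I_mul_add_one, kern]

theorem hasDerivAt_kern {j : ℕ} (hj : j < 3) {s : ℂ} (hs : exp (2 * Real.pi * I * s) ≠ 1) :
    HasDerivAt (kern j) (-kern (j + 1) s) s := by
  have hq : HasDerivAt (fun s : ℂ => exp (2 * Real.pi * I * s))
      (exp (2 * Real.pi * I * s) * (2 * Real.pi * I)) s := by
    simpa using ((hasDerivAt_id s).const_mul (2 * Real.pi * I : ℂ)).cexp
  have h1 := hq.sub_const 1
  have hne : exp (2 * Real.pi * I * s) - 1 ≠ 0 := sub_ne_zero.2 hs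
  interval_cases j
  · convert! (hq.div h1 hne).const_mul ((2 * Real.pi * I : ℂ) ^ (0 + 1)) using 1
    simp only [kern, kernRat]
    field_simp
    ring
  · convert! (hq.div (h1.pow 2) (pow_ne_zero 2 hne)).const_mul ((2 * Real.pi * I : ℂ) ^ (1 + 1))
      using 1
    simp only [kern, kernRat, Pi.pow_apply]
    field_simp
    ring
  · convert! ((hq.mul (hq.add_const 1)).div (h1.pow 3) (pow_ne_zero 3 hne)).const_mul
      ((2 * Real.pi * I : ℂ) ^ (2 + 1)) using 1
    simp only [kern, kernRat, Pi.pow_apply, Pi.mul_apply]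
    field_simp
    ring

/-- For `j = 0`, `exp(2πis) - 1 = s E(s)` with `E` free of zeros in `|Re s| < 1`, so `kern 0 =
N(s)/s` with `N` holomorphic and `N(0) = 1`. Each further kernel is minus the derivative of the
preceding one, which turns `j!/s^(j+1)` into `(j+1)!/s^(j+2)`. -/
theorem exists_reg_kern {j : ℕ} (hj : j ≤ 3) :
    ∃ a : ℂ → ℂ, DifferentiableOn ℂ a {s | |s.re| < 1} ∧
      ∀ s : ℂ, |s.re| < 1 → s ≠ 0 → kern j s = j.factorial / s ^ (j + 1) + a s := by
  induction j with
  | zero =>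
    set c : ℂ := 2 * Real.pi * I with hc
    have hc0 : c ≠ 0 := two_pi_I_ne_zero
    let ex : ℂ → ℂ := fun s => exp (c * s)
    let E : ℂ → ℂ := dslope ex 0
    have hder : HasDerivAt ex c 0 := by
      simpa [ex] using ((hasDerivAt_id (0 : ℂ)).const_mul c).cexp
    have hE0 : E 0 = c := by rw [show E 0 = deriv ex 0 from dslope_same _ _, hder.deriv]
    have hE : ∀ s, s * E s = exp (c * s) - 1 := fun s => by
      have := sub_smul_dslope ex 0 s
      simpa [ex, E] using this
    have hEd : Differentiable ℂ E := by
      rw [← differentiableOn_univ]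
      exact (differentiableOn_dslope univ_mem).2 (by fun_prop)
    have hEne : ∀ s : ℂ, |s.re| < 1 → E s ≠ 0 := fun s hs h => by
      by_cases h0 : s = 0
      · rw [h0, hE0] at h; exact hc0 h
      · have := hE s
        rw [h, mul_zero, eq_comm, sub_eq_zero] at this
        exact exp_two_pi_mul_I_mul_ne_one hs h0 this
    let N : ℂ → ℂ := fun s => c * exp (c * s) / E s
    have hN : DifferentiableOn ℂ N {s | |s.re| < 1} := fun s hs =>
      (DifferentiableAt.div (by fun_prop) (hEd s) (hEne s hs)).differentiableWithinAt
    refine ⟨dslope N 0, (differentiableOn_dslope (isOpen_abs_re_lt_one.mem_nhds (by simp))).2 hN,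
      fun s hs h0 => ?_⟩
    have h1 := sub_smul_dslope N 0 s
    have hN0 : N 0 = 1 := by simp [N, hE0, hc0]
    rw [hN0, sub_zero, smul_eq_mul] at h1
    have h2 : kern 0 s = N s / s := by
      simp only [kern, kernRat, N, ← hc, ← hE s]
      rw [zero_add, pow_one, div_div, mul_div_assoc, mul_comm s]
    rw [h2, Nat.factorial_zero, Nat.cast_one, zero_add, pow_one]
    field_simp
    linear_combination -h1
  | succ j ih =>
    obtain ⟨a, ha, hk⟩ := ih (by omega)
    refine ⟨fun s => -deriv a s, (ha.deriv isOpen_abs_re_lt_one).neg, fun s hs h0 => ?_⟩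
    have h1 := hasDerivAt_kern (j := j) (by omega) (exp_two_pi_mul_I_mul_ne_one hs h0)
    have h2 : HasDerivAt (fun s : ℂ => (j.factorial : ℂ) * (s ^ (j + 1))⁻¹ + a s)
        ((j.factorial : ℂ) * (-(((j + 1 : ℕ) : ℂ) * s ^ j) / (s ^ (j + 1)) ^ 2) + deriv a s) s :=
      (((hasDerivAt_pow (j + 1) s).inv (pow_ne_zero _ h0)).const_mul _).add
        (ha.differentiableAt (isOpen_abs_re_lt_one.mem_nhds hs)).hasDerivAt
    have h3 : kern j =ᶠ[𝓝 s] fun s : ℂ => (j.factorial : ℂ) * (s ^ (j + 1))⁻¹ + a s := by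
      filter_upwards [isOpen_abs_re_lt_one.mem_nhds hs, isOpen_ne.mem_nhds h0] with z hz hz0
      rw [hk z hz hz0, div_eq_mul_inv]
    have h4 := h1.unique (h2.congr_of_eventuallyEq h3)
    rw [neg_eq_iff_eq_neg.1 h4, Nat.factorial_succ]
    push_cast
    field_simp
    ring

/-- Every numerator is `q` times a factor of modulus at most `6`, and the denominator costs at most
`2⁴ = 16`; hence `96`. -/
theorem norm_kernRat_le {j : ℕ} {q : ℂ} (hq : ‖q‖ ≤ 1 / 2) : ‖kernRat j q‖ ≤ 96 * ‖q‖ := by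
  have h1 : 1 / 2 ≤ ‖q - 1‖ := by
    have := norm_sub_norm_le 1 q
    rw [norm_one, norm_sub_rev] at this; linarith
  have hpow : ∀ k : ℕ, k ≤ 4 → ‖q - 1‖⁻¹ ^ k ≤ 16 := fun k hk => by
    have h2 : ‖q - 1‖⁻¹ ≤ 2 := by
      rw [inv_le_comm₀ (by linarith) two_pos]; linarith
    calc ‖q - 1‖⁻¹ ^ k ≤ 2 ^ k := by gcongr
      _ ≤ 2 ^ 4 := pow_le_pow_right₀ one_le_two hk
      _ = 16 := by norm_num
  have key : ∀ (k : ℕ) (r : ℂ), k ≤ 4 → ‖r‖ ≤ 6 → ‖q * r / (q - 1) ^ k‖ ≤ 96 * ‖q‖ := by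
    intro k r hk hr
    rw [norm_div, norm_mul, norm_pow, div_eq_mul_inv, ← inv_pow]
    calc ‖q‖ * ‖r‖ * ‖q - 1‖⁻¹ ^ k ≤ ‖q‖ * 6 * 16 := by gcongr; exact hpow k hk
      _ = _ := by ring
  have hq1 : ‖q + 1‖ ≤ 6 := (norm_add_le _ _).trans (by rw [norm_one]; linarith)
  have hq2 : ‖q ^ 2 + 4 * q + 1‖ ≤ 6 := by
    refine (norm_add₃_le).trans ?_
    rw [norm_pow, norm_mul, norm_one, norm_ofNat]
    nlinarith [norm_nonneg q]
  match j with
  | 0 => simpa [kernRat] using key 1 1 (by norm_num) (by norm_num)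
  | 1 => simpa [kernRat] using key 2 1 (by norm_num) (by norm_num)
  | 2 => exact key 3 _ (by norm_num) hq1
  | j + 3 => exact key 4 _ le_rfl hq2

/-- The inversion `q ↦ q⁻¹` exchanges the two half-planes, so for `j ≥ 1` the decay below follows
from the decay above. It fails for `j = 0`, where the limit below is `1`. -/
theorem kernRat_inv {j : ℕ} (hj : 1 ≤ j) {q : ℂ} (hq : q ≠ 0) :
    kernRat j q⁻¹ = kernRat j q ∨ kernRat j q⁻¹ = -kernRat j q := by
  by_cases h1 : q = 1
  · simp [h1]
  have h2 : q - 1 ≠ 0 := sub_ne_zero.2 h1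
  have h3 : q⁻¹ - 1 = -(q - 1) / q := by field_simp; ring
  match j with
  | 1 => left; simp only [kernRat, h3]; field_simp
  | 2 => right; simp only [kernRat, h3]; field_simp; ring
  | j + 3 => left; simp only [kernRat, h3]; field_simp; ring

theorem norm_exp_two_pi_mul_I_mul (s : ℂ) :
    ‖exp (2 * Real.pi * I * s)‖ = Real.exp (-(2 * Real.pi) * s.im) := by
  rw [norm_exp]; congr 1; simp

theorem exp_neg_two_pi_le_half {x : ℝ} (hx : 1 ≤ x) : Real.exp (-(2 * Real.pi) * x) ≤ 1 / 2 := by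
  have h1 : Real.exp (-(2 * Real.pi) * x) ≤ Real.exp (-1) :=
    Real.exp_le_exp.2 (by nlinarith [Real.pi_gt_three])
  have h2 : Real.exp (-1) ≤ 1 / 2 := by
    rw [Real.exp_neg, one_div]
    exact inv_anti₀ two_pos (by have := Real.add_one_le_exp (1 : ℝ); linarith)
  exact h1.trans h2

theorem isKernel_kern {j : ℕ} (hj : 1 ≤ j) (hj' : j ≤ 3) :
    IsKernel (kern j) j (2 * Real.pi) (2 * Real.pi) := by
  refine ⟨kern_periodic j, exists_reg_kern hj', (2 * Real.pi) ^ (j + 1) * 96, fun s => ?_⟩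
  have hc : ‖(2 * Real.pi * I : ℂ) ^ (j + 1)‖ = (2 * Real.pi) ^ (j + 1) := by
    rw [norm_pow]; simp [abs_of_pos Real.pi_pos]
  have hn := norm_exp_two_pi_mul_I_mul s
  refine ⟨fun h => ?_, fun h => ?_⟩
  · rw [kern, norm_mul, hc, mul_assoc _ (96 : ℝ)]
    gcongr
    rw [← hn]
    exact norm_kernRat_le (hn ▸ exp_neg_two_pi_le_half h)
  · rw [kern, norm_mul, hc, mul_assoc _ (96 : ℝ)]
    gcongr
    have hinv : ‖(exp (2 * Real.pi * I * s))⁻¹‖ = Real.exp (2 * Real.pi * s.im) := by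
      rw [norm_inv, hn, ← Real.exp_neg]; congr 1; ring
    have h1 : ‖kernRat j (exp (2 * Real.pi * I * s))‖ =
        ‖kernRat j (exp (2 * Real.pi * I * s))⁻¹‖ := by
      rcases kernRat_inv hj (exp_ne_zero (2 * Real.pi * I * s)) with h | h <;> rw [h]
      rw [norm_neg]
    rw [h1, ← hinv]
    refine norm_kernRat_le ?_
    rw [hinv]
    have := exp_neg_two_pi_le_half (x := -s.im) (by linarith)
    rwa [neg_mul_neg] at this

theorem kern_zero_sub (s : ℂ) (hs : exp (2 * Real.pi * I * s) ≠ 1) :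
    kern 0 s - 2 * Real.pi * I = -(2 * Real.pi * I) * kernRat 0 (exp (2 * Real.pi * I * s))⁻¹ := by
  have h1 : exp (2 * Real.pi * I * s) - 1 ≠ 0 := sub_ne_zero.2 hs
  have h0 := exp_ne_zero (2 * Real.pi * I * s)
  have h3 : (exp (2 * Real.pi * I * s))⁻¹ - 1 =
      -(exp (2 * Real.pi * I * s) - 1) / exp (2 * Real.pi * I * s) := by field_simp; ring
  simp only [kern, kernRat, h3]
  field_simp
  ring

theorem norm_kern_zero_bounds (s : ℂ) :
    (1 ≤ s.im → ‖kern 0 s‖ ≤ 2 * Real.pi * 96 * Real.exp (-(2 * Real.pi) * s.im)) ∧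
    (s.im ≤ -1 → ‖kern 0 s - 2 * Real.pi * I‖ ≤
      2 * Real.pi * 96 * Real.exp ((2 * Real.pi) * s.im)) := by
  have hc : ‖(2 * Real.pi * I : ℂ)‖ = 2 * Real.pi := by simp [abs_of_pos Real.pi_pos]
  have hn := norm_exp_two_pi_mul_I_mul s
  refine ⟨fun h => ?_, fun h => ?_⟩
  · rw [kern, norm_mul, zero_add, pow_one, hc, mul_assoc _ (96 : ℝ)]
    gcongr
    rw [← hn]
    exact norm_kernRat_le (hn ▸ exp_neg_two_pi_le_half h)
  · have hinv : ‖(exp (2 * Real.pi * I * s))⁻¹‖ = Real.exp (2 * Real.pi * s.im) := by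
      rw [norm_inv, hn, ← Real.exp_neg]; congr 1; ring
    have hsmall := exp_neg_two_pi_le_half (x := -s.im) (by linarith)
    rw [neg_mul_neg] at hsmall
    rw [kern_zero_sub, norm_mul, norm_neg, hc, mul_assoc _ (96 : ℝ), ← hinv]
    · gcongr
      exact norm_kernRat_le (hinv ▸ hsmall)
    · intro h1
      rw [h1, inv_one, norm_one] at hinv
      linarith

theorem isKernel_kern_zero : IsKernel (kern 0) 0 (2 * Real.pi) 0 := by
  refine ⟨kern_periodic 0, exists_reg_kern (by norm_num), 2 * Real.pi * 96 + 2 * Real.pi,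
    fun s => ⟨fun h => ((norm_kern_zero_bounds s).1 h).trans ?_, fun h => ?_⟩⟩
  · gcongr; linarith [Real.pi_pos]
  · have h1 := (norm_kern_zero_bounds s).2 h
    have h2 : Real.exp (2 * Real.pi * s.im) ≤ 1 :=
      Real.exp_le_one_iff.2 (by nlinarith [Real.pi_pos])
    have h3 : ‖kern 0 s‖ ≤ ‖kern 0 s - 2 * Real.pi * I‖ + ‖(2 * Real.pi * I : ℂ)‖ := by
      simpa using norm_add_le (kern 0 s - 2 * Real.pi * I) (2 * Real.pi * I)
    have hc : ‖(2 * Real.pi * I : ℂ)‖ = 2 * Real.pi := by simp [abs_of_pos Real.pi_pos]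
    rw [hc] at h3
    rw [zero_mul, Real.exp_zero, mul_one]
    nlinarith [Real.pi_pos]

/-- `kern 0` tends to `2πi` in the lower half-plane. Subtracting this constant keeps the poles and
exchanges the half-plane of decay: the two kernels serve the two sides of the real axis, and their
difference `2πi` is what the passage of the conifold point detects. -/
theorem isKernel_kern_zero_sub :
    IsKernel (fun s => kern 0 s - 2 * Real.pi * I) 0 0 (2 * Real.pi) := by
  obtain ⟨a, ha, hk⟩ := exists_reg_kern (j := 0) (by norm_num)
  refine ⟨fun s => by rw [kern_periodic], ⟨fun s => a s - 2 * Real.pi * I, ha.sub_const _,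
    fun s hs h0 => by rw [hk s hs h0]; ring⟩, 2 * Real.pi * 96 + 2 * Real.pi,
    fun s => ⟨fun h => ?_, fun h => ((norm_kern_zero_bounds s).2 h).trans ?_⟩⟩
  · have h1 := (norm_kern_zero_bounds s).1 h
    have h2 : Real.exp (-(2 * Real.pi) * s.im) ≤ 1 :=
      Real.exp_le_one_iff.2 (by nlinarith [Real.pi_pos])
    have h3 := norm_sub_le (kern 0 s) (2 * Real.pi * I)
    have hc : ‖(2 * Real.pi * I : ℂ)‖ = 2 * Real.pi := by simp [abs_of_pos Real.pi_pos]
    rw [hc] at h3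
    rw [neg_zero, zero_mul, Real.exp_zero, mul_one]
    nlinarith [Real.pi_pos]
  · gcongr; linarith [Real.pi_pos]

end Kernels

namespace CYFamily

open MeasureTheory Complex Set

/-! ### The Gamma quotients -/

/-- `Γ(1 + ds) / ∏_{i ≤ 5} Γ(1 + ωᵢ s)`. -/
def hypA (Y : CYFamily) (s : ℂ) : ℂ :=
  Gamma (1 + Y.degree * s) / ∏ i : Fin 5, Gamma (1 + Y.weight i * s)

/-- `Γ(1 + ds) / ∏_{i ≤ 4} Γ(1 + ωᵢ s)`. -/
def hypB (Y : CYFamily) (s : ℂ) : ℂ :=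
  Gamma (1 + Y.degree * s) / ∏ i : Fin 4, Gamma (1 + Y.weight i.castSucc * s)

/-- The elements of `J`. -/
def idx : CYFamily → Fin 4 → ℕ
  | Y5 => ![1, 2, 3, 4]
  | Y6 => ![1, 2, 4, 5]
  | Y8 => ![1, 3, 5, 7]
  | Y10 => ![1, 3, 7, 9]

/-- The exponents `1 - j / d`. -/
def pole (Y : CYFamily) (i : Fin 4) : ℝ := 1 - Y.idx i / Y.degree

theorem degree_pos (Y : CYFamily) : 0 < Y.degree := by cases Y <;> simp [degree]

theorem degree_le (Y : CYFamily) : Y.degree ≤ 10 := by cases Y <;> simp [degree]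

theorem weight_le (Y : CYFamily) (i : Fin 5) : Y.weight i ≤ 5 := by
  cases Y <;> fin_cases i <;> simp [weight]

theorem weight_pos (Y : CYFamily) (i : Fin 5) : 0 < Y.weight i := by
  cases Y <;> fin_cases i <;> simp [weight]

theorem sum_weight (Y : CYFamily) : ∑ i : Fin 5, Y.weight i = Y.degree := by
  cases Y <;> simp [weight, degree, Fin.sum_univ_succ]

theorem weight_last (Y : CYFamily) : Y.weight (Fin.last 4) = 1 := by cases Y <;> rfl

theorem conifold_pos (Y : CYFamily) : 0 < Y.conifold := by cases Y <;> norm_num [conifold]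

theorem pole_mem (Y : CYFamily) (i : Fin 4) : 1 / 10 ≤ Y.pole i ∧ Y.pole i ≤ 9 / 10 := by
  cases Y <;> fin_cases i <;> norm_num [pole, idx, degree]

theorem pole_injective (Y : CYFamily) : Function.Injective Y.pole := by
  intro i j h
  cases Y <;> fin_cases i <;> fin_cases j <;> first | rfl | (norm_num [pole, idx, degree] at h)

/-- A Gamma quotient `g` with `g (s + 1) (s + 1) ^ m x_c = g(s) ∏ⱼ (s + j / d)` which decays like
`exp (-lam |Im s|)` on vertical strips. -/
structure IsWeight (Y : CYFamily) (g : ℂ → ℂ) (m : ℕ) (lam : ℝ) : Prop where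
  diff : DifferentiableOn ℂ g {s | -(1 / 10) < s.re}
  shift : ∀ s : ℂ, -(1 / 10) < s.re →
    g (s + 1) * (s + 1) ^ m * Y.conifold = g s * ∏ i, (s + 1 - Y.pole i)
  bound : ∀ M ε : ℝ, 0 < ε → ∃ C : ℝ, ∀ s : ℂ, -(1 / 20) ≤ s.re → s.re ≤ M →
    ‖g s‖ ≤ C * Real.exp (-(lam - ε) * |s.im|)

theorem isOpen_re_gt (c : ℝ) : IsOpen {s : ℂ | c < s.re} := isOpen_lt continuous_const continuous_re

/-- The abscissa `-1/10` is dictated by `d ≤ 10`: to its right no Gamma factor meets a pole. -/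
theorem degree_re_pos (Y : CYFamily) {s : ℂ} (hs : -(1 / 10) < s.re) :
    0 < (1 + (Y.degree : ℂ) * s).re := by
  have h1 : (Y.degree : ℝ) ≤ 10 := by exact_mod_cast Y.degree_le
  have h0 : (0 : ℝ) < Y.degree := by exact_mod_cast Y.degree_pos
  simp
  nlinarith

theorem weight_re_pos (Y : CYFamily) (i : Fin 5) {s : ℂ} (hs : -(1 / 10) < s.re) :
    0 < (1 + (Y.weight i : ℂ) * s).re := by
  have h1 : (Y.weight i : ℝ) ≤ 5 := by exact_mod_cast Y.weight_le i
  have h0 : (0 : ℝ) < Y.weight i := by exact_mod_cast Y.weight_pos i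
  simp
  nlinarith

theorem hypB_eq (Y : CYFamily) {s : ℂ} (hs : -(1 / 10) < s.re) :
    Y.hypB s = Y.hypA s * Gamma (1 + s) := by
  have h := Gamma_ne_zero_of_re_pos (Y.weight_re_pos (Fin.last 4) hs)
  rw [weight_last, Nat.cast_one, one_mul] at h
  rw [hypA, hypB, Fin.prod_univ_castSucc (n := 4), weight_last, Nat.cast_one, one_mul, ← div_div,
    div_mul_cancel₀ _ h]

theorem differentiableOn_hypA (Y : CYFamily) : DifferentiableOn ℂ Y.hypA {s | -(1 / 10) < s.re} := by
  intro s hs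
  refine (DifferentiableAt.div ?_ ?_ ?_).differentiableWithinAt
  · refine (differentiableAt_Gamma _ fun m h => ?_).comp s (by fun_prop)
    have := Y.degree_re_pos hs
    rw [h] at this
    simp at this
    linarith [m.cast_nonneg (α := ℝ)]
  · refine DifferentiableAt.fun_finsetProd fun i _ => ?_
    refine (differentiableAt_Gamma _ fun m h => ?_).comp s (by fun_prop)
    have := Y.weight_re_pos i hs
    rw [h] at this
    simp at this
    linarith [m.cast_nonneg (α := ℝ)]
  · exact Finset.prod_ne_zero_iff.2 fun i _ => Gamma_ne_zero_of_re_pos (Y.weight_re_pos i hs)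

theorem Gamma_add_nat_eq {z : ℂ} (hz : 0 < z.re) (n : ℕ) :
    Gamma (z + n) = Gamma z * ∏ k ∈ Finset.range n, (z + k) := by
  induction n with
  | zero => simp
  | succ n ih =>
    have h0 : z + n ≠ 0 := fun h => by
      have := congrArg re h
      simp at this
      linarith [n.cast_nonneg (α := ℝ)]
    rw [Nat.cast_succ, ← add_assoc, Gamma_add_one _ h0, ih, Finset.prod_range_succ]
    ring

/-- The shift produces `d` linear factors in the numerator and `∑ ω_i = d` in the denominator. After
cancellation there remain `s + j/d` for `j ∈ J` over `(s+1)^4`, and the leading coefficients combine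
to `1/x_c`. -/
theorem hypA_shift (Y : CYFamily) (s : ℂ) (hs : -(1 / 10) < s.re) :
    Y.hypA (s + 1) * (s + 1) ^ 4 * Y.conifold = Y.hypA s * ∏ i, (s + 1 - Y.pole i) := by
  have hd : Gamma (1 + Y.degree * (s + 1)) =
      Gamma (1 + Y.degree * s) * ∏ k ∈ Finset.range Y.degree, (1 + Y.degree * s + k) := by
    rw [← Gamma_add_nat_eq (Y.degree_re_pos hs)]; congr 1; ring
  have hw : ∀ i : Fin 5, Gamma (1 + Y.weight i * (s + 1)) =
      Gamma (1 + Y.weight i * s) * ∏ k ∈ Finset.range (Y.weight i), (1 + Y.weight i * s + k) := by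
    intro i
    rw [← Gamma_add_nat_eq (Y.weight_re_pos i hs)]; congr 1; ring
  have hG : ∏ i : Fin 5, Gamma (1 + Y.weight i * s) ≠ 0 :=
    Finset.prod_ne_zero_iff.2 fun i _ => Gamma_ne_zero_of_re_pos (Y.weight_re_pos i hs)
  have hne : ∀ i : Fin 5, ∏ k ∈ Finset.range (Y.weight i), (1 + (Y.weight i : ℂ) * s + k) ≠ 0 := by
    intro i
    refine Finset.prod_ne_zero_iff.2 fun k _ h => ?_
    have h1 := Y.weight_re_pos i hs
    have h2 := congrArg re h
    rw [add_re, natCast_re, zero_re] at h2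
    linarith [k.cast_nonneg (α := ℝ)]
  rw [hypA, hypA, hd]
  simp only [hw]
  rw [Finset.prod_mul_distrib]
  have key : (∏ k ∈ Finset.range Y.degree, (1 + (Y.degree : ℂ) * s + k)) * (s + 1) ^ 4 *
      Y.conifold = (∏ i : Fin 5, ∏ k ∈ Finset.range (Y.weight i), (1 + (Y.weight i : ℂ) * s + k)) *
      ∏ i, (s + 1 - Y.pole i) := by
    cases Y <;>
    · simp [degree, weight, conifold, pole, idx, Finset.prod_range_succ, Fin.prod_univ_succ]
      ring
  have hP := Finset.prod_ne_zero_iff.2 fun i (_ : i ∈ Finset.univ) => hne i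
  rw [div_mul_eq_mul_div, div_mul_eq_mul_div, div_mul_eq_mul_div, div_eq_div_iff
    (mul_ne_zero hG hP) hG]
  linear_combination Gamma (1 + Y.degree * s) * (∏ i : Fin 5, Gamma (1 + Y.weight i * s)) * key

/-- The rates `πd/2` of the numerator and `π ∑ ω_i / 2` of the denominator cancel since `∑ ω_i = d`.
The loss is `2δd ≤ 20δ ≤ ε`. -/
theorem hypA_bound (Y : CYFamily) (M ε : ℝ) (hε : 0 < ε) : ∃ C : ℝ, ∀ s : ℂ,
    -(1 / 20) ≤ s.re → s.re ≤ M → ‖Y.hypA s‖ ≤ C * Real.exp (-(0 - ε) * |s.im|) := by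
  set δ := min (ε / 20) 1 with hδ
  have hδ0 : 0 < δ := lt_min (by positivity) one_pos
  have hδ1 : δ < Real.pi / 2 := (min_le_right _ _).trans_lt (by linarith [Real.pi_gt_three])
  have hδε : δ * 20 ≤ ε := by
    have := min_le_left (ε / 20) 1
    rw [← hδ] at this; linarith
  have hd10 : (Y.degree : ℝ) ≤ 10 := by exact_mod_cast Y.degree_le
  have hd0 : (0 : ℝ) < Y.degree := by exact_mod_cast Y.degree_pos
  obtain ⟨C₁, hC₁⟩ := norm_Gamma_le (σ₀ := 1 / 2) (M := 1 + 10 * |M|) (by norm_num) hδ0 hδ1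
  obtain ⟨C₂, hC₂⟩ := norm_inv_Gamma_le (M := 2 + 5 * |M|) hδ0 hδ1
  refine ⟨|C₁| * ∏ i : Fin 5, |C₂|, fun s h1 h2 => ?_⟩
  have hM := le_abs_self M
  have hM0 := abs_nonneg M
  have hG := hC₁ (1 + Y.degree * s) (by simp; nlinarith) (by simp; nlinarith)
  have him : (1 + (Y.degree : ℂ) * s).im = Y.degree * s.im := by simp
  rw [him, abs_mul, abs_of_pos hd0] at hG
  have hW : ∀ i : Fin 5, ‖(Gamma (1 + Y.weight i * s))⁻¹‖ ≤
      |C₂| * Real.exp ((Real.pi / 2 + δ) * (Y.weight i * |s.im|)) := fun i => by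
    have hw5 : (Y.weight i : ℝ) ≤ 5 := by exact_mod_cast Y.weight_le i
    have hw0 : (0 : ℝ) < Y.weight i := by exact_mod_cast Y.weight_pos i
    have := hC₂ (1 + Y.weight i * s) (by
      simp; rw [abs_le]; constructor <;> nlinarith)
    have him : (1 + (Y.weight i : ℂ) * s).im = Y.weight i * s.im := by simp
    rw [him, abs_mul, abs_of_pos hw0] at this
    exact this.trans (by gcongr; exact le_abs_self _)
  have hsum : ∑ i : Fin 5, (Real.pi / 2 + δ) * ((Y.weight i : ℝ) * |s.im|) =
      (Real.pi / 2 + δ) * (Y.degree * |s.im|) := by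
    rw [← Finset.mul_sum, ← Finset.sum_mul, ← Nat.cast_sum, sum_weight]
  rw [hypA, div_eq_mul_inv, norm_mul, ← Finset.prod_inv_distrib, norm_prod]
  calc _ ≤ (|C₁| * Real.exp (-(Real.pi / 2 - δ) * (Y.degree * |s.im|))) *
        ∏ i : Fin 5, (|C₂| * Real.exp ((Real.pi / 2 + δ) * (Y.weight i * |s.im|))) := by
        gcongr with i
        · exact hG.trans (by gcongr; exact le_abs_self _)
        · exact hW i
    _ = (|C₁| * ∏ i : Fin 5, |C₂|) * Real.exp (2 * δ * Y.degree * |s.im|) := by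
        rw [Finset.prod_mul_distrib, ← Real.exp_sum, hsum, mul_mul_mul_comm, ← Real.exp_add]
        congr 2; ring
    _ ≤ _ := by
        gcongr
        nlinarith

theorem isWeight_hypA (Y : CYFamily) : Y.IsWeight Y.hypA 4 0 :=
  ⟨Y.differentiableOn_hypA, Y.hypA_shift, Y.hypA_bound⟩

/-- The additional factor `Γ(1+s)` cancels one power of `s + 1` in the recurrence and supplies the
decay rate `π/2`. -/
theorem isWeight_hypB (Y : CYFamily) : Y.IsWeight Y.hypB 3 (Real.pi / 2) := by
  refine ⟨?_, fun s hs => ?_, fun M ε hε => ?_⟩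
  · have hG : DifferentiableOn ℂ (fun s => Gamma (1 + s)) {s | -(1 / 10) < s.re} := fun s hs => ?_
    · exact (Y.differentiableOn_hypA.mul hG).congr fun s hs => Y.hypB_eq hs
    refine ((differentiableAt_Gamma _ fun m h => ?_).comp s (by fun_prop)).differentiableWithinAt
    have := congrArg re h
    have hs' : -(1 / 10) < s.re := hs
    simp at this
    linarith [m.cast_nonneg (α := ℝ)]
  · have hs1 : -(1 / 10) < (s + 1).re := by simp; linarith
    have h0 : 1 + s ≠ 0 := fun h => by
      have := congrArg re h
      simp at this
      linarith
    rw [hypB_eq Y hs, hypB_eq Y hs1, ← add_assoc, Gamma_add_one _ h0]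
    linear_combination Gamma (1 + s) * Y.hypA_shift s hs
  · set δ := min (ε / 2) 1 with hδ
    have hδ0 : 0 < δ := lt_min (by positivity) one_pos
    have hδ1 : δ < Real.pi / 2 := (min_le_right _ _).trans_lt (by linarith [Real.pi_gt_three])
    have hδε : δ * 2 ≤ ε := by
      have := min_le_left (ε / 2) 1
      rw [← hδ] at this; linarith
    obtain ⟨C₁, hC₁⟩ := norm_Gamma_le (σ₀ := 1 / 2) (M := 1 + M) (by norm_num) hδ0 hδ1
    obtain ⟨C₂, hC₂⟩ := Y.hypA_bound M δ hδ0
    refine ⟨|C₂| * |C₁|, fun s h1 h2 => ?_⟩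
    rw [hypB_eq Y (by linarith), norm_mul]
    have e1 := hC₁ (1 + s) (by simp; linarith) (by simp; linarith)
    have e2 := hC₂ s h1 h2
    have him : (1 + s).im = s.im := by simp
    rw [him] at e1
    calc _ ≤ (|C₂| * Real.exp (-(0 - δ) * |s.im|)) *
          (|C₁| * Real.exp (-(Real.pi / 2 - δ) * |s.im|)) := by
          gcongr
          · exact e2.trans (by gcongr; exact le_abs_self _)
          · exact e1.trans (by gcongr; exact le_abs_self _)
      _ = |C₂| * |C₁| * Real.exp (-(Real.pi / 2 - 2 * δ) * |s.im|) := by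
          rw [mul_mul_mul_comm, ← Real.exp_add]; congr 2; ring
      _ ≤ _ := by gcongr; linarith

/-- The factor `g (s - 1) / g(s)` for a weight of exponent `m`. -/
def ratio (Y : CYFamily) (m : ℕ) (s : ℂ) : ℂ := Y.conifold * s ^ m / ∏ i, (s - Y.pole i)

theorem IsWeight.eq_ratio_mul {Y : CYFamily} {g : ℂ → ℂ} {m : ℕ} {lam : ℝ}
    (hg : Y.IsWeight g m lam) {s : ℂ} (hs : -(1 / 10) < s.re) (h : ∀ i, s + 1 ≠ Y.pole i) :
    g s = Y.ratio m (s + 1) * g (s + 1) := by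
  have hP : ∏ i, (s + 1 - Y.pole i) ≠ 0 :=
    Finset.prod_ne_zero_iff.2 fun i _ => sub_ne_zero.2 (h i)
  rw [ratio, div_mul_eq_mul_div, eq_div_iff hP, ← hg.shift s hs]
  ring

theorem norm_le_norm_sub_pole (Y : CYFamily) (i : Fin 4) {s : ℂ} (hs : s.re ≤ 0) :
    ‖s‖ ≤ ‖s - Y.pole i‖ := by
  have h := (Y.pole_mem i).1
  rw [← sq_le_sq₀ (norm_nonneg _) (norm_nonneg _), ← normSq_eq_norm_sq, ← normSq_eq_norm_sq,
    normSq_apply, normSq_apply]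
  simp
  nlinarith

/-- In `Re s ≤ 0` the point `0` is nearer to `s` than any of the positive numbers `π_i`, so each of
the four quotients `|s| / |s - π_i|` is at most `1`. -/
theorem norm_ratio_four_le (Y : CYFamily) {s : ℂ} (hs : s.re ≤ 0) :
    ‖Y.ratio 4 s‖ ≤ Y.conifold := by
  have hne : ∀ i, 0 < ‖s - Y.pole i‖ := fun i => norm_pos_iff.2 <| sub_ne_zero.2 fun h => by
    have := (Y.pole_mem i).1
    rw [h, ofReal_re] at hs; linarith
  rw [ratio, norm_div, norm_mul, norm_pow, norm_prod, norm_real, Real.norm_eq_abs,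
    abs_of_pos Y.conifold_pos, div_le_iff₀ (Finset.prod_pos fun i _ => hne i)]
  have : ‖s‖ ^ 4 = ∏ i : Fin 4, ‖s‖ := by simp
  rw [this]
  gcongr with i
  · exact Y.conifold_pos.le
  · exact Y.norm_le_norm_sub_pole i hs

/-- Only three factors `s` stand against four factors `s - π_i`. The spare denominator makes the
products of ratios decay factorially, so the local solutions of the Laplace-transformed equation
converge for all `z`. -/
theorem norm_ratio_three_le (Y : CYFamily) {s : ℂ} (hs : s.re ≤ 0) :
    ‖Y.ratio 3 s‖ ≤ Y.conifold / (1 / 10 - s.re) := by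
  have hre : ∀ i, 1 / 10 - s.re ≤ ‖s - Y.pole i‖ := fun i => by
    have h1 := (Y.pole_mem i).1
    have h2 := abs_re_le_norm (s - Y.pole i)
    rw [sub_re, ofReal_re, abs_sub_comm] at h2
    linarith [le_abs_self (Y.pole i - s.re)]
  have hne : ∀ i, 0 < ‖s - Y.pole i‖ := fun i => lt_of_lt_of_le (by linarith) (hre i)
  rw [ratio, norm_div, norm_mul, norm_pow, norm_prod, norm_real, Real.norm_eq_abs,
    abs_of_pos Y.conifold_pos, div_le_div_iff₀ (Finset.prod_pos fun i _ => hne i) (by linarith),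
    mul_assoc]
  refine mul_le_mul_of_nonneg_left ?_ Y.conifold_pos.le
  rw [Fin.prod_univ_castSucc]
  have : ‖s‖ ^ 3 = ∏ i : Fin 3, ‖s‖ := by simp
  rw [this]
  refine mul_le_mul (Finset.prod_le_prod (fun _ _ => norm_nonneg _) fun i _ =>
    Y.norm_le_norm_sub_pole _ hs) (hre _) (by linarith) (Finset.prod_nonneg fun _ _ => norm_nonneg _)

/-- On the right the comparison reverses, `|s + 1 - π_i| ≤ |s + 1|`: one step to the right costs at
most `1/x_c`, which yields convergence for `|x| < x_c`. -/
theorem IsWeight.norm_add_one_le {Y : CYFamily} {g : ℂ → ℂ} {lam : ℝ}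
    (hg : Y.IsWeight g 4 lam) {s : ℂ} (hs : -(1 / 20) ≤ s.re) :
    ‖g (s + 1)‖ ≤ ‖g s‖ / Y.conifold := by
  have h := hg.shift s (by linarith)
  have h0 : 0 < ‖s + 1‖ := norm_pos_iff.2 fun h => by
    have := congrArg re h
    simp at this
    linarith
  have hle : ∀ i, ‖s + 1 - Y.pole i‖ ≤ ‖s + 1‖ := fun i => by
    have h := Y.pole_mem i
    rw [← sq_le_sq₀ (norm_nonneg _) (norm_nonneg _), ← normSq_eq_norm_sq, ← normSq_eq_norm_sq,
      normSq_apply, normSq_apply]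
    simp
    nlinarith
  have h' := congrArg norm h
  rw [norm_mul, norm_mul, norm_mul, norm_pow, norm_prod, norm_real, Real.norm_eq_abs,
    abs_of_pos Y.conifold_pos] at h'
  have hP : ∏ i, ‖s + 1 - Y.pole i‖ ≤ ‖s + 1‖ ^ 4 := by
    calc _ ≤ ∏ i : Fin 4, ‖s + 1‖ := by gcongr with i; exact hle i
      _ = _ := by simp
  rw [le_div_iff₀ Y.conifold_pos]
  refine le_of_mul_le_mul_right ?_ (pow_pos h0 4)
  calc ‖g (s + 1)‖ * Y.conifold * ‖s + 1‖ ^ 4 = ‖g s‖ * ∏ i, ‖s + 1 - Y.pole i‖ := by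
        rw [← h']; ring
    _ ≤ _ := by gcongr

end CYFamily

/-! ### Taylor remainders and an elementary bound -/

section PrincipalPart

open Complex Set

/-- Taylor expansion at `0` with holomorphic remainder. -/
theorem exists_taylor_remainder {U : Set ℂ} (hU : U ∈ 𝓝 (0 : ℂ)) {h : ℂ → ℂ}
    (hh : DifferentiableOn ℂ h U) (k : ℕ) :
    ∃ r : ℂ → ℂ, DifferentiableOn ℂ r U ∧ r 0 = iteratedDeriv k h 0 / k.factorial ∧
      ∀ s, h s = ∑ i ∈ Finset.range k, iteratedDeriv i h 0 / i.factorial * s ^ i + s ^ k * r s := by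
  have hp := (hh.analyticAt hU).hasFPowerSeriesAt
  refine ⟨(Function.swap dslope 0)^[k] h, ?_, ?_, ?_⟩
  · induction k with
    | zero => exact hh
    | succ k ih =>
      rw [Function.iterate_succ_apply']
      exact (differentiableOn_dslope hU).2 ih
  · have h1 := (hp.has_fpower_series_iterate_dslope_fslope k).coeff_zero 1
    have h2 := FormalMultilinearSeries.coeff_iterate_fslope (p := FormalMultilinearSeries.ofScalars
      ℂ fun n => iteratedDeriv n h 0 / (n.factorial : ℂ)) k 0
    rw [zero_add, FormalMultilinearSeries.coeff_ofScalars] at h2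
    rw [← h1, ← h2]
    rfl
  · intro s
    induction k with
    | zero => simp
    | succ k ih =>
      have h1 := (hp.has_fpower_series_iterate_dslope_fslope k).coeff_zero 1
      have h2 := FormalMultilinearSeries.coeff_iterate_fslope
        (p := FormalMultilinearSeries.ofScalars
        ℂ fun n => iteratedDeriv n h 0 / (n.factorial : ℂ)) k 0
      rw [zero_add, FormalMultilinearSeries.coeff_ofScalars] at h2
      have h3 : (Function.swap dslope 0)^[k] h 0 = iteratedDeriv k h 0 / k.factorial := by
        rw [← h1, ← h2]; rfl
      have h4 := sub_smul_dslope ((Function.swap dslope 0)^[k] h) 0 s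
      rw [h3, sub_zero, smul_eq_mul] at h4
      rw [Function.iterate_succ_apply', Finset.sum_range_succ]
      change _ = _ + s ^ (k + 1) * dslope ((Function.swap dslope 0)^[k] h) 0 s
      rw [pow_succ, mul_assoc, h4]
      linear_combination ih

theorem exp_neg_mul_le_div_sq {ε : ℝ} (hε : 0 < ε) {x : ℝ} (hx : x ≠ 0) :
    Real.exp (-ε * |x|) ≤ 2 / ε ^ 2 / x ^ 2 := by
  have h1 := Real.pow_div_factorial_le_exp (ε * |x|) (by positivity) 2
  have h2 : 0 < x ^ 2 := by positivity
  rw [mul_pow, sq_abs, Nat.factorial_two, Nat.cast_ofNat] at h1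
  rw [neg_mul, Real.exp_neg, div_div]
  have h3 : (2 : ℝ) / (ε ^ 2 * x ^ 2) = (ε ^ 2 * x ^ 2 / 2)⁻¹ := by rw [inv_div]
  rw [h3]
  exact inv_anti₀ (by positivity) h1

end PrincipalPart

/-! ### Barnes integrals moved to the right -/

namespace CYFamily

open MeasureTheory Complex Set

variable {Y : CYFamily} {g : ℂ → ℂ} {m : ℕ} {lam : ℝ} {κ : ℂ → ℂ} {j : ℕ} {p p' : ℝ}

/-- The abscissa of the Barnes integrals. -/
def base : ℝ := -(1 / 20)

/-- The kernel decays at rate `p` above and `p'` below, the weight at rate `lam` on both sides, and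
`exp(sη)` contributes `exp(-Im s · Im η)`; so the integrals converge for `-(p + lam) < Im η < p' +
lam`. Half of the margin pays for the loss `δ` in the bound of the weight, the other half remains as
`ε`. The bound `19/20` is `base + 1`. -/
theorem IsWeight.strip_bound (hg : Y.IsWeight g m lam) (hκ : IsKernel κ j p p') {α β : ℝ}
    (hα : -(p + lam) < α) (hβ : β < p' + lam) (n : ℕ) :
    ∃ C ε : ℝ, 0 ≤ C ∧ 0 < ε ∧ ∀ s : ℂ, base ≤ s.re → s.re ≤ 19 / 20 → 1 ≤ |s.im| →
      ∀ y ∈ Icc α β, ‖κ s * g (s + n)‖ * Real.exp (-(s.im * y)) ≤ C * Real.exp (-ε * |s.im|) := by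
  obtain ⟨Ck, hCk⟩ := hκ.bound
  set δ := min ((p + lam + α) / 2) ((p' + lam - β) / 2) with hδ
  have hδ0 : 0 < δ := lt_min (by linarith) (by linarith)
  have hδ1 : 2 * δ ≤ p + lam + α := by
    have := min_le_left ((p + lam + α) / 2) ((p' + lam - β) / 2)
    rw [← hδ] at this; linarith
  have hδ2 : 2 * δ ≤ p' + lam - β := by
    have := min_le_right ((p + lam + α) / 2) ((p' + lam - β) / 2)
    rw [← hδ] at this; linarith
  obtain ⟨Cg, hCg⟩ := hg.bound (19 / 20 + n) δ hδ0
  refine ⟨|Ck| * |Cg|, δ, by positivity, hδ0, fun s h1 h2 h3 y hy => ?_⟩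
  have hb : base = -(1 / 20) := rfl
  have e1 := hCg (s + n) (by simp; linarith [n.cast_nonneg (α := ℝ)]) (by simp; linarith)
  have e3 : (s + n).im = s.im := by simp
  rw [e3] at e1
  rw [norm_mul]
  rcases le_total 0 s.im with h | h
  · rw [abs_of_nonneg h] at h3 e1 ⊢
    have e2 := (hCk s).1 h3
    calc ‖κ s‖ * ‖g (s + n)‖ * Real.exp (-(s.im * y))
        ≤ (|Ck| * Real.exp (-p * s.im)) * (|Cg| * Real.exp (-(lam - δ) * s.im)) *
          Real.exp (-(s.im * y)) := by
          gcongr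
          · exact e2.trans (by gcongr; exact le_abs_self _)
          · exact e1.trans (by gcongr; exact le_abs_self _)
      _ = |Ck| * |Cg| * Real.exp (-(p + lam + y - δ) * s.im) := by
          rw [mul_mul_mul_comm, ← Real.exp_add, mul_assoc, ← Real.exp_add]; congr 2; ring
      _ ≤ _ := by
          gcongr
          linarith [hy.1]
  · rw [abs_of_nonpos h] at h3 e1 ⊢
    have e2 := (hCk s).2 (by linarith)
    calc ‖κ s‖ * ‖g (s + n)‖ * Real.exp (-(s.im * y))
        ≤ (|Ck| * Real.exp (p' * s.im)) * (|Cg| * Real.exp (-(lam - δ) * -s.im)) *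
          Real.exp (-(s.im * y)) := by
          gcongr
          · exact e2.trans (by gcongr; exact le_abs_self _)
          · exact e1.trans (by gcongr; exact le_abs_self _)
      _ = |Ck| * |Cg| * Real.exp (-(p' + lam - y - δ) * -s.im) := by
          rw [mul_mul_mul_comm, ← Real.exp_add, mul_assoc, ← Real.exp_add]; congr 2; ring
      _ ≤ _ := by
          gcongr
          linarith [hy.2]

theorem _root_.IsKernel.continuous_line (hκ : IsKernel κ j p p') {c : ℝ} (hc : |c| < 1) (hc0 : c ≠ 0) :
    Continuous fun τ : ℝ => κ (c + τ * I) := by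
  obtain ⟨a, ha, hk⟩ := hκ.exists_reg
  have h1 : ∀ τ : ℝ, κ (c + τ * I) = j.factorial / (c + τ * I) ^ (j + 1) + a (c + τ * I) :=
    fun τ => hk _ (by simpa using hc) fun h => hc0 (by simpa using congrArg re h)
  simp only [h1]
  refine (continuous_const.div (by fun_prop) fun τ => pow_ne_zero _ fun h =>
    hc0 (by simpa using congrArg re h)).add ?_
  exact ha.continuousOn.comp_continuous (by fun_prop) fun τ => by simpa using hc

theorem IsWeight.continuous_line (hg : Y.IsWeight g m lam) (n : ℕ) {c : ℝ} (hc : -(1 / 10) < c) :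
    Continuous fun τ : ℝ => g (c + τ * I + n) :=
  hg.diff.continuousOn.comp_continuous (by fun_prop) fun τ => by
    simp; linarith [n.cast_nonneg (α := ℝ)]

/-- The `n`-th term of the hypergeometric series, with `n` shifted by `s`. -/
def term (g : ℂ → ℂ) (η : ℂ) (n : ℕ) (s : ℂ) : ℂ := g (s + n) * exp ((s + n) * η)

theorem IsWeight.differentiableOn_term (hg : Y.IsWeight g m lam) (η : ℂ) (n : ℕ) :
    DifferentiableOn ℂ (term g η n) {s | -(1 / 10) < s.re} := by
  refine DifferentiableOn.mul (hg.diff.comp (by fun_prop) fun s hs => ?_) (by fun_prop)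
  simp only [mem_ofPred_eq, add_re, natCast_re] at hs ⊢
  linarith [n.cast_nonneg (α := ℝ)]

theorem norm_term (g : ℂ → ℂ) (η : ℂ) (n : ℕ) (s : ℂ) : ‖term g η n s‖ =
    ‖g (s + n)‖ * Real.exp (-(s.im * η.im)) * Real.exp ((s.re + n) * η.re) := by
  rw [term, norm_mul, norm_exp, mul_assoc, ← Real.exp_add]
  congr 2
  simp
  ring

theorem IsWeight.line_bound (hg : Y.IsWeight g m lam) (hκ : IsKernel κ j p p') {α β : ℝ}
    (hα : -(p + lam) < α) (hβ : β < p' + lam) (n : ℕ) :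
    ∃ C ε : ℝ, 0 ≤ C ∧ 0 < ε ∧ ∀ τ : ℝ, ∀ η : ℂ, η.im ∈ Icc α β →
      ‖κ (base + τ * I) * term g η n (base + τ * I)‖ ≤
        C * Real.exp (-ε * |τ|) * Real.exp ((base + n) * η.re) := by
  obtain ⟨C, ε, hC, hε, h⟩ := hg.strip_bound hκ hα hβ n
  have hcont : Continuous fun τ : ℝ => κ (base + τ * I) * g (base + τ * I + n) :=
    (hκ.continuous_line (by norm_num [base]) (by norm_num [base])).mul
      (hg.continuous_line n (by norm_num [base]))
  obtain ⟨D, hD⟩ := (isCompact_Icc (a := (-1 : ℝ)) (b := 1)).exists_bound_of_continuousOn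
    hcont.continuousOn
  set A := |α| + |β| with hA
  refine ⟨C + |D| * Real.exp A * Real.exp ε, ε, by positivity, hε, fun τ η hη => ?_⟩
  have hn := norm_term g η n (base + τ * I)
  have hre : ((base : ℂ) + τ * I).re = base := by simp
  have him : ((base : ℂ) + τ * I).im = τ := by simp
  rw [hre, him] at hn
  rw [norm_mul, hn, ← mul_assoc, ← mul_assoc, ← norm_mul]
  refine mul_le_mul_of_nonneg_right ?_ (Real.exp_pos _).le
  rcases le_total 1 |τ| with h1 | h1
  · have := h (base + τ * I) (by rw [hre]) (by rw [hre]; norm_num [base]) (by rwa [him]) _ hη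
    rw [him] at this
    refine this.trans ?_
    gcongr
    linarith [show 0 ≤ |D| * Real.exp A * Real.exp ε by positivity]
  · have h2 : ‖κ (base + τ * I) * g (base + τ * I + n)‖ ≤ |D| :=
      (hD τ (abs_le.1 h1)).trans (le_abs_self _)
    have h3 : -(τ * η.im) ≤ A := by
      have hy : |η.im| ≤ A := by
        rw [abs_le]
        constructor
        · linarith [hη.1, neg_abs_le α, abs_nonneg β]
        · linarith [hη.2, le_abs_self β, abs_nonneg α]
      calc -(τ * η.im) ≤ |τ * η.im| := neg_le_abs _
        _ = |τ| * |η.im| := abs_mul _ _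
        _ ≤ 1 * A := by gcongr
        _ = A := one_mul _
    calc ‖κ (base + τ * I) * g (base + τ * I + n)‖ * Real.exp (-(τ * η.im))
        ≤ |D| * Real.exp A * 1 := by rw [mul_one]; gcongr
      _ ≤ |D| * Real.exp A * (Real.exp ε * Real.exp (-ε * |τ|)) := by
          gcongr
          rw [← Real.exp_add]
          exact Real.one_le_exp (by nlinarith)
      _ ≤ _ := by
          rw [← mul_assoc]
          gcongr
          linarith

/-- The Barnes integral `-(2πi)⁻¹ ∫ κ(s) g(s + n) exp ((s + n) η) ds`. -/
def barnes (κ g : ℂ → ℂ) (n : ℕ) (η : ℂ) : ℂ :=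
  -(2 * (Real.pi : ℂ))⁻¹ * lineInt base fun s => κ s * term g η n s

/-- Between the abscissae `base` and `base + 1` the only pole is `0`, where `j!/s^(j+1)` extracts
the `j`-th derivative of the term. By periodicity of the kernel, the integral over the right line is
the next Barnes integral. -/
theorem IsWeight.barnes_succ (hg : Y.IsWeight g m lam) (hκ : IsKernel κ j p p') {η : ℂ}
    (h₁ : -(p + lam) < η.im) (h₂ : η.im < p' + lam) (n : ℕ) :
    Integrable (fun τ : ℝ => κ (base + τ * I) * term g η n (base + τ * I)) ∧
    barnes κ g n η = iteratedDeriv j (term g η n) 0 + barnes κ g (n + 1) η := by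
  obtain ⟨C, ε, hC, hε, hstrip⟩ := hg.strip_bound hκ h₁ h₂ n
  obtain ⟨a, ha, hk⟩ := hκ.exists_reg
  have hU : {s : ℂ | -(1 / 10) < s.re} ∈ 𝓝 (0 : ℂ) := (isOpen_re_gt _).mem_nhds (by simp)
  have hT := hg.differentiableOn_term η n
  obtain ⟨r, hr, hr0, hrs⟩ := exists_taylor_remainder hU hT (j + 1)
  set b : ℕ → ℂ := fun i => iteratedDeriv i (term g η n) 0 / i.factorial with hb
  have hsub1 : re ⁻¹' Icc base (base + 1) ⊆ {s : ℂ | -(1 / 10) < s.re} := fun s hs => by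
    have := hs.1
    simp only [base] at this
    exact lt_of_lt_of_le (by norm_num) this
  have hsub2 : ∀ s : ℂ, s.re ∈ Icc base (base + 1) → |s.re| < 1 := fun s hs => by
    rw [abs_lt]
    have h1 := hs.1
    have h2 := hs.2
    simp only [base] at h1 h2
    constructor <;> linarith
  have hjf : (j.factorial : ℂ) ≠ 0 := by exact_mod_cast j.factorial_ne_zero
  -- The pole at `0` is split: its simple part is the single listed simple pole, and the parts of
  -- order `k + 2` carry the Taylor coefficients in reversed order, with index `j - 1 - k`.
  have key := lineInt_sub_lineInt (ι := Unit) (c₁ := base) (c₂ := base + 1) (p := 0)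
    (by norm_num [base]) (by norm_num [base]) (q := fun _ => 0) (fun _ => by norm_num [base])
    (fun _ => by norm_num [base]) (f := fun s => κ s * term g η n s)
    (hol := fun s => j.factorial * r s + a s * term g η n s)
    (a₀ := fun _ => iteratedDeriv j (term g η n) 0) (m := j)
    (a := fun k => j.factorial * b (j - 1 - k)) ?_ ?_ ?_
  · obtain ⟨hi, -, hd⟩ := key
    refine ⟨hi, ?_⟩
    have hshift : lineInt (base + 1) (fun s => κ s * term g η n s) =
        lineInt base (fun s => κ s * term g η (n + 1) s) := by
      unfold lineInt
      congr 1; ext τ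
      have e1 : ((base + 1 : ℝ) : ℂ) + τ * I = (base + τ * I) + 1 := by push_cast; ring
      simp only [e1, hκ.periodic, term]
      congr 2
      · congr 1; push_cast; ring
      · congr 1; push_cast; ring
    rw [hshift, Fintype.sum_unique] at hd
    have hpi : (Real.pi : ℂ) ≠ 0 := ofReal_ne_zero.2 Real.pi_ne_zero
    rw [barnes, barnes, sub_eq_iff_eq_add.1 hd]
    field_simp
    ring
  · exact ((hr.mono hsub1).const_mul _).add ((ha.mono fun s hs => hsub2 s hs).mul (hT.mono hsub1))
  · intro s hs _ h0
    have h0' : s ≠ 0 := by simpa using h0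
    rw [hk s (hsub2 s hs) h0']
    have hexp : (j.factorial : ℂ) / s ^ (j + 1) * term g η n s = j.factorial * r s +
        iteratedDeriv j (term g η n) 0 / s +
        ∑ k ∈ Finset.range j, j.factorial * b (j - 1 - k) / s ^ (k + 2) := by
      rw [hrs s, Finset.sum_range_succ, ← Finset.sum_range_reflect]
      have hsum : ∑ k ∈ Finset.range j, j.factorial * b (j - 1 - k) / s ^ (k + 2) =
          (j.factorial : ℂ) / s ^ (j + 1) * ∑ k ∈ Finset.range j, b (j - 1 - k) * s ^ (j - 1 - k) := by
        rw [Finset.mul_sum]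
        refine Finset.sum_congr rfl fun k hk => ?_
        have hk' := Finset.mem_range.1 hk
        have e : s ^ (j + 1) = s ^ (k + 2) * s ^ (j - 1 - k) := by
          rw [← pow_add]; congr 1; omega
        rw [e]
        field_simp
      rw [hsum]
      simp only [hb]
      field_simp
      ring
    simp only [Fintype.sum_unique, ofReal_zero, sub_zero]
    rw [add_mul, hexp]
    ring
  · refine ⟨C * Real.exp ((|base| + 1 + n) * |η.re|) * (2 / ε ^ 2), fun s hs h1 => ?_⟩
    have h2 := hstrip s hs.1 (by have := hs.2; simp only [base] at this; linarith) h1 η.im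
      ⟨le_rfl, le_rfl⟩
    have hs0 : s.im ≠ 0 := fun h => by rw [h] at h1; norm_num at h1
    have h3 : (s.re + n) * η.re ≤ (|base| + 1 + n) * |η.re| := by
      refine (le_abs_self _).trans ?_
      rw [abs_mul]
      gcongr
      refine (abs_add_le _ _).trans ?_
      rw [Nat.abs_cast]
      have := hsub2 s hs
      linarith [abs_nonneg base]
    rw [norm_mul, norm_term, ← mul_assoc, ← mul_assoc, ← norm_mul, mul_div_assoc]
    calc _ ≤ C * Real.exp (-ε * |s.im|) * Real.exp ((|base| + 1 + n) * |η.re|) :=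
          mul_le_mul h2 (Real.exp_le_exp.2 h3) (Real.exp_pos _).le (by positivity)
      _ ≤ C * (2 / ε ^ 2 / s.im ^ 2) * Real.exp ((|base| + 1 + n) * |η.re|) := by
          gcongr
          exact exp_neg_mul_le_div_sq hε hs0
      _ = _ := by ring

theorem IsWeight.barnes_eq_sum_add (hg : Y.IsWeight g m lam) (hκ : IsKernel κ j p p') {η : ℂ}
    (h₁ : -(p + lam) < η.im) (h₂ : η.im < p' + lam) (n : ℕ) :
    barnes κ g 0 η = ∑ k ∈ Finset.range n, iteratedDeriv j (term g η k) 0 + barnes κ g n η := by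
  induction n with
  | zero => simp
  | succ n ih =>
    rw [ih, Finset.sum_range_succ, (hg.barnes_succ hκ h₁ h₂ n).2]; ring

theorem IsWeight.norm_add_nat_le {g : ℂ → ℂ} (hg : Y.IsWeight g 4 lam) {s : ℂ}
    (hs : base ≤ s.re) (n : ℕ) : ‖g (s + n)‖ ≤ ‖g s‖ * (Y.conifold⁻¹) ^ n := by
  induction n with
  | zero => simp
  | succ n ih =>
    have hb : base = -(1 / 20) := rfl
    have := hg.norm_add_one_le (s := s + n) (by simp; linarith [n.cast_nonneg (α := ℝ)])
    rw [Nat.cast_succ, ← add_assoc, pow_succ, ← mul_assoc]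
    refine this.trans ?_
    rw [div_eq_mul_inv]
    gcongr
    exact inv_nonneg.2 Y.conifold_pos.le

/-- Inside the disc of convergence the Barnes integrals are sums of residues. -/
theorem IsWeight.hasSum_barnes {g : ℂ → ℂ} (hg : Y.IsWeight g 4 lam) (hκ : IsKernel κ j p p')
    {η : ℂ} (h₁ : -(p + lam) < η.im) (h₂ : η.im < p' + lam)
    (hη : η.re < Real.log Y.conifold)
    (hs : Summable fun n => iteratedDeriv j (term g η n) 0) :
    HasSum (fun n => iteratedDeriv j (term g η n) 0) (barnes κ g 0 η) := by
  have hx : Real.exp η.re * Y.conifold⁻¹ < 1 := by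
    rw [← div_eq_mul_inv, div_lt_one Y.conifold_pos, ← Real.lt_log_iff_exp_lt Y.conifold_pos]
    exact hη
  have hx0 : 0 ≤ Real.exp η.re * Y.conifold⁻¹ :=
    mul_nonneg (Real.exp_pos _).le (inv_nonneg.2 Y.conifold_pos.le)
  -- The integrand after `n` steps is at most the initial one times `(exp(Re η) / x_c)^n`.
  have hlim : Tendsto (fun n => barnes κ g n η) atTop (𝓝 0) := by
    set D := ∫ τ : ℝ, ‖κ (base + τ * I) * term g η 0 (base + τ * I)‖ with hD
    have h0 := (hg.barnes_succ hκ h₁ h₂ 0).1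
    have hpow := (tendsto_pow_atTop_nhds_zero_of_lt_one hx0 hx).const_mul ((2 * Real.pi)⁻¹ * D)
    rw [mul_zero] at hpow
    refine squeeze_zero_norm (fun n => ?_) hpow
    rw [barnes, norm_mul, norm_neg, mul_assoc]
    have e1 : ‖((2 : ℂ) * Real.pi)⁻¹‖ = (2 * Real.pi)⁻¹ := by
      simp [abs_of_pos Real.pi_pos]
    rw [e1]
    gcongr
    rw [lineInt, hD, ← integral_mul_const]
    refine norm_integral_le_of_norm_le (h0.norm.mul_const _) (Eventually.of_forall fun τ => ?_)
    rw [norm_mul, norm_mul, mul_assoc, norm_term, norm_term]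
    gcongr ?_ * ?_
    have := hg.norm_add_nat_le (s := base + τ * I) (by simp) n
    simp only [Nat.cast_zero, add_zero]
    set s : ℂ := base + τ * I
    have e2 : Real.exp ((s.re + n) * η.re) = Real.exp (s.re * η.re) * Real.exp η.re ^ n := by
      rw [← Real.exp_nat_mul, ← Real.exp_add]; congr 1; ring
    rw [e2, mul_pow]
    calc ‖g (s + n)‖ * Real.exp (-(s.im * η.im)) * (Real.exp (s.re * η.re) * Real.exp η.re ^ n)
        ≤ (‖g s‖ * Y.conifold⁻¹ ^ n) * Real.exp (-(s.im * η.im)) *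
          (Real.exp (s.re * η.re) * Real.exp η.re ^ n) := by gcongr
      _ = _ := by ring
  have h3 : Tendsto (fun n => ∑ k ∈ Finset.range n, iteratedDeriv j (term g η k) 0) atTop
      (𝓝 (barnes κ g 0 η)) := by
    have := tendsto_const_nhds (x := barnes κ g 0 η) (f := atTop (α := ℕ)) |>.sub hlim
    rw [sub_zero] at this
    refine this.congr fun n => ?_
    rw [hg.barnes_eq_sum_add hκ h₁ h₂ n]; ring
  rw [tendsto_nhds_unique h3 hs.hasSum.tendsto_sum_nat]
  exact hs.hasSum

end CYFamily

namespace CYFamily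

open MeasureTheory Complex Set

variable {Y : CYFamily} {g : ℂ → ℂ} {m : ℕ} {lam : ℝ} {κ : ℂ → ℂ} {j : ℕ} {p p' : ℝ}

/-! ### Barnes integrals as sums of residues on the left -/

/-- The coefficients of the partial fraction decomposition of `1 / ∏ᵢ (s - πᵢ)`. -/
def poleWeight (Y : CYFamily) (i : Fin 4) : ℂ :=
  ∏ j ∈ Finset.univ.erase i, ((Y.pole i : ℂ) - Y.pole j)⁻¹

/-- This is Lagrange interpolation of the constant `1` at the nodes `π_i`. -/
theorem inv_prod_sub_pole (Y : CYFamily) {s : ℂ} (hs : ∀ i, s ≠ Y.pole i) :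
    (∏ i, (s - Y.pole i))⁻¹ = ∑ i, Y.poleWeight i / (s - Y.pole i) := by
  have hinj : Set.InjOn (fun i => (Y.pole i : ℂ)) (Finset.univ : Finset (Fin 4)) :=
    fun i _ k _ h => Y.pole_injective (ofReal_injective h)
  have h := Lagrange.eval_interpolate_not_at_node (s := Finset.univ)
    (v := fun i => (Y.pole i : ℂ)) (r := fun _ => 1) (x := s) (fun i _ => hs i)
  have h1 : Lagrange.interpolate Finset.univ (fun i => (Y.pole i : ℂ)) (fun _ => (1 : ℂ)) = 1 :=
    Lagrange.interpolate_one hinj ⟨0, Finset.mem_univ _⟩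
  rw [h1, Polynomial.eval_one, Lagrange.eval_nodal] at h
  rw [inv_eq_of_mul_eq_one_right h.symm]
  refine Finset.sum_congr rfl fun i _ => ?_
  rw [mul_one, Lagrange.nodalWeight, poleWeight, div_eq_mul_inv]

/-- The coefficients of the local solutions at the exponents `πᵢ - 1`. -/
def resCoeff (Y : CYFamily) (g : ℂ → ℂ) (m : ℕ) (i : Fin 4) (n : ℕ) : ℂ :=
  Y.conifold * (Y.pole i : ℂ) ^ m * Y.poleWeight i * g (Y.pole i) *
    ∏ k ∈ Finset.range n, Y.ratio m (Y.pole i - 1 - k)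

/-- The local solutions at the exponents `πᵢ - 1`. -/
def piece (Y : CYFamily) (g : ℂ → ℂ) (m : ℕ) (i : Fin 4) (η : ℂ) : ℂ :=
  -∑' n : ℕ, Y.resCoeff g m i n * exp ((Y.pole i - 1 - n) * η)

/-- `b` bounds the products of the factors `g (s - 1) / g s`. -/
def IsRatioBound (Y : CYFamily) (m : ℕ) (b : ℕ → ℝ) : Prop :=
  ∀ n : ℕ, ∀ s : ℂ, s.re ≤ 0 → ‖∏ k ∈ Finset.range n, Y.ratio m (s - k)‖ ≤ b n

theorem isRatioBound_four (Y : CYFamily) : Y.IsRatioBound 4 fun n => Y.conifold ^ n := by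
  intro n s hs
  rw [norm_prod]
  calc _ ≤ ∏ k ∈ Finset.range n, Y.conifold := by
        gcongr with k
        exact Y.norm_ratio_four_le (by simp; linarith [k.cast_nonneg (α := ℝ)])
    _ = _ := by simp

theorem isRatioBound_three (Y : CYFamily) :
    Y.IsRatioBound 3 fun n => ∏ k ∈ Finset.range n, Y.conifold / (1 / 10 + k) := by
  intro n s hs
  rw [norm_prod]
  refine Finset.prod_le_prod (fun _ _ => norm_nonneg _) fun k _ => ?_
  refine (Y.norm_ratio_three_le (by simp; linarith [k.cast_nonneg (α := ℝ)])).trans ?_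
  have := Y.conifold_pos.le
  gcongr
  simp
  linarith

theorem summable_ratioBound_four (Y : CYFamily) {η : ℂ} (hη : Real.log Y.conifold < η.re) :
    Summable fun n : ℕ => Y.conifold ^ n * Real.exp (-n * η.re) := by
  have h1 : Y.conifold * Real.exp (-η.re) < 1 := by
    rw [Real.exp_neg, ← div_eq_mul_inv, div_lt_one (Real.exp_pos _),
      ← Real.log_lt_iff_lt_exp Y.conifold_pos]
    exact hη
  refine (summable_geometric_of_lt_one (mul_nonneg Y.conifold_pos.le (Real.exp_pos _).le)
    h1).congr fun n => ?_
  rw [mul_pow, ← Real.exp_nat_mul]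
  ring_nf

/-- Successive terms have ratio `x_c e^{-x} / (1/10 + n) → 0`, so there is no restriction on `x`. -/
theorem summable_ratioBound_three (Y : CYFamily) (x : ℝ) :
    Summable fun n : ℕ => (∏ k ∈ Finset.range n, Y.conifold / (1 / 10 + k)) *
      Real.exp (-n * x) := by
  have hpos : ∀ n : ℕ, 0 < (∏ k ∈ Finset.range n, Y.conifold / (1 / 10 + (k : ℝ))) *
      Real.exp (-n * x) := fun n =>
    mul_pos (Finset.prod_pos fun k _ => div_pos Y.conifold_pos (by positivity)) (Real.exp_pos _)
  refine summable_of_ratio_test_tendsto_lt_one (l := 0) one_pos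
    (Eventually.of_forall fun n => (hpos n).ne') ?_
  have h1 : Tendsto (fun n : ℕ => (1 / 10 : ℝ) + n) atTop atTop :=
    tendsto_atTop_add_const_left _ _ tendsto_natCast_atTop_atTop
  have h2 := (h1.inv_tendsto_atTop).const_mul (Y.conifold * Real.exp (-x))
  rw [mul_zero] at h2
  refine h2.congr fun n => ?_
  rw [Real.norm_of_nonneg (hpos _).le, Real.norm_of_nonneg (hpos _).le, Finset.prod_range_succ,
    eq_div_iff (hpos n).ne']
  have : Real.exp (-((n + 1 : ℕ) : ℝ) * x) = Real.exp (-n * x) * Real.exp (-x) := by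
    rw [← Real.exp_add]; congr 1; push_cast; ring
  rw [this, Pi.inv_apply]
  ring

theorem norm_resCoeff_le {b : ℕ → ℝ} (hb : Y.IsRatioBound m b) (g : ℂ → ℂ) (i : Fin 4) (n : ℕ) :
    ‖Y.resCoeff g m i n‖ ≤
      ‖(Y.conifold : ℂ) * (Y.pole i : ℂ) ^ m * Y.poleWeight i * g (Y.pole i)‖ * b n := by
  rw [resCoeff, norm_mul]
  gcongr
  refine hb n _ ?_
  have := (Y.pole_mem i).2
  simp
  linarith

theorem norm_piece_term_le {b : ℕ → ℝ} (hb : Y.IsRatioBound m b) (g : ℂ → ℂ) (i : Fin 4) (η : ℂ)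
    (n : ℕ) : ‖Y.resCoeff g m i n * exp ((Y.pole i - 1 - n) * η)‖ ≤
      ‖(Y.conifold : ℂ) * (Y.pole i : ℂ) ^ m * Y.poleWeight i * g (Y.pole i)‖ *
        Real.exp ((Y.pole i - 1) * η.re) * (b n * Real.exp (-n * η.re)) := by
  rw [norm_mul, norm_exp]
  have h1 : ((Y.pole i - 1 - n) * η : ℂ).re = (Y.pole i - 1) * η.re + -n * η.re := by
    simp
    ring
  rw [h1, Real.exp_add]
  calc _ ≤ (‖(Y.conifold : ℂ) * (Y.pole i : ℂ) ^ m * Y.poleWeight i * g (Y.pole i)‖ * b n) *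
        (Real.exp ((Y.pole i - 1) * η.re) * Real.exp (-n * η.re)) := by
        gcongr
        exact norm_resCoeff_le hb g i n
    _ = _ := by ring

theorem summable_piece {b : ℕ → ℝ} (hb : Y.IsRatioBound m b) (g : ℂ → ℂ) (i : Fin 4) {η : ℂ}
    (hs : Summable fun n : ℕ => b n * Real.exp (-n * η.re)) :
    Summable fun n : ℕ => Y.resCoeff g m i n * exp ((Y.pole i - 1 - n) * η) :=
  Summable.of_norm_bounded (hs.mul_left _) fun n => norm_piece_term_le hb g i η n

theorem norm_ratio_le_of_one_le {s : ℂ} {c : ℝ} (hc : c ∈ Icc (-1 : ℝ) 0) (hs : s.re ∈ Icc c (c + 1))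
    (h : 1 ≤ |s.im|) (hm : m ≤ 4) : ‖Y.ratio m s‖ ≤ 2 ^ m * Y.conifold := by
  have h1 : ∀ i, |s.im| ≤ ‖s - Y.pole i‖ := fun i => by
    simpa using abs_im_le_norm (s - Y.pole i)
  have h2 : ‖s‖ ≤ 2 * |s.im| := by
    refine (norm_le_abs_re_add_abs_im s).trans ?_
    have : |s.re| ≤ 1 := abs_le.2 ⟨hc.1.trans hs.1, by linarith [hs.2, hc.2]⟩
    linarith
  have h3 : |s.im| ^ 4 ≤ ∏ i, ‖s - Y.pole i‖ := by
    calc |s.im| ^ 4 = ∏ i : Fin 4, |s.im| := by simp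
      _ ≤ _ := by gcongr with i; exact h1 i
  have h4 : 0 < |s.im| := by linarith
  rw [ratio, norm_div, norm_mul, norm_pow, norm_prod, norm_real, Real.norm_eq_abs,
    abs_of_pos Y.conifold_pos, div_le_iff₀ (lt_of_lt_of_le (by positivity) h3)]
  have hx := Y.conifold_pos
  calc Y.conifold * ‖s‖ ^ m ≤ Y.conifold * (2 * |s.im|) ^ m := by gcongr
    _ = 2 ^ m * Y.conifold * |s.im| ^ m := by ring
    _ ≤ 2 ^ m * Y.conifold * |s.im| ^ 4 := by gcongr
    _ ≤ _ := by gcongr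

theorem differentiableAt_ratio {s : ℂ} (h : ∀ i, s ≠ Y.pole i) : DifferentiableAt ℂ (Y.ratio m) s :=
  DifferentiableAt.div (by fun_prop) (DifferentiableAt.fun_finsetProd fun i _ => by fun_prop)
    (Finset.prod_ne_zero_iff.2 fun i _ => sub_ne_zero.2 (h i))

/-- The integrand of the Barnes integral, moved `n` steps to the left. -/
def leftTerm (Y : CYFamily) (g : ℂ → ℂ) (m : ℕ) (η : ℂ) (n : ℕ) (s : ℂ) : ℂ :=
  g s * (∏ k ∈ Finset.range n, Y.ratio m (s - k)) * exp ((s - n) * η)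

/-- One step to the left. The integrand with `n + 1` ratios on the line `c + 1` is, by the
recurrence and periodicity, the integrand with `n` ratios on the line `c`. Between the two lines the
only poles are the `π_i` contributed by the last ratio: its numerator `s^m` cancels the pole of the
kernel, as encoded by `κr`, and the equation may fail only at `q`. -/
theorem IsWeight.lineInt_left (hg : Y.IsWeight g m lam) (hm : m ≤ 4) {c q : ℝ}
    (hc : -(1 / 10) < c) (hc0 : c ≤ 0) (hcq : c < q) (hqc : q < c + 1) (hq : ∀ i, q ≠ Y.pole i)
    {κr : ℂ → ℂ}
    (hper : ∀ s, κ (s + 1) = κ s) (hκr : DifferentiableOn ℂ κr (re ⁻¹' Icc c (c + 1)))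
    (heq : ∀ s : ℂ, s.re ∈ Icc c (c + 1) → s ≠ q → κ s * s ^ m = κr s) {b : ℕ → ℝ}
    (hb : Y.IsRatioBound m b) {η : ℂ}
    (hdec : ∃ C : ℝ, ∀ s : ℂ, s.re ∈ Icc c (c + 1) → 1 ≤ |s.im| →
      ‖κ s * g s * exp (s * η)‖ ≤ C / s.im ^ 2) (n : ℕ) :
    Integrable (fun τ : ℝ => κ (c + τ * I) * Y.leftTerm g m η n (c + τ * I)) ∧
    lineInt c (fun s => κ s * Y.leftTerm g m η n s) =
      lineInt c (fun s => κ s * Y.leftTerm g m η (n + 1) s) +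
        2 * Real.pi * ∑ i, κ (Y.pole i) * (Y.resCoeff g m i n * exp ((Y.pole i - 1 - n) * η)) := by
  set S := re ⁻¹' Icc c (c + 1) with hS
  have hpole : ∀ i, c < Y.pole i ∧ Y.pole i < c + 1 := fun i => by
    have := Y.pole_mem i
    constructor <;> linarith
  have hSn : ∀ i, S ∈ 𝓝 (Y.pole i : ℂ) := fun i =>
    continuous_re.continuousAt.preimage_mem_nhds (by
      rw [ofReal_re]; exact Icc_mem_nhds (hpole i).1 (hpole i).2)
  have hpS : ∀ i, ((Y.pole i : ℝ) : ℂ).re ∈ Icc c (c + 1) := fun i => by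
    rw [ofReal_re]; exact ⟨(hpole i).1.le, (hpole i).2.le⟩
  set H : ℂ → ℂ := fun s => Y.conifold * κr s * g s *
    (∏ k ∈ Finset.range n, Y.ratio m (s - 1 - k)) * exp ((s - 1 - n) * η) with hH
  have hgS : DifferentiableOn ℂ g S := hg.diff.mono fun s hs => lt_of_lt_of_le hc hs.1
  have hrat : DifferentiableOn ℂ (fun s => ∏ k ∈ Finset.range n, Y.ratio m (s - 1 - k)) S := by
    intro s hs
    refine (DifferentiableAt.fun_finsetProd fun k _ => ?_).differentiableWithinAt
    refine (differentiableAt_ratio fun i h => ?_).comp s (by fun_prop)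
    have h1 := congrArg re h
    simp at h1
    linarith [(Y.pole_mem i).1, hs.2, k.cast_nonneg (α := ℝ)]
  have hHd : DifferentiableOn ℂ H S := by
    refine DifferentiableOn.mul (DifferentiableOn.mul (DifferentiableOn.mul (DifferentiableOn.mul
      (differentiableOn_const _) hκr) hgS) hrat) (by fun_prop)
  have hprod : ∀ s : ℂ, ∏ k ∈ Finset.range (n + 1), Y.ratio m (s - k) =
      (∏ k ∈ Finset.range n, Y.ratio m (s - 1 - k)) * Y.ratio m s := by
    intro s
    rw [Finset.prod_range_succ', Nat.cast_zero, sub_zero]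
    congr 1
    refine Finset.prod_congr rfl fun k _ => ?_
    congr 1
    push_cast
    ring
  have hHeq : ∀ s : ℂ, s.re ∈ Icc c (c + 1) → s ≠ q →
      κ s * Y.leftTerm g m η (n + 1) s = H s * (∏ i, (s - Y.pole i))⁻¹ := by
    intro s hs hsq
    rw [leftTerm, hprod, hH]
    simp only
    rw [← heq s hs hsq, ratio]
    have : (s - ((n + 1 : ℕ) : ℂ)) * η = (s - 1 - n) * η := by push_cast; ring
    rw [this, div_eq_mul_inv]
    ring
  obtain ⟨C, hC⟩ := hdec
  have hx := Y.conifold_pos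
  have key := lineInt_sub_lineInt (c₁ := c) (c₂ := c + 1) (p := q) hcq hqc (q := Y.pole)
    (fun i => (hpole i).1) (fun i => (hpole i).2)
    (f := fun s => κ s * Y.leftTerm g m η (n + 1) s)
    (hol := fun s => ∑ i, Y.poleWeight i * dslope H (Y.pole i) s)
    (a₀ := fun i => Y.poleWeight i * H (Y.pole i)) (m := 0) (a := 0) ?_ ?_ ?_
  · obtain ⟨-, hi, hd⟩ := key
    have hshift : ∀ τ : ℝ, κ ((c + 1 : ℝ) + τ * I) * Y.leftTerm g m η (n + 1) ((c + 1 : ℝ) + τ * I)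
        = κ (c + τ * I) * Y.leftTerm g m η n (c + τ * I) := by
      intro τ
      have e1 : ((c + 1 : ℝ) : ℂ) + τ * I = (c + τ * I) + 1 := by push_cast; ring
      set s : ℂ := c + τ * I with hs
      have hre : s.re = c := by simp [hs]
      have hne : ∀ i, s + 1 ≠ Y.pole i := fun i h => by
        have h1 := congrArg re h
        rw [add_re, hre, one_re, ofReal_re] at h1
        linarith [(hpole i).2]
      rw [e1, hper, leftTerm, leftTerm, hg.eq_ratio_mul (by rw [hre]; exact hc) hne, hprod]
      simp only [add_sub_cancel_right]
      have : (s + 1 - ((n + 1 : ℕ) : ℂ)) * η = (s - n) * η := by push_cast; ring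
      rw [this]
      ring
    simp only [hshift] at hi
    refine ⟨hi, ?_⟩
    have hl : lineInt (c + 1) (fun s => κ s * Y.leftTerm g m η (n + 1) s) =
        lineInt c (fun s => κ s * Y.leftTerm g m η n s) := by
      unfold lineInt
      simp only [hshift]
    rw [hl] at hd
    rw [sub_eq_iff_eq_add'.1 hd]
    congr 2
    refine Finset.sum_congr rfl fun i _ => ?_
    rw [hH]
    simp only
    rw [← heq _ (hpS i) (by exact_mod_cast (hq i).symm), resCoeff]
    ring
  · refine DifferentiableOn.fun_sum fun i _ => DifferentiableOn.const_mul ?_ _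
    exact (differentiableOn_dslope (hSn i)).2 hHd
  · intro s hs hsp hsq
    rw [hHeq s hs hsq, Y.inv_prod_sub_pole hsp, Finset.sum_range_zero, add_zero, Finset.mul_sum,
      ← Finset.sum_add_distrib]
    refine Finset.sum_congr rfl fun i _ => ?_
    have h1 := sub_smul_dslope H (Y.pole i : ℂ) s
    rw [smul_eq_mul] at h1
    have h2 : s - Y.pole i ≠ 0 := sub_ne_zero.2 (hsp i)
    field_simp
    linear_combination (-Y.poleWeight i) * h1
  · refine ⟨C * (b n * (2 ^ m * Y.conifold) * Real.exp (-(n + 1) * η.re)), fun s hs h1 => ?_⟩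
    have h2 := hC s hs h1
    have e : (s - ((n + 1 : ℕ) : ℂ)) * η = s * η + (-(n + 1)) * η := by push_cast; ring
    have hb' := hb n (s - 1) (by simp; linarith [hs.2])
    have hr := norm_ratio_le_of_one_le (Y := Y) (m := m) ⟨by linarith, hc0⟩ hs h1 hm
    have hbn : 0 ≤ b n := (norm_nonneg _).trans hb'
    have h5 : ‖exp ((-(n + 1) : ℂ) * η)‖ = Real.exp (-(n + 1) * η.re) := by
      rw [norm_exp]
      congr 1
      simp
    rw [leftTerm, hprod, e, Complex.exp_add]
    calc _ = ‖κ s * g s * exp (s * η)‖ * (‖∏ k ∈ Finset.range n, Y.ratio m (s - 1 - k)‖ *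
          ‖Y.ratio m s‖ * ‖exp ((-(n + 1) : ℂ) * η)‖) := by
          simp only [← norm_mul]
          congr 1
          ring
      _ ≤ C / s.im ^ 2 * (b n * (2 ^ m * Y.conifold) * Real.exp (-(n + 1) * η.re)) := by
          rw [h5]
          have hC0 : 0 ≤ C / s.im ^ 2 := (norm_nonneg _).trans h2
          gcongr
      _ = _ := by ring

/-- Moving the line of integration to the left expresses a Barnes integral through the local
solutions at the exponents `πᵢ - 1`. -/
theorem IsWeight.lineInt_eq_sum_piece (hg : Y.IsWeight g m lam) (hm : m ≤ 4) {c q : ℝ}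
    (hc : -(1 / 10) < c) (hc0 : c ≤ 0) (hcq : c < q) (hqc : q < c + 1) (hq : ∀ i, q ≠ Y.pole i)
    {κr : ℂ → ℂ}
    (hper : ∀ s, κ (s + 1) = κ s) (hκr : DifferentiableOn ℂ κr (re ⁻¹' Icc c (c + 1)))
    (heq : ∀ s : ℂ, s.re ∈ Icc c (c + 1) → s ≠ q → κ s * s ^ m = κr s) {b : ℕ → ℝ}
    (hb : Y.IsRatioBound m b) {η : ℂ}
    (hdec : ∃ C : ℝ, ∀ s : ℂ, s.re ∈ Icc c (c + 1) → 1 ≤ |s.im| →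
      ‖κ s * g s * exp (s * η)‖ ≤ C / s.im ^ 2)
    (hs : Summable fun n : ℕ => b n * Real.exp (-n * η.re)) :
    -(2 * (Real.pi : ℂ))⁻¹ * lineInt c (fun s => κ s * (g s * exp (s * η))) =
      ∑ i, κ (Y.pole i) * Y.piece g m i η := by
  have hstep := hg.lineInt_left hm hc hc0 hcq hqc hq hper hκr heq hb hdec
  have hpi : (Real.pi : ℂ) ≠ 0 := ofReal_ne_zero.2 Real.pi_ne_zero
  set J : ℕ → ℂ := fun n => -(2 * (Real.pi : ℂ))⁻¹ * lineInt c (fun s => κ s * Y.leftTerm g m η n s)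
    with hJ
  have hJ0 : J 0 = -(2 * (Real.pi : ℂ))⁻¹ * lineInt c (fun s => κ s * (g s * exp (s * η))) := by
    simp [hJ, leftTerm]
  have hsum : ∀ n, J 0 = J n - ∑ k ∈ Finset.range n,
      ∑ i, κ (Y.pole i) * (Y.resCoeff g m i k * exp ((Y.pole i - 1 - k) * η)) := by
    intro n
    induction n with
    | zero => simp
    | succ n ih =>
      rw [ih, Finset.sum_range_succ, hJ]
      simp only
      rw [(hstep n).2, mul_add]
      have h2 : -(2 * (Real.pi : ℂ))⁻¹ * (2 * Real.pi) = -1 := by field_simp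
      rw [← mul_assoc, h2]
      ring
  -- On `Re s = c ≤ 0` the ratios are bounded by `b n`, so `J n` is a fixed absolutely convergent
  -- integral times a summable sequence.
  have hlim : Tendsto J atTop (𝓝 0) := by
    set D := ∫ τ : ℝ, ‖κ (c + τ * I) * Y.leftTerm g m η 0 (c + τ * I)‖ with hD
    have h0 := (hstep 0).1
    have hpow := hs.tendsto_atTop_zero.const_mul ((2 * Real.pi)⁻¹ * D)
    rw [mul_zero] at hpow
    refine squeeze_zero_norm (fun n => ?_) hpow
    rw [hJ]
    simp only
    rw [norm_mul, norm_neg, mul_assoc]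
    have e1 : ‖((2 : ℂ) * Real.pi)⁻¹‖ = (2 * Real.pi)⁻¹ := by
      simp [abs_of_pos Real.pi_pos]
    rw [e1]
    gcongr
    rw [lineInt, hD, ← integral_mul_const]
    refine norm_integral_le_of_norm_le (h0.norm.mul_const _) (Eventually.of_forall fun τ => ?_)
    set s : ℂ := c + τ * I with hsdef
    have hre : s.re = c := by simp [hsdef]
    have h5 : ‖exp ((-n : ℂ) * η)‖ = Real.exp (-n * η.re) := by
      rw [norm_exp]
      congr 1
      simp
    have e : (s - n) * η = s * η + (-n) * η := by ring
    rw [leftTerm, leftTerm, e, Complex.exp_add]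
    simp only [Finset.range_zero, Finset.prod_empty, mul_one, Nat.cast_zero, sub_zero]
    calc _ = ‖κ s * (g s * exp (s * η))‖ * (‖∏ k ∈ Finset.range n, Y.ratio m (s - k)‖ *
          ‖exp ((-n : ℂ) * η)‖) := by
          simp only [← norm_mul]
          congr 1
          ring
      _ ≤ _ := by
          rw [h5]
          gcongr
          exact hb n s (by rw [hre]; exact hc0)
  have hS : HasSum (fun k => ∑ i, κ (Y.pole i) *
      (Y.resCoeff g m i k * exp ((Y.pole i - 1 - k) * η)))
      (∑ i, κ (Y.pole i) * ∑' k : ℕ, Y.resCoeff g m i k * exp ((Y.pole i - 1 - k) * η)) :=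
    hasSum_sum fun i _ => (summable_piece hb g i hs).hasSum.mul_left _
  have h3 : Tendsto J atTop (𝓝 (J 0 + ∑ i, κ (Y.pole i) *
      ∑' k : ℕ, Y.resCoeff g m i k * exp ((Y.pole i - 1 - k) * η))) := by
    refine (tendsto_const_nhds.add hS.tendsto_sum_nat).congr fun n => ?_
    rw [hsum n]; ring
  have h4 := tendsto_nhds_unique h3 hlim
  rw [← hJ0, eq_neg_of_add_eq_zero_left h4, ← Finset.sum_neg_distrib]
  refine Finset.sum_congr rfl fun i _ => ?_
  rw [piece]
  ring

/-- The condition `j + 1 ≤ m` lets `s^m` cancel the pole of the kernel at `0`: it admits `j ≤ 3` for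
`hypA` but only `j ≤ 2` for `hypB`. Since `κ` is periodic, its value `κ(π_i)` factors out of the
whole `i`-th sequence of residues. -/
theorem IsWeight.barnes_eq_sum_piece (hg : Y.IsWeight g m lam) (hm : m ≤ 4)
    (hκ : IsKernel κ j p p') (hj : j + 1 ≤ m) {b : ℕ → ℝ}
    (hb : Y.IsRatioBound m b) {η : ℂ} (h₁ : -(p + lam) < η.im) (h₂ : η.im < p' + lam)
    (hs : Summable fun n : ℕ => b n * Real.exp (-n * η.re)) :
    barnes κ g 0 η = ∑ i, κ (Y.pole i) * Y.piece g m i η := by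
  obtain ⟨a, ha, hk⟩ := hκ.exists_reg
  have hb1 : base = -(1 / 20) := rfl
  have hstrip : ∀ s : ℂ, s.re ∈ Icc base (base + 1) → |s.re| < 1 := fun s hs => by
    rw [abs_lt]
    constructor <;> linarith [hs.1, hs.2]
  obtain ⟨C, ε, hC, hε, hstr⟩ := hg.strip_bound hκ h₁ h₂ 0
  have := hg.lineInt_eq_sum_piece (κ := κ) (c := base) (q := 0) hm (by rw [hb1]; norm_num)
    (by rw [hb1]; norm_num) (by rw [hb1]; norm_num) (by rw [hb1]; norm_num)
    (fun i => by linarith [(Y.pole_mem i).1])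
    (κr := fun s => j.factorial * s ^ (m - (j + 1)) + s ^ m * a s) hκ.periodic ?_ ?_ hb (η := η) ?_ hs
  · rw [← this, barnes]
    simp [term]
  · exact (by fun_prop : DifferentiableOn ℂ (fun s : ℂ => j.factorial * s ^ (m - (j + 1))) _).add
      ((by fun_prop : DifferentiableOn ℂ (fun s : ℂ => s ^ m) _).mul (ha.mono fun s hs => hstrip s hs))
  · intro s hs h0
    have h0' : s ≠ 0 := by simpa using h0
    have e : s ^ m = s ^ (m - (j + 1)) * s ^ (j + 1) := by rw [← pow_add]; congr 1; omega
    rw [hk s (hstrip s hs) h0', add_mul, e]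
    field_simp
  · refine ⟨C * Real.exp (|η.re|) * (2 / ε ^ 2), fun s hs h1 => ?_⟩
    have h2 := hstr s hs.1 (by linarith [hs.2]) h1 η.im ⟨le_rfl, le_rfl⟩
    have hs0 : s.im ≠ 0 := fun h => by rw [h] at h1; norm_num at h1
    have h3 : s.re * η.re ≤ |η.re| := by
      refine (le_abs_self _).trans ?_
      rw [abs_mul]
      have := hstrip s hs
      nlinarith [abs_nonneg η.re]
    rw [Nat.cast_zero, add_zero] at h2
    have h4 : (s * η).re = -(s.im * η.im) + s.re * η.re := by rw [mul_re]; ring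
    rw [norm_mul, norm_exp, h4, Real.exp_add, ← mul_assoc]
    calc _ ≤ C * Real.exp (-ε * |s.im|) * Real.exp |η.re| :=
          mul_le_mul h2 (Real.exp_le_exp.2 h3) (Real.exp_pos _).le (by positivity)
      _ ≤ C * (2 / ε ^ 2 / s.im ^ 2) * Real.exp |η.re| := by
          gcongr
          exact exp_neg_mul_le_div_sq hε hs0
      _ = _ := by ring

end CYFamily

/-! ### Holomorphy of the Barnes integrals -/

namespace CYFamily

open MeasureTheory Complex Set

variable {Y : CYFamily} {g : ℂ → ℂ} {m : ℕ} {lam : ℝ} {κ : ℂ → ℂ} {j : ℕ} {p p' : ℝ}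

theorem _root_.integrable_exp_neg_mul_abs {ε : ℝ} (hε : 0 < ε) :
    Integrable fun τ : ℝ => Real.exp (-ε * |τ|) := by
  have h := integrable_of_continuous_of_inv_sq_bound (g := fun τ : ℝ => (Real.exp (-ε * |τ|) : ℂ))
    (C := 2 / ε ^ 2) (by fun_prop) fun τ hτ => by
      rw [norm_real, Real.norm_of_nonneg (Real.exp_pos _).le]
      exact exp_neg_mul_le_div_sq hε fun h => by rw [h] at hτ; norm_num at hτ
  exact h.re

theorem IsWeight.differentiableOn_barnes (hg : Y.IsWeight g m lam) (hκ : IsKernel κ j p p') (n : ℕ) :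
    DifferentiableOn ℂ (barnes κ g n) {η | -(p + lam) < η.im ∧ η.im < p' + lam} := by
  unfold barnes lineInt
  refine DifferentiableOn.const_mul (differentiableOn_integral_of_dominated (fun η hη => ?_)
    (fun τ => ?_) fun η hη => ?_) _
  · refine Continuous.aestronglyMeasurable ?_
    refine (hκ.continuous_line (by norm_num [base]) (by norm_num [base])).mul ?_
    simp only [term]
    exact (hg.continuous_line n (by norm_num [base])).mul (by fun_prop)
  · simp only [term]
    fun_prop
  · obtain ⟨α, hα1, hα2⟩ := exists_between hη.1
    obtain ⟨β, hβ1, hβ2⟩ := exists_between hη.2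
    obtain ⟨C, ε, hC, hε, h⟩ := hg.line_bound hκ hα1 hβ2 n
    set r := min 1 (min (η.im - α) (β - η.im)) with hr
    have hr1 : r ≤ 1 := min_le_left _ _
    have hr2 : r ≤ η.im - α := (min_le_right _ _).trans (min_le_left _ _)
    have hr3 : r ≤ β - η.im := (min_le_right _ _).trans (min_le_right _ _)
    have hr0 : 0 < r := lt_min one_pos (lt_min (by linarith) (by linarith))
    have him : ∀ w ∈ Metric.ball η r, w.im ∈ Icc α β ∧ |w.re| ≤ |η.re| + 1 := fun w hw => by
      rw [Metric.mem_ball, dist_eq_norm] at hw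
      have h1 := (abs_im_le_norm (w - η)).trans hw.le
      have h2 := (abs_re_le_norm (w - η)).trans (hw.le.trans hr1)
      rw [sub_im, abs_le] at h1
      rw [sub_re] at h2
      refine ⟨⟨by linarith, by linarith⟩, ?_⟩
      have := abs_add_le (w.re - η.re) η.re
      rw [sub_add_cancel] at this
      linarith
    refine ⟨r, hr0, fun w hw => ?_, fun τ => C * Real.exp (-ε * |τ|) *
      Real.exp ((|base| + n) * (|η.re| + 1)), ?_, Eventually.of_forall fun τ w hw => ?_⟩
    · exact ⟨hα1.trans_le (him w hw).1.1, (him w hw).1.2.trans_lt hβ2⟩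
    · exact ((integrable_exp_neg_mul_abs hε).const_mul C).mul_const _
    · refine (h τ w (him w hw).1).trans ?_
      refine mul_le_mul_of_nonneg_left (Real.exp_le_exp.2 ?_) (by positivity)
      refine (le_abs_self _).trans ?_
      rw [abs_mul]
      have h3 : |base + (n : ℝ)| ≤ |base| + n := by simpa using abs_add_le base (n : ℝ)
      have := (him w hw).2
      gcongr

/-! ### The periods in the disc of convergence -/

theorem hyperW_eq (Y : CYFamily) (ξ ρ : ℂ) : Y.hyperW ξ ρ = ∑' n : ℕ, term Y.hypA ξ n ρ := by
  simp only [hyperW, term, hypA, add_comm ρ]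

theorem exists_bound_term_hypA (Y : CYFamily) :
    ∃ C : ℝ, 0 ≤ C ∧ ∀ n : ℕ, ∀ ξ : ℂ, ∀ ρ ∈ Metric.ball (0 : ℂ) (1 / 20),
      ‖term Y.hypA ξ n ρ‖ ≤ C * Real.exp ‖ξ‖ * (Y.conifold⁻¹ * Real.exp ξ.re) ^ n := by
  have hsub : Metric.closedBall (0 : ℂ) (1 / 20) ⊆ {s : ℂ | -(1 / 10) < s.re} := fun s hs => by
    rw [mem_closedBall_zero_iff] at hs
    have := (abs_le.1 ((abs_re_le_norm s).trans hs)).1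
    exact lt_of_lt_of_le (by norm_num) this
  obtain ⟨C, hC⟩ := (isCompact_closedBall (0 : ℂ) (1 / 20)).exists_bound_of_continuousOn
    (Y.differentiableOn_hypA.continuousOn.mono hsub)
  refine ⟨|C|, abs_nonneg _, fun n ξ ρ hρ => ?_⟩
  have hρ' := Metric.ball_subset_closedBall hρ
  rw [mem_ball_zero_iff] at hρ
  have hre := (abs_le.1 ((abs_re_le_norm ρ).trans hρ.le)).1
  have h1 := Y.isWeight_hypA.norm_add_nat_le (s := ρ) hre n
  rw [term, norm_mul, norm_exp, mul_pow, ← Real.exp_nat_mul]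
  have h2 : ((ρ + n) * ξ).re ≤ ‖ξ‖ + n * ξ.re := by
    rw [add_mul, add_re]
    have h3 := (re_le_norm (ρ * ξ)).trans_eq (norm_mul _ _)
    have h4 : ((n : ℂ) * ξ).re = n * ξ.re := by simp
    rw [h4]
    nlinarith [norm_nonneg ξ]
  calc _ ≤ (|C| * Y.conifold⁻¹ ^ n) * Real.exp (‖ξ‖ + n * ξ.re) := by
        have := inv_nonneg.2 Y.conifold_pos.le
        gcongr
        exact h1.trans (by gcongr; exact (hC ρ hρ').trans (le_abs_self _))
    _ = _ := by rw [Real.exp_add]; ring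

theorem conifold_inv_mul_exp_lt (Y : CYFamily) {x : ℝ} (hx : x < Real.log Y.conifold) :
    0 ≤ Y.conifold⁻¹ * Real.exp x ∧ Y.conifold⁻¹ * Real.exp x < 1 := by
  refine ⟨mul_nonneg (inv_nonneg.2 Y.conifold_pos.le) (Real.exp_pos _).le, ?_⟩
  rw [inv_mul_lt_one₀ Y.conifold_pos, ← Real.lt_log_iff_exp_lt Y.conifold_pos]
  exact hx

theorem differentiableOn_term_hypA (Y : CYFamily) (ξ : ℂ) (n : ℕ) :
    DifferentiableOn ℂ (term Y.hypA ξ n) (Metric.ball 0 (1 / 20)) :=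
  (Y.isWeight_hypA.differentiableOn_term ξ n).mono fun s hs => by
    rw [mem_ball_zero_iff] at hs
    have := (abs_le.1 ((abs_re_le_norm s).trans hs.le)).1
    exact lt_of_lt_of_le (by norm_num) this

theorem summable_bound_term (Y : CYFamily) (C : ℝ) {ξ : ℂ} (hξ : ξ.re < Real.log Y.conifold) :
    Summable fun n : ℕ => C * Real.exp ‖ξ‖ * (Y.conifold⁻¹ * Real.exp ξ.re) ^ n :=
  (summable_geometric_of_lt_one (Y.conifold_inv_mul_exp_lt hξ).1
    (Y.conifold_inv_mul_exp_lt hξ).2).mul_left _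

theorem hasSum_iteratedDeriv_hyperW (Y : CYFamily) {ξ : ℂ} (hξ : ξ.re < Real.log Y.conifold)
    (j : ℕ) : HasSum (fun n => iteratedDeriv j (term Y.hypA ξ n) 0)
      (iteratedDeriv j (Y.hyperW ξ) 0) := by
  obtain ⟨C, -, h⟩ := Y.exists_bound_term_hypA
  have := hasSum_iteratedDeriv_of_summable_norm (Y.summable_bound_term C hξ)
    (Y.differentiableOn_term_hypA ξ) Metric.isOpen_ball (fun n w hw => h n ξ w hw)
    (Metric.mem_ball_self (by norm_num)) j
  rwa [← funext (Y.hyperW_eq ξ)] at this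

theorem differentiableOn_hyperW (Y : CYFamily) {ξ : ℂ} (hξ : ξ.re < Real.log Y.conifold) :
    DifferentiableOn ℂ (Y.hyperW ξ) (Metric.ball 0 (1 / 20)) := by
  obtain ⟨C, -, h⟩ := Y.exists_bound_term_hypA
  rw [funext (Y.hyperW_eq ξ)]
  exact differentiableOn_tsum_of_summable_norm (Y.summable_bound_term C hξ)
    (Y.differentiableOn_term_hypA ξ) Metric.isOpen_ball fun n w hw => h n ξ w hw

theorem iteratedDeriv_hyperW_eq_barnes (Y : CYFamily) {ξ : ℂ} (hξ : ξ.re < Real.log Y.conifold)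
    (hκ : IsKernel κ j p p') (h₁ : -p < ξ.im) (h₂ : ξ.im < p') :
    iteratedDeriv j (Y.hyperW ξ) 0 = barnes κ Y.hypA 0 ξ :=
  (Y.hasSum_iteratedDeriv_hyperW hξ j).unique (Y.isWeight_hypA.hasSum_barnes hκ (by simpa using h₁)
    (by simpa using h₂) hξ (Y.hasSum_iteratedDeriv_hyperW hξ j).summable)

/-- Going around `x = 0`. -/
theorem hyperW_add_int_mul (Y : CYFamily) (ξ ρ : ℂ) (k : ℤ) :
    Y.hyperW (ξ + k * (2 * Real.pi * I)) ρ = exp (k * (2 * Real.pi * I) * ρ) * Y.hyperW ξ ρ := by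
  rw [hyperW_eq, hyperW_eq, ← tsum_mul_left]
  refine tsum_congr fun n => ?_
  have h1 : exp ((n * k : ℤ) * (2 * Real.pi * I)) = 1 := exp_int_mul_two_pi_mul_I _
  have h2 : (ρ + n) * (ξ + k * (2 * Real.pi * I)) = (ρ + n) * ξ + k * (2 * Real.pi * I) * ρ +
      (n * k : ℤ) * (2 * Real.pi * I) := by push_cast; ring
  rw [term, term, h2, Complex.exp_add, h1, Complex.exp_add]
  ring

theorem dRho_exp_mul (k : ℤ) {f : ℂ → ℂ} {j : ℕ} (hf : ContDiffAt ℂ j f 0) :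
    dRho j (fun ρ => exp (k * (2 * Real.pi * I) * ρ) * f ρ) =
      ∑ i ∈ Finset.range (j + 1), j.choose i * (k : ℂ) ^ i * dRho (j - i) f := by
  have h0 : (2 * Real.pi * I : ℂ) ≠ 0 := two_pi_I_ne_zero
  rw [dRho, iteratedDeriv_fun_mul (by fun_prop) hf, Finset.sum_div]
  refine Finset.sum_congr rfl fun i hi => ?_
  have hi' : i ≤ j := Nat.lt_succ_iff.1 (Finset.mem_range.1 hi)
  have h3 : iteratedDeriv i (fun ρ => exp (k * (2 * Real.pi * I) * ρ)) 0 =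
      (k * (2 * Real.pi * I)) ^ i := by
    rw [iteratedDeriv_cexp_const_mul]
    simp
  have h4 : (2 * Real.pi * I : ℂ) ^ j = (2 * Real.pi * I) ^ i * (2 * Real.pi * I) ^ (j - i) := by
    rw [← pow_add]; congr 1; omega
  rw [h3, dRho, h4, mul_pow]
  field_simp

theorem dRho_hyperW_add_int_mul (Y : CYFamily) {ξ : ℂ} (hξ : ξ.re < Real.log Y.conifold) (k : ℤ)
    (j : ℕ) : dRho j (Y.hyperW (ξ + k * (2 * Real.pi * I))) =
      ∑ i ∈ Finset.range (j + 1), j.choose i * (k : ℂ) ^ i * dRho (j - i) (Y.hyperW ξ) := by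
  have h1 : Y.hyperW (ξ + k * (2 * Real.pi * I)) =
      fun ρ => exp (k * (2 * Real.pi * I) * ρ) * Y.hyperW ξ ρ :=
    funext fun ρ => Y.hyperW_add_int_mul ξ ρ k
  rw [h1, dRho_exp_mul]
  exact ((Y.differentiableOn_hyperW hξ).analyticAt
    (Metric.isOpen_ball.mem_nhds (Metric.mem_ball_self (by norm_num)))).contDiffAt

theorem differentiableOn_hyperW_zero (Y : CYFamily) :
    DifferentiableOn ℂ (fun ξ => Y.hyperW ξ 0) {ξ | ξ.re < Real.log Y.conifold} := by
  obtain ⟨C, hC, h⟩ := Y.exists_bound_term_hypA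
  intro ξ hξ
  obtain ⟨r, hr1, hr2⟩ := exists_between (show ξ.re < Real.log Y.conifold from hξ)
  have hU : IsOpen {w : ℂ | w.re < r ∧ ‖w‖ < ‖ξ‖ + 1} :=
    (isOpen_lt continuous_re continuous_const).inter (isOpen_lt continuous_norm continuous_const)
  refine (DifferentiableOn.differentiableAt (s := {w : ℂ | w.re < r ∧ ‖w‖ < ‖ξ‖ + 1}) ?_
    (hU.mem_nhds ⟨hr1, by simp⟩)).differentiableWithinAt
  simp only [hyperW_eq]
  have hpos := inv_nonneg.2 Y.conifold_pos.le
  refine differentiableOn_tsum_of_summable_norm (u := fun n => C * Real.exp (‖ξ‖ + 1) *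
    (Y.conifold⁻¹ * Real.exp r) ^ n) ((summable_geometric_of_lt_one
    (Y.conifold_inv_mul_exp_lt hr2).1 (Y.conifold_inv_mul_exp_lt hr2).2).mul_left _) (fun n => ?_) hU
    fun n w hw => ?_
  · simp only [term]; fun_prop
  · refine (h n w 0 (Metric.mem_ball_self (by norm_num))).trans ?_
    have h1 := hw.1.le
    have h2 := hw.2.le
    gcongr

/-- For `|Im ξ| < 2π` the `ρ`-derivatives of positive order are Barnes integrals, which are
holomorphic in `ξ`. Any other `ξ` is brought into that strip by whole turns, and these act by a
binomial combination of derivatives of order at most `j`. -/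
theorem differentiableOn_dRho_hyperW (Y : CYFamily) {j : ℕ} (hj : j ≤ 3) :
    DifferentiableOn ℂ (fun ξ => dRho j (Y.hyperW ξ)) {ξ | ξ.re < Real.log Y.conifold} := by
  have hH : IsOpen {ξ : ℂ | ξ.re < Real.log Y.conifold} := isOpen_lt continuous_re continuous_const
  have hloc : ∀ j ≤ 3, ∀ ξ : ℂ, ξ.re < Real.log Y.conifold → |ξ.im| < 2 * Real.pi →
      DifferentiableAt ℂ (fun ξ => dRho j (Y.hyperW ξ)) ξ := by
    intro j hj ξ hξ him
    rcases Nat.eq_zero_or_pos j with rfl | hj0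
    · simpa [dRho] using Y.differentiableOn_hyperW_zero.differentiableAt (hH.mem_nhds hξ)
    · have hk := isKernel_kern hj0 hj
      have hS : IsOpen {ξ : ℂ | ξ.re < Real.log Y.conifold ∧ |ξ.im| < 2 * Real.pi} :=
        hH.inter (isOpen_lt (continuous_abs.comp continuous_im) continuous_const)
      refine (DifferentiableOn.differentiableAt (s := {ξ : ℂ | ξ.re < Real.log Y.conifold ∧
        |ξ.im| < 2 * Real.pi}) ?_ (hS.mem_nhds ⟨hξ, him⟩))
      unfold dRho
      refine DifferentiableOn.div_const (((Y.isWeight_hypA.differentiableOn_barnes hk 0).mono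
        fun w hw => ?_).congr fun w hw => ?_) _
      · rw [mem_ofPred_eq, add_zero]; exact abs_lt.1 hw.2
      · exact Y.iteratedDeriv_hyperW_eq_barnes hw.1 hk (abs_lt.1 hw.2).1 (abs_lt.1 hw.2).2
  intro ξ hξ
  -- The nearest number of turns leaves an imaginary part of modulus at most `π`, well inside the
  -- strip.
  set k : ℤ := round (ξ.im / (2 * Real.pi)) with hk
  have hpi := Real.pi_pos
  have h1 : |ξ.im / (2 * Real.pi) - k| ≤ 1 / 2 := abs_sub_round _
  have h2 : |ξ.im - k * (2 * Real.pi)| < 2 * Real.pi := by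
    have : ξ.im - k * (2 * Real.pi) = (ξ.im / (2 * Real.pi) - k) * (2 * Real.pi) := by
      field_simp
    rw [this, abs_mul, abs_of_pos (by positivity : (0 : ℝ) < 2 * Real.pi)]
    nlinarith
  have h3 : ∀ ζ : ℂ, ζ.re < Real.log Y.conifold → dRho j (Y.hyperW ζ) =
      ∑ i ∈ Finset.range (j + 1), j.choose i * (k : ℂ) ^ i *
        dRho (j - i) (Y.hyperW (ζ - k * (2 * Real.pi * I))) := by
    intro ζ hζ
    rw [← Y.dRho_hyperW_add_int_mul (by simpa using hζ), sub_add_cancel]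
  refine DifferentiableWithinAt.congr (f := fun ζ => ∑ i ∈ Finset.range (j + 1),
    j.choose i * (k : ℂ) ^ i * dRho (j - i) (Y.hyperW (ζ - k * (2 * Real.pi * I)))) ?_ h3 (h3 ξ hξ)
  refine (DifferentiableAt.fun_sum fun i _ => DifferentiableAt.const_mul ?_ _).differentiableWithinAt
  refine (hloc (j - i) (by omega) (ξ - k * (2 * Real.pi * I)) (by simpa using hξ)
    (by simpa using h2)).comp (f := fun ζ => ζ - k * (2 * Real.pi * I)) ξ (by fun_prop)

/-- For real `ξ` every term of the series is positive. This non-vanishing is what makes the periods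
independent. -/
theorem hyperW_zero_ne_zero (Y : CYFamily) {ξ : ℝ} (hξ : ξ < Real.log Y.conifold) :
    Y.hyperW ξ 0 ≠ 0 := by
  have hs := Y.hasSum_iteratedDeriv_hyperW (ξ := ξ) (by simpa using hξ) 0
  simp only [iteratedDeriv_zero] at hs
  have hreal : ∀ n : ℕ, term Y.hypA ξ n 0 = (((Y.degree * n).factorial /
      (∏ i : Fin 5, ((Y.weight i * n).factorial : ℝ)) * Real.exp (n * ξ) : ℝ) : ℂ) := by
    intro n
    have hG : ∀ k : ℕ, Gamma (1 + k * n) = ((k * n).factorial : ℂ) := fun k => by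
      rw [← Complex.Gamma_nat_eq_factorial, add_comm]
      push_cast
      rfl
    rw [term, hypA]
    simp only [zero_add, hG]
    push_cast
    rfl
  have hre := hasSum_re hs
  intro h0
  rw [h0] at hre
  have hpos : ∀ n : ℕ, 0 < (term Y.hypA ξ n 0).re := fun n => by
    rw [hreal, ofReal_re]
    refine mul_pos (div_pos (by positivity) (Finset.prod_pos fun i _ => ?_)) (Real.exp_pos _)
    positivity
  have := hre.tsum_eq ▸ hre.summable.tsum_pos (fun n => (hpos n).le) 0 (hpos 0)
  simp at this

end CYFamily

/-! ### Analytic continuation along paths -/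

section Continuation

open Complex Set

/-- Uniqueness of analytic continuation along a path. -/
theorem IsContinuationAlong.eventuallyEq {γ : ℝ → ℂ} (hγ : Continuous γ) {F G : ℝ → ℂ → Fin 4 → ℂ}
    (hF : IsContinuationAlong γ F) (hG : IsContinuationAlong γ G) (h0 : F 0 =ᶠ[𝓝 (γ 0)] G 0) :
    F 1 =ᶠ[𝓝 (γ 1)] G 1 := by
  let P : Icc (0 : ℝ) 1 → Prop := fun t => F t =ᶠ[𝓝 (γ t)] G t
  -- Agreement of the two germs is a locally constant property on `[0, 1]`: near each time both
  -- continuations are given by functions analytic on a common ball, where the identity theorem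
  -- transports agreement between centres.
  have hP : IsLocallyConstant P := by
    rw [IsLocallyConstant.iff_eventually_eq]
    rintro ⟨t, ht⟩
    have h1 := (hF t ht).2.and (hG t ht).2
    obtain ⟨r, hr, hFr⟩ := Metric.eventually_nhds_iff_ball.1 (hF t ht).1.eventually_analyticAt
    obtain ⟨r', hr', hGr⟩ := Metric.eventually_nhds_iff_ball.1 (hG t ht).1.eventually_analyticAt
    have hball : ∀ᶠ s in 𝓝[Icc (0 : ℝ) 1] t, γ s ∈ Metric.ball (γ t) (min r r') :=
      nhdsWithin_le_nhds (hγ.continuousAt.preimage_mem_nhds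
        (Metric.ball_mem_nhds _ (lt_min hr hr')))
    have hall : ∀ᶠ s in 𝓝[Icc (0 : ℝ) 1] t,
        (F s =ᶠ[𝓝 (γ s)] G s) = (F t =ᶠ[𝓝 (γ t)] G t) := by
      filter_upwards [h1, hball] with s hs hsb
      have hst : (F t =ᶠ[𝓝 (γ s)] G t) ↔ (F t =ᶠ[𝓝 (γ t)] G t) := by
        have hA : AnalyticOnNhd ℂ (F t) (Metric.ball (γ t) (min r r')) := fun w hw =>
          hFr w (Metric.ball_subset_ball (min_le_left _ _) hw)
        have hB : AnalyticOnNhd ℂ (G t) (Metric.ball (γ t) (min r r')) := fun w hw =>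
          hGr w (Metric.ball_subset_ball (min_le_right _ _) hw)
        have hpre := (convex_ball (γ t) (min r r')).isPreconnected
        have hself : γ t ∈ Metric.ball (γ t) (min r r') := Metric.mem_ball_self (lt_min hr hr')
        exact ⟨fun h => (hA.eqOn_of_preconnected_of_eventuallyEq hB hpre hsb h).eventuallyEq_of_mem
            (Metric.isOpen_ball.mem_nhds hself),
          fun h => (hA.eqOn_of_preconnected_of_eventuallyEq hB hpre hself h).eventuallyEq_of_mem
            (Metric.isOpen_ball.mem_nhds hsb)⟩
      rw [← propext hst]
      exact propext ⟨fun h => hs.1.symm.trans (h.trans hs.2),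
        fun h => hs.1.trans (h.trans hs.2.symm)⟩
    rw [nhdsWithin_eq_map_subtype_coe ht] at hall
    exact hall
  have h := hP.apply_eq_of_isPreconnected isPreconnected_univ (x := ⟨0, by simp⟩)
    (y := ⟨1, by simp⟩) (mem_univ _) (mem_univ _)
  exact h.mp h0

/-- A continuation along `γ` made of two analytic functions. -/
theorem hasMonodromy_of_two {γ : ℝ → ℂ} (hγ : Continuous γ) {f f₁ f₂ : ℂ → Fin 4 → ℂ}
    {M : Matrix (Fin 4) (Fin 4) ℂ} {c : ℝ} (hc0 : 0 < c) (hc1 : c < 1)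
    (h₁ : ∀ t ∈ Icc 0 c, AnalyticAt ℂ f₁ (γ t)) (h₂ : ∀ t ∈ Icc c 1, AnalyticAt ℂ f₂ (γ t))
    (h12 : f₁ =ᶠ[𝓝 (γ c)] f₂) (h0 : f₁ =ᶠ[𝓝 (γ 0)] f)
    (h1 : f₂ =ᶠ[𝓝 (γ 1)] fun x => f x ᵥ* M) : HasMonodromy γ f M := by
  refine ⟨fun t => if t ≤ c then f₁ else f₂, fun t ht => ?_, by simpa [hc0.le] using h0,
    by simpa [not_le.2 hc1] using h1⟩
  rcases lt_trichotomy t c with h | rfl | h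
  · simp only [h.le, if_true]
    refine ⟨h₁ t ⟨ht.1, h.le⟩, nhdsWithin_le_nhds ?_⟩
    filter_upwards [eventually_lt_nhds h] with s hs
    simp [hs.le]
  · simp only [le_refl, if_true]
    refine ⟨h₁ t ⟨ht.1, le_rfl⟩, nhdsWithin_le_nhds ?_⟩
    filter_upwards [hγ.continuousAt.eventually (eventually_eventually_nhds.2 h12)] with s hs
    split_ifs
    · rfl
    · exact EventuallyEq.symm hs
  · simp only [not_le.2 h, if_false]
    refine ⟨h₂ t ⟨h.le, ht.2⟩, nhdsWithin_le_nhds ?_⟩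
    filter_upwards [eventually_gt_nhds h] with s hs
    simp [not_le.2 hs]

theorem continuous_circleLoop (p x₀ : ℂ) : Continuous (circleLoop p x₀) := by
  unfold circleLoop; fun_prop

theorem circleLoop_one (p x₀ : ℂ) : circleLoop p x₀ 1 = x₀ := by simp [circleLoop]

end Continuation

namespace CYFamily

open MeasureTheory Complex Set

/-! ### The characteristic polynomial at the exponents -/

/-- `exp (2πi πᵢ)`. -/
def qroot (Y : CYFamily) (i : Fin 4) : ℂ := exp (2 * Real.pi * I * Y.pole i)

theorem exists_int_of_exp_eq_one {r : ℝ} (h : exp (2 * Real.pi * I * r) = 1) : ∃ n : ℤ, r = n := by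
  obtain ⟨n, hn⟩ := exp_eq_one_iff.1 h
  refine ⟨n, ?_⟩
  have h0 : (2 * Real.pi * I : ℂ) ≠ 0 := two_pi_I_ne_zero
  have h1 : (r : ℂ) = n := mul_left_cancel₀ h0 (by rw [hn]; ring)
  exact_mod_cast h1

theorem qroot_pow (Y : CYFamily) (i : Fin 4) (n : ℕ) :
    Y.qroot i ^ n = exp (2 * Real.pi * I * ((n * Y.pole i : ℝ) : ℂ)) := by
  rw [qroot, ← Complex.exp_nat_mul]
  congr 1
  push_cast
  ring

theorem qroot_pow_ne_one (Y : CYFamily) (i : Fin 4) (n : ℕ)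
    (h : ∀ k : ℤ, (n : ℝ) * Y.pole i ≠ k) : Y.qroot i ^ n ≠ 1 := fun h1 => by
  rw [qroot_pow] at h1
  obtain ⟨k, hk⟩ := exists_int_of_exp_eq_one h1
  exact h k hk

theorem qroot_pow_degree (Y : CYFamily) (i : Fin 4) : Y.qroot i ^ Y.degree = 1 := by
  have h0 : (Y.degree : ℝ) ≠ 0 := by exact_mod_cast Y.degree_pos.ne'
  have h1 : ((Y.degree * Y.pole i : ℝ) : ℂ) = (Y.degree - Y.idx i : ℤ) := by
    rw [pole, mul_sub, mul_div_cancel₀ _ h0]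
    push_cast
    ring
  rw [qroot_pow, h1]
  convert exp_int_mul_two_pi_mul_I (Y.degree - Y.idx i : ℤ) using 2
  ring

theorem qroot_ne_one (Y : CYFamily) (i : Fin 4) : Y.qroot i ≠ 1 := by
  rw [← pow_one (Y.qroot i)]
  refine Y.qroot_pow_ne_one i 1 fun k hk => ?_
  have h := Y.pole_mem i
  rw [Nat.cast_one, one_mul] at hk
  have h1 : (0 : ℝ) < k := by linarith
  have h2 : (k : ℝ) < 1 := by linarith
  norm_cast at h1 h2
  omega

theorem natCast_mul_pole_ne (Y : CYFamily) (i : Fin 4) (n : ℕ)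
    (h : ¬ (Y.degree : ℤ) ∣ n * Y.idx i) (k : ℤ) : (n : ℝ) * Y.pole i ≠ k := fun hk => h <| by
  have h0 : (Y.degree : ℝ) ≠ 0 := by exact_mod_cast Y.degree_pos.ne'
  refine ⟨n - k, ?_⟩
  rw [pole, mul_sub, mul_one, ← mul_div_assoc] at hk
  have : (n : ℝ) * Y.idx i = Y.degree * (n - k) := by
    rw [← hk]; field_simp; ring
  exact_mod_cast this

/-- `q_i` is a `d`-th root of unity avoiding the roots excluded by `J`. Dividing `q^d - 1` by the
excluded factor, namely `q - 1`, `q² - 1`, `q⁴ - 1`, `(q⁵ - 1)(q + 1)` in the four cases, leaves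
this quartic. -/
theorem qroot_charpoly (Y : CYFamily) (i : Fin 4) :
    (Y.qroot i - 1) ^ 4 + Y.cubic / 6 * (Y.qroot i * (Y.qroot i ^ 2 + 4 * Y.qroot i + 1)) +
      Y.chern / 12 * (Y.qroot i * (Y.qroot i - 1) ^ 2) = 0 := by
  have hd := Y.qroot_pow_degree i
  have h1 := sub_ne_zero.2 (Y.qroot_ne_one i)
  have hn : ∀ n : ℕ, ¬ (Y.degree : ℤ) ∣ n * Y.idx i → Y.qroot i ^ n - 1 ≠ 0 := fun n h =>
    sub_ne_zero.2 (Y.qroot_pow_ne_one i n (Y.natCast_mul_pole_ne i n h))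
  set q := Y.qroot i
  cases Y with
  | Y5 =>
    simp only [degree, cubic, chern] at hd ⊢
    refine (mul_eq_zero.1 (?_ : (q - 1) * _ = 0)).resolve_left h1
    linear_combination hd
  | Y6 =>
    have h2 := hn 2 (by fin_cases i <;> simp [degree, idx])
    simp only [degree, cubic, chern] at hd ⊢
    refine (mul_eq_zero.1 (?_ : (q ^ 2 - 1) * _ = 0)).resolve_left h2
    linear_combination hd
  | Y8 =>
    have h2 := hn 4 (by fin_cases i <;> simp [degree, idx])
    simp only [degree, cubic, chern] at hd ⊢
    refine (mul_eq_zero.1 (?_ : (q ^ 4 - 1) * _ = 0)).resolve_left h2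
    linear_combination hd
  | Y10 =>
    have h2 := hn 5 (by fin_cases i <;> simp [degree, idx])
    have h3 := hn 2 (by fin_cases i <;> simp [degree, idx])
    have h4 : (q ^ 5 - 1) * (q + 1) ≠ 0 := mul_ne_zero h2 fun h => h3 (by linear_combination (q - 1) * h)
    simp only [degree, cubic, chern] at hd ⊢
    refine (mul_eq_zero.1 (?_ : ((q ^ 5 - 1) * (q + 1)) * _ = 0)).resolve_left h4
    linear_combination hd

theorem kern_pole (Y : CYFamily) (j : ℕ) (i : Fin 4) :
    kern j (Y.pole i) = (2 * Real.pi * I) ^ (j + 1) * kernRat j (Y.qroot i) := rfl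

/-- This is the quartic divided by `(q - 1)^4`. The kernel of the fourth period cannot be
distinguished at the exponents from the constant `2πi`, which is also the jump of the kernel of `w`;
hence the fourth period is the vanishing one. -/
theorem kern_three_pole (Y : CYFamily) (i : Fin 4) :
    -(Y.cubic / 6 : ℂ) * (kern 3 (Y.pole i) / (2 * Real.pi * I) ^ 3) -
      Y.chern / 12 * (kern 1 (Y.pole i) / (2 * Real.pi * I) ^ 1) = 2 * Real.pi * I := by
  have h0 : (2 * Real.pi * I : ℂ) ≠ 0 := two_pi_I_ne_zero
  have h1 := sub_ne_zero.2 (Y.qroot_ne_one i)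
  have hq := Y.qroot_charpoly i
  rw [kern_pole, kern_pole]
  generalize (2 * Real.pi * I : ℂ) = τ at h0 ⊢
  rw [pow_succ _ 3, pow_succ _ 1, mul_assoc, mul_assoc,
    mul_div_cancel_left₀ _ (pow_ne_zero _ h0), mul_div_cancel_left₀ _ (pow_ne_zero _ h0)]
  set q := Y.qroot i
  simp only [kernRat]
  have h2 : q * (q ^ 2 + 4 * q + 1) / (q - 1) ^ 4 * (Y.cubic / 6 : ℂ) +
      q / (q - 1) ^ 2 * (Y.chern / 12 : ℂ) = -1 := by
    field_simp
    linear_combination 72 * hq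
  linear_combination (-τ) * h2

/-! ### The monodromy of the periods -/

theorem periodsLog_add_two_pi_mul_I (Y : CYFamily) (a : ℂ) {ξ : ℂ}
    (hξ : ξ.re < Real.log Y.conifold) :
    Y.periodsLog a (ξ + 2 * Real.pi * I) = Y.periodsLog a ξ ᵥ* (Y.matKRbar a * Y.matL a) := by
  have h := fun j => Y.dRho_hyperW_add_int_mul hξ 1 j
  simp only [Int.cast_one, one_mul, one_pow, mul_one] at h
  have h0 : ∀ ξ, Y.hyperW ξ 0 = dRho 0 (Y.hyperW ξ) := fun ξ => by simp [dRho]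
  have e0 := h 0
  have e1 := h 1
  have e2 := h 2
  have e3 := h 3
  simp [Finset.sum_range_succ, Nat.choose] at e0 e1 e2 e3
  unfold periodsLog
  simp only [h0]
  rw [e0, e1, e2, e3]
  generalize dRho 0 (Y.hyperW ξ) = D0
  generalize dRho 1 (Y.hyperW ξ) = D1
  generalize dRho 2 (Y.hyperW ξ) = D2
  generalize dRho 3 (Y.hyperW ξ) = D3
  cases Y <;>
  · ext k
    fin_cases k <;>
    · simp [matKRbar, matL, Matrix.vecMul, dotProduct, Fin.sum_univ_four, Matrix.mul_apply, cubic,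
        chern]
      try ring

theorem differentiableOn_periodsLog (Y : CYFamily) (a : ℂ) :
    DifferentiableOn ℂ (Y.periodsLog a) {ξ | ξ.re < Real.log Y.conifold} := by
  have h0 : ∀ ξ, Y.hyperW ξ 0 = dRho 0 (Y.hyperW ξ) := fun ξ => by simp [dRho]
  have h := fun j (hj : j ≤ 3) => Y.differentiableOn_dRho_hyperW hj
  have h0 := h 0 (by norm_num)
  have h1 := h 1 (by norm_num)
  have h2 := h 2 (by norm_num)
  have h3 := h 3 (by norm_num)
  rw [differentiableOn_pi]
  intro k
  fin_cases k
  · simpa [periodsLog, dRho] using h0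
  · simpa [periodsLog] using h1
  · simpa [periodsLog] using! (h2.const_mul _).add (h1.const_mul _)
  · simpa [periodsLog] using! (h3.const_mul (-((Y.cubic : ℂ) / 6))).sub
      (h1.const_mul ((Y.chern : ℂ) / 12))

theorem isOpen_re_lt_log (Y : CYFamily) : IsOpen {ξ : ℂ | ξ.re < Real.log Y.conifold} :=
  isOpen_lt continuous_re continuous_const

/-- The periods are linearly independent. -/
theorem eq_zero_of_periodsLog_vecMul (Y : CYFamily) (a : ℂ) {ξ₀ : ℂ}
    (hξ₀ : ξ₀.re < Real.log Y.conifold) {D : Matrix (Fin 4) (Fin 4) ℂ}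
    (h : ∀ᶠ ξ in 𝓝 ξ₀, Y.periodsLog a ξ ᵥ* D = 0) : D = 0 := by
  have hall : ∀ ξ : ℂ, ξ.re < Real.log Y.conifold → Y.periodsLog a ξ ᵥ* D = 0 := by
    have hd := (Y.differentiableOn_periodsLog a)
    have hA : DifferentiableOn ℂ (fun ξ => Y.periodsLog a ξ ᵥ* D)
        {ξ | ξ.re < Real.log Y.conifold} := by
      rw [differentiableOn_pi] at hd ⊢
      intro k
      simp only [Matrix.vecMul, dotProduct]
      exact DifferentiableOn.fun_sum fun i _ => (hd i).mul_const _
    have hz : AnalyticOnNhd ℂ (fun _ : ℂ => (0 : Fin 4 → ℂ)) {ξ | ξ.re < Real.log Y.conifold} :=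
      fun _ _ => analyticAt_const
    exact (hA.analyticOnNhd Y.isOpen_re_lt_log).eqOn_of_preconnected_of_eventuallyEq hz
      (convex_halfSpace_re_lt _).isPreconnected hξ₀ h
  set x : ℝ := Real.log Y.conifold - 1 with hx
  have hxlt : x < Real.log Y.conifold := by linarith
  have hw := Y.hyperW_zero_ne_zero hxlt
  set w : ℕ → ℂ := fun j => dRho j (Y.hyperW x) with hwdef
  have hw0 : w 0 ≠ 0 := by simpa [hwdef, dRho] using hw
  have hk : ∀ k : ℤ, ∀ l, (Y.periodsLog a (x + k * (2 * Real.pi * I)) ᵥ* D) l = 0 := fun k l => by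
    rw [hall _ (by simpa using hxlt)]; rfl
  have hdr := fun (k : ℤ) (j : ℕ) => Y.dRho_hyperW_add_int_mul (ξ := x) (by simpa using hxlt) k j
  have h0 : ∀ ξ, Y.hyperW ξ 0 = dRho 0 (Y.hyperW ξ) := fun ξ => by simp [dRho]
  have hK : (Y.cubic : ℂ) ≠ 0 := by cases Y <;> norm_num [cubic]
  have hcol : ∀ l, D 0 l = 0 ∧ D 1 l = 0 ∧ D 2 l = 0 ∧ D 3 l = 0 := by
    intro l
    -- At the points `x + 2πik` the relation is a cubic polynomial in `k`. Its third, second and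
    -- first differences and its value at `k = 0` give the vanishing of `D 3 l`, `D 2 l`, `D 1 l`,
    -- `D 0 l` in turn.
    have e : ∀ k : ℤ, w 0 * D 0 l + (w 1 + k * w 0) * D 1 l +
        (Y.cubic / 2 * (w 2 + 2 * k * w 1 + k ^ 2 * w 0) + a * (w 1 + k * w 0)) * D 2 l +
        (-(Y.cubic / 6) * (w 3 + 3 * k * w 2 + 3 * k ^ 2 * w 1 + k ^ 3 * w 0) -
          Y.chern / 12 * (w 1 + k * w 0)) * D 3 l = 0 := by
      intro k
      have := hk k l
      simp only [Matrix.vecMul, dotProduct, Fin.sum_univ_four, periodsLog, h0, hdr,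
        Finset.sum_range_succ, Finset.sum_range_zero, Nat.choose] at this
      simp at this
      rw [← this]
      ring
    have e0 := e 0
    have e1 := e 1
    have e2 := e 2
    have e3 := e 3
    push_cast at e0 e1 e2 e3
    have d3 : D 3 l = 0 := by
      have : (Y.cubic : ℂ) * w 0 * D 3 l = 0 := by
        linear_combination -e3 + 3 * e2 - 3 * e1 + e0
      simpa [hK, hw0] using this
    rw [d3] at e0 e1 e2 e3
    have d2 : D 2 l = 0 := by
      have : (Y.cubic : ℂ) * w 0 * D 2 l = 0 := by
        linear_combination e2 - 2 * e1 + e0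
      simpa [hK, hw0] using this
    rw [d2] at e0 e1
    have d1 : D 1 l = 0 := by
      have : w 0 * D 1 l = 0 := by
        linear_combination e1 - e0
      simpa [hw0] using this
    rw [d1] at e0
    have d0 : D 0 l = 0 := by
      have : w 0 * D 0 l = 0 := by
        linear_combination e0
      simpa [hw0] using this
    exact ⟨d0, d1, d2, d3⟩
  ext i l
  fin_cases i
  exacts [(hcol l).1, (hcol l).2.1, (hcol l).2.2.1, (hcol l).2.2.2]

theorem log_re_lt (Y : CYFamily) {x₀ : ℝ} (h0 : 0 < x₀) (h1 : x₀ < Y.conifold) :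
    (Complex.log x₀).re < Real.log Y.conifold := by
  rw [log_re, norm_real, Real.norm_of_nonneg h0.le]
  exact Real.log_lt_log h0 h1

/-- Two continuations along the same loop have the same final germ, so `Π (M - M') = 0` near `x₀`,
and independence of the periods applies. -/
theorem hasMonodromy_unique (Y : CYFamily) (a : ℂ) {p : ℂ} {x₀ : ℝ} (h0 : 0 < x₀)
    (h1 : x₀ < Y.conifold) {M M' : Matrix (Fin 4) (Fin 4) ℂ}
    (h : HasMonodromy (circleLoop p x₀) (Y.periods a) M)
    (h' : HasMonodromy (circleLoop p x₀) (Y.periods a) M') : M = M' := by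
  obtain ⟨F, hF, hF0, hF1⟩ := h
  obtain ⟨G, hG, hG0, hG1⟩ := h'
  have h2 := hF.eventuallyEq (continuous_circleLoop p x₀) hG (hF0.trans hG0.symm)
  have h3 := hF1.symm.trans (h2.trans hG1)
  rw [circleLoop_one] at h3
  have hx : (x₀ : ℂ) ∈ slitPlane := ofReal_mem_slitPlane.2 h0
  have h4 : ∀ᶠ ξ in 𝓝 (Complex.log x₀), Y.periodsLog a ξ ᵥ* (M - M') = 0 := by
    have hc : Tendsto exp (𝓝 (Complex.log x₀)) (𝓝 (x₀ : ℂ)) := by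
      have := continuous_exp.tendsto (Complex.log x₀)
      rwa [exp_log (by exact_mod_cast h0.ne')] at this
    have him : ∀ᶠ ξ in 𝓝 (Complex.log (x₀ : ℂ)), |ξ.im| < Real.pi := by
      refine (continuous_abs.comp continuous_im).continuousAt.eventually_lt continuousAt_const ?_
      simp [log_im, arg_ofReal_of_nonneg h0.le, Real.pi_pos]
    filter_upwards [hc.eventually h3, him] with ξ h5 h6
    have h7 : Complex.log (exp ξ) = ξ :=
      log_exp (abs_lt.1 h6).1 (abs_lt.1 h6).2.le
    simp only [periods, h7] at h5
    rw [Matrix.vecMul_sub, h5, sub_self]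
  exact sub_eq_zero.1 (Y.eq_zero_of_periodsLog_vecMul a (Y.log_re_lt h0 h1) h4)

end CYFamily

/-! ### The monodromy of the periods about the conifold point -/

namespace CYFamily

open MeasureTheory Complex Set

variable {Y : CYFamily} {g : ℂ → ℂ} {m : ℕ}

theorem differentiableOn_piece {b : ℕ → ℝ} (hb : Y.IsRatioBound m b) (g : ℂ → ℂ) (i : Fin 4) {r : ℝ}
    (hs : Summable fun n : ℕ => b n * Real.exp (-n * r)) :
    DifferentiableOn ℂ (Y.piece g m i) {η | r < η.re} := by
  unfold piece
  refine (differentiableOn_tsum_of_summable_norm (hs.mul_left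
    (‖(Y.conifold : ℂ) * (Y.pole i : ℂ) ^ m * Y.poleWeight i * g (Y.pole i)‖ *
        Real.exp ((Y.pole i - 1) * r))) (fun n => by fun_prop)
    (isOpen_lt continuous_const continuous_re) fun n w hw => ?_).neg
  refine (norm_piece_term_le hb g i w n).trans ?_
  have h1 : r ≤ w.re := le_of_lt hw
  have h2 := (Y.pole_mem i).2
  have hbn : 0 ≤ b n := (norm_nonneg _).trans (hb n 0 le_rfl)
  have h3 : (Y.pole i - 1) * w.re ≤ (Y.pole i - 1) * r := by nlinarith
  have h4 : -(n : ℝ) * w.re ≤ -n * r := by nlinarith [n.cast_nonneg (α := ℝ)]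
  gcongr ?_ * Real.exp ?_ * (?_ * Real.exp ?_)

theorem analyticAt_piece_four (Y : CYFamily) (g : ℂ → ℂ) (i : Fin 4) {η : ℂ}
    (hη : Real.log Y.conifold < η.re) : AnalyticAt ℂ (Y.piece g 4 i) η := by
  obtain ⟨r, h1, h2⟩ := exists_between hη
  exact (differentiableOn_piece Y.isRatioBound_four g i (Y.summable_ratioBound_four (η := r)
    (by simpa using h1))).analyticAt ((isOpen_lt continuous_const continuous_re).mem_nhds h2)

/-- The period vector continued to `|Im log x| < 2π`, with prescribed first entry. -/
def contPeriods (Y : CYFamily) (a u ξ : ℂ) : Fin 4 → ℂ :=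
  ![u, barnes (kern 1) Y.hypA 0 ξ / (2 * Real.pi * I) ^ 1,
    (Y.cubic : ℂ) / 2 * (barnes (kern 2) Y.hypA 0 ξ / (2 * Real.pi * I) ^ 2) +
      a * (barnes (kern 1) Y.hypA 0 ξ / (2 * Real.pi * I) ^ 1),
    -((Y.cubic : ℂ) / 6) * (barnes (kern 3) Y.hypA 0 ξ / (2 * Real.pi * I) ^ 3) -
      (Y.chern : ℂ) / 12 * (barnes (kern 1) Y.hypA 0 ξ / (2 * Real.pi * I) ^ 1)]

/-- The period which vanishes at the conifold point. -/
def vanishingPeriod (Y : CYFamily) (ξ : ℂ) : ℂ :=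
  -((Y.cubic : ℂ) / 6) * (barnes (kern 3) Y.hypA 0 ξ / (2 * Real.pi * I) ^ 3) -
    (Y.chern : ℂ) / 12 * (barnes (kern 1) Y.hypA 0 ξ / (2 * Real.pi * I) ^ 1)

theorem contPeriods_vecMul (Y : CYFamily) (a u ξ : ℂ) :
    Y.contPeriods a u ξ ᵥ* matKR = Y.contPeriods a (u + Y.vanishingPeriod ξ) ξ := by
  ext k
  fin_cases k <;>
    simp [contPeriods, vanishingPeriod, matKR, Matrix.vecMul, dotProduct, Fin.sum_univ_four]

theorem periodsLog_eq_contPeriods (Y : CYFamily) (a : ℂ) {ξ : ℂ}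
    (hξ : ξ.re < Real.log Y.conifold) (him : |ξ.im| < 2 * Real.pi) :
    Y.periodsLog a ξ = Y.contPeriods a (Y.hyperW ξ 0) ξ := by
  have h : ∀ j, 1 ≤ j → j ≤ 3 → dRho j (Y.hyperW ξ) =
      barnes (kern j) Y.hypA 0 ξ / (2 * Real.pi * I) ^ j := fun j h1 h3 => by
    rw [dRho, Y.iteratedDeriv_hyperW_eq_barnes hξ (isKernel_kern h1 h3) (abs_lt.1 him).1
      (abs_lt.1 him).2]
  rw [periodsLog, contPeriods, h 1 le_rfl (by norm_num), h 2 (by norm_num) (by norm_num),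
    h 3 (by norm_num) le_rfl]

theorem analyticAt_barnes_hypA (Y : CYFamily) {κ : ℂ → ℂ} {j : ℕ} {p p' : ℝ}
    (hκ : IsKernel κ j p p') {ξ : ℂ} (h₁ : -p < ξ.im) (h₂ : ξ.im < p') :
    AnalyticAt ℂ (barnes κ Y.hypA 0) ξ :=
  (Y.isWeight_hypA.differentiableOn_barnes hκ 0).analyticAt
    (((isOpen_lt continuous_const continuous_im).inter
      (isOpen_lt continuous_im continuous_const)).mem_nhds (by simpa using ⟨h₁, h₂⟩))

theorem analyticAt_vanishingPeriod (Y : CYFamily) {ξ : ℂ} (him : |ξ.im| < 2 * Real.pi) :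
    AnalyticAt ℂ Y.vanishingPeriod ξ := by
  have h := fun j (h1 : 1 ≤ j) (h3 : j ≤ 3) =>
    Y.analyticAt_barnes_hypA (isKernel_kern h1 h3) (abs_lt.1 him).1 (abs_lt.1 him).2
  have h1 := h 1 le_rfl (by norm_num)
  have h3 := h 3 (by norm_num) le_rfl
  unfold vanishingPeriod
  exact (analyticAt_const.mul h3.div_const).sub (analyticAt_const.mul h1.div_const)

theorem analyticAt_contPeriods (Y : CYFamily) (a : ℂ) {u : ℂ → ℂ} {ξ : ℂ}
    (him : |ξ.im| < 2 * Real.pi) (hu : AnalyticAt ℂ u ξ) :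
    AnalyticAt ℂ (fun ξ => Y.contPeriods a (u ξ) ξ) ξ := by
  have h := fun j (h1 : 1 ≤ j) (h3 : j ≤ 3) =>
    Y.analyticAt_barnes_hypA (isKernel_kern h1 h3) (abs_lt.1 him).1 (abs_lt.1 him).2
  have h1 := h 1 le_rfl (by norm_num)
  have h2 := h 2 (by norm_num) (by norm_num)
  rw [analyticAt_pi_iff]
  intro k
  fin_cases k
  · exact hu
  · exact h1.div_const
  · exact (analyticAt_const.mul h2.div_const).add (analyticAt_const.mul h1.div_const)
  · exact Y.analyticAt_vanishingPeriod him

/-- The first period for `|x| > x_c`, continued from the lower half-plane. -/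
def outerPeriod (Y : CYFamily) (ξ : ℂ) : ℂ := ∑ i, kern 0 (Y.pole i) * Y.piece Y.hypA 4 i ξ

theorem analyticAt_outerPeriod (Y : CYFamily) {ξ : ℂ} (hξ : Real.log Y.conifold < ξ.re) :
    AnalyticAt ℂ Y.outerPeriod ξ := by
  unfold outerPeriod
  exact Finset.analyticAt_fun_sum _ fun i _ =>
    analyticAt_const.mul (Y.analyticAt_piece_four Y.hypA i hξ)

theorem barnes_hypA_eq_sum_piece (Y : CYFamily) {κ : ℂ → ℂ} {j : ℕ} {p p' : ℝ} (hj : j ≤ 3)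
    (hκ : IsKernel κ j p p') {ξ : ℂ} (hξ : Real.log Y.conifold < ξ.re) (h₁ : -p < ξ.im)
    (h₂ : ξ.im < p') : barnes κ Y.hypA 0 ξ = ∑ i, κ (Y.pole i) * Y.piece Y.hypA 4 i ξ :=
  Y.isWeight_hypA.barnes_eq_sum_piece le_rfl hκ (by omega) Y.isRatioBound_four (by simpa using h₁)
    (by simpa using h₂) (Y.summable_ratioBound_four hξ)

/-- By `kern_three_pole` all four connection coefficients equal `2πi`. -/
theorem vanishingPeriod_eq_sum_piece (Y : CYFamily) {ξ : ℂ} (hξ : Real.log Y.conifold < ξ.re)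
    (him : |ξ.im| < 2 * Real.pi) :
    Y.vanishingPeriod ξ = ∑ i, (2 * Real.pi * I) * Y.piece Y.hypA 4 i ξ := by
  have h := fun j (h1 : 1 ≤ j) (h3 : j ≤ 3) =>
    Y.barnes_hypA_eq_sum_piece h3 (isKernel_kern h1 h3) hξ (abs_lt.1 him).1 (abs_lt.1 him).2
  rw [vanishingPeriod, h 1 le_rfl (by norm_num), h 3 (by norm_num) le_rfl, Finset.sum_div,
    Finset.sum_div, Finset.mul_sum, Finset.mul_sum, ← Finset.sum_sub_distrib]
  refine Finset.sum_congr rfl fun i _ => ?_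
  have h5 := Y.kern_three_pole i
  linear_combination Y.piece Y.hypA 4 i ξ * h5

/-- The first period continued through the lower half-plane. -/
def lowerPeriod (Y : CYFamily) (ξ : ℂ) : ℂ :=
  if ξ.im < 0 then barnes (kern 0) Y.hypA 0 ξ
  else if ξ.re < Real.log Y.conifold then Y.hyperW ξ 0 else Y.outerPeriod ξ

/-- The first period continued through the lower half-plane and around the conifold point into the
upper half-plane. -/
def upperPeriod (Y : CYFamily) (ξ : ℂ) : ℂ :=
  if 0 < ξ.im then barnes (fun s => kern 0 s - 2 * Real.pi * I) Y.hypA 0 ξ + Y.vanishingPeriod ξ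
  else if ξ.re < Real.log Y.conifold then Y.hyperW ξ 0 + Y.vanishingPeriod ξ else Y.outerPeriod ξ

theorem eventually_abs_im_lt {ξ : ℂ} {c : ℝ} (h : |ξ.im| < c) : ∀ᶠ w in 𝓝 ξ, |w.im| < c :=
  (continuous_abs.comp continuous_im).continuousAt.eventually_lt continuousAt_const h

theorem eventually_re_lt {ξ : ℂ} {c : ℝ} (h : ξ.re < c) : ∀ᶠ w in 𝓝 ξ, w.re < c :=
  continuous_re.continuousAt.eventually_lt continuousAt_const h

theorem eventually_lt_re {ξ : ℂ} {c : ℝ} (h : c < ξ.re) : ∀ᶠ w in 𝓝 ξ, c < w.re :=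
  continuousAt_const.eventually_lt continuous_re.continuousAt h

theorem hyperW_zero_eq_barnes (Y : CYFamily) {ξ : ℂ} (hξ : ξ.re < Real.log Y.conifold)
    {κ : ℂ → ℂ} {p p' : ℝ} (hκ : IsKernel κ 0 p p') (h₁ : -p < ξ.im) (h₂ : ξ.im < p') :
    Y.hyperW ξ 0 = barnes κ Y.hypA 0 ξ := by
  rw [← Y.iteratedDeriv_hyperW_eq_barnes hξ hκ h₁ h₂, iteratedDeriv_zero]

theorem lowerPeriod_eventuallyEq_inner (Y : CYFamily) {ξ : ℂ} (hξ : ξ.re < Real.log Y.conifold)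
    (him : ξ.im = 0) : Y.lowerPeriod =ᶠ[𝓝 ξ] fun ξ => Y.hyperW ξ 0 := by
  filter_upwards [eventually_re_lt hξ, eventually_abs_im_lt (c := 2 * Real.pi)
    (by rw [him]; simpa using Real.pi_pos)] with w h1 h2
  rw [lowerPeriod]
  split_ifs with h3
  · exact (Y.hyperW_zero_eq_barnes h1 isKernel_kern_zero (abs_lt.1 h2).1 h3).symm
  · rfl

theorem lowerPeriod_eventuallyEq_outer (Y : CYFamily) {ξ : ℂ} (hξ : Real.log Y.conifold < ξ.re)
    (him : ξ.im = 0) : Y.lowerPeriod =ᶠ[𝓝 ξ] Y.outerPeriod := by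
  filter_upwards [eventually_lt_re hξ, eventually_abs_im_lt (c := 2 * Real.pi)
    (by rw [him]; simpa using Real.pi_pos)] with w h1 h2
  rw [lowerPeriod]
  split_ifs with h3 h4
  · exact Y.barnes_hypA_eq_sum_piece (by norm_num) isKernel_kern_zero h1 (abs_lt.1 h2).1 h3
  · exact absurd h4 h1.not_gt
  · rfl

theorem upperPeriod_eventuallyEq_inner (Y : CYFamily) {ξ : ℂ} (hξ : ξ.re < Real.log Y.conifold)
    (him : ξ.im = 0) : Y.upperPeriod =ᶠ[𝓝 ξ] fun ξ => Y.hyperW ξ 0 + Y.vanishingPeriod ξ := by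
  filter_upwards [eventually_re_lt hξ, eventually_abs_im_lt (c := 2 * Real.pi)
    (by rw [him]; simpa using Real.pi_pos)] with w h1 h2
  rw [upperPeriod]
  split_ifs with h3
  · rw [Y.hyperW_zero_eq_barnes h1 isKernel_kern_zero_sub (by simpa using h3) (abs_lt.1 h2).2]
  · rfl

/-- The Picard–Lefschetz step. Outside the disc, `kern 0 - 2πi` gives the coefficients `κ₀(π_i) -
2πi` and the vanishing period gives `2πi`; their sum is the coefficient `κ₀(π_i)` of the
continuation through the lower half-plane. -/
theorem upperPeriod_eventuallyEq_outer (Y : CYFamily) {ξ : ℂ} (hξ : Real.log Y.conifold < ξ.re)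
    (him : ξ.im = 0) : Y.upperPeriod =ᶠ[𝓝 ξ] Y.outerPeriod := by
  filter_upwards [eventually_lt_re hξ, eventually_abs_im_lt (c := 2 * Real.pi)
    (by rw [him]; simpa using Real.pi_pos)] with w h1 h2
  rw [upperPeriod]
  split_ifs with h3 h4
  · rw [Y.barnes_hypA_eq_sum_piece (by norm_num) isKernel_kern_zero_sub h1 (by simpa using h3)
      (abs_lt.1 h2).2, Y.vanishingPeriod_eq_sum_piece h1 h2, ← Finset.sum_add_distrib, outerPeriod]
    exact Finset.sum_congr rfl fun i _ => by ring
  · exact absurd h4 h1.not_gt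
  · rfl

theorem analyticAt_hyperW_zero (Y : CYFamily) {ξ : ℂ} (hξ : ξ.re < Real.log Y.conifold) :
    AnalyticAt ℂ (fun ξ => Y.hyperW ξ 0) ξ :=
  Y.differentiableOn_hyperW_zero.analyticAt (Y.isOpen_re_lt_log.mem_nhds hξ)

theorem analyticAt_lowerPeriod (Y : CYFamily) {ξ : ℂ} (h₁ : -(2 * Real.pi) < ξ.im)
    (h : ξ.im < 0 ∨ ξ.im = 0 ∧ ξ.re ≠ Real.log Y.conifold) : AnalyticAt ℂ Y.lowerPeriod ξ := by
  rcases h with h | ⟨h, h'⟩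
  · refine (Y.analyticAt_barnes_hypA isKernel_kern_zero h₁ h).congr ?_
    filter_upwards [continuous_im.continuousAt.eventually_lt continuousAt_const h] with w hw
    rw [lowerPeriod, if_pos hw]
  · rcases lt_or_gt_of_ne h' with h' | h'
    · exact (Y.analyticAt_hyperW_zero h').congr (Y.lowerPeriod_eventuallyEq_inner h' h).symm
    · exact (Y.analyticAt_outerPeriod h').congr (Y.lowerPeriod_eventuallyEq_outer h' h).symm

theorem analyticAt_upperPeriod (Y : CYFamily) {ξ : ℂ} (h₁ : ξ.im < 2 * Real.pi)
    (h : 0 < ξ.im ∨ ξ.im = 0 ∧ ξ.re ≠ Real.log Y.conifold) : AnalyticAt ℂ Y.upperPeriod ξ := by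
  have hV : |ξ.im| < 2 * Real.pi := by
    rcases h with h | ⟨h, -⟩
    · rwa [abs_of_pos h]
    · rw [h]; simpa using Real.pi_pos
  rcases h with h | ⟨h, h'⟩
  · refine ((Y.analyticAt_barnes_hypA isKernel_kern_zero_sub (by simpa using h) h₁).add
      (Y.analyticAt_vanishingPeriod hV)).congr ?_
    filter_upwards [continuousAt_const.eventually_lt continuous_im.continuousAt h] with w hw
    rw [upperPeriod, if_pos hw]
    rfl
  · rcases lt_or_gt_of_ne h' with h' | h'
    · exact ((Y.analyticAt_hyperW_zero h').add (Y.analyticAt_vanishingPeriod hV)).congr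
        (Y.upperPeriod_eventuallyEq_inner h' h).symm
    · exact (Y.analyticAt_outerPeriod h').congr (Y.upperPeriod_eventuallyEq_outer h' h).symm

/-- The circle leaves `x₀` into the lower half-plane, meets the axis again at `2x_c - x₀ > x_c` for
`t = 1/2` and returns through the upper half-plane. `lowerPeriod` and `upperPeriod` cover the two
halves and agree at the crossing; back at `x₀` the first period has gained the fourth. The remaining
entries are single-valued along the loop, since `Re γ > 0`. -/
theorem hasMonodromy_conifold (Y : CYFamily) (a : ℂ) {x₀ : ℝ} (h0 : 0 < x₀) (h1 : x₀ < Y.conifold) :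
    HasMonodromy (circleLoop Y.conifold x₀) (Y.periods a) matKR := by
  set γ := circleLoop Y.conifold x₀ with hγ
  have hγval : ∀ t, (γ t).re = Y.conifold - (Y.conifold - x₀) * Real.cos (2 * Real.pi * t) ∧
      (γ t).im = -((Y.conifold - x₀) * Real.sin (2 * Real.pi * t)) := by
    intro t
    have e : (2 * Real.pi * I * t : ℂ) = ((2 * Real.pi * t : ℝ) : ℂ) * I := by push_cast; ring
    have e2 : ((x₀ : ℂ) - Y.conifold) = ((x₀ - Y.conifold : ℝ) : ℂ) := by push_cast; rfl
    rw [hγ, circleLoop, e, e2]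
    constructor
    · rw [add_re, re_ofReal_mul, exp_ofReal_mul_I_re, ofReal_re]; ring
    · rw [add_im, im_ofReal_mul, exp_ofReal_mul_I_im, ofReal_im]; ring
  have hre : ∀ t, 0 < (γ t).re := fun t => by
    rw [(hγval t).1]
    nlinarith [Real.cos_le_one (2 * Real.pi * t)]
  have hslit : ∀ t, γ t ∈ slitPlane := fun t => Or.inl (hre t)
  have harg : ∀ t, |(Complex.log (γ t)).im| < 2 * Real.pi := fun t => by
    rw [log_im]
    exact (abs_arg_le_pi _).trans_lt (by linarith [Real.pi_pos])
  have hpi := Real.pi_pos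
  have hreal : ∀ t, (γ t).im = 0 → (Complex.log (γ t)).im = 0 ∧
      (Complex.log (γ t)).re = Real.log (γ t).re := fun t ht => by
    have : γ t = ((γ t).re : ℂ) := by apply Complex.ext <;> simp [ht]
    rw [this, ← ofReal_log (hre t).le]
    simp
  have hx : (γ 0).re = x₀ ∧ (γ 0).im = 0 := by
    rw [(hγval 0).1, (hγval 0).2]; simp
  have hx1 : (γ 1).re = x₀ ∧ (γ 1).im = 0 := by
    rw [(hγval 1).1, (hγval 1).2]; simp
  have hh : (γ (1 / 2)).re = 2 * Y.conifold - x₀ ∧ (γ (1 / 2)).im = 0 := by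
    have : 2 * Real.pi * (1 / 2) = Real.pi := by ring
    rw [(hγval _).1, (hγval _).2, this, Real.cos_pi, Real.sin_pi]
    constructor <;> ring
  have hin : ∀ t, (γ t).im = 0 → (γ t).re = x₀ → (Complex.log (γ t)).re < Real.log Y.conifold :=
    fun t ht ht' => by
      rw [(hreal t ht).2, ht']
      exact Real.log_lt_log h0 h1
  have hout : Real.log Y.conifold < (Complex.log (γ (1 / 2))).re := by
    rw [(hreal _ hh.2).2, hh.1]
    exact Real.log_lt_log Y.conifold_pos (by linarith)
  have hlog : ∀ t, Tendsto Complex.log (𝓝 (γ t)) (𝓝 (Complex.log (γ t))) := fun t =>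
    (continuousAt_clog (hslit t)).tendsto
  have hper : ∀ t, (γ t).im = 0 → (γ t).re = x₀ → ∀ᶠ x in 𝓝 (γ t), Y.periods a x =
      Y.contPeriods a (Y.hyperW (Complex.log x) 0) (Complex.log x) := fun t ht ht' => by
    filter_upwards [(hlog t).eventually (eventually_re_lt (hin t ht ht')),
      (hlog t).eventually (eventually_abs_im_lt (harg t))] with x h2 h3
    exact Y.periodsLog_eq_contPeriods a h2 h3
  refine hasMonodromy_of_two (c := 1 / 2) (continuous_circleLoop _ _)
    (f₁ := fun x => Y.contPeriods a (Y.lowerPeriod (Complex.log x)) (Complex.log x))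
    (f₂ := fun x => Y.contPeriods a (Y.upperPeriod (Complex.log x)) (Complex.log x))
    (by norm_num) (by norm_num) (fun t ht => ?_) (fun t ht => ?_) ?_ ?_ ?_
  · refine AnalyticAt.fun_comp (g := fun ξ => Y.contPeriods a (Y.lowerPeriod ξ) ξ)
      (Y.analyticAt_contPeriods a (harg t)
      (Y.analyticAt_lowerPeriod (abs_lt.1 (harg t)).1 ?_)) (analyticAt_clog (hslit t))
    rcases eq_or_lt_of_le ht.1 with rfl | h2
    · exact Or.inr ⟨(hreal 0 hx.2).1, (hin 0 hx.2 hx.1).ne⟩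
    rcases eq_or_lt_of_le ht.2 with rfl | h3
    · exact Or.inr ⟨(hreal _ hh.2).1, hout.ne'⟩
    left
    rw [log_im, arg_neg_iff, (hγval t).2]
    have : 0 < Real.sin (2 * Real.pi * t) := Real.sin_pos_of_pos_of_lt_pi (by positivity)
      (by nlinarith)
    nlinarith
  · refine AnalyticAt.fun_comp (g := fun ξ => Y.contPeriods a (Y.upperPeriod ξ) ξ)
      (Y.analyticAt_contPeriods a (harg t)
      (Y.analyticAt_upperPeriod (abs_lt.1 (harg t)).2 ?_)) (analyticAt_clog (hslit t))
    rcases eq_or_lt_of_le ht.1 with rfl | h2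
    · exact Or.inr ⟨(hreal _ hh.2).1, hout.ne'⟩
    rcases eq_or_lt_of_le ht.2 with rfl | h3
    · exact Or.inr ⟨(hreal _ hx1.2).1, (hin _ hx1.2 hx1.1).ne⟩
    left
    have h4 : 0 < Real.sin (2 * Real.pi - 2 * Real.pi * t) :=
      Real.sin_pos_of_pos_of_lt_pi (by nlinarith) (by nlinarith)
    rw [Real.sin_two_pi_sub] at h4
    have h5 : 0 < (γ t).im := by
      rw [(hγval t).2]
      nlinarith
    rw [log_im]
    refine lt_of_le_of_ne (arg_nonneg_iff.2 h5.le) fun h6 => ?_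
    rw [eq_comm, arg_eq_zero_iff] at h6
    exact h5.ne' h6.2
  · filter_upwards [(hlog _).eventually (Y.lowerPeriod_eventuallyEq_outer hout (hreal _ hh.2).1),
      (hlog _).eventually (Y.upperPeriod_eventuallyEq_outer hout (hreal _ hh.2).1)] with x h2 h3
    rw [h2, h3]
  · filter_upwards [(hlog _).eventually (Y.lowerPeriod_eventuallyEq_inner (hin 0 hx.2 hx.1)
      (hreal _ hx.2).1), hper 0 hx.2 hx.1] with x h2 h3
    rw [h2, h3]
  · filter_upwards [(hlog _).eventually (Y.upperPeriod_eventuallyEq_inner (hin 1 hx1.2 hx1.1)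
      (hreal _ hx1.2).1), hper 1 hx1.2 hx1.1] with x h2 h3
    rw [h2, h3, contPeriods_vecMul]

/-- Near the point of parameter `t` the branch of the logarithm is `log (x e^{-2πit}) + 2πit`, where
the principal branch is evaluated near the positive number `x₀`. -/
theorem hasMonodromy_zero (Y : CYFamily) (a : ℂ) {x₀ : ℝ} (h0 : 0 < x₀) (h1 : x₀ < Y.conifold) :
    HasMonodromy (circleLoop 0 x₀) (Y.periods a) (Y.matKRbar a * Y.matL a) := by
  set γ := circleLoop 0 x₀ with hγ
  set rot : ℝ → ℂ := fun t => exp (-(2 * Real.pi * I * t)) with hrot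
  have hγ' : ∀ t : ℝ, γ t = x₀ * exp (2 * Real.pi * I * t) := fun t => by simp [hγ, circleLoop]
  have hγrot : ∀ s t : ℝ, γ s * rot t = x₀ * exp (((2 * Real.pi * (s - t) : ℝ) : ℂ) * I) :=
    fun s t => by
      rw [hγ', hrot, mul_assoc, ← Complex.exp_add]
      congr 2
      push_cast
      ring
  have hself : ∀ t, γ t * rot t = x₀ := fun t => by rw [hγrot]; simp
  have hpi := Real.pi_pos
  have hre : ∀ s t : ℝ, |s - t| < 1 / 8 → 0 < (γ s * rot t).re := fun s t hst => by
    rw [hγrot, re_ofReal_mul, exp_ofReal_mul_I_re]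
    refine mul_pos h0 (Real.cos_pos_of_mem_Ioo ?_)
    rw [abs_lt] at hst
    constructor <;> nlinarith
  refine ⟨fun t x => Y.periodsLog a (Complex.log (x * rot t) + 2 * Real.pi * I * t),
    fun t _ => ⟨?_, nhdsWithin_le_nhds ?_⟩, ?_, ?_⟩
  · refine AnalyticAt.fun_comp (g := Y.periodsLog a)
      ((Y.differentiableOn_periodsLog a).analyticAt (Y.isOpen_re_lt_log.mem_nhds ?_)) ?_
    · rw [hself]
      have : (2 * Real.pi * I * t : ℂ).re = 0 := by simp
      rw [mem_ofPred_eq, add_re, this, add_zero]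
      exact Y.log_re_lt h0 h1
    · refine AnalyticAt.add (AnalyticAt.fun_comp (g := Complex.log) (analyticAt_clog ?_)
        (analyticAt_id.mul analyticAt_const)) analyticAt_const
      rw [hself]
      exact ofReal_mem_slitPlane.2 h0
  · have : ∀ᶠ s : ℝ in 𝓝 t, |s - t| < 1 / 8 :=
      (by fun_prop : Continuous fun s : ℝ => |s - t|).continuousAt.eventually_lt
        continuousAt_const (by simp)
    filter_upwards [this] with s hs
    have e1 : ∀ᶠ x in 𝓝 (γ s), 0 < (x * rot t).re :=
      continuousAt_const.eventually_lt (by fun_prop) (hre s t hs)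
    have e2 : ∀ᶠ x in 𝓝 (γ s), 0 < (x * rot s).re :=
      continuousAt_const.eventually_lt (by fun_prop) (hre s s (by simp))
    filter_upwards [e1, e2] with x h2 h3
    have hn2 : x * rot t ≠ 0 := fun h => by rw [h] at h2; simp at h2
    have hn3 : x * rot s ≠ 0 := fun h => by rw [h] at h3; simp at h3
    congr 1
    have h4 : exp (Complex.log (x * rot s) + 2 * Real.pi * I * s) =
        exp (Complex.log (x * rot t) + 2 * Real.pi * I * t) := by
      have e5 : ∀ r : ℝ, rot r * exp (2 * Real.pi * I * r) = 1 := fun r => by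
        rw [hrot, ← Complex.exp_add, neg_add_cancel, Complex.exp_zero]
      rw [Complex.exp_add, Complex.exp_add, exp_log hn2, exp_log hn3, mul_assoc x, mul_assoc x, e5, e5]
    obtain ⟨n, hn⟩ := exp_eq_exp_iff_exists_int.1 h4
    have him := congrArg im hn
    have e3 : ∀ r : ℝ, (2 * Real.pi * I * r : ℂ).im = 2 * Real.pi * r := fun r => by simp
    have e4 : ((n : ℂ) * (2 * Real.pi * I)).im = n * (2 * Real.pi) := by simp
    rw [add_im, add_im, add_im, e3, e3, e4, log_im, log_im] at him
    have a2 := abs_lt.1 (abs_arg_lt_pi_div_two_iff.2 (Or.inl h2))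
    have a3 := abs_lt.1 (abs_arg_lt_pi_div_two_iff.2 (Or.inl h3))
    rw [abs_lt] at hs
    -- Both arguments are less than `π/2` in modulus and `|s - t| < 1/8`, so `2π|n| < π + π/4`.
    have hn0 : n = 0 := by
      have b1 : (n : ℝ) < 1 := by nlinarith
      have b2 : (-1 : ℝ) < n := by nlinarith
      norm_cast at b1
      have b2' : (-1 : ℤ) < n := by exact_mod_cast b2
      omega
    rw [hn, hn0]
    simp
  · refine Eventually.of_forall fun x => ?_
    simp [periods, hrot]
  · have h2 : rot 1 = 1 := by
      simp only [hrot, ofReal_one, mul_one, Complex.exp_neg, exp_two_pi_mul_I, inv_one]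
    have hx : γ 1 = x₀ := circleLoop_one _ _
    rw [hx]
    have h3 : ∀ᶠ x in 𝓝 (x₀ : ℂ), (Complex.log x).re < Real.log Y.conifold :=
      (continuousAt_clog (ofReal_mem_slitPlane.2 h0)).eventually
        (eventually_re_lt (Y.log_re_lt h0 h1))
    filter_upwards [h3] with x h4
    rw [h2, mul_one, ofReal_one, mul_one, Y.periodsLog_add_two_pi_mul_I a h4]
    rfl

end CYFamily

namespace CYFamily

open MeasureTheory Complex Set

/-! ### The holomorphic solutions as local solutions at `z = 0` -/

/-- The solutions of the Laplace-transformed equation at the exponents `-πᵢ`. -/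
def localSol (Y : CYFamily) (i : Fin 4) (ζ : ℂ) : ℂ := exp (-ζ) * Y.piece Y.hypB 3 i (-ζ)

/-- The values at the exponents of the kernels of `f₁, …, f₄`. -/
def kernVal (Y : CYFamily) (a : ℂ) (i : Fin 4) : Fin 4 → ℂ :=
  ![kern 0 (Y.pole i), kern 1 (Y.pole i) / (2 * Real.pi * I) ^ 1,
    (Y.cubic : ℂ) / 2 * (kern 2 (Y.pole i) / (2 * Real.pi * I) ^ 2) +
      a * (kern 1 (Y.pole i) / (2 * Real.pi * I) ^ 1), 2 * Real.pi * I]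

/-- The constant `c_N`. -/
def normConst (Y : CYFamily) : ℂ :=
  2 * Real.pi * I / ((1 - Y.alphaPow 1) * exp (-(Real.pi * I / Y.degree)) * (16 * Real.pi ^ 4) *
    Y.weight 0)

theorem idx_pos (Y : CYFamily) (i : Fin 4) : 0 < Y.idx i := by
  cases Y <;> fin_cases i <;> simp [idx]

theorem idx_lt (Y : CYFamily) (i : Fin 4) : Y.idx i < Y.degree := by
  cases Y <;> fin_cases i <;> simp [idx, degree]

theorem degree_ne_zero (Y : CYFamily) : (Y.degree : ℂ) ≠ 0 := by exact_mod_cast Y.degree_pos.ne'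

theorem pole_cast (Y : CYFamily) (i : Fin 4) : (Y.pole i : ℂ) = 1 - Y.idx i / Y.degree := by
  simp [pole]

/-- The coefficients of `φ_k` obey the recurrence of the residues on the left up to a sign, so only
the leading coefficients have to be compared. -/
theorem phiCoeff_add_one (Y : CYFamily) {s : ℂ} (hs : -1 < s.re) :
    Y.phiCoeff (s + 1) * ∏ l, (s + 1 + Y.pole l) = Y.conifold * (s + 1) ^ 3 * Y.phiCoeff s := by
  have hG : ∀ k : ℕ, Gamma (((k + 1 : ℕ) : ℂ) * s + (k + 1 : ℕ) + 1) ≠ 0 := fun k =>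
    Gamma_ne_zero_of_re_pos (by simp; nlinarith [k.cast_nonneg (α := ℝ)])
  have hne : ∀ k l : ℕ, ((k + 1 : ℕ) : ℂ) * s + (k + 1 : ℕ) + 1 + l ≠ 0 := fun k l h => by
    have := congrArg re h
    simp at this
    nlinarith [k.cast_nonneg (α := ℝ), l.cast_nonneg (α := ℝ)]
  have hshift : ∀ k n : ℕ, Gamma (((k + 1 : ℕ) : ℂ) * s + (k + 1 : ℕ) + 1 + n) =
      Gamma (((k + 1 : ℕ) : ℂ) * s + (k + 1 : ℕ) + 1) *
        ∏ l ∈ Finset.range n, (((k + 1 : ℕ) : ℂ) * s + (k + 1 : ℕ) + 1 + l) := fun k n =>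
    Gamma_add_nat_eq (by simp; nlinarith [k.cast_nonneg (α := ℝ)]) n
  have h1 : Gamma (1 + (s + 1)) = Gamma (1 + s) * (1 + s) := by
    rw [← add_assoc, Gamma_add_one _ fun h => by
      have := congrArg re h
      simp at this
      linarith, mul_comm]
  have hP : ∀ k n : ℕ, ∏ l ∈ Finset.range n, (((k + 1 : ℕ) : ℂ) * s + (k + 1 : ℕ) + 1 + l) ≠ 0 :=
    fun k n => Finset.prod_ne_zero_iff.2 fun l _ => hne k l
  cases Y with
  | Y5 =>
    have e1 : Gamma (2 + (s + 1)) = Gamma (2 + s) * (2 + s) := by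
      convert hshift 0 1 using 2 <;> simp <;> ring_nf
    have e2 : Gamma (6 + 5 * (s + 1)) = Gamma (6 + 5 * s) * ∏ l ∈ Finset.range 5,
        (((4 + 1 : ℕ) : ℂ) * s + (4 + 1 : ℕ) + 1 + l) := by
      convert hshift 4 5 using 2
      · push_cast; ring
      · congr 1; push_cast; ring
    have h3 : Gamma (6 + 5 * s) ≠ 0 := by
      convert hG 4 using 2; push_cast; ring
    have h4 := hP 4 5
    simp only [phiCoeff, h1, e1, e2]
    generalize Gamma (1 + s) = G1
    generalize Gamma (2 + s) = G2
    rw [div_mul_eq_mul_div, mul_div_assoc', div_eq_div_iff (mul_ne_zero h3 h4) h3]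
    simp [Finset.prod_range_succ, Fin.prod_univ_succ, pole, idx, degree, conifold]
    ring
  | Y6 =>
    have e1 : Gamma (3 + 2 * (s + 1)) = Gamma (3 + 2 * s) * ∏ l ∈ Finset.range 2,
        (((1 + 1 : ℕ) : ℂ) * s + (1 + 1 : ℕ) + 1 + l) := by
      convert hshift 1 2 using 2
      · push_cast; ring
      · congr 1; push_cast; ring
    have e2 : Gamma (7 + 6 * (s + 1)) = Gamma (7 + 6 * s) * ∏ l ∈ Finset.range 6,
        (((5 + 1 : ℕ) : ℂ) * s + (5 + 1 : ℕ) + 1 + l) := by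
      convert hshift 5 6 using 2
      · push_cast; ring
      · congr 1; push_cast; ring
    have h3 : Gamma (7 + 6 * s) ≠ 0 := by
      convert hG 5 using 2; push_cast; ring
    have h4 := hP 5 6
    simp only [phiCoeff, h1, e1, e2]
    generalize Gamma (1 + s) = G1
    generalize Gamma (3 + 2 * s) = G2
    rw [div_mul_eq_mul_div, mul_div_assoc', div_eq_div_iff (mul_ne_zero h3 h4) h3]
    simp [Finset.prod_range_succ, Fin.prod_univ_succ, pole, idx, degree, conifold]
    ring
  | Y8 =>
    have e1 : Gamma (5 + 4 * (s + 1)) = Gamma (5 + 4 * s) * ∏ l ∈ Finset.range 4,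
        (((3 + 1 : ℕ) : ℂ) * s + (3 + 1 : ℕ) + 1 + l) := by
      convert hshift 3 4 using 2
      · push_cast; ring
      · congr 1; push_cast; ring
    have e2 : Gamma (9 + 8 * (s + 1)) = Gamma (9 + 8 * s) * ∏ l ∈ Finset.range 8,
        (((7 + 1 : ℕ) : ℂ) * s + (7 + 1 : ℕ) + 1 + l) := by
      convert hshift 7 8 using 2
      · push_cast; ring
      · congr 1; push_cast; ring
    have h3 : Gamma (9 + 8 * s) ≠ 0 := by
      convert hG 7 using 2; push_cast; ring
    have h4 := hP 7 8
    simp only [phiCoeff, h1, e1, e2]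
    generalize Gamma (1 + s) = G1
    generalize Gamma (5 + 4 * s) = G2
    rw [div_mul_eq_mul_div, mul_div_assoc', div_eq_div_iff (mul_ne_zero h3 h4) h3]
    simp [Finset.prod_range_succ, Fin.prod_univ_succ, pole, idx, degree, conifold]
    ring
  | Y10 =>
    have e1 : Gamma (2 + 2 * (s + 1)) = Gamma (2 + 2 * s) * ((2 + 2 * s) * (3 + 2 * s)) := by
      have a1 : (2 + 2 * s) ≠ 0 := fun h => by
        have := congrArg re h
        simp at this
        linarith
      have a2 : (2 + 2 * s + 1) ≠ 0 := fun h => by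
        have := congrArg re h
        simp at this
        linarith
      rw [show 2 + 2 * (s + 1) = 2 + 2 * s + 1 + 1 by ring, Gamma_add_one _ a2, Gamma_add_one _ a1]
      ring
    have e1' : Gamma (6 + 5 * (s + 1)) = Gamma (6 + 5 * s) * ∏ l ∈ Finset.range 5,
        (((4 + 1 : ℕ) : ℂ) * s + (4 + 1 : ℕ) + 1 + l) := by
      convert hshift 4 5 using 2
      · push_cast; ring
      · congr 1; push_cast; ring
    have e2 : Gamma (11 + 10 * (s + 1)) = Gamma (11 + 10 * s) * ∏ l ∈ Finset.range 10,
        (((9 + 1 : ℕ) : ℂ) * s + (9 + 1 : ℕ) + 1 + l) := by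
      convert hshift 9 10 using 2
      · push_cast; ring
      · congr 1; push_cast; ring
    have h3 : Gamma (11 + 10 * s) ≠ 0 := by
      convert hG 9 using 2; push_cast; ring
    have h4 := hP 9 10
    simp only [phiCoeff, h1, e1, e1', e2]
    generalize Gamma (1 + s) = G1
    generalize Gamma (2 + 2 * s) = G2
    generalize Gamma (6 + 5 * s) = G4
    rw [div_mul_eq_mul_div, mul_div_assoc', div_eq_div_iff (mul_ne_zero h3 h4) h3]
    simp [Finset.prod_range_succ, Fin.prod_univ_succ, pole, idx, degree, conifold]
    ring

/-- The fractions `ωₗ j / d`. -/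
def frac (Y : CYFamily) (i l : Fin 4) : ℂ := Y.weight l.castSucc * Y.idx i / Y.degree

/-- `J` contains no `j` for which `d` divides some `ω_l j`; this keeps the Gamma values below finite
and the reflection formula applicable. -/
theorem frac_ne_int (Y : CYFamily) (i l : Fin 4) (k : ℤ) : Y.frac i l ≠ k := fun h => by
  have h0 := Y.degree_ne_zero
  rw [frac, div_eq_iff h0] at h
  have h1 : (Y.weight l.castSucc * Y.idx i : ℤ) = k * Y.degree := by exact_mod_cast h
  have h2 : (Y.degree : ℤ) ∣ Y.weight l.castSucc * Y.idx i := ⟨k, by rw [h1, mul_comm]⟩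
  revert h2
  cases Y <;> fin_cases i <;> fin_cases l <;> simp [degree, weight, idx]

/-- Since `ω_l π_i = ω_l - ω_l j/d`, each Gamma factor is `Γ(1 - ω_l j/d)` times a polynomial. What
remains is an identity of rational numbers, one for each family and each exponent. -/
theorem resCoeff_zero_eq (Y : CYFamily) (i : Fin 4) :
    Y.resCoeff Y.hypB 3 i 0 * (Y.degree * (Y.idx i - 1).factorial *
      ∏ l, Gamma (1 - Y.frac i l)) = (-1) ^ (Y.idx i + 1) := by
  have h0 := Y.degree_ne_zero
  have hne : ∀ l : Fin 4, ∀ k : ℕ, 1 - Y.frac i l + k ≠ 0 := fun l k h =>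
    Y.frac_ne_int i l (1 + k) (by push_cast; linear_combination -h)
  have hG : ∀ l, Gamma (1 + Y.weight l.castSucc * Y.pole i) =
      Gamma (1 - Y.frac i l) * ∏ k ∈ Finset.range (Y.weight l.castSucc), (1 - Y.frac i l + k) := by
    intro l
    have : (1 + Y.weight l.castSucc * Y.pole i : ℂ) = 1 - Y.frac i l + Y.weight l.castSucc := by
      rw [pole_cast, frac]; field_simp; ring
    rw [this]
    generalize Y.weight l.castSucc = n
    induction n with
    | zero => simp
    | succ n ih =>
      rw [Nat.cast_succ, ← add_assoc, Gamma_add_one _ (hne l n), ih, Finset.prod_range_succ]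
      ring
  have hd : Gamma (1 + Y.degree * Y.pole i) = ((Y.degree - Y.idx i).factorial : ℂ) := by
    rw [← Complex.Gamma_nat_eq_factorial, Nat.cast_sub (Y.idx_lt i).le, pole_cast]
    congr 1
    field_simp
    ring
  have hG0 : ∏ l, Gamma (1 - Y.frac i l) ≠ 0 := Finset.prod_ne_zero_iff.2 fun l _ =>
    Gamma_ne_zero fun k h => hne l k (by rw [h]; ring)
  have hP : ∏ l : Fin 4, ∏ k ∈ Finset.range (Y.weight l.castSucc), (1 - Y.frac i l + k) ≠ 0 :=
    Finset.prod_ne_zero_iff.2 fun l _ => Finset.prod_ne_zero_iff.2 fun k _ => hne l k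
  have key : (Y.conifold : ℂ) * (Y.pole i : ℂ) ^ 3 * Y.poleWeight i *
      (Y.degree - Y.idx i).factorial * (Y.degree * (Y.idx i - 1).factorial) =
      (-1) ^ (Y.idx i + 1) *
        ∏ l : Fin 4, ∏ k ∈ Finset.range (Y.weight l.castSucc), (1 - Y.frac i l + k) := by
    have hw : Y.poleWeight i = ∏ j, if j = i then 1 else ((Y.pole i : ℂ) - Y.pole j)⁻¹ := by
      rw [poleWeight, Finset.prod_ite, Finset.prod_const_one, one_mul]
      congr 1
      ext j
      simp
    rw [hw]
    cases Y <;> fin_cases i <;>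
    · simp [Fin.prod_univ_four, frac, weight, degree, idx, pole, conifold, Finset.prod_range_succ,
        Nat.factorial]
      norm_num
  rw [resCoeff, Finset.range_zero, Finset.prod_empty, mul_one, hypB, hd]
  simp only [hG]
  rw [Finset.prod_mul_distrib]
  field_simp
  linear_combination key

/-- One Gamma factor of `c(-π_i)` has argument `ω₀ j/d + 1` and the denominator is `j!`. Extracting
`ω₀ j/d` from the former and `j` from the latter leaves `ω₀ / (d (j-1)!)`. -/
theorem phiCoeff_neg_pole (Y : CYFamily) (i : Fin 4) :
    Y.phiCoeff (-Y.pole i) * (Y.degree * (Y.idx i - 1).factorial) =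
      Y.weight 0 * ∏ l, Gamma (Y.frac i l) := by
  have h0 := Y.degree_ne_zero
  have hf : Y.frac i 0 ≠ 0 := by simpa using Y.frac_ne_int i 0 0
  have hfac : (Y.idx i : ℂ) * (Y.idx i - 1).factorial = (Y.idx i).factorial := by
    exact_mod_cast Nat.mul_factorial_pred (Y.idx_pos i).ne'
  have hG : Gamma (Y.idx i + 1) = (Y.idx i).factorial := Complex.Gamma_nat_eq_factorial _
  have h1 := Gamma_add_one _ hf
  have hne : ((Y.idx i).factorial : ℂ) ≠ 0 := by exact_mod_cast (Y.idx i).factorial_ne_zero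
  rw [Fin.prod_univ_four]
  have hi0 : (Y.idx i : ℂ) ≠ 0 := by exact_mod_cast (Y.idx_pos i).ne'
  have hp := Y.pole_cast i
  cases Y with
  | Y5 =>
    simp only [phiCoeff]
    have a1 : 1 + -(Y5.pole i : ℂ) = Y5.frac i 0 := by rw [hp, frac]; simp [weight, degree]
    have a2 : 2 + -(Y5.pole i : ℂ) = Y5.frac i 0 + 1 := by rw [← a1]; ring
    have a3 : 6 + 5 * -(Y5.pole i : ℂ) = Y5.idx i + 1 := by rw [hp]; simp [degree]; ring
    have a4 : ∀ l, Y5.frac i l = Y5.frac i 0 := fun l => by fin_cases l <;> simp [frac, weight]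
    rw [a1, a2, a3, h1, hG, a4 1, a4 2, a4 3, ← hfac]
    have a5 : Y5.frac i 0 = Y5.idx i / 5 := by simp [frac, weight, degree]
    rw [← hfac] at hne
    have := right_ne_zero_of_mul hne
    generalize Gamma (Y5.frac i 0) = G
    rw [a5]
    simp [degree, weight]
    field_simp
  | Y6 =>
    simp only [phiCoeff]
    have a1 : 1 + -(Y6.pole i : ℂ) = Y6.frac i 1 := by rw [hp, frac]; simp [weight, degree]
    have a2 : 3 + 2 * -(Y6.pole i : ℂ) = Y6.frac i 0 + 1 := by
      rw [hp, frac]; simp [weight, degree]; ring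
    have a3 : 7 + 6 * -(Y6.pole i : ℂ) = Y6.idx i + 1 := by rw [hp]; simp [degree]; ring
    have a4 : Y6.frac i 2 = Y6.frac i 1 := by simp [frac, weight]
    have a4' : Y6.frac i 3 = Y6.frac i 1 := by simp [frac, weight]
    rw [a1, a2, a3, h1, hG, a4, a4', ← hfac]
    have a5 : Y6.frac i 0 = 2 * Y6.idx i / 6 := by simp [frac, weight, degree]
    rw [← hfac] at hne
    have := right_ne_zero_of_mul hne
    generalize Gamma (Y6.frac i 0) = G
    rw [a5]
    simp [degree, weight]
    field_simp
  | Y8 =>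
    simp only [phiCoeff]
    have a1 : 1 + -(Y8.pole i : ℂ) = Y8.frac i 1 := by rw [hp, frac]; simp [weight, degree]
    have a2 : 5 + 4 * -(Y8.pole i : ℂ) = Y8.frac i 0 + 1 := by
      rw [hp, frac]; simp [weight, degree]; ring
    have a3 : 9 + 8 * -(Y8.pole i : ℂ) = Y8.idx i + 1 := by rw [hp]; simp [degree]; ring
    have a4 : Y8.frac i 2 = Y8.frac i 1 := by simp [frac, weight]
    have a4' : Y8.frac i 3 = Y8.frac i 1 := by simp [frac, weight]
    rw [a1, a2, a3, h1, hG, a4, a4', ← hfac]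
    have a5 : Y8.frac i 0 = 4 * Y8.idx i / 8 := by simp [frac, weight, degree]
    rw [← hfac] at hne
    have := right_ne_zero_of_mul hne
    generalize Gamma (Y8.frac i 0) = G
    rw [a5]
    simp [degree, weight]
    field_simp
  | Y10 =>
    simp only [phiCoeff]
    have a1 : 1 + -(Y10.pole i : ℂ) = Y10.frac i 2 := by rw [hp, frac]; simp [weight, degree]
    have a2 : 6 + 5 * -(Y10.pole i : ℂ) = Y10.frac i 0 + 1 := by
      rw [hp, frac]; simp [weight, degree]; ring
    have a2' : 2 + 2 * -(Y10.pole i : ℂ) = Y10.frac i 1 := by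
      rw [hp, frac]; simp [weight, degree]; ring
    have a3 : 11 + 10 * -(Y10.pole i : ℂ) = Y10.idx i + 1 := by rw [hp]; simp [degree]; ring
    have a4 : Y10.frac i 3 = Y10.frac i 2 := by simp [frac, weight]
    rw [a1, a2, a2', a3, h1, hG, a4, ← hfac]
    have a5 : Y10.frac i 0 = 5 * Y10.idx i / 10 := by simp [frac, weight, degree]
    rw [← hfac] at hne
    have := right_ne_zero_of_mul hne
    generalize Gamma (Y10.frac i 0) = G
    rw [a5]
    simp [degree, weight]
    field_simp

theorem one_sub_exp_mul_Gamma (z : ℂ) (hz : ∀ k : ℤ, z ≠ k) :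
    (1 - exp (2 * Real.pi * I * z)) * Gamma z * Gamma (1 - z) =
      -(2 * Real.pi * I) * exp (Real.pi * I * z) := by
  have hs : sin (Real.pi * z) ≠ 0 := fun h => by
    obtain ⟨k, hk⟩ := Complex.sin_eq_zero_iff.1 h
    refine hz k (mul_left_cancel₀ (ofReal_ne_zero.2 Real.pi_ne_zero) ?_)
    rw [hk]; ring
  have h1 := Complex.Gamma_mul_Gamma_one_sub z
  have h2 : 1 - exp (2 * Real.pi * I * z) = -2 * I * sin (Real.pi * z) * exp (Real.pi * I * z) := by
    have e1 : exp (2 * Real.pi * I * z) = exp (Real.pi * I * z) * exp (Real.pi * I * z) := by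
      rw [← Complex.exp_add]; congr 1; ring
    have e2 : exp (-(Real.pi * z) * I) * exp (Real.pi * I * z) = 1 := by
      rw [← Complex.exp_add]; ring_nf; simp
    have e3 : exp (Real.pi * z * I) = exp (Real.pi * I * z) := by congr 1; ring
    rw [Complex.sin, e1, e3]
    linear_combination (-1 : ℂ) * e2 +
      (exp (-(Real.pi * z) * I) - exp (Real.pi * I * z)) * exp (Real.pi * I * z) * I_sq
  rw [mul_assoc, h1, h2]
  field_simp

theorem one_sub_alphaPow_ne_zero (Y : CYFamily) : 1 - Y.alphaPow 1 ≠ 0 := by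
  rw [alphaPow, mul_one, sub_ne_zero]
  refine fun h => (isPrimitiveRoot_exp Y.degree Y.degree_pos.ne').ne_one ?_ h.symm
  cases Y <;> norm_num [degree]

/-- The connection constants. -/
theorem neg_resCoeff_zero_eq (Y : CYFamily) (i : Fin 4) :
    kern 0 (Y.pole i) * -Y.resCoeff Y.hypB 3 i 0 = Y.normConst * ((1 - Y.alphaPow 1) *
      ((1 - Y.alphaPow (Y.weight 0 * Y.idx i)) * (1 - Y.alphaPow (Y.weight 1 * Y.idx i)) *
      (1 - Y.alphaPow (Y.weight 2 * Y.idx i)) * Y.alphaPow (((Y.idx i : ℂ) - 1) / 2) *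
      Y.phiCoeff (-Y.pole i))) := by
  have h0 := Y.degree_ne_zero
  have hα := Y.one_sub_alphaPow_ne_zero
  have hpi : (Real.pi : ℂ) ≠ 0 := ofReal_ne_zero.2 Real.pi_ne_zero
  have hw0 : (Y.weight 0 : ℂ) ≠ 0 := by exact_mod_cast (Y.weight_pos 0).ne'
  have hfac : ((Y.idx i - 1).factorial : ℂ) ≠ 0 := by
    exact_mod_cast (Y.idx i - 1).factorial_ne_zero
  have hw3 : Y.weight 3 = 1 := by cases Y <;> rfl
  have ha : ∀ l : Fin 4, Y.alphaPow (Y.weight l.castSucc * Y.idx i) =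
      exp (2 * Real.pi * I * Y.frac i l) := fun l => by
    rw [alphaPow, frac]; congr 1; ring
  have hG := fun l => one_sub_exp_mul_Gamma _ (Y.frac_ne_int i l)
  have hG0 : ∏ l, Gamma (1 - Y.frac i l) ≠ 0 := Finset.prod_ne_zero_iff.2 fun l _ =>
    Gamma_ne_zero fun k h => Y.frac_ne_int i l (1 + k) (by push_cast; linear_combination -h)
  have hr := Y.resCoeff_zero_eq i
  have hphi := Y.phiCoeff_neg_pole i
  -- Four reflection formulas are multiplied. As `∑_{l≤4} ω_l = d - 1`, the exponents sum to `j -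
  -- j/d`, whence the sign `(-1)^j` and the phase.
  have hprod : (∏ l, (1 - exp (2 * Real.pi * I * Y.frac i l))) * (∏ l, Gamma (Y.frac i l)) *
      ∏ l, Gamma (1 - Y.frac i l) =
      (16 * Real.pi ^ 4) * ((-1) ^ (Y.idx i) * exp (-(Real.pi * I * (Y.idx i / Y.degree)))) := by
    rw [← Finset.prod_mul_distrib, ← Finset.prod_mul_distrib]
    simp only [hG]
    rw [Finset.prod_mul_distrib, ← Complex.exp_sum, ← Finset.mul_sum, Finset.prod_const]
    have hs : ∑ l, Y.frac i l = Y.idx i - Y.idx i / Y.degree := by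
      have : ∑ l : Fin 4, (Y.weight l.castSucc : ℂ) = Y.degree - 1 := by
        have h := Y.sum_weight
        rw [Fin.sum_univ_castSucc (n := 4), weight_last] at h
        rw [← h]
        push_cast
        ring
      simp only [frac]
      rw [← Finset.sum_div, ← Finset.sum_mul, this]
      field_simp
    have he : exp (Real.pi * I * (Y.idx i - Y.idx i / Y.degree)) =
        (-1) ^ (Y.idx i) * exp (-(Real.pi * I * (Y.idx i / Y.degree))) := by
      rw [← exp_pi_mul_I, ← Complex.exp_nat_mul, ← Complex.exp_add]
      congr 1
      ring
    rw [hs, he]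
    simp only [Finset.card_univ, Fintype.card_fin]
    linear_combination 16 * (Real.pi : ℂ) ^ 4 * ((-1) ^ (Y.idx i) *
      exp (-(Real.pi * I * (Y.idx i / Y.degree)))) * I_pow_four
  have ht : Y.alphaPow (Y.weight 3 * Y.idx i) ≠ 1 := fun h => by
    have := ha 3
    rw [show Y.weight (Fin.castSucc 3) = Y.weight 3 from rfl, h] at this
    obtain ⟨k, hk⟩ := exp_eq_one_iff.1 this.symm
    refine Y.frac_ne_int i 3 k (mul_left_cancel₀ two_pi_I_ne_zero ?_)
    rw [hk]; ring
  -- `ŵ_m` contains only three of the four factors `1 - α^{ω_l j}`. The missing one is supplied by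
  -- `kern 0`, because `2πi q/(q-1) = 2πi / (1 - q⁻¹)` and `q⁻¹ = α^j`.
  have hkern : kern 0 (Y.pole i) * (1 - Y.alphaPow (Y.weight 3 * Y.idx i)) = 2 * Real.pi * I := by
    have hq : Y.qroot i * Y.alphaPow (Y.weight 3 * Y.idx i) = 1 := by
      have : 2 * Real.pi * I * (1 - Y.idx i / Y.degree) + 2 * Real.pi * I / Y.degree *
          ((1 : ℕ) * Y.idx i) = 2 * Real.pi * I := by
        push_cast
        field_simp
        ring
      rw [qroot, alphaPow, hw3, ← Complex.exp_add, pole_cast, this, exp_two_pi_mul_I]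
    have hq1 := sub_ne_zero.2 (Y.qroot_ne_one i)
    rw [kern_pole, kernRat]
    field_simp
    linear_combination (-(2 * Real.pi * I)) * hq
  have ht' := sub_ne_zero.2 ht.symm
  -- The half-integral power of `α` in `ŵ_m` cancels the dependence of the phase on `j`, so that one
  -- constant serves all four exponents.
  have hE : Y.alphaPow (((Y.idx i : ℂ) - 1) / 2) * exp (-(Real.pi * I * (Y.idx i / Y.degree))) =
      exp (-(Real.pi * I / Y.degree)) := by
    rw [alphaPow, ← Complex.exp_add]
    congr 1
    field_simp
    ring
  rw [Fin.prod_univ_four, ← ha, ← ha, ← ha, ← ha] at hprod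
  change (1 - Y.alphaPow (Y.weight 0 * Y.idx i)) * (1 - Y.alphaPow (Y.weight 1 * Y.idx i)) *
    (1 - Y.alphaPow (Y.weight 2 * Y.idx i)) * (1 - Y.alphaPow (Y.weight 3 * Y.idx i)) *
    (∏ l, Gamma (Y.frac i l)) * (∏ l, Gamma (1 - Y.frac i l)) = _ at hprod
  rw [normConst]
  have hE0 := exp_ne_zero (-(Real.pi * I / Y.degree))
  set E := exp (-(Real.pi * I / Y.degree))
  set E' := exp (-(Real.pi * I * (Y.idx i / Y.degree)))
  set α := Y.alphaPow 1
  set A := Y.alphaPow (((Y.idx i : ℂ) - 1) / 2)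
  set t := Y.alphaPow (Y.weight 3 * Y.idx i)
  set X := (1 - Y.alphaPow (Y.weight 0 * Y.idx i)) * (1 - Y.alphaPow (Y.weight 1 * Y.idx i)) *
    (1 - Y.alphaPow (Y.weight 2 * Y.idx i))
  set PG := ∏ l, Gamma (Y.frac i l)
  set PG' := ∏ l, Gamma (1 - Y.frac i l)
  set φ := Y.phiCoeff (-Y.pole i)
  set r := Y.resCoeff Y.hypB 3 i 0
  set κ := kern 0 (Y.pole i)
  set F := ((Y.idx i - 1).factorial : ℂ)
  have hR : 2 * Real.pi * I / ((1 - α) * E * (16 * Real.pi ^ 4) * Y.weight 0) *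
      ((1 - α) * (X * A * φ)) = 2 * Real.pi * I * (X * A * φ) /
        (E * (16 * Real.pi ^ 4) * Y.weight 0) := by
    field_simp
  rw [hR, eq_div_iff (by simp [hE0, hpi, hw0])]
  refine mul_right_cancel₀ (mul_ne_zero (mul_ne_zero (mul_ne_zero h0 hfac) hG0) ht') ?_
  have hsign : (-1 : ℂ) ^ (Y.idx i + 1) = -(-1) ^ (Y.idx i) := by rw [pow_succ]; ring
  rw [hsign] at hr
  linear_combination (-(1 - t) * κ * E * (16 * Real.pi ^ 4) * Y.weight 0) * hr -
    2 * Real.pi * I * X * A * PG' * (1 - t) * hphi -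
    2 * Real.pi * I * A * Y.weight 0 * hprod +
    (-1) ^ (Y.idx i) * E * (16 * Real.pi ^ 4) * Y.weight 0 * hkern -
    2 * Real.pi * I * Y.weight 0 * 16 * Real.pi ^ 4 * (-1) ^ (Y.idx i) * hE

end CYFamily

/-! ### The solutions `f₁, …, f₄` in terms of the local solutions -/

namespace CYFamily

open MeasureTheory Complex Set

/-- Both sides satisfy the same first-order recurrence. The sign `(-1)^n` comes from evaluating the
ratio at `-(n - π_i + 1)`, with three factors in the numerator and four in the denominator. -/
theorem resCoeff_eq_phiCoeff (Y : CYFamily) (i : Fin 4) (n : ℕ) :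
    Y.resCoeff Y.hypB 3 i n * Y.phiCoeff (-Y.pole i) =
      Y.resCoeff Y.hypB 3 i 0 * (Y.phiCoeff (n - Y.pole i) * (-1) ^ n) := by
  induction n with
  | zero => simp
  | succ n ih =>
    have hp := Y.pole_mem i
    have h1 := Y.phiCoeff_add_one (s := n - Y.pole i) (by
      simp; linarith [n.cast_nonneg (α := ℝ)])
    have hne : ∀ l, (n - Y.pole i + 1 + Y.pole l : ℂ) ≠ 0 := fun l h => by
      have h2 := congrArg re h
      have := (Y.pole_mem l).1
      simp at h2
      linarith [n.cast_nonneg (α := ℝ)]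
    have hP : ∏ l, (n - Y.pole i + 1 + Y.pole l : ℂ) ≠ 0 :=
      Finset.prod_ne_zero_iff.2 fun l _ => hne l
    have h3 : Y.resCoeff Y.hypB 3 i (n + 1) =
        Y.resCoeff Y.hypB 3 i n * Y.ratio 3 (Y.pole i - 1 - n) := by
      rw [resCoeff, Finset.prod_range_succ, ← mul_assoc, ← resCoeff]
    have h4 : Y.ratio 3 (Y.pole i - 1 - n) = -(Y.conifold * (n - Y.pole i + 1) ^ 3) /
        ∏ l, (n - Y.pole i + 1 + Y.pole l : ℂ) := by
      have : ∏ l, (Y.pole i - 1 - n - Y.pole l : ℂ) = ∏ l, (n - Y.pole i + 1 + Y.pole l : ℂ) := by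
        simp only [Fin.prod_univ_four]; ring
      rw [ratio, this]
      congr 1
      ring
    have h5 : Y.phiCoeff (n - Y.pole i + 1) = Y.conifold * (n - Y.pole i + 1) ^ 3 *
        Y.phiCoeff (n - Y.pole i) / ∏ l, (n - Y.pole i + 1 + Y.pole l : ℂ) := by
      rw [eq_div_iff hP, h1]
    have h6 : ((n + 1 : ℕ) : ℂ) - Y.pole i = n - Y.pole i + 1 := by push_cast; ring
    rw [h3, h4, h6, h5, pow_succ, mul_right_comm, ih]
    field_simp
    ring

theorem localSol_eq_phi (Y : CYFamily) (i : Fin 4) (ζ : ℂ) :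
    Y.localSol i ζ * Y.phiCoeff (-Y.pole i) =
      -Y.resCoeff Y.hypB 3 i 0 * Y.phi (Y.degree - Y.idx i) ζ := by
  have h0 := Y.degree_ne_zero
  have hk : ((Y.degree - Y.idx i : ℕ) : ℂ) / Y.degree = Y.pole i := by
    rw [Nat.cast_sub (Y.idx_lt i).le, pole_cast, sub_div, div_self h0]
  rw [localSol, piece, phi, hk, mul_neg, neg_mul, neg_mul, neg_inj, ← tsum_mul_left,
    ← tsum_mul_right, ← tsum_mul_left]
  refine tsum_congr fun n => ?_
  have h1 : exp ((n - Y.pole i) * ζ) = exp (-ζ) * exp ((Y.pole i - 1 - n) * -ζ) := by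
    rw [← Complex.exp_add]; congr 1; ring
  rw [h1]
  linear_combination exp (-ζ) * exp ((Y.pole i - 1 - n) * -ζ) * Y.resCoeff_eq_phiCoeff i n

theorem phiCoeff_neg_pole_ne_zero (Y : CYFamily) (i : Fin 4) : Y.phiCoeff (-Y.pole i) ≠ 0 := by
  have h := Y.phiCoeff_neg_pole i
  intro h0
  rw [h0, zero_mul, eq_comm, mul_eq_zero, Finset.prod_eq_zero_iff] at h
  rcases h with h | ⟨l, -, h⟩
  · exact (Y.weight_pos 0).ne' (by exact_mod_cast h)
  · exact Gamma_ne_zero (fun k h => Y.frac_ne_int i l (-k) (by rw [h]; push_cast; rfl)) h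

/-- The contribution of the exponent `-k / d` to `ŵ^∞_m`. -/
def wTerm (Y : CYFamily) (k : ℕ) (ζ : ℂ) : ℂ :=
  (1 - Y.alphaPow 1) * ((1 - Y.alphaPow (Y.weight 0 * k)) * (1 - Y.alphaPow (Y.weight 1 * k)) *
    (1 - Y.alphaPow (Y.weight 2 * k)) * Y.alphaPow (((k : ℂ) - 1) / 2) * Y.phi (Y.degree - k) ζ)

theorem alphaPow_natCast (Y : CYFamily) (k : ℕ) : Y.alphaPow k = Y.alphaPow 1 ^ k := by
  rw [alphaPow, alphaPow, ← Complex.exp_nat_mul]; congr 1; ring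

/-- If `k ∉ J`, then `d` divides `ω_l k` for one of the first three weights and the corresponding
factor `1 - α^{ω_l k}` vanishes; only the four exponents in `J` survive. -/
theorem wInf_eq_sum (Y : CYFamily) (m : ℕ) (ζ : ℂ) :
    Y.wInf m ζ = ∑ i, Y.alphaPow (Y.idx i) ^ m * Y.wTerm (Y.idx i) ζ := by
  have h1 : Y.wInf m ζ = ∑ k ∈ Finset.Ico 1 Y.degree, Y.alphaPow k ^ m * Y.wTerm k ζ := by
    rw [wInf, Finset.mul_sum]
    refine Finset.sum_congr rfl fun k _ => ?_
    have : Y.alphaPow (k * m + ((k : ℂ) - 1) / 2) =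
        Y.alphaPow k ^ m * Y.alphaPow (((k : ℂ) - 1) / 2) := by
      rw [alphaPow, alphaPow, alphaPow, ← Complex.exp_nat_mul, ← Complex.exp_add]
      congr 1
      ring
    rw [this, wTerm]
    ring
  have hα : Y.alphaPow 1 ^ Y.degree = 1 := by
    rw [alphaPow, ← Complex.exp_nat_mul, mul_one, mul_div_cancel₀ _ Y.degree_ne_zero,
      exp_two_pi_mul_I]
  have hz : ∀ k : ℕ, (∃ l : Fin 5, l.1 < 3 ∧ Y.degree ∣ Y.weight l * k) → Y.wTerm k ζ = 0 := by
    rintro k ⟨l, hl, c, hc⟩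
    have h2 : (1 - Y.alphaPow (Y.weight l * k)) = 0 := by
      rw [← Nat.cast_mul, hc, alphaPow_natCast, pow_mul, hα, one_pow, sub_self]
    rw [wTerm]
    obtain ⟨l, hl5⟩ := l
    interval_cases l
    · change 1 - Y.alphaPow (Y.weight 0 * k) = 0 at h2
      rw [h2]; ring
    · change 1 - Y.alphaPow (Y.weight 1 * k) = 0 at h2
      rw [h2]; ring
    · change 1 - Y.alphaPow (Y.weight 2 * k) = 0 at h2
      rw [h2]; ring
  rw [h1]
  have hbad : ∀ k ∈ Finset.Ico 1 Y.degree, k ∉ Finset.univ.image Y.idx →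
      ∃ l : Fin 5, l.1 < 3 ∧ Y.degree ∣ Y.weight l * k := by
    cases Y <;> simp only [degree, weight, idx] <;> decide
  have hsub : Finset.univ.image Y.idx ⊆ Finset.Ico 1 Y.degree := fun k hk => by
    obtain ⟨i, -, rfl⟩ := Finset.mem_image.1 hk
    exact Finset.mem_Ico.2 ⟨Y.idx_pos i, Y.idx_lt i⟩
  rw [← Finset.sum_subset hsub fun k hk hk' => by rw [hz k (hbad k hk hk'), mul_zero],
    Finset.sum_image]
  intro i _ j _ hij
  refine Y.pole_injective ?_
  rw [pole, pole, hij]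

theorem localSol_eq_wTerm (Y : CYFamily) (i : Fin 4) (ζ : ℂ) :
    kern 0 (Y.pole i) * Y.localSol i ζ = Y.normConst * Y.wTerm (Y.idx i) ζ := by
  refine mul_right_cancel₀ (Y.phiCoeff_neg_pole_ne_zero i) ?_
  rw [wTerm]
  linear_combination kern 0 (Y.pole i) * Y.localSol_eq_phi i ζ +
    Y.phi (Y.degree - Y.idx i) ζ * Y.neg_resCoeff_zero_eq i

theorem qroot_mul_alphaPow (Y : CYFamily) (i : Fin 4) : Y.qroot i * Y.alphaPow (Y.idx i) = 1 := by
  have h0 := Y.degree_ne_zero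
  have : 2 * Real.pi * I * (1 - Y.idx i / Y.degree) + 2 * Real.pi * I / Y.degree * Y.idx i =
      2 * Real.pi * I := by
    field_simp
    ring
  rw [qroot, alphaPow, ← Complex.exp_add, pole_cast, this, exp_two_pi_mul_I]

/-- This explains `N`: its columns express the quotients of the kernel values by `kern 0(π_i)` in
the monomials `1, q⁻¹, q⁻², q`, which are the weights of `ŵ_0, ŵ_1, ŵ_2, ŵ_{d-1}` relative to `ŵ_0`.
After this the solutions are described by kernels alone. -/
theorem holF_eq (Y : CYFamily) (a ζ : ℂ) (k : Fin 4) :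
    Y.holF a Y.normConst ζ k = ∑ i, Y.kernVal a i k * Y.localSol i ζ := by
  have h0 : (2 * Real.pi * I : ℂ) ≠ 0 := two_pi_I_ne_zero
  have hterm : ∀ i, Y.kernVal a i k * Y.localSol i ζ = (Y.kernVal a i k / kern 0 (Y.pole i)) *
      (Y.normConst * Y.wTerm (Y.idx i) ζ) := fun i => by
    have h1 := sub_ne_zero.2 (Y.qroot_ne_one i)
    have h2 : Y.qroot i ≠ 0 := exp_ne_zero _
    have h3 : kern 0 (Y.pole i) ≠ 0 := by
      rw [kern_pole, kernRat]
      exact mul_ne_zero (pow_ne_zero _ h0) (div_ne_zero h2 h1)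
    rw [← localSol_eq_wTerm]
    field_simp
  -- With `α^j = q⁻¹` and `α^{j(d-1)} = q` these are identities in `q`. The columns of `f₂` and `f₃`
  -- hold only modulo the quartic, the other two identically.
  have hval : ∀ i, Y.kernVal a i k / kern 0 (Y.pole i) = Y.matN a 0 k +
      Y.matN a 1 k * Y.alphaPow (Y.idx i) + Y.matN a 2 k * Y.alphaPow (Y.idx i) ^ 2 +
      Y.matN a 3 k * Y.alphaPow (Y.idx i) ^ (Y.degree - 1) := fun i => by
    have h1 := sub_ne_zero.2 (Y.qroot_ne_one i)
    have h2 : Y.qroot i ≠ 0 := exp_ne_zero _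
    have hq := Y.qroot_charpoly i
    have ht := Y.qroot_mul_alphaPow i
    have htd : Y.alphaPow (Y.idx i) ^ (Y.degree - 1) = Y.qroot i := by
      have h4 : Y.alphaPow (Y.idx i) = (Y.qroot i)⁻¹ := eq_inv_of_mul_eq_one_right ht
      have h5 := pow_sub_one_mul Y.degree_pos.ne' (Y.qroot i)
      rw [qroot_pow_degree] at h5
      rw [h4, inv_pow, inv_eq_of_mul_eq_one_right h5]
    have ht' : Y.alphaPow (Y.idx i) = (Y.qroot i)⁻¹ := eq_inv_of_mul_eq_one_right ht
    rw [htd, ht']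
    simp only [kernVal, kern_pole, kernRat]
    generalize (2 * Real.pi * I : ℂ) = τ at h0 ⊢
    generalize Y.qroot i = q at h1 h2 hq ⊢
    cases Y
    all_goals
      fin_cases k <;> simp [matN, cubic] <;> simp [cubic, chern] at hq
      · exact ⟨h0, h2, h1⟩
      · field_simp
        linear_combination hq
      · field_simp
        first
        | linear_combination (5 + 5 * q + 2 * a * (q - 1)) * hq
        | linear_combination (3 + 3 * q + 2 * a * (q - 1)) * hq
        | linear_combination (1 + q + a * (q - 1)) * hq
        | linear_combination (1 + q + 2 * a * (q - 1)) * hq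
      · field_simp
        ring
  rw [Finset.sum_congr rfl fun i _ => hterm i, holF]
  simp only [Pi.smul_apply, smul_eq_mul, Matrix.vecMul, dotProduct, Fin.sum_univ_four (f := fun
    x => (![_, _, _, _] : Fin 4 → ℂ) x * _), hval]
  simp only [Matrix.cons_val_zero, Matrix.cons_val_one, Matrix.cons_val, wInf_eq_sum,
    Finset.mul_sum, Finset.sum_mul, ← Finset.sum_add_distrib]
  refine Finset.sum_congr rfl fun i _ => ?_
  ring

end CYFamily

/-! ### Entire series in `exp ζ` and the Euler operators -/

section ExpSeries

open Complex Set

/-- Coefficients of an entire function. -/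
def IsEntireCoeff (c : ℕ → ℂ) : Prop := ∀ R : ℝ, 0 < R → Summable fun n => ‖c n‖ * R ^ n

/-- `∑ₙ cₙ exp ((n + s) ζ)`. -/
def expSeries (c : ℕ → ℂ) (s ζ : ℂ) : ℂ := ∑' n : ℕ, c n * exp ((n + s) * ζ)

/-- A polynomial factor is absorbed by doubling the radius, through `n ≤ 2^n`. -/
theorem IsEntireCoeff.mul_linear {c : ℕ → ℂ} (hc : IsEntireCoeff c) (p q : ℂ) :
    IsEntireCoeff fun n => (p * n + q) * c n := by
  intro R hR
  refine Summable.of_nonneg_of_le (fun n => by positivity) (fun n => ?_)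
    ((hc (2 * R) (by positivity)).mul_left (‖p‖ + ‖q‖))
  have h1 : ‖p * n + q‖ ≤ (‖p‖ + ‖q‖) * 2 ^ n := by
    refine (norm_add_le _ _).trans ?_
    rw [norm_mul, norm_natCast, add_mul]
    have h2 : (n : ℝ) ≤ 2 ^ n := by exact_mod_cast Nat.lt_two_pow_self.le
    have h3 : (1 : ℝ) ≤ 2 ^ n := one_le_pow₀ one_le_two
    gcongr
    exact le_mul_of_one_le_right (norm_nonneg _) h3
  rw [norm_mul, mul_pow]
  calc _ ≤ (‖p‖ + ‖q‖) * 2 ^ n * ‖c n‖ * R ^ n := by gcongr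
    _ = _ := by ring

theorem IsEntireCoeff.norm_le {c : ℕ → ℂ} (s : ℂ) {R : ℝ} (n : ℕ) {ζ : ℂ} (h : ‖ζ‖ ≤ R) :
    ‖c n * exp ((n + s) * ζ)‖ ≤ Real.exp (‖s‖ * R) * (‖c n‖ * Real.exp R ^ n) := by
  rw [norm_mul, norm_exp, ← Real.exp_nat_mul]
  have h1 : ((n + s) * ζ).re ≤ ‖s‖ * R + n * R := by
    refine (re_le_norm _).trans ?_
    rw [norm_mul]
    have h2 : ‖(n : ℂ) + s‖ ≤ ‖s‖ + n := by
      rw [add_comm]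
      exact (norm_add_le _ _).trans_eq (by rw [norm_natCast])
    calc _ ≤ (‖s‖ + n) * R := by gcongr
      _ = _ := by ring
  calc _ ≤ ‖c n‖ * Real.exp (‖s‖ * R + n * R) := by gcongr
    _ = _ := by rw [Real.exp_add]; ring

theorem IsEntireCoeff.summable {c : ℕ → ℂ} (hc : IsEntireCoeff c) (s ζ : ℂ) :
    Summable fun n : ℕ => c n * exp ((n + s) * ζ) :=
  Summable.of_norm_bounded ((hc _ (Real.exp_pos ‖ζ‖)).mul_left _) fun n =>
    IsEntireCoeff.norm_le s n le_rfl

theorem IsEntireCoeff.differentiable {c : ℕ → ℂ} (hc : IsEntireCoeff c) (s : ℂ) :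
    Differentiable ℂ (expSeries c s) := fun ζ => by
  have hU : IsOpen (Metric.ball (0 : ℂ) (‖ζ‖ + 1)) := Metric.isOpen_ball
  refine (differentiableOn_tsum_of_summable_norm ((hc _ (Real.exp_pos (‖ζ‖ + 1))).mul_left
    (Real.exp (‖s‖ * (‖ζ‖ + 1)))) (fun n => by fun_prop) hU fun n w hw =>
    IsEntireCoeff.norm_le s n (mem_ball_zero_iff.1 hw).le).differentiableAt
    (hU.mem_nhds (mem_ball_zero_iff.2 (by linarith)))

theorem IsEntireCoeff.deriv {c : ℕ → ℂ} (hc : IsEntireCoeff c) (s ζ : ℂ) :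
    deriv (expSeries c s) ζ = expSeries (fun n => (n + s) * c n) s ζ := by
  have hU : IsOpen (Metric.ball (0 : ℂ) (‖ζ‖ + 1)) := Metric.isOpen_ball
  have h := hasSum_iteratedDeriv_of_summable_norm ((hc _ (Real.exp_pos (‖ζ‖ + 1))).mul_left
    (Real.exp (‖s‖ * (‖ζ‖ + 1)))) (F := fun n ζ => c n * exp ((n + s) * ζ)) (fun n => by fun_prop)
    hU (fun n w hw => IsEntireCoeff.norm_le s n (mem_ball_zero_iff.1 hw).le)
    (mem_ball_zero_iff.2 (by linarith : ‖ζ‖ < ‖ζ‖ + 1)) 1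
  simp only [iteratedDeriv_one] at h
  rw [show expSeries c s = fun w => ∑' n : ℕ, c n * exp ((n + s) * w) from rfl, ← h.tsum_eq]
  refine tsum_congr fun n => ?_
  have h1 : HasDerivAt (fun w => c n * exp ((n + s) * w))
      (c n * (exp ((n + s) * ζ) * ((n + s) * 1))) ζ :=
    (((hasDerivAt_id ζ).const_mul _).cexp).const_mul _
  rw [h1.deriv]
  ring

theorem eulerOp_expSeries {c : ℕ → ℂ} (hc : IsEntireCoeff c) (s p q : ℂ) :
    CYFamily.eulerOp p q (expSeries c s) = expSeries (fun n => (p * (n + s) + q) * c n) s := by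
  have h' : IsEntireCoeff fun n => (n + s) * c n := by simpa using hc.mul_linear 1 s
  funext ζ
  rw [CYFamily.eulerOp, hc.deriv, expSeries, expSeries, expSeries, ← tsum_mul_left, ← tsum_mul_left,
    ← ((h'.summable s ζ).mul_left p).tsum_add ((hc.summable s ζ).mul_left q)]
  exact tsum_congr fun n => by ring

theorem IsEntireCoeff.mul_linear' {c : ℕ → ℂ} (hc : IsEntireCoeff c) (s p q : ℂ) :
    IsEntireCoeff fun n => (p * (n + s) + q) * c n := by
  have := hc.mul_linear p (p * s + q)
  intro R hR
  refine (this R hR).congr fun n => ?_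
  congr 3
  ring

theorem foldr_eulerOp_expSeries {c : ℕ → ℂ} (hc : IsEntireCoeff c) (s p : ℂ) (l : List ℕ) :
    l.foldr (fun (j : ℕ) G => CYFamily.eulerOp p j G) (expSeries c s) =
      expSeries (fun n => (l.map fun j : ℕ => p * (n + s) + j).prod * c n) s ∧
    IsEntireCoeff fun n => (l.map fun j : ℕ => p * (n + s) + j).prod * c n := by
  induction l with
  | nil => simpa using hc
  | cons j l ih =>
    simp only [List.foldr_cons, List.map_cons, List.prod_cons, mul_assoc]
    refine ⟨?_, ih.2.mul_linear' s p j⟩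
    rw [ih.1, eulerOp_expSeries ih.2]

end ExpSeries

/-! ### The local solutions solve the Laplace-transformed equation -/

namespace CYFamily

open MeasureTheory Complex Set

theorem isEntireCoeff_resCoeff (Y : CYFamily) (i : Fin 4) :
    IsEntireCoeff fun n => -Y.resCoeff Y.hypB 3 i n := by
  intro R hR
  refine Summable.of_nonneg_of_le (fun n => by positivity) (fun n => ?_)
    ((Y.summable_ratioBound_three (-Real.log R)).mul_left
      ‖(Y.conifold : ℂ) * (Y.pole i : ℂ) ^ 3 * Y.poleWeight i * Y.hypB (Y.pole i)‖)
  have h : Real.exp (-(n : ℝ) * -Real.log R) = R ^ n := by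
    rw [neg_mul_neg, Real.exp_nat_mul, Real.exp_log hR]
  rw [norm_neg, h, ← mul_assoc]
  gcongr
  exact norm_resCoeff_le Y.isRatioBound_three Y.hypB i n

theorem localSol_eq_expSeries (Y : CYFamily) (i : Fin 4) :
    Y.localSol i = expSeries (fun n => -Y.resCoeff Y.hypB 3 i n) (-Y.pole i) := by
  funext ζ
  rw [localSol, piece, expSeries, mul_neg, ← tsum_mul_left, ← tsum_neg]
  refine tsum_congr fun n => ?_
  have : exp ((n + -Y.pole i) * ζ) = exp (-ζ) * exp ((Y.pole i - 1 - n) * -ζ) := by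
    rw [← Complex.exp_add]; congr 1; ring
  rw [this]
  ring

theorem differentiable_localSol (Y : CYFamily) (i : Fin 4) : Differentiable ℂ (Y.localSol i) := by
  rw [localSol_eq_expSeries]
  exact (Y.isEntireCoeff_resCoeff i).differentiable _

/-- The set `J` is symmetric under `j ↦ d - j`, so the numbers `j/d` are the `π_l`; and `μ d⁴ x_c =
1`. -/
theorem laplace_char (Y : CYFamily) (s : ℂ) :
    Y.prefactor * (Y.residues.map fun j : ℕ => (Y.degree : ℂ) * s + j).prod * Y.conifold =
      ∏ l, (s + Y.pole l) := by
  cases Y <;>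
  · simp [prefactor, residues, degree, conifold, Fin.prod_univ_four, pole, idx]
    ring

/-- The initial term of the fourth-order part vanishes because `-π_i` is a root of the indicial
polynomial. The subsequent ones cancel termwise against `z(θ+1)³` by the recurrence of the residues.
-/
theorem isLaplaceSolution_localSol (Y : CYFamily) (i : Fin 4) :
    Y.IsLaplaceSolution (Y.localSol i) := by
  refine ⟨Y.differentiable_localSol i, fun ζ => ?_⟩
  have hc := Y.isEntireCoeff_resCoeff i
  set c : ℕ → ℂ := fun n => -Y.resCoeff Y.hypB 3 i n with hcdef
  have hx : (Y.conifold : ℂ) ≠ 0 := ofReal_ne_zero.2 Y.conifold_pos.ne'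
  have e1 := eulerOp_expSeries hc (-Y.pole i) 1 1
  have c1 := hc.mul_linear' (-Y.pole i) 1 1
  have e2 := eulerOp_expSeries c1 (-Y.pole i) 1 1
  have c2 := c1.mul_linear' (-Y.pole i) 1 1
  have e3 := eulerOp_expSeries c2 (-Y.pole i) 1 1
  have c3 := c2.mul_linear' (-Y.pole i) 1 1
  obtain ⟨ef, cf⟩ := foldr_eulerOp_expSeries hc (-Y.pole i) Y.degree Y.residues
  rw [localSol_eq_expSeries, ef, Function.iterate_succ_apply', Function.iterate_succ_apply',
    Function.iterate_one, e1, e2, e3]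
  rw [expSeries, expSeries, (cf.summable _ ζ).tsum_eq_zero_add, mul_add, ← tsum_mul_left,
    ← tsum_mul_left, add_left_comm]
  have h0 : (Y.residues.map fun j : ℕ => (Y.degree : ℂ) * ((0 : ℕ) + -Y.pole i) + j).prod = 0 := by
    have h := Y.laplace_char ((0 : ℕ) + -Y.pole i)
    have h1 : ∏ l, (((0 : ℕ) + -Y.pole i : ℂ) + Y.pole l) = 0 :=
      Finset.prod_eq_zero (Finset.mem_univ i) (by simp)
    rw [h1] at h
    have hμ : (Y.prefactor : ℂ) ≠ 0 := by cases Y <;> norm_num [prefactor]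
    simpa [hx, hμ] using h
  have hs : Summable fun n : ℕ => (Y.prefactor : ℂ) *
      ((Y.residues.map fun j : ℕ => (Y.degree : ℂ) * (((n + 1 : ℕ) : ℂ) + -Y.pole i) + j).prod *
        c (n + 1) * exp ((((n + 1 : ℕ) : ℂ) + -Y.pole i) * ζ)) :=
    ((summable_nat_add_iff 1).2 (cf.summable (-Y.pole i) ζ)).mul_left _
  rw [h0, zero_mul, zero_mul, mul_zero, zero_add,
    ← ((c3.summable _ ζ).mul_left (exp ζ)).tsum_add hs]
  refine (tsum_congr fun n => ?_).trans tsum_zero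
  have he : exp ((((n + 1 : ℕ) : ℂ) + -Y.pole i) * ζ) = exp ζ * exp ((n + -Y.pole i) * ζ) := by
    rw [← Complex.exp_add]; congr 1; push_cast; ring
  have hP := Y.laplace_char (((n + 1 : ℕ) : ℂ) + -Y.pole i)
  have hP0 : ∏ l, (((n + 1 : ℕ) : ℂ) + -Y.pole i + Y.pole l) ≠ 0 :=
    Finset.prod_ne_zero_iff.2 fun l _ h => by
      have h2 := congrArg re h
      have h3 := (Y.pole_mem l).1
      have h4 := (Y.pole_mem i).2
      simp at h2
      linarith [n.cast_nonneg (α := ℝ)]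
  have hr : c (n + 1) * ∏ l, (((n + 1 : ℕ) : ℂ) + -Y.pole i + Y.pole l) =
      -(Y.conifold * (n + -Y.pole i + 1) ^ 3) * c n := by
    have h3 : c (n + 1) = c n * Y.ratio 3 (Y.pole i - 1 - n) := by
      rw [hcdef]
      simp only
      rw [resCoeff, Finset.prod_range_succ, ← mul_assoc, ← resCoeff]
      ring
    have h5 : ∏ l, (Y.pole i - 1 - n - Y.pole l : ℂ) =
        ∏ l, (((n + 1 : ℕ) : ℂ) + -Y.pole i + Y.pole l) := by
      simp only [Fin.prod_univ_four]; push_cast; ring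
    rw [h3, ratio, h5]
    field_simp
    ring
  rw [he]
  refine mul_right_cancel₀ hx ?_
  linear_combination exp ζ * exp ((n + -Y.pole i) * ζ) * (c (n + 1) * hP + hr)

theorem localSol_sub_int_mul (Y : CYFamily) (i : Fin 4) (ζ : ℂ) (k : ℤ) :
    Y.localSol i (ζ - k * (2 * Real.pi * I)) = Y.qroot i ^ k * Y.localSol i ζ := by
  rw [localSol_eq_expSeries, expSeries, expSeries, ← tsum_mul_left]
  refine tsum_congr fun n => ?_
  have h1 : exp ((n + -Y.pole i) * (ζ - k * (2 * Real.pi * I))) =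
      Y.qroot i ^ k * exp ((n + -Y.pole i) * ζ) := by
    have h2 : (n + -Y.pole i) * (ζ - k * (2 * Real.pi * I)) =
        k * (2 * Real.pi * I * Y.pole i) + (n + -Y.pole i) * ζ -
          ((n * k : ℤ) : ℂ) * (2 * Real.pi * I) := by push_cast; ring
    rw [h2, Complex.exp_periodic.sub_int_mul_eq, Complex.exp_add, Complex.exp_int_mul, qroot]
  rw [h1]
  ring

theorem localSol_sub_two_pi (Y : CYFamily) (i : Fin 4) (ζ : ℂ) :
    Y.localSol i (ζ - 2 * Real.pi * I) = Y.qroot i * Y.localSol i ζ := by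
  simpa using Y.localSol_sub_int_mul i ζ 1

/-- If the solution vanished, so would the power series `∑ cₙ zⁿ` off `0`, and by continuity its
constant term; but that term is a non-zero residue. -/
theorem localSol_ne_zero (Y : CYFamily) (i : Fin 4) : ∃ ζ, Y.localSol i ζ ≠ 0 := by
  by_contra! h
  have hc := Y.isEntireCoeff_resCoeff i
  set c : ℕ → ℂ := fun n => -Y.resCoeff Y.hypB 3 i n with hcdef
  have hcont : ContinuousOn (fun z : ℂ => ∑' n : ℕ, c n * z ^ n) (Metric.ball 0 1) :=
    continuousOn_tsum (fun n => by fun_prop) (by simpa using hc 1 one_pos) fun n z hz => by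
      rw [norm_mul, norm_pow]
      exact mul_le_of_le_one_right (norm_nonneg _)
        (pow_le_one₀ (norm_nonneg _) (mem_ball_zero_iff.1 hz).le)
  have hz : ∀ z : ℂ, z ≠ 0 → ∑' n : ℕ, c n * z ^ n = 0 := by
    intro z hz
    have h1 := h (Complex.log z)
    rw [localSol_eq_expSeries, expSeries] at h1
    have h2 : ∀ n : ℕ, exp ((n + -Y.pole i) * Complex.log z) =
        exp (-Y.pole i * Complex.log z) * z ^ n := fun n => by
      rw [add_mul, Complex.exp_add, Complex.exp_nat_mul, exp_log hz, mul_comm]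
    simp only [h2, mul_left_comm, tsum_mul_left] at h1
    exact (mul_eq_zero.1 h1).resolve_left (exp_ne_zero _)
  have h0 := (hcont.continuousAt (Metric.ball_mem_nhds 0 one_pos)).tendsto
  have h1 : Tendsto (fun z : ℂ => ∑' n : ℕ, c n * z ^ n) (𝓝[≠] 0) (𝓝 0) :=
    tendsto_const_nhds.congr' (eventually_nhdsWithin_of_forall fun z hz' => (hz z hz').symm)
  have h2 := tendsto_nhds_unique (h0.mono_left nhdsWithin_le_nhds) h1
  rw [tsum_eq_single 0 fun n hn => by simp [hn]] at h2
  have h3 : Y.resCoeff Y.hypB 3 i 0 = 0 := by simpa [hcdef] using h2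
  have h4 := Y.resCoeff_zero_eq i
  rw [h3, zero_mul] at h4
  exact pow_ne_zero _ (by norm_num) h4.symm

theorem qroot_injective (Y : CYFamily) : Function.Injective Y.qroot := by
  intro i j h
  have h1 : exp (2 * Real.pi * I * ((Y.pole i - Y.pole j : ℝ) : ℂ)) = 1 := by
    rw [ofReal_sub, mul_sub, Complex.exp_sub]
    exact div_eq_one_iff_eq (exp_ne_zero _) |>.2 h
  obtain ⟨k, hk⟩ := exists_int_of_exp_eq_one h1
  have hi := Y.pole_mem i
  have hj := Y.pole_mem j
  have h2 : (k : ℝ) < 1 := by linarith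
  have h3 : (-1 : ℝ) < k := by linarith
  have h3' : (-1 : ℤ) < k := by exact_mod_cast h3
  norm_cast at h2
  have hk0 : k = 0 := by omega
  refine Y.pole_injective ?_
  rw [hk0] at hk
  push_cast at hk
  linarith

/-- The holomorphic solutions are linearly independent. -/
theorem eq_zero_of_sum_holF (Y : CYFamily) (a : ℂ) {v : Fin 4 → ℂ}
    (h : ∀ ζ, ∑ k, Y.holF a Y.normConst ζ k * v k = 0) : v = 0 := by
  set c : Fin 4 → ℂ := fun i => ∑ k, Y.kernVal a i k * v k with hc
  have h1 : ∀ ζ, ∑ i, c i * Y.localSol i ζ = 0 := fun ζ => by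
    rw [← h ζ]
    simp only [holF_eq, hc, Finset.sum_mul]
    rw [Finset.sum_comm]
    exact Finset.sum_congr rfl fun k _ => Finset.sum_congr rfl fun i _ => by ring
  -- Each turn multiplies the `i`-th local solution by `q_i`. As the `q_i` are distinct, the
  -- Vandermonde argument separates the four summands.
  have h2 : ∀ ζ, ∀ n : ℕ, ∑ i, c i * Y.localSol i ζ * Y.qroot i ^ n = 0 := fun ζ n => by
    induction n generalizing ζ with
    | zero => simpa using h1 ζ
    | succ n ih =>
      rw [← ih (ζ - 2 * Real.pi * I)]
      exact Finset.sum_congr rfl fun i _ => by rw [localSol_sub_two_pi]; ring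
  have h3 : ∀ i, c i = 0 := fun i => by
    obtain ⟨ζ, hζ⟩ := Y.localSol_ne_zero i
    have := Matrix.eq_zero_of_forall_pow_sum_mul_pow_eq_zero (v := fun i => c i * Y.localSol i ζ)
      Y.qroot_injective fun n => h2 ζ n
    exact (mul_eq_zero.1 (congrFun this i)).resolve_right hζ
  set τ : ℂ := 2 * Real.pi * I with hτ
  have hτ0 : τ ≠ 0 := two_pi_I_ne_zero
  -- Clearing denominators in the relation at `q_i` yields a polynomial of degree at most `3` with
  -- the four roots `q_i`, hence zero. Its values at `0`, `1`, `2`, `3` determine the `v k`.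
  let P : Polynomial ℂ := .C (v 0) * (.X * (.X - 1) ^ 2) + .C (v 1) * (.X * (.X - 1)) +
    .C (v 2) * (.C (Y.cubic / 2) * (.X * (.X + 1)) + .C a * (.X * (.X - 1))) +
      .C (v 3) * (.X - 1) ^ 3
  have hPe : ∀ x : ℂ, P.eval x = v 0 * (x * (x - 1) ^ 2) + v 1 * (x * (x - 1)) +
      v 2 * (Y.cubic / 2 * (x * (x + 1)) + a * (x * (x - 1))) + v 3 * (x - 1) ^ 3 := by
    intro x; simp [P]
  have hP : P = 0 := by
    refine Polynomial.eq_zero_of_natDegree_lt_card_of_eval_eq_zero P Y.qroot_injective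
      (fun i => ?_) ?_
    · have h4 := sub_ne_zero.2 (Y.qroot_ne_one i)
      have h5 := h3 i
      simp only [hc, Fin.sum_univ_four, kernVal, kern_pole, kernRat, Matrix.cons_val_zero,
        Matrix.cons_val_one, Matrix.cons_val, ← hτ] at h5
      rw [hPe]
      have h6 : (Y.qroot i / (Y.qroot i - 1)) * v 0 + (Y.qroot i / (Y.qroot i - 1) ^ 2) * v 1 +
          (Y.cubic / 2 * (Y.qroot i * (Y.qroot i + 1) / (Y.qroot i - 1) ^ 3) +
            a * (Y.qroot i / (Y.qroot i - 1) ^ 2)) * v 2 + v 3 = 0 := by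
        refine mul_left_cancel₀ hτ0 ?_
        rw [mul_zero, ← h5]
        field_simp
        ring
      have h7 : (Y.qroot i - 1) ^ 3 * ((Y.qroot i / (Y.qroot i - 1)) * v 0 +
          (Y.qroot i / (Y.qroot i - 1) ^ 2) * v 1 +
          (Y.cubic / 2 * (Y.qroot i * (Y.qroot i + 1) / (Y.qroot i - 1) ^ 3) +
            a * (Y.qroot i / (Y.qroot i - 1) ^ 2)) * v 2 + v 3) = 0 := by rw [h6, mul_zero]
      rw [← h7]
      field_simp
    · have : P.natDegree ≤ 3 := by simp only [P]; compute_degree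
      simpa using Nat.lt_succ_of_le this
  rw [hP] at hPe
  have hK : (Y.cubic : ℂ) ≠ 0 := by cases Y <;> norm_num [cubic]
  have p0 := hPe 0
  have p1 := hPe 1
  have p2 := hPe 2
  have p3 := hPe 3
  simp only [Polynomial.eval_zero] at p0 p1 p2 p3
  have v3 : v 3 = 0 := by linear_combination p0
  have v2 : v 2 = 0 := by
    have : (Y.cubic : ℂ) * v 2 = 0 := by linear_combination -p1
    exact (mul_eq_zero.1 this).resolve_left hK
  rw [v3, v2] at p2 p3
  have v0 : v 0 = 0 := by linear_combination (p2 * 3 - p3) / 6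
  have v1 : v 1 = 0 := by rw [v0] at p2; linear_combination -p2 / 2
  ext k
  fin_cases k
  exacts [v0, v1, v2, v3]

end CYFamily

namespace CYFamily

open MeasureTheory Complex Set

/-! ### Formal monodromy -/

theorem hyperGTerm_eq (Y : CYFamily) (n : ℕ) (ζ : ℂ) :
    Y.hyperGTerm n ζ = fun ρ => exp (-ζ) * term Y.hypB (-ζ) n ρ := by
  funext ρ
  have h : exp (-(n + ρ + 1) * ζ) = exp (-ζ) * exp ((ρ + n) * -ζ) := by
    rw [← Complex.exp_add]; congr 1; ring
  rw [hyperGTerm, h, term, hypB]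
  simp only [add_comm ρ]
  ring

theorem contDiffAt_term_hypB (Y : CYFamily) (η : ℂ) (n j : ℕ) :
    ContDiffAt ℂ j (term Y.hypB η n) 0 :=
  ((Y.isWeight_hypB.differentiableOn_term η n).analyticAt
    ((isOpen_re_gt _).mem_nhds (by simp))).contDiffAt

theorem dRho_hyperGTerm (Y : CYFamily) (n j : ℕ) (ζ : ℂ) :
    dRho j (Y.hyperGTerm n ζ) =
      exp (-ζ) * (iteratedDeriv j (term Y.hypB (-ζ) n) 0 / (2 * Real.pi * I) ^ j) := by
  rw [dRho, hyperGTerm_eq, iteratedDeriv_const_mul _ (Y.contDiffAt_term_hypB (-ζ) n j), mul_div_assoc]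

theorem dRho_hyperGTerm_sub (Y : CYFamily) (n j : ℕ) (ζ : ℂ) (k : ℤ) :
    dRho j (Y.hyperGTerm n (ζ - k * (2 * Real.pi * I))) =
      ∑ i ∈ Finset.range (j + 1), j.choose i * (k : ℂ) ^ i * dRho (j - i) (Y.hyperGTerm n ζ) := by
  have h1 : Y.hyperGTerm n (ζ - k * (2 * Real.pi * I)) =
      fun ρ => exp (k * (2 * Real.pi * I) * ρ) * Y.hyperGTerm n ζ ρ := by
    funext ρ
    have h2 : -(n + ρ + 1) * (ζ - k * (2 * Real.pi * I)) = k * (2 * Real.pi * I) * ρ +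
        -(n + ρ + 1) * ζ + (((n + 1) * k : ℤ) : ℂ) * (2 * Real.pi * I) := by push_cast; ring
    rw [hyperGTerm, hyperGTerm, h2, Complex.exp_periodic.int_mul, Complex.exp_add]
    ring
  rw [h1, dRho_exp_mul]
  rw [hyperGTerm_eq]
  exact contDiffAt_const.mul (Y.contDiffAt_term_hypB (-ζ) n j)

theorem psiTerm_three_sub (Y : CYFamily) (a : ℂ) (C : ℕ → ℂ) (n : ℕ) (ζ : ℂ) (k : ℤ) :
    Y.psiTerm a C n (ζ - k * (2 * Real.pi * I)) 3 = Y.psiTerm a C n ζ 3 := by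
  have h2 : -(2 + n : ℂ) * (ζ - k * (2 * Real.pi * I)) = -(2 + n) * ζ +
      (((2 + n) * k : ℤ) : ℂ) * (2 * Real.pi * I) := by push_cast; ring
  simp only [psiTerm, Matrix.cons_val]
  rw [h2, Complex.exp_periodic.int_mul, Complex.exp_periodic.sub_int_mul_eq]

theorem isFormalMonodromy_matL (Y : CYFamily) (a : ℂ) (C : ℕ → ℂ) :
    Y.IsFormalMonodromy a C (Y.matL a) := by
  intro n ζ
  have h := fun j => Y.dRho_hyperGTerm_sub n j ζ 1
  simp only [Int.cast_one, one_mul, one_pow, mul_one] at h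
  have h0 : ∀ ζ, Y.hyperGTerm n ζ 0 = dRho 0 (Y.hyperGTerm n ζ) := fun ζ => by simp [dRho]
  have e0 := h 0
  have e1 := h 1
  have e2 := h 2
  simp [Finset.sum_range_succ, Nat.choose] at e0 e1 e2
  have e3 := Y.psiTerm_three_sub a C n ζ 1
  simp only [Int.cast_one, one_mul] at e3
  ext k
  fin_cases k
  · cases Y <;> simp [psiTerm, h0, e0, matL, Matrix.vecMul, dotProduct, Fin.sum_univ_four]
  · cases Y <;> simp [psiTerm, h0, e1, matL, Matrix.vecMul, dotProduct, Fin.sum_univ_four] <;> ring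
  · cases Y <;> simp [psiTerm, h0, e1, e2, matL, Matrix.vecMul, dotProduct, Fin.sum_univ_four,
      cubic] <;> ring
  · change Y.psiTerm a C n (ζ - 2 * Real.pi * I) 3 = (Y.psiTerm a C n ζ ᵥ* Y.matL a) 3
    rw [e3]
    cases Y <;> simp [matL, Matrix.vecMul, dotProduct, Fin.sum_univ_four]

theorem isFormalMonodromy_unique (Y : CYFamily) (a : ℂ) {C : ℕ → ℂ} (hC : C 0 = 1)
    {L L' : Matrix (Fin 4) (Fin 4) ℂ} (h : Y.IsFormalMonodromy a C L)
    (h' : Y.IsFormalMonodromy a C L') : L = L' := by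
  set D := L - L' with hD
  have hv : ∀ ζ, Y.psiTerm a C 0 ζ ᵥ* D = 0 := fun ζ => by
    rw [hD, Matrix.vecMul_sub, ← h 0 ζ, ← h' 0 ζ, sub_self]
  have h0 : ∀ ζ, Y.hyperGTerm 0 ζ 0 = dRho 0 (Y.hyperGTerm 0 ζ) := fun ζ => by simp [dRho]
  have hw0 : ∀ ζ, dRho 0 (Y.hyperGTerm 0 ζ) = exp (-ζ) := fun ζ => by
    rw [← h0, hyperGTerm]
    simp
  have hK : (Y.cubic : ℂ) ≠ 0 := by cases Y <;> norm_num [cubic]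
  have hcol : ∀ l, D 0 l = 0 ∧ D 1 l = 0 ∧ D 2 l = 0 ∧ D 3 l = 0 := by
    intro l
    -- The initial terms suffice. After `k` turns the first three entries become polynomials in `k`
    -- of degrees `0`, `1`, `2` while the fourth is unchanged, so differences in `k` isolate `D 2 l`
    -- and then `D 1 l`.
    have e : ∀ ζ : ℂ, ∀ k : ℤ, exp (-ζ) * D 0 l +
        (dRho 1 (Y.hyperGTerm 0 ζ) + k * exp (-ζ)) * D 1 l +
        (Y.cubic / 2 * (dRho 2 (Y.hyperGTerm 0 ζ) + 2 * k * dRho 1 (Y.hyperGTerm 0 ζ) +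
          k ^ 2 * exp (-ζ)) + a * (dRho 1 (Y.hyperGTerm 0 ζ) + k * exp (-ζ))) * D 2 l +
        Y.psiTerm a C 0 ζ 3 * D 3 l = 0 := by
      intro ζ k
      have := congrFun (hv (ζ - k * (2 * Real.pi * I))) l
      have h3 := Y.psiTerm_three_sub a C 0 ζ k
      simp only [Matrix.vecMul, dotProduct, Fin.sum_univ_four, h3] at this
      simp only [psiTerm, h0, dRho_hyperGTerm_sub, Finset.sum_range_succ, Finset.sum_range_zero,
        Nat.choose, Matrix.cons_val_zero, Matrix.cons_val_one, Matrix.cons_val] at this ⊢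
      simp [hw0] at this
      rw [← this]
      simp
    have d2 : D 2 l = 0 := by
      have e0 := e 0 0
      have e1 := e 0 1
      have e2 := e 0 2
      simp only [neg_zero, Complex.exp_zero] at e0 e1 e2
      push_cast at e0 e1 e2
      have : (Y.cubic : ℂ) * D 2 l = 0 := by linear_combination e2 - 2 * e1 + e0
      exact (mul_eq_zero.1 this).resolve_left hK
    have d1 : D 1 l = 0 := by
      have e0 := e 0 0
      have e1 := e 0 1
      simp only [neg_zero, Complex.exp_zero, d2] at e0 e1
      push_cast at e0 e1
      linear_combination e1 - e0
    have hpsi : ∀ x : ℝ, Y.psiTerm a C 0 x 3 = (Real.sqrt Y.cubic : ℂ) /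
        (2 * Real.pi * I * Y.conifold) * (Real.exp (-Y.conifold * Real.exp x - 2 * x) : ℂ) := by
      intro x
      simp only [psiTerm, Matrix.cons_val, hC]
      push_cast
      rw [sub_eq_add_neg, Complex.exp_add]
      simp
      ring
    have hc0 : (Real.sqrt Y.cubic : ℂ) / (2 * Real.pi * I * Y.conifold) ≠ 0 := by
      refine div_ne_zero (ofReal_ne_zero.2 (Real.sqrt_ne_zero'.2 ?_)) (mul_ne_zero two_pi_I_ne_zero
        (ofReal_ne_zero.2 Y.conifold_pos.ne'))
      cases Y <;> norm_num [cubic]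
    have e0 := e ((0 : ℝ) : ℂ) 0
    have e1 := e ((1 : ℝ) : ℂ) 0
    rw [d1, d2, hpsi] at e0 e1
    -- The fourth formal solution is separated from the first by comparing `ζ = 0` with `ζ = 1`: its
    -- leading term is not proportional to `exp (-ζ)`.
    have hexp : (Real.exp 1 * Real.exp (-Y.conifold * Real.exp 1 - 2 * 1) : ℝ) ≠
        Real.exp (-Y.conifold * Real.exp 0 - 2 * 0) := by
      rw [← Real.exp_add]
      refine fun h => absurd (Real.exp_injective h) (ne_of_lt ?_)
      have h1 := Real.exp_le_exp.2 (zero_le_one (α := ℝ))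
      have := Y.conifold_pos
      nlinarith
    have d3 : D 3 l = 0 := by
      have e2 : exp ((1 : ℝ) : ℂ) * exp (-((1 : ℝ) : ℂ)) = 1 := by
        rw [← Complex.exp_add]; simp
      simp only [ofReal_zero, neg_zero, Complex.exp_zero] at e0
      have : ((Real.sqrt Y.cubic : ℂ) / (2 * Real.pi * I * Y.conifold)) *
          (((Real.exp 1 * Real.exp (-Y.conifold * Real.exp 1 - 2 * 1) : ℝ) : ℂ) -
            (Real.exp (-Y.conifold * Real.exp 0 - 2 * 0) : ℝ)) * D 3 l = 0 := by
        rw [ofReal_mul, ofReal_exp 1]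
        linear_combination exp ((1 : ℝ) : ℂ) * e1 - e0 - D 0 l * e2
      refine (mul_eq_zero.1 this).resolve_left (mul_ne_zero hc0 (sub_ne_zero.2 ?_))
      exact_mod_cast hexp
    refine ⟨?_, d1, d2, d3⟩
    rw [d3] at e0
    simpa using e0
  have hD0 : D = 0 := by
    ext i l
    fin_cases i
    exacts [(hcol l).1, (hcol l).2.1, (hcol l).2.2.1, (hcol l).2.2.2]
  exact sub_eq_zero.1 hD0

/-! ### Stokes matrices -/

theorem isUnit_det_matL (Y : CYFamily) (a : ℂ) : IsUnit (Y.matL a).det := by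
  have : (Y.matL a).det = 1 := by
    cases Y <;> simp [matL, Matrix.det_succ_row_zero, Fin.sum_univ_succ, Fin.succAbove]
  rw [this]; exact isUnit_one

theorem isUnit_det_matKRbar (Y : CYFamily) (a : ℂ) : IsUnit (Y.matKRbar a).det := by
  have : (Y.matKRbar a).det = 1 := by
    cases Y <;> simp [matKRbar, Matrix.det_succ_row_zero, Fin.sum_univ_succ, Fin.succAbove]
  rw [this]; exact isUnit_one

theorem holF_sub_int_mul (Y : CYFamily) (a ζ : ℂ) (n : ℤ) (k : Fin 4) :
    Y.holF a Y.normConst (ζ - n * (2 * Real.pi * I)) k =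
      ∑ i, Y.kernVal a i k * Y.qroot i ^ n * Y.localSol i ζ := by
  rw [holF_eq]
  exact Finset.sum_congr rfl fun i _ => by rw [localSol_sub_int_mul]; ring

/-- The Stokes relations reduced to algebra in `q`. Multiplication of the kernel values by `q`
represents `z ↦ e^{-2πi} z`. On the constant kernel of `f₄` it is the last column of `K_R̄`, and on
the whole row it is `K_R̄ L K_R`. What is not an identity in `q` is a multiple of the quartic. -/
theorem qroot_cubic_identities (Y : CYFamily) (a : ℂ) (i : Fin 4) :
    (∀ k, k ≠ 3 → Y.kernVal a i k = (Y.kernVal a i ᵥ* Y.matKRbar a) k) ∧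
    Y.kernVal a i 3 * Y.qroot i = (Y.kernVal a i ᵥ* Y.matKRbar a) 3 ∧
    ∀ k, Y.kernVal a i k * Y.qroot i = (Y.kernVal a i ᵥ* (Y.matKRbar a * Y.matL a * matKR)) k := by
  have h1 := sub_ne_zero.2 (Y.qroot_ne_one i)
  have hq := Y.qroot_charpoly i
  simp only [kernVal, kern_pole, kernRat]
  have h0 : (2 * Real.pi * I : ℂ) ≠ 0 := two_pi_I_ne_zero
  generalize (2 * Real.pi * I : ℂ) = τ at h0 ⊢
  generalize Y.qroot i = q at h1 hq ⊢
  have e1 : τ ^ (0 + 1) * (q / (q - 1)) = τ * (q / (q - 1)) := by ring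
  have e2 : τ ^ (1 + 1) * (q / (q - 1) ^ 2) / τ ^ 1 = τ * (q / (q - 1) ^ 2) := by
    field_simp; ring
  have e3 : τ ^ (2 + 1) * (q * (q + 1) / (q - 1) ^ 3) / τ ^ 2 =
      τ * (q * (q + 1) / (q - 1) ^ 3) := by field_simp; ring
  rw [e1, e2, e3]
  refine ⟨fun k hk => ?_, ?_, fun k => ?_⟩
  · fin_cases k
    · cases Y <;> simp [matKRbar, Matrix.vecMul, dotProduct, Fin.sum_univ_four]
    · cases Y <;> simp [matKRbar, Matrix.vecMul, dotProduct, Fin.sum_univ_four]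
    · cases Y <;> simp [matKRbar, Matrix.vecMul, dotProduct, Fin.sum_univ_four]
    · exact absurd rfl hk
  · cases Y <;> simp [matKRbar, Matrix.vecMul, dotProduct, Fin.sum_univ_four, cubic, chern] at hq ⊢ <;>
      field_simp <;> first | linear_combination 2 * hq | linear_combination hq
  · fin_cases k <;> cases Y <;>
      simp [matKRbar, matL, matKR, Matrix.mul_apply, Matrix.vecMul, dotProduct, Fin.sum_univ_four,
        cubic, chern] at hq ⊢ <;> field_simp <;>
      first | ring1 | linear_combination 2 * hq | linear_combination hq

/-- The solutions `(f₁(z), f₂(z), f₃(z), f₄(e^{-2πi} z))`. -/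
theorem holF_twist (Y : CYFamily) (a ζ : ℂ) :
    ![Y.holF a Y.normConst ζ 0, Y.holF a Y.normConst ζ 1, Y.holF a Y.normConst ζ 2,
      Y.holF a Y.normConst (ζ - 2 * Real.pi * I) 3] = Y.holF a Y.normConst ζ ᵥ* Y.matKRbar a := by
  have hv : ∀ k, (Y.holF a Y.normConst ζ ᵥ* Y.matKRbar a) k =
      ∑ i, (Y.kernVal a i ᵥ* Y.matKRbar a) k * Y.localSol i ζ := fun k => by
    simp only [Matrix.vecMul, dotProduct, holF_eq, Finset.sum_mul]
    rw [Finset.sum_comm]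
    exact Finset.sum_congr rfl fun i _ => Finset.sum_congr rfl fun l _ => by ring
  have h1 : ∀ k, k ≠ 3 → Y.holF a Y.normConst ζ k =
      (Y.holF a Y.normConst ζ ᵥ* Y.matKRbar a) k := fun k hk => by
    rw [hv, holF_eq]
    exact Finset.sum_congr rfl fun i _ => by rw [(Y.qroot_cubic_identities a i).1 k hk]
  have h2 := Y.holF_sub_int_mul a ζ 1 3
  rw [Int.cast_one, one_mul] at h2
  ext k
  fin_cases k
  · exact h1 0 (by decide)
  · exact h1 1 (by decide)
  · exact h1 2 (by decide)
  · change Y.holF a Y.normConst (ζ - 2 * Real.pi * I) 3 = _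
    rw [h2]
    refine (Finset.sum_congr rfl fun i _ => ?_).trans (hv 3).symm
    rw [zpow_one, (Y.qroot_cubic_identities a i).2.1]

theorem holF_sub_two_pi (Y : CYFamily) (a ζ : ℂ) :
    Y.holF a Y.normConst (ζ - 2 * Real.pi * I) =
      Y.holF a Y.normConst ζ ᵥ* (Y.matKRbar a * Y.matL a * matKR) := by
  ext k
  have h2 := Y.holF_sub_int_mul a ζ 1 k
  rw [Int.cast_one, one_mul] at h2
  rw [h2]
  simp only [zpow_one, (Y.qroot_cubic_identities a _).2.2]
  simp only [Matrix.vecMul, dotProduct, holF_eq, Finset.sum_mul]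
  rw [Finset.sum_comm]
  exact Finset.sum_congr rfl fun i _ => Finset.sum_congr rfl fun l _ => by ring

theorem holPhi_even (Y : CYFamily) (a c : ℂ) (k : ℤ) (ζ : ℂ) :
    Y.holPhi a c (2 * k) ζ = Y.holF a c (ζ - k * (2 * Real.pi * I)) ᵥ* Y.matL a ^ (-k) := by
  have h : ((2 * k : ℤ) : ℂ) * Real.pi * I = k * (2 * Real.pi * I) := by push_cast; ring
  rw [holPhi, if_pos (even_two_mul k), h, Int.mul_ediv_cancel_left k two_ne_zero]

theorem holPhi_odd (Y : CYFamily) (a : ℂ) (k : ℤ) (ζ : ℂ) :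
    Y.holPhi a Y.normConst (2 * k + 1) ζ =
      Y.holF a Y.normConst (ζ - k * (2 * Real.pi * I)) ᵥ* Y.matKRbar a ᵥ* Y.matL a ^ (-k) := by
  have h : (((2 * k + 1 : ℤ) : ℂ) - 1) * Real.pi * I = k * (2 * Real.pi * I) := by push_cast; ring
  rw [holPhi, if_neg (Int.not_even_two_mul_add_one k), h, add_sub_cancel_right,
    Int.mul_ediv_cancel_left k two_ne_zero, holF_twist]

/-- `Φ_{l+2kπ}` is `f` turned `k` times and multiplied by `L^{-k}`, and `Φ_{l+(2k+1)π}` has an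
additional `K_R̄` in between. The first relation is immediate; the second is one further turn, `K_R̄
L K_R`. -/
theorem areStokesMatrices (Y : CYFamily) (a : ℂ) :
    AreStokesMatrices (Y.holPhi a Y.normConst) (Y.matL a) (Y.matKRbar a) matKR := by
  have hL := Y.isUnit_det_matL a
  intro k
  have h1 : Y.matL a ^ (-k) * Y.matL a ^ k = 1 := by
    rw [← Matrix.zpow_add hL, neg_add_cancel, zpow_zero]
  have h2 : Y.matL a ^ (-k) * Y.matL a ^ (k + 1) = Y.matL a := by
    rw [← Matrix.zpow_add hL, neg_add_cancel_left, zpow_one]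
  refine ⟨fun ζ _ => ?_, fun ζ _ => ?_⟩
  · rw [holPhi_odd, holPhi_even, Matrix.vecMul_vecMul, Matrix.vecMul_vecMul]
    congr 1
    rw [← mul_assoc, ← mul_assoc, h1, one_mul]
  · have h3 : ((2 : ℤ) * k + 2) = 2 * (k + 1) := by ring
    have h4 : ζ - ((k + 1 : ℤ) : ℂ) * (2 * Real.pi * I) =
        ζ - k * (2 * Real.pi * I) - 2 * Real.pi * I := by push_cast; ring
    rw [h3, holPhi_even, holPhi_odd, h4, holF_sub_two_pi, Matrix.vecMul_vecMul,
      Matrix.vecMul_vecMul, Matrix.vecMul_vecMul, neg_add']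
    congr 1
    have h5 : Y.matKRbar a * Y.matL a * matKR * Y.matL a ^ (-k - 1) =
        Y.matKRbar a * (Y.matL a ^ (-k) * Y.matL a ^ (k + 1)) * matKR * Y.matL a ^ (-k - 1) := by
      rw [h2]
    rw [h5]
    simp only [mul_assoc]

theorem differentiable_holF (Y : CYFamily) (a : ℂ) (k : Fin 4) :
    Differentiable ℂ fun ζ => Y.holF a Y.normConst ζ k := by
  simp only [holF_eq]
  exact Differentiable.fun_sum fun i _ => (Y.differentiable_localSol i).const_mul _

theorem eq_zero_of_holF_vecMul (Y : CYFamily) (a : ℂ) {D : Matrix (Fin 4) (Fin 4) ℂ} {U : Set ℂ}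
    (hU : IsOpen U) (hne : U.Nonempty) (h : ∀ ζ ∈ U, Y.holF a Y.normConst ζ ᵥ* D = 0) : D = 0 := by
  obtain ⟨ζ₀, hζ₀⟩ := hne
  have hcol : ∀ l, (fun k => D k l) = 0 := fun l => by
    refine Y.eq_zero_of_sum_holF a fun ζ => ?_
    have hd : Differentiable ℂ fun ζ => ∑ k, Y.holF a Y.normConst ζ k * D k l :=
      Differentiable.fun_sum fun k _ => (Y.differentiable_holF a k).mul_const _
    have hA := (hd.differentiableOn (s := univ)).analyticOnNhd isOpen_univ
    have hz : AnalyticOnNhd ℂ (fun _ : ℂ => (0 : ℂ)) univ := fun _ _ => analyticAt_const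
    refine hA.eqOn_of_preconnected_of_eventuallyEq hz isPreconnected_univ (mem_univ ζ₀) ?_
      (mem_univ ζ)
    filter_upwards [hU.mem_nhds hζ₀] with w hw
    exact congrFun (h w hw) l
  ext k l
  exact congrFun (hcol l) k

theorem isOpen_angularRegion (m : ℤ) : IsOpen (angularRegion m) :=
  (isOpen_lt continuous_const continuous_im).inter (isOpen_lt continuous_im continuous_const)

/-- Already the two relations with `k = 0` determine the matrices: they hold on non-empty open sets,
the `f_k` are linearly independent, and the conjugating matrices are invertible. -/
theorem areStokesMatrices_iff (Y : CYFamily) (a : ℂ) (Kbar K : Matrix (Fin 4) (Fin 4) ℂ) :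
    AreStokesMatrices (Y.holPhi a Y.normConst) (Y.matL a) Kbar K ↔
      Kbar = Y.matKRbar a ∧ K = matKR := by
  refine ⟨fun h => ?_, fun h => by rw [h.1, h.2]; exact Y.areStokesMatrices a⟩
  have h0 := h 0
  have h0' := Y.areStokesMatrices a 0
  have hpi := Real.pi_pos
  have e0 : ∀ ζ, Y.holPhi a Y.normConst (2 * 0) ζ = Y.holF a Y.normConst ζ := fun ζ => by
    rw [holPhi_even]; simp
  have e1 : ∀ ζ, Y.holPhi a Y.normConst (2 * 0 + 1) ζ =
      Y.holF a Y.normConst ζ ᵥ* Y.matKRbar a := fun ζ => by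
    rw [holPhi_odd]; simp
  refine ⟨?_, ?_⟩
  · have hD := Y.eq_zero_of_holF_vecMul a (D := Kbar - Y.matKRbar a)
      ((isOpen_angularRegion (2 * 0 + 1)).inter (isOpen_angularRegion (2 * 0)))
      ⟨Real.pi * I, by
        simp only [angularRegion, mem_inter_iff, mem_ofPred_eq, im_ofReal_mul, I_im]
        push_cast
        refine ⟨⟨?_, ?_⟩, ⟨?_, ?_⟩⟩ <;> linarith⟩
      fun ζ hζ => by
        have a1 := h0.1 ζ hζ
        have a2 := h0'.1 ζ hζ
        rw [e0] at a1 a2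
        simp only [neg_zero, zpow_zero, one_mul, mul_one] at a1 a2
        rw [Matrix.vecMul_sub, ← a1, ← a2, sub_self]
    exact sub_eq_zero.1 hD
  · have hL := Y.isUnit_det_matL a
    have hD := Y.eq_zero_of_holF_vecMul a
      (D := Y.matKRbar a * (Y.matL a * (K - matKR) * (Y.matL a)⁻¹))
      ((isOpen_angularRegion (2 * 0 + 2)).inter (isOpen_angularRegion (2 * 0 + 1)))
      ⟨(2 * Real.pi : ℝ) * I, by
        simp only [angularRegion, mem_inter_iff, mem_ofPred_eq, im_ofReal_mul, I_im]
        push_cast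
        refine ⟨⟨?_, ?_⟩, ⟨?_, ?_⟩⟩ <;> linarith⟩
      fun ζ hζ => by
        have a1 := h0.2 ζ hζ
        have a2 := h0'.2 ζ hζ
        rw [e1] at a1 a2
        simp only [zero_add, zpow_one, neg_zero, zero_sub, Matrix.zpow_neg_one] at a1 a2
        rw [mul_sub, sub_mul, ← Matrix.vecMul_vecMul, Matrix.vecMul_sub, ← a1, ← a2, sub_self]
    have hK := Y.isUnit_det_matKRbar a
    have h3 : K - matKR = (Y.matL a)⁻¹ * ((Y.matKRbar a)⁻¹ *
        (Y.matKRbar a * (Y.matL a * (K - matKR) * (Y.matL a)⁻¹))) * Y.matL a := by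
      rw [Matrix.nonsing_inv_mul_cancel_left _ _ hK, mul_assoc (Y.matL a),
        Matrix.nonsing_inv_mul_cancel_left _ _ hL, Matrix.nonsing_inv_mul_cancel_right _ _ hL]
    rw [hD, mul_zero, mul_zero, zero_mul] at h3
    exact sub_eq_zero.1 h3

/-! ### The Laplace-transformed equation -/

theorem eulerOp_sum (p q : ℂ) {G : Fin 4 → ℂ → ℂ} (hG : ∀ i, Differentiable ℂ (G i))
    (c : Fin 4 → ℂ) : eulerOp p q (fun ζ => ∑ i, c i * G i ζ) =
      fun ζ => ∑ i, c i * eulerOp p q (G i) ζ := by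
  funext ζ
  rw [eulerOp, deriv_fun_sum fun i _ => ((hG i) ζ).const_mul _, Finset.mul_sum, Finset.mul_sum,
    ← Finset.sum_add_distrib]
  refine Finset.sum_congr rfl fun i _ => ?_
  rw [deriv_const_mul _ ((hG i) ζ), eulerOp]
  ring

theorem differentiable_eulerOp (p q : ℂ) {F : ℂ → ℂ} (hF : Differentiable ℂ F) :
    Differentiable ℂ (eulerOp p q F) := by
  have h : Differentiable ℂ (deriv F) := by
    intro ζ
    exact ((hF.differentiableOn (s := univ)).deriv isOpen_univ).differentiableAt univ_mem
  exact (h.const_mul p).add (hF.const_mul q)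

theorem isLaplaceSolution_sum (Y : CYFamily) {G : Fin 4 → ℂ → ℂ}
    (hG : ∀ i, Y.IsLaplaceSolution (G i)) (c : Fin 4 → ℂ) :
    Y.IsLaplaceSolution fun ζ => ∑ i, c i * G i ζ := by
  have hd := fun i => (hG i).1
  refine ⟨Differentiable.fun_sum fun i _ => (hd i).const_mul _, fun ζ => ?_⟩
  have h1 := fun i => differentiable_eulerOp 1 1 (hd i)
  have h2 := fun i => differentiable_eulerOp 1 1 (h1 i)
  have hf : ∀ (p : ℂ) (l : List ℕ),
      (l.foldr (fun (j : ℕ) H => eulerOp p j H) fun ζ => ∑ i, c i * G i ζ) =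
        (fun ζ => ∑ i, c i * l.foldr (fun (j : ℕ) H => eulerOp p j H) (G i) ζ) ∧
      ∀ i, Differentiable ℂ (l.foldr (fun (j : ℕ) H => eulerOp p j H) (G i)) := fun p l => by
    induction l with
    | nil => exact ⟨rfl, hd⟩
    | cons j l ih =>
      simp only [List.foldr_cons]
      rw [ih.1, eulerOp_sum p j ih.2 c]
      exact ⟨rfl, fun i => differentiable_eulerOp p j (ih.2 i)⟩
  rw [(hf _ _).1, Function.iterate_succ_apply', Function.iterate_succ_apply',
    Function.iterate_one, eulerOp_sum 1 1 hd, eulerOp_sum 1 1 h1, eulerOp_sum 1 1 h2,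
    Finset.mul_sum, Finset.mul_sum, ← Finset.sum_add_distrib]
  refine Finset.sum_eq_zero fun i _ => ?_
  have := (hG i).2 ζ
  rw [Function.iterate_succ_apply', Function.iterate_succ_apply', Function.iterate_one] at this
  linear_combination c i * this

theorem isLaplaceSolution_holPhi (Y : CYFamily) (a : ℂ) (m : ℤ) (k : Fin 4) :
    Y.IsLaplaceSolution fun ζ => Y.holPhi a Y.normConst m ζ k := by
  have hlin : ∀ (n : ℤ) (A : Matrix (Fin 4) (Fin 4) ℂ), Y.IsLaplaceSolution fun ζ =>
      (Y.holF a Y.normConst (ζ - n * (2 * Real.pi * I)) ᵥ* A) k := fun n A => by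
    have : (fun ζ => (Y.holF a Y.normConst (ζ - n * (2 * Real.pi * I)) ᵥ* A) k) = fun ζ =>
        ∑ i, (∑ l, Y.kernVal a i l * Y.qroot i ^ n * A l k) * Y.localSol i ζ := by
      funext ζ
      simp only [Matrix.vecMul, dotProduct, holF_sub_int_mul, Finset.sum_mul]
      rw [Finset.sum_comm]
      exact Finset.sum_congr rfl fun i _ => Finset.sum_congr rfl fun l _ => by ring
    rw [this]
    exact Y.isLaplaceSolution_sum Y.isLaplaceSolution_localSol _
  rcases Int.even_or_odd' m with ⟨n, rfl | rfl⟩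
  · simp only [holPhi_even]
    exact hlin n _
  · simp only [holPhi_odd, Matrix.vecMul_vecMul]
    exact hlin n _

end CYFamily

namespace CYFamily

open MeasureTheory Complex Set

/-! ### Asymptotics of the solutions given by decaying kernels -/

variable {Y : CYFamily} {κ : ℂ → ℂ} {j : ℕ} {p p' : ℝ}

theorem eventually_sectorAtInfinity {α β : ℝ} {P : ℂ → Prop} {R : ℝ}
    (h : ∀ ζ : ℂ, R ≤ ζ.re → α ≤ ζ.im → ζ.im ≤ β → P ζ) : ∀ᶠ ζ in sectorAtInfinity α β, P ζ := by
  rw [sectorAtInfinity, eventually_inf_principal]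
  filter_upwards [tendsto_comap.eventually (eventually_ge_atTop R)] with ζ h1 h2
  exact h ζ h1 h2.1 h2.2

theorem tendsto_re_sectorAtInfinity (α β : ℝ) : Tendsto re (sectorAtInfinity α β) atTop :=
  tendsto_comap.mono_left inf_le_left

theorem isLittleO_sectorAtInfinity {α β : ℝ} {F G : ℂ → ℂ} {A C δ : ℝ} (hδ : 0 < δ)
    (h : ∀ ζ : ℂ, A ≤ ζ.re → α ≤ ζ.im → ζ.im ≤ β → ‖F ζ‖ ≤ C * Real.exp (-δ * ζ.re) * ‖G ζ‖) :
    F =o[sectorAtInfinity α β] G := by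
  have h1 : Tendsto (fun ζ : ℂ => C * Real.exp (-δ * ζ.re)) (sectorAtInfinity α β) (𝓝 0) := by
    have h2 : Tendsto (fun x : ℝ => C * Real.exp (-δ * x)) atTop (𝓝 (C * 0)) :=
      (Real.tendsto_exp_atBot.comp
        ((tendsto_const_mul_atBot_of_neg (by linarith)).2 tendsto_id)).const_mul _
    rw [mul_zero] at h2
    exact h2.comp (tendsto_re_sectorAtInfinity α β)
  rw [isLittleO_iff]
  intro c hc
  filter_upwards [h1.eventually (gt_mem_nhds hc), eventually_sectorAtInfinity h] with ζ h2 h3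
  exact h3.trans (by gcongr)

/-- The residues on the left give the solution exactly, and `N` steps to the right give the first
`N` terms of the formal series; the remainder is the Barnes integral after `N` steps. With `η = -ζ`
the strip of convergence becomes the sector, enlarged by `π/2` on either side through the decay of
`hypB`. -/
theorem isLittleO_sum_localSol (hκ : IsKernel κ j p p') (hj : j + 1 ≤ 3) {α β : ℝ}
    (hα : -(p' + Real.pi / 2) < α) (hβ : β < p + Real.pi / 2) (N : ℕ) :
    (fun ζ => ∑ i, κ (Y.pole i) * Y.localSol i ζ -
      ∑ n ∈ Finset.range N, exp (-ζ) * iteratedDeriv j (term Y.hypB (-ζ) n) 0)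
      =o[sectorAtInfinity α β] fun ζ => exp (-N * ζ) := by
  obtain ⟨C, ε, hC, hε, hb⟩ := Y.isWeight_hypB.line_bound hκ (α := -β) (β := -α)
    (by linarith) (by linarith) N
  -- The prefactor `e^{-ζ}` gains a full power of `z⁻¹` and the abscissa `base = -1/20` loses a
  -- twentieth of it.
  refine isLittleO_sectorAtInfinity (A := 0) (δ := 19 / 20)
    (C := (2 * Real.pi)⁻¹ * (C * ∫ τ : ℝ, Real.exp (-ε * |τ|))) (by norm_num)
    fun ζ _ h1 h2 => ?_
  have hi : (-ζ).im ∈ Icc (-β) (-α) := by rw [neg_im]; exact ⟨neg_le_neg h2, neg_le_neg h1⟩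
  have hl : -(p + Real.pi / 2) < (-ζ).im := by linarith [hi.1]
  have hr : (-ζ).im < p' + Real.pi / 2 := by linarith [hi.2]
  have e1 := Y.isWeight_hypB.barnes_eq_sum_piece (by norm_num) hκ hj Y.isRatioBound_three hl hr
    (Y.summable_ratioBound_three _)
  have e2 : ∑ i, κ (Y.pole i) * Y.localSol i ζ -
      ∑ n ∈ Finset.range N, exp (-ζ) * iteratedDeriv j (term Y.hypB (-ζ) n) 0 =
      exp (-ζ) * barnes κ Y.hypB N (-ζ) := by
    have h3 : ∑ i, κ (Y.pole i) * Y.localSol i ζ = exp (-ζ) * barnes κ Y.hypB 0 (-ζ) := by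
      rw [e1, Finset.mul_sum]
      exact Finset.sum_congr rfl fun i _ => by rw [localSol]; ring
    rw [h3, Y.isWeight_hypB.barnes_eq_sum_add hκ hl hr N, ← Finset.mul_sum]
    ring
  have hnorm : ‖barnes κ Y.hypB N (-ζ)‖ ≤ (2 * Real.pi)⁻¹ *
      ((C * ∫ τ : ℝ, Real.exp (-ε * |τ|)) * Real.exp ((base + N) * -ζ.re)) := by
    rw [barnes, norm_mul, norm_neg]
    have e3 : ‖((2 : ℂ) * Real.pi)⁻¹‖ = (2 * Real.pi)⁻¹ := by simp [abs_of_pos Real.pi_pos]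
    rw [e3]
    gcongr
    rw [lineInt, ← integral_const_mul, ← integral_mul_const]
    exact norm_integral_le_of_norm_le (((integrable_exp_neg_mul_abs hε).const_mul _).mul_const _)
      (Eventually.of_forall fun τ => by simpa using hb τ (-ζ) hi)
  rw [e2, norm_mul, norm_exp, norm_exp]
  calc _ ≤ Real.exp (-ζ).re * ((2 * Real.pi)⁻¹ *
        ((C * ∫ τ : ℝ, Real.exp (-ε * |τ|)) * Real.exp ((base + N) * -ζ.re))) := by gcongr
    _ = _ := by
      have e4 : Real.exp (-ζ).re * Real.exp ((base + N) * -ζ.re) =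
          Real.exp (-(19 / 20) * ζ.re) * Real.exp (-N * ζ).re := by
        rw [← Real.exp_add, ← Real.exp_add]
        congr 1
        simp [base]
        ring
      linear_combination (2 * Real.pi)⁻¹ * (C * ∫ τ : ℝ, Real.exp (-ε * |τ|)) * e4

/-- The sector is dictated by `kern 0`, which decays only in the upper half-plane. It contains both
`Ξ_l` and `Ξ_{l+π}`, so the same `f₁, f₂, f₃` serve for `m = 0` and `m = 1`. -/
theorem isLittleO_holF (Y : CYFamily) (a : ℂ) (C : ℕ → ℂ) {α β : ℝ} (hα : -(Real.pi / 2) < α)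
    (hβ : β < 5 * Real.pi / 2) (N : ℕ) {k : Fin 4} (hk : k ≠ 3) :
    (fun ζ => Y.holF a Y.normConst ζ k - ∑ n ∈ Finset.range N, Y.psiTerm a C n ζ k)
      =o[sectorAtInfinity α β] fun ζ => exp (-N * ζ) := by
  have hpi := Real.pi_pos
  have h0 := isLittleO_sum_localSol (Y := Y) isKernel_kern_zero (by norm_num) (α := α) (β := β)
    (by linarith) (by linarith) N
  have h1 := isLittleO_sum_localSol (Y := Y) (isKernel_kern (j := 1) le_rfl (by norm_num))
    (by norm_num) (α := α) (β := β) (by linarith) (by linarith) N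
  have h2 := isLittleO_sum_localSol (Y := Y) (isKernel_kern (j := 2) (by norm_num) (by norm_num))
    (by norm_num) (α := α) (β := β) (by linarith) (by linarith) N
  simp only [holF_eq]
  fin_cases k
  · refine h0.congr_left fun ζ => ?_
    congr 1
    refine Finset.sum_congr rfl fun n _ => ?_
    have := Y.dRho_hyperGTerm n 0 ζ
    simpa [psiTerm, dRho] using this.symm
  · refine (h1.const_mul_left ((2 * Real.pi * I) ^ 1)⁻¹).congr_left fun ζ => ?_
    simp only [psiTerm, kernVal, dRho_hyperGTerm, mul_sub, Finset.mul_sum]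
    congr 1
    · exact Finset.sum_congr rfl fun i _ => by simp [-Complex.inv_I]; ring
    · exact Finset.sum_congr rfl fun n _ => by simp [-Complex.inv_I]; ring
  · refine ((h2.const_mul_left ((Y.cubic : ℂ) / 2 * ((2 * Real.pi * I) ^ 2)⁻¹)).add
      (h1.const_mul_left (a * ((2 * Real.pi * I) ^ 1)⁻¹))).congr_left fun ζ => ?_
    simp only [psiTerm, kernVal, dRho_hyperGTerm, mul_sub, Finset.mul_sum]
    rw [sub_add_sub_comm, ← Finset.sum_add_distrib, ← Finset.sum_add_distrib]
    congr 1
    · exact Finset.sum_congr rfl fun i _ => by simp [-Complex.inv_I]; ring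
    · exact Finset.sum_congr rfl fun n _ => by simp [-Complex.inv_I]; ring
  · exact absurd rfl hk

/-! ### Translation by the formal monodromy -/

theorem psiTerm_sub_int_mul (Y : CYFamily) (a : ℂ) (C : ℕ → ℂ) (n : ℕ) (ζ : ℂ) (k : ℤ) :
    Y.psiTerm a C n (ζ - k * (2 * Real.pi * I)) ᵥ* Y.matL a ^ (-k) = Y.psiTerm a C n ζ := by
  have hL := Y.isUnit_det_matL a
  have h := Y.isFormalMonodromy_matL a C n
  have hnat : ∀ (k : ℕ) (ζ : ℂ), Y.psiTerm a C n (ζ - k * (2 * Real.pi * I)) =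
      Y.psiTerm a C n ζ ᵥ* Y.matL a ^ k := fun k => by
    induction k with
    | zero => intro ζ; simp
    | succ k ih =>
      intro ζ
      have e : ζ - ((k + 1 : ℕ) : ℂ) * (2 * Real.pi * I) =
          ζ - k * (2 * Real.pi * I) - 2 * Real.pi * I := by push_cast; ring
      rw [e, h, ih, Matrix.vecMul_vecMul, pow_succ]
  rcases Int.eq_nat_or_neg k with ⟨l, rfl | rfl⟩
  · rw [Int.cast_natCast, hnat, Matrix.vecMul_vecMul, ← zpow_natCast, ← Matrix.zpow_add hL,
      add_neg_cancel, zpow_zero, Matrix.vecMul_one]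
  · rw [neg_neg, zpow_natCast, ← hnat]
    congr 1
    push_cast
    ring

/-- Powers of `L` do not mix the exponentially scaled fourth entry with the other three, so the two
kinds of error estimate survive multiplication by them. -/
theorem matL_zpow_block (Y : CYFamily) (a : ℂ) (n : ℤ) :
    (∀ k : Fin 4, k ≠ 3 → (Y.matL a ^ n) 3 k = 0 ∧ (Y.matL a ^ n) k 3 = 0) ∧
      (Y.matL a ^ n) 3 3 = 1 := by
  have hL := Y.isUnit_det_matL a
  have hrow : Pi.single (3 : Fin 4) (1 : ℂ) ᵥ* Y.matL a = Pi.single 3 1 := by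
    ext k
    rw [Matrix.single_one_vecMul]
    cases Y <;> fin_cases k <;> simp [matL]
  have hcol : Y.matL a *ᵥ Pi.single (3 : Fin 4) (1 : ℂ) = Pi.single 3 1 := by
    ext k
    rw [Matrix.mulVec_single_one]
    cases Y <;> fin_cases k <;> simp [matL]
  have hrow' : ∀ n : ℤ, Pi.single (3 : Fin 4) (1 : ℂ) ᵥ* Y.matL a ^ n = Pi.single 3 1 := fun n => by
    induction n using Int.induction_on with
    | zero => simp
    | succ i ih => rw [Matrix.zpow_add_one hL, ← Matrix.vecMul_vecMul, ih, hrow]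
    | pred i ih =>
      rw [Matrix.zpow_sub_one hL, ← Matrix.vecMul_vecMul, ih]
      nth_rw 1 [← hrow]
      rw [Matrix.vecMul_vecMul, Matrix.mul_nonsing_inv _ hL, Matrix.vecMul_one]
  have hcol' : ∀ n : ℤ, Y.matL a ^ n *ᵥ Pi.single (3 : Fin 4) (1 : ℂ) = Pi.single 3 1 := fun n => by
    induction n using Int.induction_on with
    | zero => rw [zpow_zero, Matrix.one_mulVec]
    | succ i ih => rw [Matrix.zpow_add_one hL, ← Matrix.mulVec_mulVec, hcol, ih]
    | pred i ih =>
      rw [Matrix.zpow_sub_one hL, ← Matrix.mulVec_mulVec]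
      nth_rw 1 [← hcol]
      rw [Matrix.mulVec_mulVec _ _ (Y.matL a),
        Matrix.nonsing_inv_mul _ hL, Matrix.one_mulVec, ih]
  have h1 := hrow' n
  have h2 := hcol' n
  rw [Matrix.single_one_vecMul] at h1
  rw [Matrix.mulVec_single_one] at h2
  refine ⟨fun k hk => ⟨?_, ?_⟩, ?_⟩
  · simpa [hk] using congrFun h1 k
  · simpa [hk] using congrFun h2 k
  · simpa using congrFun h1 3

theorem tendsto_sub_sectorAtInfinity (α β : ℝ) (k : ℤ) :
    Tendsto (fun ζ : ℂ => ζ - k * (2 * Real.pi * I)) (sectorAtInfinity α β)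
      (sectorAtInfinity (α - k * (2 * Real.pi)) (β - k * (2 * Real.pi))) := by
  rw [sectorAtInfinity, sectorAtInfinity, tendsto_inf]
  constructor
  · rw [tendsto_comap_iff]
    refine (tendsto_comap.mono_left inf_le_left).congr fun ζ => ?_
    simp
  · rw [tendsto_principal, eventually_inf_principal]
    refine Eventually.of_forall fun ζ hζ => ?_
    have : (ζ - k * (2 * Real.pi * I)).im = ζ.im - k * (2 * Real.pi) := by simp
    rw [mem_ofPred_eq, this]
    exact ⟨by linarith [hζ.1], by linarith [hζ.2]⟩

/-- The formal solutions turned `k` times and multiplied by `L^{-k}` are unchanged, while the sector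
moves by `2πk`, that is by `2k` in the index `m`. -/
theorem IsAsymptoticTo.shift {a : ℂ} {C : ℕ → ℂ} {m : ℤ} {F : ℂ → Fin 4 → ℂ}
    (h : Y.IsAsymptoticTo a C m F) (k : ℤ) :
    Y.IsAsymptoticTo a C (2 * k + m) fun ζ =>
      F (ζ - k * (2 * Real.pi * I)) ᵥ* Y.matL a ^ (-k) := by
  intro α β hα hαβ hβ N
  push_cast at hα hβ
  obtain ⟨h1, h2⟩ := h (α - k * (2 * Real.pi)) (β - k * (2 * Real.pi)) (by linarith) (by linarith)
    (by linarith) N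
  have ht := tendsto_sub_sectorAtInfinity α β k
  have hb := Y.matL_zpow_block a (-k)
  have hd : ∀ (ζ : ℂ) (l : Fin 4), (F (ζ - k * (2 * Real.pi * I)) ᵥ* Y.matL a ^ (-k)) l -
      ∑ n ∈ Finset.range N, Y.psiTerm a C n ζ l = ∑ i, (F (ζ - k * (2 * Real.pi * I)) i -
        ∑ n ∈ Finset.range N, Y.psiTerm a C n (ζ - k * (2 * Real.pi * I)) i) *
        (Y.matL a ^ (-k)) i l := fun ζ l => by
    simp only [← Y.psiTerm_sub_int_mul a C _ ζ k, Matrix.vecMul, dotProduct, sub_mul,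
      Finset.sum_sub_distrib, Finset.sum_mul]
    rw [Finset.sum_comm]
  have hexp : ∀ (M : ℕ) (ζ : ℂ), exp (-M * (ζ - k * (2 * Real.pi * I))) = exp (-M * ζ) :=
    fun M ζ => by
      have : -(M : ℂ) * (ζ - k * (2 * Real.pi * I)) = -M * ζ + ((M * k : ℤ) : ℂ) *
        (2 * Real.pi * I) := by push_cast; ring
      rw [this, Complex.exp_periodic.int_mul]
  refine ⟨fun l hl => ?_, ?_⟩
  · simp only [hd, Fin.sum_univ_four, (hb.1 l hl).1, mul_zero, add_zero]
    have h3 : ∀ i : Fin 4, i ≠ 3 → (fun ζ => (F (ζ - k * (2 * Real.pi * I)) i -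
        ∑ n ∈ Finset.range N, Y.psiTerm a C n (ζ - k * (2 * Real.pi * I)) i) *
        (Y.matL a ^ (-k)) i l) =o[sectorAtInfinity α β] fun ζ => exp (-N * ζ) := fun i hi =>
      by
        simpa only [mul_comm] using!
          (((h1 i hi).comp_tendsto ht).congr_right fun ζ => hexp N ζ).const_mul_left ((Y.matL a ^ (-k)) i l)
    exact ((h3 0 (by decide)).add (h3 1 (by decide))).add (h3 2 (by decide))
  · simp only [hd, Fin.sum_univ_four, (hb.1 _ (show (0 : Fin 4) ≠ 3 by decide)).2,
      (hb.1 _ (show (1 : Fin 4) ≠ 3 by decide)).2, (hb.1 _ (show (2 : Fin 4) ≠ 3 by decide)).2,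
      hb.2, mul_zero, zero_add, mul_one]
    refine (h2.comp_tendsto ht).congr_right fun ζ => ?_
    have := hexp (N + 1) ζ
    push_cast at this
    simp only [Function.comp]
    rw [this, Complex.exp_periodic.sub_int_mul_eq]

/-- By translation only `m = 0` and `m = 1` matter. The expansion of `f₄` holds for `|arg z| <
3π/2`, which covers `Ξ_l`; that of `f₄(e^{-2πi} z)` holds for `π/2 < arg z < 7π/2`, which covers
`Ξ_{l+π}`. -/
theorem isAsymptoticTo_holPhi (Y : CYFamily) (a : ℂ) (C : ℕ → ℂ)
    (h : ∀ α β : ℝ, -(3 * Real.pi / 2) < α → β < 3 * Real.pi / 2 → ∀ N : ℕ,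
      (fun ζ => Y.holF a Y.normConst ζ 3 - ∑ n ∈ Finset.range N, Y.psiTerm a C n ζ 3)
        =o[sectorAtInfinity α β]
          fun ζ => exp (-Y.conifold * exp ζ) * exp (-(N + 1) * ζ)) (m : ℤ) :
    Y.IsAsymptoticTo a C m (Y.holPhi a Y.normConst m) := by
  have hpi := Real.pi_pos
  rcases Int.even_or_odd' m with ⟨n, rfl | rfl⟩
  · have h0 : Y.IsAsymptoticTo a C 0 (Y.holF a Y.normConst) := fun α β hα _ hβ N => by
      push_cast at hα hβ
      exact ⟨fun k hk => Y.isLittleO_holF a C (by linarith) (by linarith) N hk,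
        h α β (by linarith) (by linarith) N⟩
    have := h0.shift n
    rw [add_zero] at this
    simpa only [← holPhi_even] using this
  · have h0 : Y.IsAsymptoticTo a C 1 fun ζ => Y.holF a Y.normConst ζ ᵥ* Y.matKRbar a :=
      fun α β hα _ hβ N => by
        push_cast at hα hβ
        simp only [← holF_twist]
        refine ⟨fun k hk => ?_, ?_⟩
        · refine (Y.isLittleO_holF a C (by linarith) (by linarith) N hk).congr_left fun ζ => ?_
          fin_cases k
          · rfl
          · rfl
          · rfl
          · exact absurd rfl hk
        · have h1 := (h (α - (1 : ℤ) * (2 * Real.pi)) (β - (1 : ℤ) * (2 * Real.pi))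
            (by push_cast; linarith) (by push_cast; linarith) N).comp_tendsto
            (tendsto_sub_sectorAtInfinity α β 1)
          refine h1.congr (fun ζ => ?_) fun ζ => ?_
          · simp only [Function.comp, psiTerm_three_sub]
            simp only [Int.cast_one, one_mul]
            rfl
          · have e : -(N + 1 : ℂ) * (ζ - (1 : ℤ) * (2 * Real.pi * I)) = -(N + 1) * ζ +
                ((N + 1 : ℤ) : ℂ) * (2 * Real.pi * I) := by push_cast; ring
            simp only [Function.comp]
            rw [Complex.exp_periodic.sub_int_mul_eq, e, Complex.exp_periodic.int_mul]
    simpa only [← holPhi_odd] using h0.shift n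

end CYFamily

namespace CYFamily

open MeasureTheory Complex Set

/-! ### Decay of the Gamma quotient on vertical strips -/

theorem norm_Gamma_one_add_mul_I_sq (y : ℝ) :
    ‖Gamma (1 + y * I)‖ ^ 2 * Real.sinh (Real.pi * y) = Real.pi * y := by
  rcases eq_or_ne y 0 with rfl | hy
  · simp
  have hz : (y * I : ℂ) ≠ 0 := by simpa using hy
  have hs : Real.sinh (Real.pi * y) ≠ 0 := by
    rw [Ne, Real.sinh_eq_zero]; exact mul_ne_zero Real.pi_ne_zero hy
  have h1 := Complex.Gamma_mul_Gamma_one_sub (y * I)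
  have h2 : Gamma (1 - y * I) = (starRingEnd ℂ) (Gamma (1 + y * I)) := by
    rw [← Gamma_conj]; simp [sub_eq_add_neg]
  have h3 : Gamma (1 + y * I) = y * I * Gamma (y * I) := by rw [add_comm, Gamma_add_one _ hz]
  have h4 : sin (Real.pi * (y * I)) = (Real.sinh (Real.pi * y) : ℂ) * I := by
    rw [← mul_assoc, Complex.sin_mul_I]; push_cast; rfl
  have h5 : ((‖Gamma (1 + y * I)‖ ^ 2 : ℝ) : ℂ) = Gamma (1 + y * I) * Gamma (1 - y * I) := by
    rw [h2, mul_conj, normSq_eq_norm_sq]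
  have h6 : ((‖Gamma (1 + y * I)‖ ^ 2 : ℝ) : ℂ) * (Real.sinh (Real.pi * y) : ℝ) =
      ((Real.pi * y : ℝ) : ℂ) := by
    have hs' : ((Real.sinh (Real.pi * y) : ℝ) : ℂ) ≠ 0 := ofReal_ne_zero.2 hs
    rw [h5, h3, mul_assoc (y * I : ℂ), h1, h4]
    rw [ofReal_mul]
    generalize ((Real.sinh (Real.pi * y) : ℝ) : ℂ) = S at hs'
    field_simp
  exact_mod_cast h6

theorem sinh_mul_sinh_le {x y : ℝ} (hx : 0 ≤ x) (hy : 0 ≤ y) :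
    Real.sinh x * Real.sinh y ≤ Real.sinh (x + y) := by
  rw [Real.sinh_add]
  have h1 := Real.sinh_nonneg_iff.2 hx
  have h2 := Real.sinh_nonneg_iff.2 hy
  have h3 := (Real.sinh_lt_cosh y).le
  have h4 := Real.cosh_pos x
  nlinarith [mul_le_mul_of_nonneg_left h3 h1]

/-- By `|Γ(1+iy)|² = πy / sinh(πy)` and `∏ sinh(πω_i t) ≤ sinh(πdt)`, the square of the modulus is
at most `d / (π⁴ t⁴ ∏ ω_i)`. Then `d ≤ 5 ∏ ω_i` and `5 ≤ π⁴`. The general strip bound has no decay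
at all, whereas this one makes the integral of `A` absolutely convergent. -/
theorem norm_hypA_mul_I_le (Y : CYFamily) (τ : ℝ) : ‖Y.hypA (τ * I)‖ * τ ^ 2 ≤ 1 := by
  rcases eq_or_ne τ 0 with rfl | hτ
  · simp
  have hpi := Real.pi_gt_three
  set t := |τ| with ht
  have ht0 : 0 < t := abs_pos.2 hτ
  have hG : ∀ w : ℕ, 0 < w → ‖Gamma (1 + w * (τ * I))‖ ^ 2 * Real.sinh (Real.pi * (w * t)) =
      Real.pi * (w * t) := fun w hw => by
    rcases abs_choice τ with h | h
    · have := norm_Gamma_one_add_mul_I_sq (w * t)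
      rw [ht, h] at this ⊢
      push_cast at this
      rw [← mul_assoc]; exact this
    · have := norm_Gamma_one_add_mul_I_sq (-(w * t))
      rw [mul_neg, Real.sinh_neg, mul_neg, neg_inj] at this
      rw [ht, h] at this ⊢
      push_cast at this
      rw [mul_neg, neg_neg] at this
      rw [← mul_assoc]; exact this
  have hS : ∀ w : ℕ, 0 < w → 0 < Real.sinh (Real.pi * (w * t)) := fun w hw => by
    rw [Real.sinh_pos_iff]; have : (0 : ℝ) < w := by exact_mod_cast hw
    positivity
  have hsinh : ∏ i, Real.sinh (Real.pi * (Y.weight i * t)) ≤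
      Real.sinh (Real.pi * (Y.degree * t)) := by
    rw [← sum_weight]
    simp only [Fin.sum_univ_five, Fin.prod_univ_five]
    push_cast
    have hp := fun i => (hS _ (Y.weight_pos i)).le
    have ha : ∀ i, 0 ≤ Real.pi * (Y.weight i * t) := fun i => by positivity
    have key : ∀ x y z : ℝ, 0 ≤ x → 0 ≤ y → z ≤ Real.sinh x →
        z * Real.sinh y ≤ Real.sinh (x + y) := fun x y z hx hy hz =>
      (mul_le_mul_of_nonneg_right hz (Real.sinh_nonneg_iff.2 hy)).trans (sinh_mul_sinh_le hx hy)
    have h1 := key _ _ _ (ha 0) (ha 1) le_rfl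
    have h2 := key _ _ _ (by linarith [ha 0, ha 1]) (ha 2) h1
    have h3 := key _ _ _ (by linarith [ha 0, ha 1, ha 2]) (ha 3) h2
    have h4 := key _ _ _ (by linarith [ha 0, ha 1, ha 2, ha 3]) (ha 4) h3
    refine h4.trans_eq ?_
    congr 1
    ring
  have hA : ‖Y.hypA (τ * I)‖ ^ 2 * ∏ i, ‖Gamma (1 + Y.weight i * (τ * I))‖ ^ 2 =
      ‖Gamma (1 + Y.degree * (τ * I))‖ ^ 2 := by
    rw [Finset.prod_pow, ← norm_prod, ← mul_pow, ← norm_mul, hypA, div_mul_cancel₀]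
    exact Finset.prod_ne_zero_iff.2 fun i _ =>
      Gamma_ne_zero_of_re_pos (Y.weight_re_pos i (by simp))
  have hprod : (∏ i, ‖Gamma (1 + Y.weight i * (τ * I))‖ ^ 2) *
      ∏ i, Real.sinh (Real.pi * (Y.weight i * t)) = ∏ i, Real.pi * (Y.weight i * t) := by
    rw [← Finset.prod_mul_distrib]
    exact Finset.prod_congr rfl fun i _ => hG _ (Y.weight_pos i)
  have hd := hG _ Y.degree_pos
  have hSd := hS _ Y.degree_pos
  have hmain : ‖Y.hypA (τ * I)‖ ^ 2 * ∏ i, Real.pi * (Y.weight i * t) ≤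
      Real.pi * (Y.degree * t) := by
    rw [← hprod, ← mul_assoc, hA, ← hd]
    gcongr
  have hw : (Y.degree : ℝ) ≤ 5 * ∏ i, (Y.weight i : ℝ) := by
    cases Y <;> simp [degree, weight, Fin.prod_univ_five] <;> norm_num
  have hw0 : 0 < ∏ i, (Y.weight i : ℝ) :=
    Finset.prod_pos fun i _ => by exact_mod_cast Y.weight_pos i
  rw [Finset.prod_mul_distrib, Finset.prod_mul_distrib] at hmain
  simp only [Finset.prod_const, Finset.card_univ, Fintype.card_fin] at hmain
  set P := ∏ i, (Y.weight i : ℝ)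
  set X := ‖Y.hypA (τ * I)‖
  have h1 : (X * t ^ 2) ^ 2 * (Real.pi ^ 4 * (Real.pi * t * P)) ≤ 5 * (Real.pi * t * P) := by
    calc _ = X ^ 2 * (Real.pi ^ 5 * (P * t ^ 5)) := by ring
      _ ≤ _ := hmain
      _ ≤ Real.pi * (5 * P * t) := by gcongr
      _ = _ := by ring
  have h2 : (X * t ^ 2) ^ 2 * Real.pi ^ 4 ≤ 5 := by
    have : 0 < Real.pi * t * P := by positivity
    rw [← mul_assoc] at h1
    exact le_of_mul_le_mul_right h1 this
  have h3 : (5 : ℝ) ≤ Real.pi ^ 4 := by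
    have : (3 : ℝ) ^ 4 ≤ Real.pi ^ 4 := by gcongr
    linarith
  rw [← sq_abs τ]
  have h4 : (X * t ^ 2) ^ 2 ≤ 1 := by
    by_contra h
    nlinarith
  exact (abs_le_one_iff_mul_self_le_one.2 (by nlinarith)).trans' (le_abs_self _)

/-- Phragmén–Lindelöf for `A(s)(s+1)²` on the strip `0 ≤ Re s ≤ 1`: the left edge is the estimate on
the imaginary axis, and the right edge follows from it by one step of the recurrence. -/
theorem exists_hypA_bound (Y : CYFamily) : ∃ C : ℝ, 0 ≤ C ∧ ∀ s : ℂ, 0 ≤ s.re → s.re ≤ 1 →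
    ‖Y.hypA s‖ * (1 + s.im ^ 2) ≤ C := by
  have hcont : Continuous fun τ : ℝ => Y.hypA (τ * I) :=
    Y.differentiableOn_hypA.continuousOn.comp_continuous (by fun_prop) fun τ => by simp
  obtain ⟨D, hD⟩ := (isCompact_Icc (a := (-1 : ℝ)) (b := 1)).exists_bound_of_continuousOn
    hcont.continuousOn
  have h0 : ∀ τ : ℝ, ‖Y.hypA (τ * I)‖ * (1 + τ ^ 2) ≤ 2 + 2 * |D| := fun τ => by
    have h1 := Y.norm_hypA_mul_I_le τ
    rcases le_total |τ| 1 with h | h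
    · have h2 := (hD τ (abs_le.1 h)).trans (le_abs_self D)
      linarith [abs_nonneg D]
    · have h2 : 1 ≤ τ ^ 2 := by rw [← sq_abs]; nlinarith
      nlinarith [norm_nonneg (Y.hypA (τ * I)), abs_nonneg D]
  have hx := Y.conifold_pos
  obtain ⟨C₁, hC₁⟩ := Y.hypA_bound 1 1 one_pos
  set M := (2 + 2 * |D|) * max 1 (4 / Y.conifold) with hM
  have hM0 : 0 ≤ M := by positivity
  refine ⟨M, hM0, fun s h1 h2 => ?_⟩
  have hPL : ‖Y.hypA s * (s + 1) ^ 2‖ ≤ M := by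
    refine PhragmenLindelof.vertical_strip (f := fun s => Y.hypA s * (s + 1) ^ 2) (a := 0) (b := 1)
      ?_ ?_ ?_ ?_ h1 h2
    · refine DifferentiableOn.diffContOnCl ?_
      have hcl : closure (re ⁻¹' Ioo (0 : ℝ) 1) ⊆ {s : ℂ | -(1 / 10) < s.re} := by
        refine (closure_mono (t := re ⁻¹' Icc (0 : ℝ) 1)
          (preimage_mono Ioo_subset_Icc_self)).trans ?_
        rw [(isClosed_Icc.preimage continuous_re).closure_eq]
        exact fun s hs => lt_of_lt_of_le (by norm_num) hs.1
      exact (Y.differentiableOn_hypA.mono hcl).mul (by fun_prop)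
    -- In a strip of width `1` growth up to `exp (B e^{c|Im z|})` with `c < π` is allowed. Here `c =
    -- 1` and `B = 3`: one unit from `A` and two from the square.
    · refine ⟨1, by rw [sub_zero, div_one]; linarith [Real.pi_gt_three], 3, ?_⟩
      refine IsBigO.of_bound (4 * |C₁|) ?_
      rw [eventually_inf_principal]
      refine Eventually.of_forall fun z hz => ?_
      have e1 := hC₁ z (by linarith [hz.1]) hz.2.le
      have e2 : ‖z + 1‖ ≤ 2 * Real.exp |z.im| := by
        have := Complex.norm_le_abs_re_add_abs_im (z + 1)
        have h3 : |(z + 1).re| ≤ 2 := by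
          rw [abs_le]; simp; constructor <;> linarith [hz.1, hz.2]
        have h4 : (z + 1).im = z.im := by simp
        rw [h4] at this
        have h5 := Real.add_one_le_exp |z.im|
        linarith [abs_nonneg z.im]
      have e3 : |z.im| ≤ Real.exp |z.im| := by linarith [Real.add_one_le_exp |z.im|]
      rw [norm_mul, norm_pow, Real.norm_of_nonneg (Real.exp_pos _).le, one_mul]
      calc ‖Y.hypA z‖ * ‖z + 1‖ ^ 2 ≤ (|C₁| * Real.exp (-(0 - 1) * |z.im|)) *
            (2 * Real.exp |z.im|) ^ 2 := by
            gcongr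
            exact e1.trans (by gcongr; exact le_abs_self _)
        _ = 4 * |C₁| * Real.exp (3 * |z.im|) := by
            have : Real.exp (3 * |z.im|) = Real.exp (-(0 - 1) * |z.im|) * Real.exp |z.im| ^ 2 := by
              rw [← Real.exp_nat_mul, ← Real.exp_add]; congr 1; push_cast; ring
            rw [this]; ring
        _ ≤ _ := by gcongr
    · intro z hz
      have e : z = z.im * I := by apply Complex.ext <;> simp [hz]
      have e1 := h0 z.im
      rw [← e] at e1
      have e2 : ‖z + 1‖ ^ 2 = 1 + z.im ^ 2 := by
        rw [← normSq_eq_norm_sq, normSq_apply]; simp [hz]; ring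
      rw [norm_mul, norm_pow, e2]
      exact e1.trans (le_mul_of_one_le_right (by positivity) (le_max_left _ _))
    · intro z hz
      have e : z = z.im * I + 1 := by apply Complex.ext <;> simp [hz]
      have e1 := h0 z.im
      have e2 : ‖z + 1‖ ^ 2 = 4 + z.im ^ 2 := by
        rw [← normSq_eq_norm_sq, normSq_apply]; simp [hz]; ring
      have e3 := Y.isWeight_hypA.norm_add_one_le (s := z.im * I) (by simp)
      rw [← e] at e3
      rw [norm_mul, norm_pow, e2]
      calc _ ≤ ‖Y.hypA (z.im * I)‖ / Y.conifold * (4 * (1 + z.im ^ 2)) := by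
            gcongr; nlinarith [sq_nonneg z.im]
        _ = ‖Y.hypA (z.im * I)‖ * (1 + z.im ^ 2) * (4 / Y.conifold) := by ring
        _ ≤ _ := by rw [hM]; gcongr; exact le_max_right _ _
  refine le_trans ?_ hPL
  rw [norm_mul, norm_pow]
  gcongr
  rw [← normSq_eq_norm_sq, normSq_apply]
  simp
  nlinarith

/-! ### The Mellin inverse of the Gamma quotient -/

/-- `-i ∫ A(i τ) exp (i τ y) dτ`. -/
def cutPeriod (Y : CYFamily) (y : ℝ) : ℂ := -I * lineInt 0 fun s => Y.hypA s * exp (s * y)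

theorem exists_hypA_line_bound (Y : CYFamily) : ∃ C : ℝ, 0 ≤ C ∧ ∀ (n : ℕ) (s : ℂ), 0 ≤ s.re →
    s.re ≤ 1 → ‖Y.hypA (s + n)‖ ≤ C * (1 + s.im ^ 2)⁻¹ * Y.conifold⁻¹ ^ n := by
  obtain ⟨C, hC, h⟩ := Y.exists_hypA_bound
  refine ⟨C, hC, fun n s h1 h2 => ?_⟩
  have hx := Y.conifold_pos
  refine (Y.isWeight_hypA.norm_add_nat_le (by norm_num [base]; linarith) n).trans ?_
  gcongr
  rw [← div_eq_mul_inv, le_div_iff₀ (by positivity)]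
  exact h s h1 h2

theorem integrable_hypA_line (Y : CYFamily) (n : ℕ) (y : ℝ) :
    Integrable fun τ : ℝ => Y.hypA (τ * I + n) * exp ((τ * I + n) * y) := by
  obtain ⟨C, hC, h⟩ := Y.exists_hypA_line_bound
  have hcont : Continuous fun τ : ℝ => Y.hypA (τ * I + n) :=
    Y.differentiableOn_hypA.continuousOn.comp_continuous (by fun_prop) fun τ => by
      simp; linarith [n.cast_nonneg (α := ℝ)]
  refine (integrable_inv_one_add_sq.const_mul (C * Y.conifold⁻¹ ^ n * Real.exp (n * y))).mono'
    (by fun_prop) (Eventually.of_forall fun τ => ?_)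
  have := h n (τ * I) (by simp) (by simp)
  rw [norm_mul, norm_exp]
  have e : ((τ * I + n : ℂ) * y).re = n * y := by simp
  have e2 : ((τ * I : ℂ)).im = τ := by simp
  rw [e2] at this
  rw [e]
  calc _ ≤ C * (1 + τ ^ 2)⁻¹ * Y.conifold⁻¹ ^ n * Real.exp (n * y) := by gcongr
    _ = _ := by ring

/-- `A` has no poles to the right of the imaginary axis, so the contour moves freely by `n`. -/
theorem cutPeriod_eq_line (Y : CYFamily) (n : ℕ) (y : ℝ) :
    Y.cutPeriod y = -I * ∫ τ : ℝ, Y.hypA (τ * I + n) * exp ((τ * I + n) * y) := by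
  obtain ⟨C, hC, h⟩ := Y.exists_hypA_line_bound
  induction n with
  | zero => simp [cutPeriod, lineInt]
  | succ n ih =>
    rw [ih]
    congr 1
    have hx := Y.conifold_pos
    have key := lineInt_sub_lineInt (ι := Empty) (c₁ := 0) (c₂ := 1) (p := 1 / 2) (by norm_num)
      (by norm_num) (q := fun _ => 0) (fun i => i.elim) (fun i => i.elim)
      (f := fun s => Y.hypA (s + n) * exp ((s + n) * y))
      (hol := fun s => Y.hypA (s + n) * exp ((s + n) * y)) (a₀ := fun _ => 0) (m := 0)
      (a := fun _ => 0) ?_ (fun s _ _ _ => by simp) ?_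
    · have h2 := key.2.2
      simp only [Finset.univ_eq_empty, Finset.sum_empty, mul_zero] at h2
      have h3 := sub_eq_zero.1 h2
      simp only [lineInt, ofReal_zero, zero_add, ofReal_one] at h3
      rw [← h3]
      refine integral_congr_ae (Eventually.of_forall fun τ => ?_)
      have : (1 : ℂ) + τ * I + n = τ * I + (n + 1 : ℕ) := by push_cast; ring
      simp only [this]
    · refine DifferentiableOn.mul (Y.differentiableOn_hypA.comp (by fun_prop) fun s hs => ?_)
        (by fun_prop)
      have h1 : (0 : ℝ) ≤ s.re := hs.1
      simp only [mem_ofPred_eq, add_re, natCast_re]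
      linarith [n.cast_nonneg (α := ℝ)]
    · refine ⟨C * Y.conifold⁻¹ ^ n * Real.exp ((1 + n) * |y|), fun s hs h1 => ?_⟩
      have e1 := h n s hs.1 hs.2
      have e2 : ((s + n) * (y : ℂ)).re ≤ (1 + n) * |y| := by
        have : ((s + n) * (y : ℂ)).re = (s.re + n) * y := by simp
        rw [this]
        refine (le_abs_self _).trans ?_
        rw [abs_mul, abs_of_nonneg (by linarith [hs.1, n.cast_nonneg (α := ℝ)])]
        gcongr
        exact hs.2
      have h0 : 0 < s.im ^ 2 := by
        have : s.im ≠ 0 := fun h => by rw [h] at h1; norm_num at h1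
        positivity
      rw [norm_mul, norm_exp]
      calc _ ≤ (C * (1 + s.im ^ 2)⁻¹ * Y.conifold⁻¹ ^ n) * Real.exp ((1 + n) * |y|) := by gcongr
        _ ≤ (C * (s.im ^ 2)⁻¹ * Y.conifold⁻¹ ^ n) * Real.exp ((1 + n) * |y|) := by
            gcongr; linarith
        _ = _ := by rw [div_eq_mul_inv]; ring

/-- On the line of abscissa `n` the integral is `O((e^y / x_c)^n)`. Letting `n → ∞` kills it for
`e^y < x_c`. -/
theorem cutPeriod_eq_zero (Y : CYFamily) {y : ℝ} (hy : y < Real.log Y.conifold) :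
    Y.cutPeriod y = 0 := by
  obtain ⟨C, hC, h⟩ := Y.exists_hypA_line_bound
  have hx : Real.exp y * Y.conifold⁻¹ < 1 := by
    rw [← div_eq_mul_inv, div_lt_one Y.conifold_pos, ← Real.lt_log_iff_exp_lt Y.conifold_pos]
    exact hy
  have hx0 : 0 ≤ Real.exp y * Y.conifold⁻¹ :=
    mul_nonneg (Real.exp_pos _).le (inv_nonneg.2 Y.conifold_pos.le)
  have hb : ∀ n : ℕ, ‖Y.cutPeriod y‖ ≤ (C * ∫ τ : ℝ, (1 + τ ^ 2)⁻¹) *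
      (Real.exp y * Y.conifold⁻¹) ^ n := fun n => by
    rw [Y.cutPeriod_eq_line n, norm_mul, norm_neg, norm_I, one_mul, ← integral_const_mul,
      ← integral_mul_const]
    refine norm_integral_le_of_norm_le ((integrable_inv_one_add_sq.const_mul _).mul_const _)
      (Eventually.of_forall fun τ => ?_)
    have := h n (τ * I) (by simp) (by simp)
    rw [norm_mul, norm_exp]
    have e : ((τ * I + n : ℂ) * y).re = n * y := by simp
    have e2 : ((τ * I : ℂ)).im = τ := by simp
    rw [e2] at this
    rw [e, mul_pow, ← Real.exp_nat_mul]
    calc _ ≤ C * (1 + τ ^ 2)⁻¹ * Y.conifold⁻¹ ^ n * Real.exp (n * y) := by gcongr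
      _ = _ := by ring
  have hlim := (tendsto_pow_atTop_nhds_zero_of_lt_one hx0 hx).const_mul
    (C * ∫ τ : ℝ, (1 + τ ^ 2)⁻¹)
  rw [mul_zero] at hlim
  exact norm_le_zero_iff.1 (ge_of_tendsto' hlim hb)

theorem continuous_cutPeriod (Y : CYFamily) : Continuous Y.cutPeriod := by
  refine continuous_const.mul ?_
  unfold lineInt
  have h0 := (Y.integrable_hypA_line 0 0).norm
  refine continuous_of_dominated (bound := fun τ : ℝ =>
    ‖Y.hypA (τ * I + (0 : ℕ)) * exp ((τ * I + (0 : ℕ)) * (0 : ℝ))‖) (fun y => ?_) (fun y => ?_) h0 ?_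
  · simpa using (Y.integrable_hypA_line 0 y).aestronglyMeasurable
  · exact Eventually.of_forall fun τ => by simp [norm_exp]
  · exact Eventually.of_forall fun τ => by fun_prop

/-- Moving the line to the left with the constant kernel `2πi` gives `∑_i 2πi P_i`, which is the
fourth period by `vanishingPeriod_eq_sum_piece`. A constant kernel has no pole, so `q = 1/20` is an
arbitrary point of the strip that avoids the `π_i`. -/
theorem cutPeriod_eq_vanishingPeriod (Y : CYFamily) {y : ℝ} (hy : Real.log Y.conifold < y) :
    Y.cutPeriod y = Y.vanishingPeriod y := by
  have hpi : (Real.pi : ℂ) ≠ 0 := ofReal_ne_zero.2 Real.pi_ne_zero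
  obtain ⟨C, hC, h⟩ := Y.exists_hypA_line_bound
  have := Y.isWeight_hypA.lineInt_eq_sum_piece (κ := fun _ => 2 * Real.pi * I) (c := 0)
    (q := 1 / 20) le_rfl (by norm_num) le_rfl (by norm_num) (by norm_num)
    (fun i => by linarith [(Y.pole_mem i).1]) (κr := fun s => 2 * Real.pi * I * s ^ 4)
    (fun _ => rfl) (by fun_prop) (fun _ _ _ => rfl) Y.isRatioBound_four (η := y) ?_
    (Y.summable_ratioBound_four (by simpa using hy))
  · rw [Y.vanishingPeriod_eq_sum_piece (by simpa using hy) (by simp [Real.pi_pos]), ← this,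
      cutPeriod]
    have e : lineInt 0 (fun s => 2 * Real.pi * I * (Y.hypA s * exp (s * y))) =
        2 * Real.pi * I * lineInt 0 fun s => Y.hypA s * exp (s * y) := by
      simp only [lineInt, integral_const_mul]
    rw [e]
    generalize lineInt 0 (fun s => Y.hypA s * exp (s * y)) = X
    field_simp
  · refine ⟨2 * Real.pi * (C * Real.exp |y|), fun s hs h1 => ?_⟩
    have e1 := h 0 s hs.1 (by simpa using hs.2)
    have h0 : 0 < s.im ^ 2 := by
      have : s.im ≠ 0 := fun h => by rw [h] at h1; norm_num at h1
      positivity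
    have e2 : (s * (y : ℂ)).re ≤ |y| := by
      have : (s * (y : ℂ)).re = s.re * y := by simp
      rw [this]
      refine (le_abs_self _).trans ?_
      rw [abs_mul, abs_of_nonneg hs.1]
      exact mul_le_of_le_one_left (abs_nonneg _) (by simpa using hs.2)
    rw [Nat.cast_zero, add_zero, pow_zero, mul_one] at e1
    have e3 : ‖(2 * Real.pi * I : ℂ)‖ = 2 * Real.pi := by simp [abs_of_pos Real.pi_pos]
    rw [norm_mul, norm_mul, norm_exp, e3]
    calc _ ≤ 2 * Real.pi * (C * (1 + s.im ^ 2)⁻¹) * Real.exp |y| := by gcongr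
      _ ≤ 2 * Real.pi * (C * (s.im ^ 2)⁻¹) * Real.exp |y| := by gcongr; linarith
      _ = _ := by rw [div_eq_mul_inv]; ring

end CYFamily

section RayIntegrals

open MeasureTheory Complex Set

/-! ### Laplace integrals along rays -/

theorem integral_exp_smul_comp_exp (g : ℝ → ℂ) :
    ∫ τ : ℝ, Real.exp τ • g (Real.exp τ) = ∫ t in Ioi (0 : ℝ), g t := by
  have h := integral_image_eq_integral_abs_deriv_smul (s := univ) (f := Real.exp) (f' := Real.exp)
    MeasurableSet.univ (fun x _ => (Real.hasDerivAt_exp x).hasDerivWithinAt)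
    Real.exp_injective.injOn g
  rw [image_univ, Real.range_exp] at h
  rw [h]
  simp [abs_of_pos (Real.exp_pos _)]

theorem integrable_exp_mul_exp_neg {b : ℝ} (hb : 0 < b) (M : ℕ) :
    Integrable fun τ : ℝ => Real.exp τ ^ (M + 1) * Real.exp (-(b * Real.exp τ)) := by
  have h := integrableOn_image_iff_integrableOn_abs_deriv_smul (s := univ) (f := Real.exp)
    (f' := Real.exp) MeasurableSet.univ (fun x _ => (Real.hasDerivAt_exp x).hasDerivWithinAt)
    Real.exp_injective.injOn fun t : ℝ => t ^ ((M + 1 : ℝ) - 1) * Real.exp (-(b * t))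
  rw [image_univ, Real.range_exp] at h
  have h2 := h.1 (integrableOn_rpow_mul_exp_neg (by positivity) hb)
  rw [integrableOn_univ] at h2
  refine h2.congr (Eventually.of_forall fun τ => ?_)
  simp only [abs_of_pos (Real.exp_pos _), smul_eq_mul, add_sub_cancel_right, Real.rpow_natCast]
  ring

theorem integral_exp_mul_exp_neg {b : ℝ} (hb : 0 < b) (M : ℕ) :
    ∫ τ : ℝ, Real.exp τ ^ (M + 1) * Real.exp (-(b * Real.exp τ)) = M.factorial / b ^ (M + 1) := by
  have h := integral_image_eq_integral_abs_deriv_smul (s := univ) (f := Real.exp)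
    (f' := Real.exp) MeasurableSet.univ (fun x _ => (Real.hasDerivAt_exp x).hasDerivWithinAt)
    Real.exp_injective.injOn fun t : ℝ => t ^ ((M + 1 : ℝ) - 1) * Real.exp (-(b * t))
  rw [image_univ, Real.range_exp, Real.integral_rpow_mul_exp_neg_mul_Ioi (by positivity) hb,
    Real.Gamma_nat_eq_factorial] at h
  have e : ((M : ℝ) + 1) = ((M + 1 : ℕ) : ℝ) := by push_cast; ring
  rw [e, Real.rpow_natCast] at h
  rw [setIntegral_univ] at h
  rw [div_eq_mul_inv, ← inv_pow, ← one_div, mul_comm, h]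
  refine integral_congr_ae (Eventually.of_forall fun τ => ?_)
  push_cast
  simp only [abs_of_pos (Real.exp_pos _), smul_eq_mul, add_sub_cancel_right, Real.rpow_natCast]
  ring

theorem exp_mul_exp_neg_le {b : ℝ} (hb : 0 < b) {τ : ℝ} (hτ : τ ≠ 0) :
    Real.exp τ * Real.exp (-(b * Real.exp τ)) ≤ (2 + 6 / b ^ 3) / τ ^ 2 := by
  have h2 : 0 < τ ^ 2 := by positivity
  rw [le_div_iff₀ h2]
  rcases le_total τ 0 with h | h
  · have h1 : Real.exp (-(b * Real.exp τ)) ≤ 1 := Real.exp_le_one_iff.2 (by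
      have := Real.exp_pos τ; nlinarith)
    have h3 := Real.quadratic_le_exp_of_nonneg (x := -τ) (by linarith)
    have h4 : Real.exp τ * Real.exp (-τ) = 1 := by rw [← Real.exp_add]; simp
    have h5 : τ ^ 2 * Real.exp τ ≤ 2 := by nlinarith [Real.exp_pos τ]
    have h6 : 0 ≤ 6 / b ^ 3 := by positivity
    nlinarith [Real.exp_pos τ, mul_le_mul_of_nonneg_left h1
      (mul_nonneg (Real.exp_pos τ).le h2.le)]
  · set x := Real.exp τ with hx
    have hx1 : τ ≤ x := by linarith [Real.add_one_le_exp τ]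
    have hx0 : 0 < x := Real.exp_pos τ
    have h3 := Real.pow_div_factorial_le_exp (b * x) (by positivity) 3
    have h4 : Real.exp (b * x) * Real.exp (-(b * x)) = 1 := by rw [← Real.exp_add]; simp
    have h5 : x ^ 3 * Real.exp (-(b * x)) ≤ 6 / b ^ 3 := by
      rw [le_div_iff₀ (by positivity)]
      have h6 : ((3).factorial : ℝ) = 6 := by norm_num [Nat.factorial]
      rw [h6, div_le_iff₀ (by norm_num)] at h3
      calc x ^ 3 * Real.exp (-(b * x)) * b ^ 3 = (b * x) ^ 3 * Real.exp (-(b * x)) := by ring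
        _ ≤ Real.exp (b * x) * 6 * Real.exp (-(b * x)) := by gcongr
        _ = 6 := by linear_combination 6 * h4
    calc x * Real.exp (-(b * x)) * τ ^ 2 ≤ x * Real.exp (-(b * x)) * x ^ 2 := by gcongr
      _ = x ^ 3 * Real.exp (-(b * x)) := by ring
      _ ≤ 6 / b ^ 3 := h5
      _ ≤ _ := by linarith

/-- The integrand `h(w) exp (-z w) dw` in the coordinates `w = exp u`, `z = exp ζ`. -/
def laplaceKer (h : ℂ → ℂ) (ζ u : ℂ) : ℂ := h (exp u) * (exp u * exp (-exp (ζ + u)))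

/-- The Laplace integral of `h` along the ray `arg w = φ`, with `z = exp ζ`. -/
def rayInt (h : ℂ → ℂ) (φ : ℝ) (ζ : ℂ) : ℂ := ∫ τ : ℝ, laplaceKer h ζ (τ + φ * I)

theorem norm_exp_neg_exp (w : ℂ) :
    ‖exp (-exp w)‖ = Real.exp (-(Real.exp w.re * Real.cos w.im)) := by
  rw [norm_exp, neg_re, exp_re]

theorem norm_laplaceKer_le {h : ℂ → ℂ} {C : ℝ} {M : ℕ} {ζ u : ℂ}
    (hb : ‖h (exp u)‖ ≤ C * Real.exp u.re ^ M) {b : ℝ}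
    (hζ : b ≤ Real.exp ζ.re * Real.cos (ζ.im + u.im)) :
    ‖laplaceKer h ζ u‖ ≤ C * (Real.exp u.re ^ (M + 1) * Real.exp (-(b * Real.exp u.re))) := by
  have hC : 0 ≤ C * Real.exp u.re ^ M := (norm_nonneg _).trans hb
  rw [laplaceKer, norm_mul, norm_mul, norm_exp_neg_exp, norm_exp, add_re, add_im, Real.exp_add]
  calc _ ≤ C * Real.exp u.re ^ M * (Real.exp u.re * Real.exp (-(b * Real.exp u.re))) := by
        gcongr ?_ * (_ * Real.exp (-?_))
        have := mul_le_mul_of_nonneg_right hζ (Real.exp_pos u.re).le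
        linarith
    _ = _ := by ring

theorem cos_pos_of_abs_lt {x : ℝ} (hx : |x| < Real.pi / 2) : 0 < Real.cos x :=
  Real.cos_pos_of_mem_Ioo (abs_lt.1 hx)

theorem integrable_laplaceKer {h : ℂ → ℂ} {φ : ℝ} {ζ : ℂ} (hζ : |ζ.im + φ| < Real.pi / 2)
    (hc : Continuous fun τ : ℝ => h (exp (τ + φ * I))) {C : ℝ} {M : ℕ}
    (hb : ∀ τ : ℝ, ‖h (exp (τ + φ * I))‖ ≤ C * Real.exp τ ^ M) :
    Integrable fun τ : ℝ => laplaceKer h ζ (τ + φ * I) := by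
  have hpos := mul_pos (Real.exp_pos ζ.re) (cos_pos_of_abs_lt hζ)
  refine ((integrable_exp_mul_exp_neg hpos M).const_mul C).mono' ?_ (Eventually.of_forall fun τ => ?_)
  · refine Continuous.aestronglyMeasurable ?_
    exact hc.mul (by fun_prop)
  · have := norm_laplaceKer_le (h := h) (C := C) (M := M) (ζ := ζ) (u := τ + φ * I)
      (by simpa using hb τ) (b := Real.exp ζ.re * Real.cos (ζ.im + φ)) (by simp)
    simpa using this

theorem norm_rayInt_le {h : ℂ → ℂ} {φ : ℝ} {ζ : ℂ} (hζ : |ζ.im + φ| < Real.pi / 2) {C : ℝ} {M : ℕ}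
    (hb : ∀ τ : ℝ, ‖h (exp (τ + φ * I))‖ ≤ C * Real.exp τ ^ M) :
    ‖rayInt h φ ζ‖ ≤
      C * (M.factorial / (Real.exp ζ.re * Real.cos (ζ.im + φ)) ^ (M + 1)) := by
  have hpos := mul_pos (Real.exp_pos ζ.re) (cos_pos_of_abs_lt hζ)
  rw [← integral_exp_mul_exp_neg hpos, ← integral_const_mul]
  refine norm_integral_le_of_norm_le ((integrable_exp_mul_exp_neg hpos M).const_mul C)
    (Eventually.of_forall fun τ => ?_)
  have := norm_laplaceKer_le (h := h) (C := C) (M := M) (ζ := ζ) (u := τ + φ * I)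
    (by simpa using hb τ) (b := Real.exp ζ.re * Real.cos (ζ.im + φ)) (by simp)
  simpa using this

/-- In the variable `t = |w|` this is Euler's integral with the complex parameter `r = exp (ζ +
φi)`, whose real part is positive by the condition on the angle. -/
theorem rayInt_pow {φ : ℝ} {ζ : ℂ} (hζ : |ζ.im + φ| < Real.pi / 2) (n : ℕ) :
    rayInt (fun w => w ^ n) φ ζ = n.factorial * exp (-(n + 1) * ζ) := by
  set r := exp (ζ + φ * I) with hr
  have hr0 : 0 < r.re := by
    rw [hr, exp_re]
    have := mul_pos (Real.exp_pos (ζ + φ * I).re) (cos_pos_of_abs_lt hζ)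
    simpa using this
  have h1 := integral_cpow_mul_exp_neg_mul_Ioi_of_re_pos (a := n + 1) (r := r)
    (by simp; positivity) hr0
  have h2 : exp (-((n + 1) * log r)) = exp (-(n + 1) * ζ) * exp (-((n + 1) * (φ * I))) := by
    have : exp ((n + 1) * log r) = r ^ (n + 1) := by
      have h3 : ((n : ℂ) + 1) * log r = (n + 1 : ℕ) * log r := by push_cast; ring
      rw [h3, exp_nat_mul, exp_log]
      exact exp_ne_zero _
    rw [Complex.exp_neg, this, hr, ← exp_nat_mul, ← Complex.exp_neg, ← Complex.exp_add]
    congr 1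
    push_cast
    ring
  have h3 : rayInt (fun w => w ^ n) φ ζ = exp ((n + 1) * (φ * I)) *
      ∫ t in Ioi (0 : ℝ), (t : ℂ) ^ ((n + 1 : ℂ) - 1) * exp (-(r * t)) := by
    rw [← integral_exp_smul_comp_exp, rayInt, ← integral_const_mul]
    refine integral_congr_ae (Eventually.of_forall fun τ => ?_)
    have e1 : exp ((n + 1) * (φ * I)) = exp (φ * I) ^ n * exp (φ * I) := by
      rw [← pow_succ, ← exp_nat_mul]; push_cast; rfl
    have e2 : exp (ζ + (τ + φ * I)) = r * exp τ := by
      rw [hr, ← Complex.exp_add]; congr 1; ring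
    simp only [laplaceKer, real_smul, ofReal_exp, add_sub_cancel_right, cpow_natCast, e1, e2,
      Complex.exp_add (τ : ℂ)]
    ring
  rw [h3, h1, h2, Gamma_nat_eq_factorial]
  have h4 : exp ((n + 1) * (φ * I)) * exp (-((n + 1) * (φ * I))) = 1 := by
    rw [← Complex.exp_add]; simp
  linear_combination exp (-(n + 1) * ζ) * n.factorial * h4

theorem rayInt_sub_sum {h : ℂ → ℂ} {φ : ℝ} {ζ : ℂ} (hζ : |ζ.im + φ| < Real.pi / 2)
    (hc : Continuous fun τ : ℝ => h (exp (τ + φ * I))) {C : ℝ}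
    (hb : ∀ τ : ℝ, ‖h (exp (τ + φ * I))‖ ≤ C) (v : ℕ → ℂ) (M : ℕ) :
    rayInt h φ ζ - ∑ n ∈ Finset.range M, v n * (n.factorial * exp (-(n + 1) * ζ)) =
      rayInt (fun w => h w - ∑ n ∈ Finset.range M, v n * w ^ n) φ ζ := by
  have hi := integrable_laplaceKer hζ hc (M := 0) (C := C) (fun τ => by simpa using hb τ)
  have hp : ∀ n : ℕ, Integrable fun τ : ℝ => laplaceKer (fun w => w ^ n) ζ (τ + φ * I) := fun n =>
    integrable_laplaceKer hζ (by fun_prop) (M := n) (C := 1) fun τ => by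
      rw [norm_pow, norm_exp]; simp
  simp only [← rayInt_pow hζ]
  unfold rayInt
  simp only [← integral_const_mul]
  rw [← integral_finsetSum _ fun n _ => (hp n).const_mul _, ← integral_sub hi
    (integrable_finsetSum _ fun n _ => (hp n).const_mul _)]
  refine integral_congr_ae (Eventually.of_forall fun τ => ?_)
  simp only [laplaceKer, sub_mul, Finset.sum_mul, mul_assoc]

/-- Near `0` this is the local Taylor estimate. For `‖w‖ ≥ r` both the bounded function and the
monomials of degree below `M` are dominated by a multiple of `(‖w‖ / r)^M`. -/
theorem exists_taylor_bound {h : ℂ → ℂ} {p : FormalMultilinearSeries ℂ ℂ ℂ}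
    (hp : HasFPowerSeriesAt h p 0) {S : Set ℂ} {C : ℝ} (hb : ∀ w ∈ S, ‖h w‖ ≤ C) (M : ℕ) :
    ∃ D : ℝ, ∀ w ∈ S, ‖h w - ∑ n ∈ Finset.range M, p.coeff n * w ^ n‖ ≤ D * ‖w‖ ^ M := by
  have h1 := hp.isBigO_sub_partialSum_pow M
  obtain ⟨D, hD⟩ := h1.bound
  obtain ⟨r, hr, hball⟩ := Metric.eventually_nhds_iff_ball.1 hD
  refine ⟨max D ((|C| + ∑ n ∈ Finset.range M, ‖p.coeff n‖ * r ^ n) / r ^ M), fun w hw => ?_⟩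
  have hs : ∑ n ∈ Finset.range M, p.coeff n * w ^ n = p.partialSum M w := by
    rw [FormalMultilinearSeries.partialSum]
    exact Finset.sum_congr rfl fun n _ => by
      rw [FormalMultilinearSeries.apply_eq_pow_smul_coeff, smul_eq_mul, mul_comm]
  rcases lt_or_ge ‖w‖ r with hwr | hwr
  · have := hball w (by simpa using hwr)
    rw [zero_add, ← hs, Real.norm_of_nonneg (by positivity)] at this
    exact this.trans (by gcongr; exact le_max_left _ _)
  · have hq : 1 ≤ ‖w‖ / r := (one_le_div hr).2 hwr
    have h2 : ‖h w - ∑ n ∈ Finset.range M, p.coeff n * w ^ n‖ ≤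
        (|C| + ∑ n ∈ Finset.range M, ‖p.coeff n‖ * r ^ n) * (‖w‖ / r) ^ M := by
      refine (norm_sub_le _ _).trans ?_
      rw [add_mul, Finset.sum_mul]
      refine add_le_add ?_ ((norm_sum_le _ _).trans (Finset.sum_le_sum fun n hn => ?_))
      · exact ((hb w hw).trans (le_abs_self C)).trans
          (le_mul_of_one_le_right (abs_nonneg C) (one_le_pow₀ hq))
      · have e : ‖w‖ ^ n = r ^ n * (‖w‖ / r) ^ n := by rw [← mul_pow]; congr 1; field_simp
        rw [norm_mul, norm_pow, e, mul_assoc]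
        gcongr _ * (_ * ?_)
        exact pow_le_pow_right₀ hq (Finset.mem_range.1 hn).le
    refine h2.trans ?_
    rw [div_pow, mul_div_assoc', ← div_mul_eq_mul_div]
    gcongr
    exact le_max_right _ _

/-- Watson's lemma. -/
theorem exists_watson_bound {h : ℂ → ℂ} {p : FormalMultilinearSeries ℂ ℂ ℂ}
    (hp : HasFPowerSeriesAt h p 0) {φ : ℝ} (hc : Continuous fun τ : ℝ => h (exp (τ + φ * I)))
    {C : ℝ} (hb : ∀ τ : ℝ, ‖h (exp (τ + φ * I))‖ ≤ C) (M : ℕ) :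
    ∃ D : ℝ, ∀ ζ : ℂ, |ζ.im + φ| < Real.pi / 2 →
      ‖rayInt h φ ζ - ∑ n ∈ Finset.range M, p.coeff n * (n.factorial * exp (-(n + 1) * ζ))‖ ≤
        D * (M.factorial / (Real.exp ζ.re * Real.cos (ζ.im + φ)) ^ (M + 1)) := by
  obtain ⟨D, hD⟩ := exists_taylor_bound hp (S := range fun τ : ℝ => exp (τ + φ * I)) (C := C)
    (by rintro _ ⟨τ, rfl⟩; exact hb τ) M
  refine ⟨D, fun ζ hζ => ?_⟩
  rw [rayInt_sub_sum hζ hc hb]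
  refine norm_rayInt_le hζ fun τ => ?_
  have := hD _ ⟨τ, rfl⟩
  simpa [norm_exp] using this

/-- Rotation of the ray of integration. -/
theorem rayInt_eq_rayInt {h : ℂ → ℂ} {φ₁ φ₂ : ℝ} (hφ : φ₁ < φ₂) {ζ : ℂ}
    (h₁ : |ζ.im + φ₁| < Real.pi / 2) (h₂ : |ζ.im + φ₂| < Real.pi / 2)
    (hd : ∀ u : ℂ, u.im ∈ Icc φ₁ φ₂ → DifferentiableAt ℂ h (exp u)) {C : ℝ}
    (hb : ∀ u : ℂ, u.im ∈ Icc φ₁ φ₂ → ‖h (exp u)‖ ≤ C) : rayInt h φ₁ ζ = rayInt h φ₂ ζ := by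
  -- With `u = -is`, the horizontal line of height `φ` in the logarithmic coordinate becomes the
  -- vertical line of abscissa `-φ`, and the residue theorem without poles applies.
  have hray : ∀ φ : ℝ, rayInt h φ ζ = lineInt (-φ) fun s => laplaceKer h ζ (-I * s) := fun φ => by
    unfold rayInt lineInt
    refine integral_congr_ae (Eventually.of_forall fun τ => ?_)
    have : (τ + φ * I : ℂ) = -I * ((-φ : ℝ) + τ * I) := by
      push_cast; linear_combination (τ : ℂ) * I_mul_I
    simp only [this]
  have hdiff : DifferentiableOn ℂ (fun s => laplaceKer h ζ (-I * s)) (re ⁻¹' Icc (-φ₂) (-φ₁)) := by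
    intro s hs
    have him : (-I * s).im ∈ Icc φ₁ φ₂ := by
      simp only [mul_im, neg_re, I_re, neg_im, I_im]
      exact ⟨by linarith [hs.2], by linarith [hs.1]⟩
    have h1 := hd _ him
    refine DifferentiableAt.differentiableWithinAt ?_
    unfold laplaceKer
    have h2 : DifferentiableAt ℂ (fun s => h (exp (-I * s))) s :=
      h1.comp (f := fun s => exp (-I * s)) s (by fun_prop)
    fun_prop
  obtain ⟨δ, hδ, hcos⟩ : ∃ δ > 0, ∀ y ∈ Icc φ₁ φ₂, δ ≤ Real.cos (ζ.im + y) := by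
    have hcont : ContinuousOn (fun y => Real.cos (ζ.im + y)) (Icc φ₁ φ₂) := by fun_prop
    obtain ⟨y₀, hy₀, hmin⟩ := isCompact_Icc.exists_isMinOn ⟨φ₁, le_rfl, hφ.le⟩ hcont
    refine ⟨_, cos_pos_of_abs_lt ?_, fun y hy => hmin hy⟩
    rw [abs_lt] at h₁ h₂ ⊢
    constructor <;> linarith [hy₀.1, hy₀.2]
  have key := lineInt_sub_lineInt (ι := Empty) (c₁ := -φ₂) (c₂ := -φ₁) (p := (-φ₂ + -φ₁) / 2)
    (by linarith) (by linarith) (q := fun _ => 0) (fun i => i.elim) (fun i => i.elim)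
    (f := fun s => laplaceKer h ζ (-I * s)) (a₀ := fun _ => 0) (m := 0) (a := fun _ => 0)
    hdiff (fun s _ _ _ => by simp) ?_
  · have h3 := key.2.2
    simp only [Finset.univ_eq_empty, Finset.sum_empty, mul_zero] at h3
    rw [hray, hray, sub_eq_zero.1 h3]
  · set b := Real.exp ζ.re * δ with hbd
    have hb0 : 0 < b := by positivity
    refine ⟨|C| * (2 + 6 / b ^ 3), fun s hs h1 => ?_⟩
    have him : (-I * s).im ∈ Icc φ₁ φ₂ := by
      simp only [mul_im, neg_re, I_re, neg_im, I_im]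
      exact ⟨by linarith [hs.2], by linarith [hs.1]⟩
    have hre : (-I * s).re = s.im := by simp
    have hs0 : s.im ≠ 0 := fun h => by rw [h] at h1; norm_num at h1
    have h2 := norm_laplaceKer_le (h := h) (C := |C|) (M := 0) (ζ := ζ) (u := -I * s)
      (by simpa using (hb _ him).trans (le_abs_self C)) (b := b)
      (by rw [hbd]; gcongr; exact hcos _ him)
    rw [hre, zero_add, pow_one] at h2
    refine h2.trans ?_
    rw [mul_div_assoc]
    gcongr
    exact exp_mul_exp_neg_le hb0 hs0

theorem differentiableOn_rayInt {h : ℂ → ℂ} {φ : ℝ}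
    (hc : Continuous fun τ : ℝ => h (exp (τ + φ * I))) {C : ℝ}
    (hb : ∀ τ : ℝ, ‖h (exp (τ + φ * I))‖ ≤ C) :
    DifferentiableOn ℂ (rayInt h φ) {ζ | |ζ.im + φ| < Real.pi / 2} := by
  have hU : IsOpen {ζ : ℂ | |ζ.im + φ| < Real.pi / 2} :=
    isOpen_lt (by fun_prop) continuous_const
  unfold rayInt
  refine differentiableOn_integral_of_dominated (fun z hz => ?_) (fun τ => ?_) fun z hz => ?_
  · exact (integrable_laplaceKer hz hc (M := 0) (C := C)
      (fun τ => by simpa using hb τ)).aestronglyMeasurable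
  · unfold laplaceKer
    fun_prop
  · have hpos := mul_pos (Real.exp_pos z.re) (cos_pos_of_abs_lt hz)
    set b := Real.exp z.re * Real.cos (z.im + φ) / 2 with hbd
    have hb0 : 0 < b := by positivity
    have hcont : ContinuousAt (fun w : ℂ => Real.exp w.re * Real.cos (w.im + φ)) z := by fun_prop
    have hev : ∀ᶠ w in 𝓝 z, b < Real.exp w.re * Real.cos (w.im + φ) :=
      hcont.eventually (lt_mem_nhds (by rw [hbd]; linarith))
    obtain ⟨r, hr, hball⟩ := Metric.eventually_nhds_iff_ball.1 (hev.and (hU.mem_nhds hz))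
    refine ⟨r, hr, fun w hw => (hball w hw).2, _,
      (integrable_exp_mul_exp_neg hb0 0).const_mul C, Eventually.of_forall fun τ w hw => ?_⟩
    have := norm_laplaceKer_le (h := h) (C := C) (M := 0) (ζ := w) (u := τ + φ * I)
      (by simpa using hb τ) (b := b) (by simpa using (hball w hw).1.le)
    simpa using this

end RayIntegrals

namespace CYFamily

open MeasureTheory Complex Set

/-! ### The vanishing period near the conifold point -/

/-- The vanishing period as a function of `w = x - x_c`. -/
def conifoldPeriod (Y : CYFamily) (w : ℂ) : ℂ := Y.vanishingPeriod (log (Y.conifold + w))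

/-- Outside the disc the period is a sum of exponentials whose exponents `π_i - 1 - n` are negative,
so it is bounded by the sum of the absolute values at `R`. -/
theorem exists_vanishingPeriod_bound (Y : CYFamily) {R : ℝ} (hR : Real.log Y.conifold < R) :
    ∃ C : ℝ, ∀ ξ : ℂ, R ≤ ξ.re → |ξ.im| < 2 * Real.pi → ‖Y.vanishingPeriod ξ‖ ≤ C := by
  have hs := fun i => (summable_piece Y.isRatioBound_four Y.hypA i (η := R)
    (Y.summable_ratioBound_four (by simpa using hR))).norm
  refine ⟨∑ i, 2 * Real.pi * ∑' n : ℕ,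
    ‖Y.resCoeff Y.hypA 4 i n * exp ((Y.pole i - 1 - n) * (R : ℂ))‖, fun ξ h1 h2 => ?_⟩
  rw [Y.vanishingPeriod_eq_sum_piece (hR.trans_le h1) h2]
  refine (norm_sum_le _ _).trans (Finset.sum_le_sum fun i _ => ?_)
  have e3 : ‖(2 * Real.pi * I : ℂ)‖ = 2 * Real.pi := by simp [abs_of_pos Real.pi_pos]
  rw [norm_mul, e3, piece, norm_neg]
  gcongr
  refine tsum_of_norm_bounded (hs i).hasSum fun n => ?_
  rw [norm_mul, norm_mul, norm_exp, norm_exp]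
  refine mul_le_mul_of_nonneg_left (Real.exp_le_exp.2 ?_) (norm_nonneg _)
  have hre : ∀ z : ℂ, ((Y.pole i - 1 - n) * z : ℂ).re = -(1 + n - Y.pole i) * z.re := fun z => by
    have : (Y.pole i - 1 - n : ℂ) = ((Y.pole i - 1 - n : ℝ) : ℂ) := by push_cast; rfl
    rw [this, re_ofReal_mul]
    ring
  rw [hre, hre, ofReal_re]
  have : 0 ≤ 1 + n - Y.pole i := by linarith [(Y.pole_mem i).2, n.cast_nonneg (α := ℝ)]
  nlinarith

/-- A ray issuing from `x_c > 0` in a direction other than `-1` never meets the negative axis; hence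
all directions `|φ| < π` are available for rotation. -/
theorem conifold_add_mem_slitPlane (Y : CYFamily) {t φ : ℝ} (ht : 0 ≤ t) (hφ : |φ| < Real.pi) :
    (Y.conifold + t * exp (φ * I) : ℂ) ∈ slitPlane := by
  have hx := Y.conifold_pos
  rw [abs_lt] at hφ
  rw [mem_slitPlane_iff]
  by_cases h : t * Real.sin φ = 0
  · left
    rcases mul_eq_zero.1 h with h | h
    · simp [h, hx]
    · rw [Real.sin_eq_zero_iff_of_lt_of_lt hφ.1 hφ.2] at h
      simp [h]
      positivity
  · right
    have : (Y.conifold + t * exp (φ * I) : ℂ).im = t * Real.sin φ := by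
      simp [exp_ofReal_mul_I_im]
    rwa [this]

theorem exp_eq_re_mul (u : ℂ) : exp u = Real.exp u.re * exp (u.im * I) := by
  rw [ofReal_exp, ← Complex.exp_add, re_add_im]

theorem analyticAt_conifoldPeriod (Y : CYFamily) {w : ℂ}
    (hw : (Y.conifold + w : ℂ) ∈ slitPlane) : AnalyticAt ℂ Y.conifoldPeriod w := by
  have h1 : AnalyticAt ℂ (fun w : ℂ => log (Y.conifold + w)) w :=
    (analyticAt_clog hw).fun_comp (f := fun w : ℂ => (Y.conifold + w : ℂ)) (by fun_prop)
  refine AnalyticAt.fun_comp (g := Y.vanishingPeriod) ?_ h1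
  refine Y.analyticAt_vanishingPeriod ?_
  rw [log_im]
  exact (abs_arg_le_pi _).trans_lt (by linarith [Real.pi_pos])

theorem analyticAt_conifoldPeriod_exp (Y : CYFamily) {u : ℂ} (hu : |u.im| < Real.pi) :
    AnalyticAt ℂ Y.conifoldPeriod (exp u) := by
  refine Y.analyticAt_conifoldPeriod ?_
  rw [exp_eq_re_mul]
  exact Y.conifold_add_mem_slitPlane (Real.exp_pos _).le hu

/-- Far away the expansion outside the disc gives a bound. Near `x_c` continuity in polar
coordinates on a compact rectangle does, the radius `0` included since the period is analytic there.
-/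
theorem exists_conifoldPeriod_bound (Y : CYFamily) {φ₀ : ℝ} (hφ : φ₀ < Real.pi) :
    ∃ C : ℝ, ∀ u : ℂ, |u.im| ≤ φ₀ → ‖Y.conifoldPeriod (exp u)‖ ≤ C := by
  have hx := Y.conifold_pos
  obtain ⟨C₁, hC₁⟩ := Y.exists_vanishingPeriod_bound (R := Real.log Y.conifold + 1) (by linarith)
  -- `|x_c + w| ≤ e · x_c` forces `|w| ≤ T`, and beyond that modulus `log |x|` is at least `log x_c
  -- + 1`.
  set T := Real.exp 1 * Y.conifold + Y.conifold with hT
  have hcont : ContinuousOn (fun q : ℝ × ℝ => Y.conifoldPeriod (q.1 * exp (q.2 * I)))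
      (Icc 0 T ×ˢ Icc (-φ₀) φ₀) := fun q hq => by
    have h1 := (Y.analyticAt_conifoldPeriod (Y.conifold_add_mem_slitPlane hq.1.1
      ((abs_le.2 ⟨hq.2.1, hq.2.2⟩).trans_lt hφ))).continuousAt
    have h2 : ContinuousAt (fun q : ℝ × ℝ => (q.1 * exp (q.2 * I) : ℂ)) q := by fun_prop
    exact (ContinuousAt.comp (f := fun q : ℝ × ℝ => (q.1 * exp (q.2 * I) : ℂ)) h1
      h2).continuousWithinAt
  obtain ⟨C₂, hC₂⟩ := (isCompact_Icc.prod isCompact_Icc).exists_bound_of_continuousOn hcont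
  refine ⟨max C₁ C₂, fun u hu => ?_⟩
  rcases le_total (Real.exp 1 * Y.conifold) ‖(Y.conifold + exp u : ℂ)‖ with h | h
  · refine (hC₁ _ ?_ ?_).trans (le_max_left _ _)
    · rw [log_re]
      have : Real.log Y.conifold + 1 = Real.log (Real.exp 1 * Y.conifold) := by
        rw [Real.log_mul (Real.exp_pos _).ne' hx.ne', Real.log_exp, add_comm]
      rw [this]
      exact Real.log_le_log (by positivity) h
    · rw [log_im]
      exact (abs_arg_le_pi _).trans_lt (by linarith [Real.pi_pos])
  · have h1 : Real.exp u.re ≤ T := by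
      have h2 := norm_sub_le (Y.conifold + exp u : ℂ) Y.conifold
      rw [add_sub_cancel_left, norm_exp, norm_real, Real.norm_of_nonneg hx.le] at h2
      linarith
    have := hC₂ (Real.exp u.re, u.im) ⟨⟨(Real.exp_pos _).le, h1⟩, abs_le.1 hu⟩
    rw [exp_eq_re_mul u]
    exact this.trans (le_max_right _ _)

theorem conifoldPeriod_ofReal (Y : CYFamily) {t : ℝ} (ht : 0 < t) :
    Y.conifoldPeriod t = Y.cutPeriod (Real.log (Y.conifold + t)) := by
  have hx := Y.conifold_pos
  rw [cutPeriod_eq_vanishingPeriod _ (Real.log_lt_log hx (by linarith)), conifoldPeriod,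
    ofReal_log (by positivity)]
  push_cast
  rfl

theorem cutPeriod_log_conifold (Y : CYFamily) : Y.cutPeriod (Real.log Y.conifold) = 0 := by
  have h1 : Tendsto Y.cutPeriod (𝓝[<] (Real.log Y.conifold))
      (𝓝 (Y.cutPeriod (Real.log Y.conifold))) :=
    Y.continuous_cutPeriod.continuousAt.tendsto.mono_left nhdsWithin_le_nhds
  refine tendsto_nhds_unique h1 (tendsto_const_nhds.congr' ?_)
  filter_upwards [self_mem_nhdsWithin] with y hy
  exact (Y.cutPeriod_eq_zero hy).symm

/-- `cutPeriod` is continuous on the whole line, vanishes before `log x_c` and equals the fourth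
period after it; so the fourth period vanishes at the conifold point. -/
theorem conifoldPeriod_zero (Y : CYFamily) : Y.conifoldPeriod 0 = 0 := by
  have hx := Y.conifold_pos
  have h0 : (Y.conifold + 0 : ℂ) ∈ slitPlane := by
    simpa using Y.conifold_add_mem_slitPlane le_rfl (φ := 0) (by simp [Real.pi_pos])
  have h1 : Tendsto (fun t : ℝ => Y.conifoldPeriod t) (𝓝[>] 0) (𝓝 (Y.conifoldPeriod 0)) :=
    ((Y.analyticAt_conifoldPeriod h0).continuousAt.tendsto.comp
      (continuous_ofReal.tendsto' 0 0 (by simp))).mono_left nhdsWithin_le_nhds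
  have h2 : Tendsto (fun t : ℝ => Y.cutPeriod (Real.log (Y.conifold + t))) (𝓝[>] 0)
      (𝓝 (Y.cutPeriod (Real.log (Y.conifold + 0)))) := by
    have : ContinuousAt (fun t : ℝ => Y.cutPeriod (Real.log (Y.conifold + t))) 0 := by
      refine Y.continuous_cutPeriod.continuousAt.comp
        (f := fun t : ℝ => Real.log (Y.conifold + t)) ?_
      exact ContinuousAt.log (by fun_prop) (by simpa using hx.ne')
    exact this.tendsto.mono_left nhdsWithin_le_nhds
  rw [add_zero, cutPeriod_log_conifold] at h2
  refine tendsto_nhds_unique h1 (h2.congr' ?_)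
  filter_upwards [self_mem_nhdsWithin] with t ht
  exact (Y.conifoldPeriod_ofReal ht).symm

/-! ### The Laplace representation of `f₄` -/

theorem holF_three_eq_lineInt (Y : CYFamily) (a : ℂ) (x : ℝ) :
    Y.holF a Y.normConst x 3 = -I * ∫ τ : ℝ, Y.hypA (τ * I) *
      (exp (-((1 + τ * I) * x)) * Gamma (1 + τ * I)) := by
  obtain ⟨C, hC⟩ := Y.isWeight_hypB.bound 1 (Real.pi / 4) (by positivity)
  have hpi : (Real.pi : ℂ) ≠ 0 := ofReal_ne_zero.2 Real.pi_ne_zero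
  have := Y.isWeight_hypB.lineInt_eq_sum_piece (κ := fun _ => 2 * Real.pi * I) (c := 0)
    (q := 1 / 20) (by norm_num) (by norm_num) le_rfl (by norm_num) (by norm_num)
    (fun i => by linarith [(Y.pole_mem i).1]) (κr := fun s => 2 * Real.pi * I * s ^ 3)
    (fun _ => rfl) (by fun_prop) (fun _ _ _ => rfl) Y.isRatioBound_three (η := -x) ?_
    (Y.summable_ratioBound_three _)
  · have h1 : Y.holF a Y.normConst x 3 = exp (-x) * (∑ i, (2 * Real.pi * I) *
        Y.piece Y.hypB 3 i (-x)) := by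
      rw [holF_eq, Finset.mul_sum]
      refine Finset.sum_congr rfl fun i _ => ?_
      rw [localSol]
      change (2 * Real.pi * I) * _ = _
      ring
    have h2 : lineInt 0 (fun s => 2 * Real.pi * I * (Y.hypB s * exp (s * -x))) =
        2 * Real.pi * I * ∫ τ : ℝ, Y.hypB (τ * I) * exp (τ * I * -x) := by
      simp only [lineInt, integral_const_mul, ofReal_zero, zero_add]
    have h3 : ∫ τ : ℝ, Y.hypA (τ * I) * (exp (-((1 + τ * I) * x)) * Gamma (1 + τ * I)) =
        exp (-x) * ∫ τ : ℝ, Y.hypB (τ * I) * exp (τ * I * -x) := by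
      rw [← integral_const_mul]
      refine integral_congr_ae (Eventually.of_forall fun τ => ?_)
      have e : exp (-((1 + τ * I) * x)) = exp (-x) * exp (τ * I * -x) := by
        rw [← Complex.exp_add]; congr 1; ring
      simp only [e, Y.hypB_eq (s := τ * I) (by simp)]
      ring
    rw [h1, ← this, h2, h3]
    generalize ∫ τ : ℝ, Y.hypB (τ * I) * exp (τ * I * -x) = X
    field_simp
  · refine ⟨2 * Real.pi * (|C| * (2 / (Real.pi / 4) ^ 2) * Real.exp |x|), fun s hs h1 => ?_⟩
    have e1 := hC s (by linarith [hs.1]) (by simpa using hs.2)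
    have h0 : s.im ≠ 0 := fun h => by rw [h] at h1; norm_num at h1
    have e2 : (s * (-x : ℂ)).re ≤ |x| := by
      have : (s * (-x : ℂ)).re = s.re * -x := by simp
      rw [this]
      refine (le_abs_self _).trans ?_
      rw [abs_mul, abs_neg, abs_of_nonneg hs.1]
      exact mul_le_of_le_one_left (abs_nonneg _) (by simpa using hs.2)
    have e3 : ‖(2 * Real.pi * I : ℂ)‖ = 2 * Real.pi := by simp [abs_of_pos Real.pi_pos]
    have e4 := exp_neg_mul_le_div_sq (show 0 < Real.pi / 4 by positivity) h0
    rw [norm_mul, norm_mul, norm_exp, e3]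
    calc _ ≤ 2 * Real.pi * (|C| * Real.exp (-(Real.pi / 2 - Real.pi / 4) * |s.im|)) *
          Real.exp |x| := by
          gcongr
          exact e1.trans (by gcongr; exact le_abs_self C)
      _ = 2 * Real.pi * (|C| * Real.exp (-(Real.pi / 4) * |s.im|)) * Real.exp |x| := by
          congr 4; ring
      _ ≤ 2 * Real.pi * (|C| * (2 / (Real.pi / 4) ^ 2 / s.im ^ 2)) * Real.exp |x| := by gcongr
      _ = _ := by ring

/-- Insert Euler's integral for `Γ(1 + iτ)` and exchange the integrations. Fubini applies because
`A(iτ)` is integrable and `|t^{iτ}| = 1`; the inner integral is then the inverse Mellin transform of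
`A`. -/
theorem holF_three_eq_integral (Y : CYFamily) (a : ℂ) (x : ℝ) :
    Y.holF a Y.normConst x 3 =
      ∫ t in Ioi (0 : ℝ), Y.cutPeriod (Real.log t) * exp (-(exp x * t)) := by
  set F : ℝ → ℝ → ℂ := fun τ t => Y.hypA (τ * I) *
    (exp (τ * I * (Real.log t : ℂ)) * exp (-(exp x * t))) with hF
  have hr : 0 < (exp (x : ℂ)).re := by rw [exp_ofReal_re]; exact Real.exp_pos x
  have hint : Integrable (Function.uncurry F) (volume.prod (volume.restrict (Ioi (0 : ℝ)))) := by
    have hA := Y.integrable_hypA_line 0 0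
    simp only [Nat.cast_zero, add_zero, ofReal_zero, mul_zero, Complex.exp_zero, mul_one] at hA
    have hE : IntegrableOn (fun t : ℝ => exp (-(exp (x : ℂ) * t))) (Ioi 0) := by
      have h1 := integrableOn_rpow_mul_exp_neg (σ := 1) one_pos (Real.exp_pos x)
      simp only [sub_self, Real.rpow_zero, one_mul] at h1
      have h2 := h1.ofReal (𝕜 := ℂ)
      refine IntegrableOn.congr_fun h2 (fun t _ => ?_) measurableSet_Ioi
      simp
    have hp := hA.mul_prod hE
    refine hp.norm.mono' ?_ (Eventually.of_forall fun q => ?_)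
    · have hm : Measurable fun q : ℝ × ℝ => exp (q.1 * I * (Real.log q.2 : ℂ)) := by fun_prop
      refine (hp.aestronglyMeasurable.mul hm.aestronglyMeasurable).congr
        (Eventually.of_forall fun q => ?_)
      simp only [Function.uncurry, hF, Pi.mul_apply]
      ring
    · have h1 : ‖exp (q.1 * I * (Real.log q.2 : ℂ))‖ = 1 := by
        rw [norm_exp]
        simp
      simp only [Function.uncurry, hF, norm_mul, h1, one_mul]
      exact le_rfl
  have h1 : ∀ τ : ℝ, Y.hypA (τ * I) * (exp (-((1 + τ * I) * x)) * Gamma (1 + τ * I)) =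
      ∫ t in Ioi (0 : ℝ), F τ t := fun τ => by
    have h2 := integral_cpow_mul_exp_neg_mul_Ioi_of_re_pos (a := 1 + τ * I) (r := exp x)
      (by simp) hr
    rw [Complex.log_exp (by simp [Real.pi_pos]) (by simp [Real.pi_pos.le])] at h2
    rw [← h2, ← integral_const_mul]
    refine setIntegral_congr_fun measurableSet_Ioi fun t ht => ?_
    have ht' : (t : ℂ) ≠ 0 := ofReal_ne_zero.2 (ne_of_gt ht)
    simp only [hF]
    rw [cpow_def_of_ne_zero ht', add_sub_cancel_left, ofReal_log (le_of_lt ht),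
      mul_comm (log (t : ℂ))]
  rw [holF_three_eq_lineInt]
  simp only [h1]
  rw [integral_integral_swap hint, ← integral_const_mul]
  refine integral_congr_ae (Eventually.of_forall fun t => ?_)
  simp only [hF, cutPeriod, lineInt, ofReal_zero, zero_add]
  simp only [← mul_assoc]
  rw [integral_mul_const]
  ring

/-- The integrand lives on `t > x_c`; the substitution `t = x_c + w` extracts `exp(-x_c z)`. -/
theorem holF_three_eq_rayInt_zero (Y : CYFamily) (a : ℂ) (x : ℝ) :
    Y.holF a Y.normConst x 3 = exp (-Y.conifold * exp x) * rayInt Y.conifoldPeriod 0 x := by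
  have hx := Y.conifold_pos
  set g : ℝ → ℂ := fun t => Y.cutPeriod (Real.log t) * exp (-(exp x * t)) with hg
  have h1 : ∫ t in Ioi (0 : ℝ), g t = ∫ t in Ioi Y.conifold, g t := by
    refine setIntegral_eq_of_subset_of_forall_sdiff_eq_zero measurableSet_Ioi
      (Ioi_subset_Ioi hx.le) fun t ht => ?_
    have h0 : (0 : ℝ) < t := ht.1
    have h2 : t ≤ Y.conifold := not_lt.1 ht.2
    have h3 : Y.cutPeriod (Real.log t) = 0 := by
      rcases h2.eq_or_lt with h | h
      · rw [h]; exact Y.cutPeriod_log_conifold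
      · exact Y.cutPeriod_eq_zero (Real.log_lt_log h0 h)
    simp only [hg, h3, zero_mul]
  have h2 : ∫ t in Ioi Y.conifold, g t = ∫ t in Ioi (0 : ℝ), g (t + Y.conifold) := by
    rw [← integral_indicator measurableSet_Ioi, ← integral_indicator measurableSet_Ioi,
      ← integral_add_right_eq_self _ Y.conifold]
    refine integral_congr_ae (Eventually.of_forall fun t => ?_)
    simp only [indicator, mem_Ioi]
    congr 1
    simp
  rw [holF_three_eq_integral, h1, h2, ← integral_exp_smul_comp_exp, rayInt, ← integral_const_mul]
  refine integral_congr_ae (Eventually.of_forall fun τ => ?_)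
  have e1 := Y.conifoldPeriod_ofReal (Real.exp_pos τ)
  have e2 : exp (-(exp (x : ℂ) * ((Y.conifold + Real.exp τ : ℝ) : ℂ))) =
      exp (-Y.conifold * exp x) * exp (-exp (x + τ)) := by
    rw [← Complex.exp_add, Complex.exp_add (x : ℂ)]; congr 1; push_cast; ring
  simp only [hg, laplaceKer, ofReal_zero, zero_mul, add_zero, ← ofReal_exp τ, e1, real_smul,
    add_comm (Real.exp τ) Y.conifold]
  rw [e2]
  ring

theorem continuous_conifoldPeriod_ray (Y : CYFamily) {φ : ℝ} (hφ : |φ| < Real.pi) :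
    Continuous fun τ : ℝ => Y.conifoldPeriod (exp (τ + φ * I)) :=
  continuous_iff_continuousAt.2 fun τ =>
    (Y.analyticAt_conifoldPeriod_exp (u := τ + φ * I) (by simpa using hφ)).continuousAt.comp
      (f := fun τ : ℝ => exp (τ + φ * I)) (by fun_prop)

/-- The case `φ = 0` extends from real `ζ` to `|Im ζ| < π/2` by the identity theorem. On the overlap
with the sector of `φ` the ray may be rotated, and the identity theorem extends the formula to the
whole second sector. -/
theorem holF_three_eq_rayInt (Y : CYFamily) (a : ℂ) {φ : ℝ} (hφ : |φ| < Real.pi) {ζ : ℂ}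
    (hζ : |ζ.im + φ| < Real.pi / 2) :
    Y.holF a Y.normConst ζ 3 = exp (-Y.conifold * exp ζ) * rayInt Y.conifoldPeriod φ ζ := by
  have hpi := Real.pi_pos
  obtain ⟨C, hC⟩ := Y.exists_conifoldPeriod_bound hφ
  have hopen : ∀ φ : ℝ, IsOpen {ζ : ℂ | |ζ.im + φ| < Real.pi / 2} := fun φ =>
    isOpen_lt (by fun_prop) continuous_const
  have hconv : ∀ φ : ℝ, IsPreconnected {ζ : ℂ | |ζ.im + φ| < Real.pi / 2} := fun φ => by
    have : {ζ : ℂ | |ζ.im + φ| < Real.pi / 2} =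
        im ⁻¹' Ioo (-(Real.pi / 2) - φ) (Real.pi / 2 - φ) := by
      ext ζ
      simp only [mem_ofPred_eq, mem_preimage, mem_Ioo, abs_lt]
      constructor <;> rintro ⟨h1, h2⟩ <;> constructor <;> linarith
    rw [this]
    exact ((convex_Ioo _ _).linear_preimage imLm).isPreconnected
  have hray : ∀ ψ : ℝ, |ψ| ≤ |φ| → AnalyticOnNhd ℂ
      (fun ζ => exp (-Y.conifold * exp ζ) * rayInt Y.conifoldPeriod ψ ζ)
      {ζ : ℂ | |ζ.im + ψ| < Real.pi / 2} := fun ψ hψ => by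
    refine DifferentiableOn.analyticOnNhd (DifferentiableOn.mul (by fun_prop) ?_) (hopen ψ)
    exact differentiableOn_rayInt (Y.continuous_conifoldPeriod_ray (hψ.trans_lt hφ)) (C := C)
      fun τ => hC _ (by simpa using hψ)
  have hf : ∀ S : Set ℂ, AnalyticOnNhd ℂ (fun ζ => Y.holF a Y.normConst ζ 3) S := fun S =>
    ((Y.differentiable_holF a 3).differentiableOn.analyticOnNhd isOpen_univ).mono (subset_univ S)
  have h0 : EqOn (fun ζ => Y.holF a Y.normConst ζ 3)
      (fun ζ => exp (-Y.conifold * exp ζ) * rayInt Y.conifoldPeriod 0 ζ)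
      {ζ : ℂ | |ζ.im + (0 : ℝ)| < Real.pi / 2} := by
    refine (hf _).eqOn_of_preconnected_of_frequently_eq (hray 0 (by simp)) (hconv 0) (z₀ := 0)
      (by simp [hpi]) ?_
    have h1 : Tendsto (fun n : ℕ => ((1 / ((n : ℝ) + 1) : ℝ) : ℂ)) atTop (𝓝[≠] 0) := by
      refine tendsto_nhdsWithin_iff.2 ⟨?_, Eventually.of_forall fun n => ?_⟩
      · exact (continuous_ofReal.tendsto' _ _ (by simp)).comp
          (tendsto_one_div_add_atTop_nhds_zero_nat (𝕜 := ℝ))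
      · have : 0 < 1 / ((n : ℝ) + 1) := by positivity
        exact ofReal_ne_zero.2 this.ne'
    exact h1.frequently (Frequently.of_forall fun n => Y.holF_three_eq_rayInt_zero a _)
  have hrot : ∀ ζ : ℂ, |ζ.im + (0 : ℝ)| < Real.pi / 2 → |ζ.im + φ| < Real.pi / 2 →
      rayInt Y.conifoldPeriod 0 ζ = rayInt Y.conifoldPeriod φ ζ := fun ζ h1 h2 => by
    rcases lt_trichotomy φ 0 with h | h | h
    · rw [abs_of_neg h] at hφ hC
      have hu : ∀ u : ℂ, u.im ∈ Icc φ 0 → |u.im| ≤ -φ := fun u hu => by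
        rw [abs_of_nonpos hu.2]; linarith [hu.1]
      exact (rayInt_eq_rayInt h h2 h1 (fun u hu' => (Y.analyticAt_conifoldPeriod_exp
        ((hu u hu').trans_lt hφ)).differentiableAt) fun u hu' => hC u (hu u hu')).symm
    · rw [h]
    · rw [abs_of_pos h] at hφ hC
      have hu : ∀ u : ℂ, u.im ∈ Icc 0 φ → |u.im| ≤ φ := fun u hu => by
        rw [abs_of_nonneg hu.1]; exact hu.2
      exact rayInt_eq_rayInt h h1 h2 (fun u hu' => (Y.analyticAt_conifoldPeriod_exp
        ((hu u hu').trans_lt hφ)).differentiableAt) fun u hu' => hC u (hu u hu')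
  obtain ⟨hφ1, hφ2⟩ := abs_lt.1 hφ
  -- The point `-iφ/2` lies midway between the two sectors and belongs to both exactly because `|φ|
  -- < π`.
  have hz1 : |((-(φ / 2) : ℝ) * I : ℂ).im + (0 : ℝ)| < Real.pi / 2 := by
    rw [im_ofReal_mul, I_im, abs_lt]; constructor <;> linarith
  have hz2 : |((-(φ / 2) : ℝ) * I : ℂ).im + φ| < Real.pi / 2 := by
    rw [im_ofReal_mul, I_im, abs_lt]; constructor <;> linarith
  refine (hf _).eqOn_of_preconnected_of_eventuallyEq (hray φ le_rfl) (hconv φ) hz2 ?_ hζ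
  filter_upwards [(hopen 0).mem_nhds hz1, (hopen φ).mem_nhds hz2] with w hw1 hw2
  rw [← hrot w hw1 hw2]
  exact h0 hw1

end CYFamily

namespace CYFamily

open MeasureTheory Complex Set

/-! ### Asymptotics of `f₄` -/

theorem analyticAt_conifoldPeriod_zero (Y : CYFamily) : AnalyticAt ℂ Y.conifoldPeriod 0 :=
  Y.analyticAt_conifoldPeriod (by
    simpa using Y.conifold_add_mem_slitPlane le_rfl (φ := 0) (by simp [Real.pi_pos]))

/-- The Taylor series of the vanishing period at the conifold point. -/
def conifoldTaylor (Y : CYFamily) : FormalMultilinearSeries ℂ ℂ ℂ :=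
  Y.analyticAt_conifoldPeriod_zero.choose

theorem hasFPowerSeriesAt_conifoldTaylor (Y : CYFamily) :
    HasFPowerSeriesAt Y.conifoldPeriod Y.conifoldTaylor 0 :=
  Y.analyticAt_conifoldPeriod_zero.choose_spec

theorem coeff_zero_eq {h : ℂ → ℂ} {p : FormalMultilinearSeries ℂ ℂ ℂ}
    (hp : HasFPowerSeriesAt h p 0) : p.coeff 0 = h 0 := hp.coeff_zero _

theorem coeff_one_eq {h : ℂ → ℂ} {p : FormalMultilinearSeries ℂ ℂ ℂ}
    (hp : HasFPowerSeriesAt h p 0) : p.coeff 1 = deriv h 0 := by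
  rw [hp.deriv]; rfl

theorem conifoldTaylor_coeff_zero (Y : CYFamily) : Y.conifoldTaylor.coeff 0 = 0 := by
  rw [coeff_zero_eq Y.hasFPowerSeriesAt_conifoldTaylor, conifoldPeriod_zero]

/-- The coefficients `C_n` of the formal solution at the conifold point. -/
def conifoldCoeff (Y : CYFamily) (n : ℕ) : ℂ :=
  (n + 1).factorial * Y.conifoldTaylor.coeff (n + 1) / Y.conifoldTaylor.coeff 1

/-! ### Stirling's formula -/

/-- In Stirling's formula the factors `(n/e)^n` cancel by `∑ ω_i = d`, the geometric factors by `∏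
ω_i^{ω_i} = x_c d^d`, and the square roots leave `√K_d` because `K_d ∏ ω_i = d`. -/
theorem tendsto_factorial_ratio (Y : CYFamily) :
    Tendsto (fun n : ℕ => ((Y.degree * n).factorial : ℝ) / (∏ i, ((Y.weight i * n).factorial : ℝ)) *
      (n : ℝ) ^ 2 * Y.conifold ^ n) atTop (𝓝 (Real.sqrt Y.cubic / (4 * Real.pi ^ 2))) := by
  have hS : ∀ w : ℕ, 0 < w → Tendsto (fun n : ℕ => Stirling.stirlingSeq (w * n)) atTop
      (𝓝 (Real.sqrt Real.pi)) := fun w hw =>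
    Stirling.tendsto_stirlingSeq_sqrt_pi.comp (tendsto_id.const_mul_atTop' hw)
  have hpi := Real.sqrt_pos.2 Real.pi_pos
  have hlim := ((hS _ Y.degree_pos).div (tendsto_finsetProd Finset.univ fun i _ =>
    hS _ (Y.weight_pos i)) (by simp [hpi.ne'])).mul_const (Real.sqrt Y.cubic / 4)
  have hval : Real.sqrt Real.pi / (∏ _i : Fin 5, Real.sqrt Real.pi) * (Real.sqrt Y.cubic / 4) =
      Real.sqrt Y.cubic / (4 * Real.pi ^ 2) := by
    have h4 : ∏ _i : Fin 5, Real.sqrt Real.pi = Real.pi ^ 2 * Real.sqrt Real.pi := by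
      rw [Finset.prod_const, Finset.card_univ, Fintype.card_fin]
      nth_rw 2 [← Real.sq_sqrt Real.pi_pos.le]
      ring
    rw [h4]
    field_simp
  rw [hval] at hlim
  refine hlim.congr' ?_
  filter_upwards [eventually_gt_atTop 0] with n hn
  have hn0 : (0 : ℝ) < n := by exact_mod_cast hn
  have hw0 : ∀ i, (0 : ℝ) < Y.weight i := fun i => by exact_mod_cast Y.weight_pos i
  have hd0 : (0 : ℝ) < Y.degree := by exact_mod_cast Y.degree_pos
  have hfac : ∀ w : ℕ, 0 < w → ((w * n).factorial : ℝ) = Stirling.stirlingSeq (w * n) *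
      (Real.sqrt (2 * w * n) * ((w : ℝ) ^ w) ^ n * ((n / Real.exp 1) ^ n) ^ w) := fun w hw => by
    have hw' : (0 : ℝ) < w := by exact_mod_cast hw
    have e : ((w : ℝ) ^ w) ^ n * ((n / Real.exp 1) ^ n) ^ w =
        (((w * n : ℕ) : ℝ) / Real.exp 1) ^ (w * n) := by
      rw [← pow_mul, ← pow_mul, mul_comm n w, ← mul_pow]; congr 1; push_cast; ring
    rw [Stirling.stirlingSeq, mul_assoc, e]
    push_cast
    rw [mul_assoc (2 : ℝ)]
    field_simp
  have hcon : (∏ i, (Y.weight i : ℝ) ^ Y.weight i) = Y.conifold * (Y.degree : ℝ) ^ Y.degree := by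
    cases Y <;> norm_num [weight, degree, conifold, Fin.prod_univ_succ]
  have hK : (Y.cubic : ℝ) * ∏ i, (Y.weight i : ℝ) = Y.degree := by
    cases Y <;> norm_num [weight, degree, cubic, Fin.prod_univ_succ]
  have hsq : 4 * Real.sqrt (2 * Y.degree * n) * (n : ℝ) ^ 2 =
      Real.sqrt Y.cubic * ∏ i, Real.sqrt (2 * Y.weight i * n) := by
    have hP : (∏ i, Real.sqrt (2 * Y.weight i * n)) ^ 2 =
        32 * (n : ℝ) ^ 5 * ∏ i, (Y.weight i : ℝ) := by
      rw [← Finset.prod_pow]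
      simp only [Fin.prod_univ_five]
      rw [Real.sq_sqrt (by positivity), Real.sq_sqrt (by positivity), Real.sq_sqrt (by positivity),
        Real.sq_sqrt (by positivity), Real.sq_sqrt (by positivity)]
      ring
    have h0 : 0 ≤ ∏ i, Real.sqrt (2 * Y.weight i * n) := Finset.prod_nonneg fun i _ => by positivity
    refine (pow_left_inj₀ (by positivity) (by positivity) two_ne_zero).1 ?_
    rw [mul_pow, mul_pow, mul_pow, Real.sq_sqrt (by positivity), Real.sq_sqrt (by positivity), hP,
      ← hK]
    ring
  have hSpos : ∀ w : ℕ, 0 < w → Stirling.stirlingSeq (w * n) ≠ 0 := fun w hw => by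
    obtain ⟨k, hk⟩ := Nat.exists_eq_succ_of_ne_zero (Nat.mul_pos hw hn).ne'
    rw [hk]
    exact (Stirling.stirlingSeq'_pos k).ne'
  rw [hfac _ Y.degree_pos, Finset.prod_congr rfl fun i _ => hfac _ (Y.weight_pos i)]
  simp only [Finset.prod_mul_distrib, Finset.prod_pow, Finset.prod_pow_eq_pow_sum, sum_weight, hcon,
    Pi.div_apply]
  have hp1 : ∏ i, Stirling.stirlingSeq (Y.weight i * n) ≠ 0 :=
    Finset.prod_ne_zero_iff.2 fun i _ => hSpos _ (Y.weight_pos i)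
  have hp2 : ∏ i, Real.sqrt (2 * Y.weight i * n) ≠ 0 :=
    Finset.prod_ne_zero_iff.2 fun i _ => (Real.sqrt_pos.2 (by have := hw0 i; positivity)).ne'
  have hx := Y.conifold_pos
  generalize ∏ i, Stirling.stirlingSeq (Y.weight i * n) = P1 at *
  generalize ∏ i, Real.sqrt (2 * Y.weight i * n) = P2 at *
  rw [mul_pow]
  have hq : ((n / Real.exp 1) ^ n) ^ Y.degree ≠ 0 := by positivity
  have hdd : ((Y.degree : ℝ) ^ Y.degree) ^ n ≠ 0 := by positivity
  generalize ((n / Real.exp 1) ^ n) ^ Y.degree = Q at *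
  generalize ((Y.degree : ℝ) ^ Y.degree) ^ n = E at *
  have hxn : Y.conifold ^ n ≠ 0 := by positivity
  have hSd := hSpos _ Y.degree_pos
  generalize Stirling.stirlingSeq (Y.degree * n) = S at *
  field_simp
  linear_combination -hsq

/-! ### The leading coefficient -/

theorem exists_cutPeriod_bound (Y : CYFamily) : ∃ C : ℝ, ∀ y, ‖Y.cutPeriod y‖ ≤ C := by
  have hx := Y.conifold_pos
  obtain ⟨C, hC⟩ := Y.exists_conifoldPeriod_bound (φ₀ := 0) Real.pi_pos
  have hC0 : 0 ≤ C := (norm_nonneg _).trans (hC 0 (by simp))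
  refine ⟨C, fun y => ?_⟩
  rcases lt_trichotomy y (Real.log Y.conifold) with h | h | h
  · rw [Y.cutPeriod_eq_zero h, norm_zero]; exact hC0
  · rw [h, Y.cutPeriod_log_conifold, norm_zero]; exact hC0
  · have h1 : 0 < Real.exp y - Y.conifold := sub_pos.2 ((Real.log_lt_iff_lt_exp hx).1 h)
    have h2 := Y.conifoldPeriod_ofReal h1
    rw [add_sub_cancel, Real.log_exp] at h2
    have h3 := hC (Real.log (Real.exp y - Y.conifold) : ℝ) (by simp)
    rwa [← ofReal_exp, Real.exp_log h1, h2] at h3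

/-- Fourier inversion at `0`: up to constants, `cutPeriod(y) e^{-ny}` is the Fourier transform of `τ
↦ A(n + iτ)`. It is integrable because `cutPeriod` is bounded and vanishes to the left of `log x_c`.
-/
theorem hypA_natCast_eq (Y : CYFamily) {n : ℕ} (hn : 0 < n) :
    Y.hypA n = I / (2 * Real.pi) * ∫ y : ℝ, Y.cutPeriod y * exp (-(n * y)) := by
  have hpi := Real.pi_pos
  have hn0 : (0 : ℝ) < n := by exact_mod_cast hn
  set f : ℝ → ℂ := fun τ => Y.hypA (τ * I + n) with hf
  have hfc : Continuous f :=
    Y.differentiableOn_hypA.continuousOn.comp_continuous (by fun_prop) fun τ => by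
      simp; linarith [n.cast_nonneg (α := ℝ)]
  have hfi : Integrable f := by simpa using Y.integrable_hypA_line n 0
  obtain ⟨C, hC⟩ := Y.exists_cutPeriod_bound
  set g : ℝ → ℂ := fun y => Y.cutPeriod y * exp (-(n * y)) with hg
  have hgi : Integrable g := by
    have h1 : IntegrableOn g (Ioi (Real.log Y.conifold)) := by
      refine ((integrableOn_exp_mul_Ioi (a := -n) (by linarith) _).const_mul C).mono'
        (Continuous.aestronglyMeasurable (Y.continuous_cutPeriod.mul (by fun_prop)))
        (Eventually.of_forall fun y => ?_)
      rw [hg, norm_mul, norm_exp]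
      have : (-(n * y : ℂ)).re = -n * y := by simp
      rw [this]
      gcongr
      exact hC y
    have h2 : IntegrableOn g (Iic (Real.log Y.conifold)) := by
      refine (integrableOn_zero (μ := volume)).congr_fun (fun y hy => ?_) measurableSet_Iic
      have : Y.cutPeriod y = 0 := by
        rcases (show y ≤ _ from hy).eq_or_lt with h | h
        · rw [h, Y.cutPeriod_log_conifold]
        · exact Y.cutPeriod_eq_zero h
      simp [hg, this]
    rw [← integrableOn_univ, ← Iic_union_Ioi (a := Real.log Y.conifold)]
    exact h2.union h1
  -- The frequency `w` corresponds to `y = -2πw`, and `cutPeriod` is evaluated on the line of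
  -- abscissa `n`.
  have hF : FourierTransform.fourier f = fun w : ℝ => I * g (w * (-(2 * Real.pi))) := by
    funext w
    rw [Real.fourier_real_eq_integral_exp_smul, hg]
    simp only
    rw [Y.cutPeriod_eq_line n]
    have h1 : ∫ τ : ℝ, Y.hypA (τ * I + n) * exp ((τ * I + n) * ((w * (-(2 * Real.pi)) : ℝ) : ℂ)) =
        exp (n * ((w * (-(2 * Real.pi)) : ℝ) : ℂ)) *
          ∫ τ : ℝ, exp (((-2 * Real.pi * τ * w : ℝ) : ℂ) * I) • f τ := by
      rw [← integral_const_mul]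
      refine integral_congr_ae (Eventually.of_forall fun τ => ?_)
      have : exp ((τ * I + n) * ((w * (-(2 * Real.pi)) : ℝ) : ℂ)) =
          exp (n * ((w * (-(2 * Real.pi)) : ℝ) : ℂ)) * exp (((-2 * Real.pi * τ * w : ℝ) : ℂ) * I) := by
        rw [← Complex.exp_add]; congr 1; push_cast; ring
      simp only [this, smul_eq_mul, hf]
      ring
    rw [h1]
    have h2 : exp (n * ((w * (-(2 * Real.pi)) : ℝ) : ℂ)) *
        exp (-(n * ((w * (-(2 * Real.pi)) : ℝ) : ℂ))) = 1 := by rw [← Complex.exp_add]; simp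
    linear_combination (-(∫ τ : ℝ, exp (((-2 * Real.pi * τ * w : ℝ) : ℂ) * I) • f τ)) * h2 +
      (∫ τ : ℝ, exp (((-2 * Real.pi * τ * w : ℝ) : ℂ) * I) • f τ) *
      exp (n * ((w * (-(2 * Real.pi)) : ℝ) : ℂ)) *
        exp (-(n * ((w * (-(2 * Real.pi)) : ℝ) : ℂ))) * I_mul_I
  have hne : -(2 * Real.pi) ≠ 0 := by linarith
  have hFi : Integrable (FourierTransform.fourier f) := by
    rw [hF]
    exact (hgi.comp_mul_right' hne).const_mul I
  have hinv := hfi.fourierInv_fourier_eq hFi (v := 0) hfc.continuousAt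
  rw [Real.fourierInv_eq'] at hinv
  simp only [inner_zero_right, mul_zero, ofReal_zero, zero_mul, Complex.exp_zero, one_smul,
    hF] at hinv
  rw [integral_const_mul, Measure.integral_comp_mul_right] at hinv
  have h0 : f 0 = Y.hypA n := by simp [hf]
  rw [← h0, ← hinv, abs_inv, abs_neg, abs_of_pos (by positivity : 0 < 2 * Real.pi), real_smul]
  push_cast
  rw [div_eq_mul_inv]
  ring

/-- The vanishing period as a function of `log x - log x_c`. -/
def conifoldPeriodLog (Y : CYFamily) (u : ℂ) : ℂ := Y.conifoldPeriod (Y.conifold * (exp u - 1))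

theorem conifoldPeriodLog_ofReal (Y : CYFamily) {u : ℝ} (hu : 0 < u) :
    Y.conifoldPeriodLog u = Y.cutPeriod (Real.log Y.conifold + u) := by
  have hx := Y.conifold_pos
  have h1 : 0 < Y.conifold * (Real.exp u - 1) :=
    mul_pos hx (sub_pos.2 (Real.one_lt_exp_iff.2 hu))
  have h2 := Y.conifoldPeriod_ofReal h1
  have h3 : Y.conifold + Y.conifold * (Real.exp u - 1) = Y.conifold * Real.exp u := by ring
  rw [h3, Real.log_mul hx.ne' (Real.exp_pos u).ne', Real.log_exp] at h2
  rw [← h2, conifoldPeriodLog]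
  push_cast
  rfl

theorem hypA_natCast_mul (Y : CYFamily) {n : ℕ} (hn : 0 < n) :
    Y.hypA n * Y.conifold ^ n =
      I / (2 * Real.pi) * rayInt Y.conifoldPeriodLog 0 (Real.log n : ℝ) := by
  have hx := Y.conifold_pos
  have hn0 : (0 : ℝ) < n := by exact_mod_cast hn
  set g : ℝ → ℂ := fun y => Y.cutPeriod y * exp (-(n * y)) with hg
  have h1 : ∫ y : ℝ, g y = ∫ y in Ioi (Real.log Y.conifold), g y := by
    rw [← setIntegral_univ]
    refine setIntegral_eq_of_subset_of_forall_sdiff_eq_zero MeasurableSet.univ (subset_univ _)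
      fun y hy => ?_
    have : Y.cutPeriod y = 0 := by
      rcases (not_lt.1 (show ¬Real.log Y.conifold < y from hy.2)).eq_or_lt with h | h
      · rw [h, Y.cutPeriod_log_conifold]
      · exact Y.cutPeriod_eq_zero h
    simp only [hg, this, zero_mul]
  have h2 : ∫ y in Ioi (Real.log Y.conifold), g y =
      ∫ u in Ioi (0 : ℝ), g (u + Real.log Y.conifold) := by
    rw [← integral_indicator measurableSet_Ioi, ← integral_indicator measurableSet_Ioi,
      ← integral_add_right_eq_self _ (Real.log Y.conifold)]
    refine integral_congr_ae (Eventually.of_forall fun t => ?_)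
    simp only [indicator, mem_Ioi]
    congr 1
    simp
  have h3 : (Y.conifold : ℂ) ^ n = exp (n * (Real.log Y.conifold : ℝ)) := by
    rw [exp_nat_mul, ← ofReal_exp, Real.exp_log hx]
  rw [Y.hypA_natCast_eq hn, h1, h2, ← integral_exp_smul_comp_exp, mul_assoc, rayInt,
    ← integral_mul_const]
  congr 1
  refine integral_congr_ae (Eventually.of_forall fun τ => ?_)
  have e1 := Y.conifoldPeriodLog_ofReal (Real.exp_pos τ)
  have e2 : exp (-(n * ((Real.exp τ + Real.log Y.conifold : ℝ) : ℂ))) * (Y.conifold : ℂ) ^ n =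
      exp (-exp ((Real.log n : ℝ) + τ)) := by
    rw [h3, ← Complex.exp_add, Complex.exp_add (Real.log n : ℂ), ← ofReal_exp, Real.exp_log hn0]
    congr 1; push_cast; ring
  simp only [hg, laplaceKer, ofReal_zero, zero_mul, add_zero, ← ofReal_exp τ, e1, real_smul]
  rw [← e2, add_comm (Real.log Y.conifold)]
  ring

/-- `n² A(n) x_c^n` has two limits to compare: Watson's lemma at `z = n` gives `(i/2π) · x_c` times
the derivative of the period at `x_c`, the constant term being zero, and Stirling's formula gives
`√K_d / (4π²)`. -/
theorem conifoldTaylor_coeff_one (Y : CYFamily) :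
    Y.conifoldTaylor.coeff 1 = (Real.sqrt Y.cubic : ℂ) / (2 * Real.pi * I * Y.conifold) := by
  have hx := Y.conifold_pos
  have hpi := Real.pi_pos
  obtain ⟨C, hC⟩ := Y.exists_cutPeriod_bound
  have hinner : HasDerivAt (fun u : ℂ => (Y.conifold : ℂ) * (exp u - 1)) Y.conifold 0 := by
    simpa using ((Complex.hasDerivAt_exp 0).sub_const 1).const_mul (Y.conifold : ℂ)
  have h0 : (Y.conifold : ℂ) * (exp 0 - 1) = 0 := by simp
  have han : AnalyticAt ℂ Y.conifoldPeriodLog 0 :=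
    AnalyticAt.fun_comp (g := Y.conifoldPeriod) (f := fun u : ℂ => (Y.conifold : ℂ) * (exp u - 1))
      (by rw [h0]; exact Y.analyticAt_conifoldPeriod_zero) (by fun_prop)
  obtain ⟨q, hq⟩ := han
  have hq0 : q.coeff 0 = 0 := by
    rw [coeff_zero_eq hq, conifoldPeriodLog, h0, conifoldPeriod_zero]
  have hq1 : q.coeff 1 = Y.conifoldTaylor.coeff 1 * Y.conifold := by
    rw [coeff_one_eq hq, coeff_one_eq Y.hasFPowerSeriesAt_conifoldTaylor]
    have hd : HasDerivAt Y.conifoldPeriod (deriv Y.conifoldPeriod 0)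
        ((Y.conifold : ℂ) * (exp 0 - 1)) := by
      rw [h0]
      exact Y.analyticAt_conifoldPeriod_zero.differentiableAt.hasDerivAt
    exact (hd.comp (0 : ℂ) hinner).deriv
  have hreal : ∀ τ : ℝ, Y.conifoldPeriodLog (exp (τ + (0 : ℝ) * I)) =
      Y.cutPeriod (Real.log Y.conifold + Real.exp τ) := fun τ => by
    rw [← Y.conifoldPeriodLog_ofReal (Real.exp_pos τ)]
    simp
  obtain ⟨D, hD⟩ := exists_watson_bound hq (φ := 0) (C := C)
    (by simp only [hreal]; exact Y.continuous_cutPeriod.comp (by fun_prop))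
    (fun τ => by rw [hreal]; exact hC _) 2
  have hlim1 : Tendsto (fun n : ℕ => (n : ℂ) ^ 2 *
      rayInt Y.conifoldPeriodLog 0 (Real.log n : ℝ)) atTop (𝓝 (q.coeff 1)) := by
    rw [tendsto_iff_norm_sub_tendsto_zero]
    have h1 : Tendsto (fun n : ℕ => D * 2 * (1 / (n : ℝ))) atTop (𝓝 0) := by
      simpa using tendsto_one_div_atTop_nhds_zero_nat.const_mul (D * 2)
    refine squeeze_zero' (Eventually.of_forall fun n => norm_nonneg _) ?_ h1
    filter_upwards [eventually_gt_atTop 0] with n hn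
    have hn0 : (0 : ℝ) < n := by exact_mod_cast hn
    have hnc : (n : ℂ) ≠ 0 := by exact_mod_cast hn.ne'
    have h2 := hD (Real.log n : ℝ) (by rw [ofReal_im]; simp [hpi])
    have h3 : exp (-((1 : ℕ) + 1 : ℂ) * (Real.log n : ℝ)) = ((n : ℂ) ^ 2)⁻¹ := by
      have : -((1 : ℕ) + 1 : ℂ) * (Real.log n : ℝ) = -((2 : ℕ) * (Real.log n : ℝ)) := by
        push_cast; ring
      rw [this, Complex.exp_neg, exp_nat_mul, ← ofReal_exp, Real.exp_log hn0]
      simp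
    rw [Finset.sum_range_succ, Finset.sum_range_one, hq0, zero_mul, zero_add, h3] at h2
    simp only [ofReal_im, ofReal_re, add_zero, Real.cos_zero, mul_one, Real.exp_log hn0,
      Nat.factorial_one, Nat.cast_one, one_mul, Nat.factorial_two, Nat.cast_ofNat] at h2
    have h4 : (n : ℂ) ^ 2 * rayInt Y.conifoldPeriodLog 0 (Real.log n : ℝ) - q.coeff 1 =
        (n : ℂ) ^ 2 * (rayInt Y.conifoldPeriodLog 0 (Real.log n : ℝ) -
          q.coeff 1 * ((n : ℂ) ^ 2)⁻¹) := by field_simp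
    rw [h4, norm_mul, norm_pow, Complex.norm_natCast]
    calc _ ≤ (n : ℝ) ^ 2 * (D * (2 / (n : ℝ) ^ (2 + 1))) := by gcongr
      _ = _ := by field_simp; ring
  have hlim2 := (continuous_ofReal.tendsto _).comp Y.tendsto_factorial_ratio
  have hlim3 := hlim1.const_mul (I / (2 * Real.pi))
  have huniq := tendsto_nhds_unique_of_eventuallyEq hlim2 hlim3 (by
    filter_upwards [eventually_gt_atTop 0] with n hn
    have h1 := Y.hypA_natCast_mul hn
    have h2 : Y.hypA n = ((Y.degree * n).factorial : ℂ) / ∏ i, ((Y.weight i * n).factorial : ℂ) := by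
      rw [hypA]
      congr 1
      · rw [add_comm, ← Nat.cast_mul, Gamma_nat_eq_factorial]
      · exact Finset.prod_congr rfl fun i _ => by
          rw [add_comm, ← Nat.cast_mul, Gamma_nat_eq_factorial]
    simp only [Function.comp]
    generalize rayInt Y.conifoldPeriodLog 0 (Real.log n : ℝ) = X at h1 ⊢
    push_cast
    rw [← h2]
    linear_combination (n : ℂ) ^ 2 * h1)
  rw [hq1] at huniq
  push_cast at huniq
  have hpc : (Real.pi : ℂ) ≠ 0 := ofReal_ne_zero.2 hpi.ne'
  have hxc : (Y.conifold : ℂ) ≠ 0 := ofReal_ne_zero.2 hx.ne'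
  have hI := I_ne_zero
  rw [div_eq_iff (by simp [hpi.ne'])] at huniq
  rw [eq_div_iff (by simp [hpi.ne', hx.ne']), huniq]
  field_simp
  ring

/-! ### The asymptotic expansion of `f₄` -/

theorem conifoldTaylor_coeff_one_ne_zero (Y : CYFamily) : Y.conifoldTaylor.coeff 1 ≠ 0 := by
  have h : (Y.cubic : ℝ) ≠ 0 := by cases Y <;> norm_num [cubic]
  rw [conifoldTaylor_coeff_one]
  simp [Real.pi_ne_zero, Y.conifold_pos.ne', h]

theorem conifoldCoeff_zero (Y : CYFamily) : Y.conifoldCoeff 0 = 1 := by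
  rw [conifoldCoeff]
  simp [Y.conifoldTaylor_coeff_one_ne_zero]

theorem psiTerm_three (Y : CYFamily) (a : ℂ) (n : ℕ) (ζ : ℂ) :
    Y.psiTerm a Y.conifoldCoeff n ζ 3 = exp (-Y.conifold * exp ζ) *
      (Y.conifoldTaylor.coeff (n + 1) * ((n + 1).factorial * exp (-((n + 1 : ℕ) + 1) * ζ))) := by
  have h := Y.conifoldTaylor_coeff_one_ne_zero
  have e : -((n + 1 : ℕ) + 1 : ℂ) * ζ = -(2 + n) * ζ := by push_cast; ring
  rw [e]
  change (Real.sqrt Y.cubic : ℂ) / (2 * Real.pi * I * Y.conifold) * _ *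
    (Y.conifoldCoeff n * _) = _
  rw [← conifoldTaylor_coeff_one, conifoldCoeff]
  field_simp

theorem holF_three_sub_sum (Y : CYFamily) (a : ℂ) {φ : ℝ} (hφ : |φ| < Real.pi) {ζ : ℂ}
    (hζ : |ζ.im + φ| < Real.pi / 2) (N : ℕ) :
    Y.holF a Y.normConst ζ 3 - ∑ n ∈ Finset.range N, Y.psiTerm a Y.conifoldCoeff n ζ 3 =
      exp (-Y.conifold * exp ζ) * (rayInt Y.conifoldPeriod φ ζ - ∑ n ∈ Finset.range (N + 1),
        Y.conifoldTaylor.coeff n * (n.factorial * exp (-(n + 1) * ζ))) := by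
  rw [Finset.sum_range_succ', conifoldTaylor_coeff_zero, zero_mul, add_zero, mul_sub,
    Finset.mul_sum, Y.holF_three_eq_rayInt a hφ hζ]
  congr 1
  exact Finset.sum_congr rfl fun n _ => Y.psiTerm_three a n ζ

/-- Watson's lemma is used with `N + 1` Taylor terms, the first of which is zero. So the error is of
order `z^{-(N+2)}`, one power better than required. -/
theorem exists_holF_three_bound (Y : CYFamily) (a : ℂ) {φ : ℝ} (hφ : |φ| < Real.pi) {α β : ℝ}
    (hα : -(Real.pi / 2) < α + φ) (hβ : β + φ < Real.pi / 2) (N : ℕ) :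
    ∃ D : ℝ, ∀ ζ : ℂ, α ≤ ζ.im → ζ.im ≤ β →
      ‖Y.holF a Y.normConst ζ 3 - ∑ n ∈ Finset.range N, Y.psiTerm a Y.conifoldCoeff n ζ 3‖ ≤
        D * Real.exp (-(N + 2) * ζ.re) * ‖exp (-Y.conifold * exp ζ)‖ := by
  obtain ⟨C, hC⟩ := Y.exists_conifoldPeriod_bound hφ
  obtain ⟨D, hD⟩ := exists_watson_bound Y.hasFPowerSeriesAt_conifoldTaylor
    (Y.continuous_conifoldPeriod_ray hφ) (C := C) (fun τ => hC _ (by simp)) (N + 1)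
  obtain ⟨δ, hδ, hcos⟩ : ∃ δ > 0, ∀ y, α ≤ y → y ≤ β → δ ≤ Real.cos (y + φ) := by
    rcases lt_or_ge β α with h | h
    · exact ⟨1, one_pos, fun y h1 h2 => absurd (h1.trans h2) (not_le.2 h)⟩
    have hcont : ContinuousOn (fun y => Real.cos (y + φ)) (Icc α β) := by fun_prop
    obtain ⟨y₀, hy₀, hmin⟩ := isCompact_Icc.exists_isMinOn ⟨α, le_rfl, h⟩ hcont
    refine ⟨_, cos_pos_of_abs_lt ?_, fun y h1 h2 => hmin ⟨h1, h2⟩⟩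
    rw [abs_lt]
    constructor <;> linarith [hy₀.1, hy₀.2]
  refine ⟨|D| * ((N + 1).factorial / δ ^ (N + 2)), fun ζ h1 h2 => ?_⟩
  have hζ : |ζ.im + φ| < Real.pi / 2 := by rw [abs_lt]; constructor <;> linarith
  rw [Y.holF_three_sub_sum a hφ hζ, norm_mul, mul_comm]
  refine mul_le_mul_of_nonneg_right ((hD ζ hζ).trans ?_) (norm_nonneg _)
  have hexp : Real.exp (-(N + 2) * ζ.re) = (Real.exp ζ.re ^ (N + 2))⁻¹ := by
    rw [← Real.exp_nat_mul, ← Real.exp_neg]; congr 1; push_cast; ring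
  calc D * ((N + 1).factorial / (Real.exp ζ.re * Real.cos (ζ.im + φ)) ^ (N + 1 + 1))
      ≤ |D| * ((N + 1).factorial / (Real.exp ζ.re * δ) ^ (N + 2)) := by
        have h3 := hcos _ h1 h2
        have h4 := hδ.trans_le h3
        gcongr
        exact le_abs_self D
    _ = _ := by rw [hexp, mul_pow]; field_simp

theorem isLittleO_holF_three (Y : CYFamily) (a : ℂ) {α β : ℝ} (hα : -(3 * Real.pi / 2) < α)
    (hβ : β < 3 * Real.pi / 2) (N : ℕ) :
    (fun ζ => Y.holF a Y.normConst ζ 3 -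
      ∑ n ∈ Finset.range N, Y.psiTerm a Y.conifoldCoeff n ζ 3) =o[sectorAtInfinity α β]
        fun ζ => exp (-Y.conifold * exp ζ) * exp (-(N + 1) * ζ) := by
  have hpi := Real.pi_pos
  -- Three rays, of arguments `π - δ`, `0` and `-(π - δ)`, cover the sector. The overlaps lie at `Im
  -- ζ = ∓(π/2 - δ/2)`, and `2δ` is the margin that the outer rays need at `α` and `β`.
  obtain ⟨δ, hδ, hδ', hα', hβ'⟩ : ∃ δ > 0, δ < Real.pi / 2 ∧ -(3 * Real.pi / 2) + 2 * δ ≤ α ∧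
      β ≤ 3 * Real.pi / 2 - 2 * δ := by
    refine ⟨min (Real.pi / 4) (min ((α + 3 * Real.pi / 2) / 2) ((3 * Real.pi / 2 - β) / 2)),
      lt_min (by positivity) (lt_min (by linarith) (by linarith)),
      (min_le_left _ _).trans_lt (by linarith), ?_, ?_⟩
    · have := (min_le_right (Real.pi / 4) _).trans
        (min_le_left ((α + 3 * Real.pi / 2) / 2) ((3 * Real.pi / 2 - β) / 2))
      linarith
    · have := (min_le_right (Real.pi / 4) _).trans
        (min_le_right ((α + 3 * Real.pi / 2) / 2) ((3 * Real.pi / 2 - β) / 2))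
      linarith
  obtain ⟨D₁, h₁⟩ := Y.exists_holF_three_bound a (φ := Real.pi - δ)
    (by rw [abs_lt]; constructor <;> linarith) (α := α) (β := -(Real.pi / 2 - δ / 2))
    (by linarith) (by linarith) N
  obtain ⟨D₂, h₂⟩ := Y.exists_holF_three_bound a (φ := 0) (by simpa using hpi)
    (α := -(Real.pi / 2 - δ / 2)) (β := Real.pi / 2 - δ / 2) (by linarith) (by linarith) N
  obtain ⟨D₃, h₃⟩ := Y.exists_holF_three_bound a (φ := -(Real.pi - δ))
    (by rw [abs_lt]; constructor <;> linarith) (α := Real.pi / 2 - δ / 2) (β := β)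
    (by linarith) (by linarith) N
  refine isLittleO_sectorAtInfinity (A := 0) (C := max D₁ (max D₂ D₃)) (δ := 1) one_pos
    fun ζ _ h4 h5 => ?_
  have key : ∀ D ≤ max D₁ (max D₂ D₃), D * Real.exp (-(N + 2) * ζ.re) *
      ‖exp (-Y.conifold * exp ζ)‖ ≤ max D₁ (max D₂ D₃) * Real.exp (-1 * ζ.re) *
        ‖exp (-Y.conifold * exp ζ) * exp (-(N + 1) * ζ)‖ := fun D hD => by
    have e : ‖exp (-(N + 1) * ζ)‖ = Real.exp (-(N + 1) * ζ.re) := by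
      rw [norm_exp]; congr 1; simp
    have e2 : Real.exp (-(N + 2) * ζ.re) =
        Real.exp (-1 * ζ.re) * Real.exp (-(N + 1) * ζ.re) := by
      rw [← Real.exp_add]; congr 1; ring
    rw [norm_mul, e, e2]
    calc _ ≤ max D₁ (max D₂ D₃) * (Real.exp (-1 * ζ.re) * Real.exp (-(N + 1) * ζ.re)) *
          ‖exp (-Y.conifold * exp ζ)‖ := by gcongr
      _ = _ := by ring
  rcases le_total ζ.im (-(Real.pi / 2 - δ / 2)) with h | h
  · exact (h₁ ζ h4 h).trans (key _ (le_max_left _ _))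
  rcases le_total ζ.im (Real.pi / 2 - δ / 2) with h' | h'
  · exact (h₂ ζ h h').trans (key _ ((le_max_left _ _).trans (le_max_right _ _)))
  · exact (h₃ ζ h' h5).trans (key _ ((le_max_right _ _).trans (le_max_right _ _)))

end CYFamily

namespace CYFamily

open MeasureTheory Complex Set

/-! ### Asymptotic expansions along the positive real direction -/

/-- The first `N` terms of the formal series `∑ₑ h(e) z ^ e` with leading exponent `E`. -/
def truncSeries (E : ℤ) (h : ℤ → ℂ) (N : ℕ) (ζ : ℂ) : ℂ :=
  ∑ n ∈ Finset.range N, h (E - n) * exp ((E - n : ℂ) * ζ)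

/-- `H` has the asymptotic expansion `∑ₑ h(e) z ^ e`, with leading exponent at most `E`, in a
neighbourhood of the positive real direction. -/
structure HasExpansion (E : ℤ) (H : ℂ → ℂ) (h : ℤ → ℂ) : Prop where
  diff : Differentiable ℂ H
  supp : ∀ e, E < e → h e = 0
  bound : ∀ r < (1 : ℝ), ∀ N : ℕ, ∃ C R : ℝ, 0 ≤ R ∧ ∀ ζ : ℂ, R ≤ ζ.re → |ζ.im| ≤ r →
    ‖H ζ - truncSeries E h N ζ‖ ≤ C * Real.exp ((E - N) * ζ.re)

variable {E : ℤ} {H G : ℂ → ℂ} {h g : ℤ → ℂ}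

theorem HasExpansion.add (hH : HasExpansion E H h) (hG : HasExpansion E G g) :
    HasExpansion E (fun ζ => H ζ + G ζ) fun e => h e + g e := by
  refine ⟨hH.diff.add hG.diff, fun e he => by rw [hH.supp e he, hG.supp e he, add_zero],
    fun r hr N => ?_⟩
  obtain ⟨C₁, R₁, hR₁, h₁⟩ := hH.bound r hr N
  obtain ⟨C₂, R₂, _, h₂⟩ := hG.bound r hr N
  refine ⟨C₁ + C₂, max R₁ R₂, hR₁.trans (le_max_left _ _), fun ζ h1 h2 => ?_⟩
  have e1 : H ζ + G ζ - truncSeries E (fun e => h e + g e) N ζ =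
      (H ζ - truncSeries E h N ζ) + (G ζ - truncSeries E g N ζ) := by
    simp only [truncSeries, add_mul, Finset.sum_add_distrib]; ring
  rw [e1, add_mul]
  exact (norm_add_le _ _).trans (add_le_add (h₁ ζ ((le_max_left _ _).trans h1) h2)
    (h₂ ζ ((le_max_right _ _).trans h1) h2))

theorem HasExpansion.const_mul (hH : HasExpansion E H h) (c : ℂ) :
    HasExpansion E (fun ζ => c * H ζ) fun e => c * h e := by
  refine ⟨hH.diff.const_mul c, fun e he => by rw [hH.supp e he, mul_zero], fun r hr N => ?_⟩
  obtain ⟨C, R, hR, hb⟩ := hH.bound r hr N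
  refine ⟨‖c‖ * C, R, hR, fun ζ h1 h2 => ?_⟩
  have e1 : c * H ζ - truncSeries E (fun e => c * h e) N ζ = c * (H ζ - truncSeries E h N ζ) := by
    simp only [truncSeries, mul_assoc, mul_sub, Finset.mul_sum]
  rw [e1, norm_mul, mul_assoc]
  gcongr
  exact hb ζ h1 h2

theorem HasExpansion.exp_mul (hH : HasExpansion E H h) :
    HasExpansion (E + 1) (fun ζ => exp ζ * H ζ) fun e => h (e - 1) := by
  refine ⟨Complex.differentiable_exp.mul hH.diff, fun e he => hH.supp _ (by linarith),
    fun r hr N => ?_⟩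
  obtain ⟨C, R, hR, hb⟩ := hH.bound r hr N
  refine ⟨C, R, hR, fun ζ h1 h2 => ?_⟩
  have e1 : exp ζ * H ζ - truncSeries (E + 1) (fun e => h (e - 1)) N ζ =
      exp ζ * (H ζ - truncSeries E h N ζ) := by
    rw [truncSeries, truncSeries, mul_sub, Finset.mul_sum]
    congr 1
    refine Finset.sum_congr rfl fun n _ => ?_
    have h3 : E + 1 - (n : ℤ) - 1 = E - n := by ring
    have h4 : exp (((E + 1 : ℤ) - n : ℂ) * ζ) = exp ζ * exp ((E - n : ℂ) * ζ) := by
      rw [← Complex.exp_add]; congr 1; push_cast; ring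
    rw [h3, h4]
    ring
  rw [e1, norm_mul, norm_exp]
  calc _ ≤ Real.exp ζ.re * (C * Real.exp ((E - N) * ζ.re)) := by gcongr; exact hb ζ h1 h2
    _ = C * (Real.exp ζ.re * Real.exp ((E - N) * ζ.re)) := by ring
    _ = _ := by rw [← Real.exp_add]; congr 2; push_cast; ring

theorem HasExpansion.raise (hH : HasExpansion E H h) : HasExpansion (E + 1) H h := by
  refine ⟨hH.diff, fun e he => hH.supp _ (by linarith), fun r hr N => ?_⟩
  cases N with
  | zero =>
    obtain ⟨C, R, hR, hb⟩ := hH.bound r hr 0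
    refine ⟨|C|, R, hR, fun ζ h1 h2 => ?_⟩
    have h3 := hb ζ h1 h2
    simp only [truncSeries, Finset.range_zero, Finset.sum_empty, Nat.cast_zero, sub_zero] at h3 ⊢
    refine h3.trans ?_
    push_cast
    have h5 : 0 ≤ ζ.re := hR.trans h1
    gcongr
    · exact le_abs_self C
    · linarith
  | succ N =>
    obtain ⟨C, R, hR, hb⟩ := hH.bound r hr N
    refine ⟨C, R, hR, fun ζ h1 h2 => ?_⟩
    have e1 : truncSeries (E + 1) h (N + 1) ζ = truncSeries E h N ζ := by
      rw [truncSeries, Finset.sum_range_succ', truncSeries, hH.supp _ (by simp), zero_mul, add_zero]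
      refine Finset.sum_congr rfl fun n _ => ?_
      have h3 : E + 1 - ((n + 1 : ℕ) : ℤ) = E - n := by push_cast; ring
      have h4 : ((E + 1 : ℤ) - (n + 1 : ℕ) : ℂ) = E - n := by push_cast; ring
      rw [h3, h4]
    have e2 : (((E + 1 : ℤ) : ℝ) - (N + 1 : ℕ)) = E - N := by push_cast; ring
    rw [e1, e2]
    exact hb ζ h1 h2

/-- Cauchy's estimate on a disc of fixed radius in the logarithmic coordinate preserves the order of
the error. It consumes part of the strip, which is why the expansion is required for every `r < 1`.
-/
theorem HasExpansion.deriv (hH : HasExpansion E H h) :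
    HasExpansion E (deriv H) fun e => e * h e := by
  have hd : Differentiable ℂ (_root_.deriv H) := fun ζ =>
    ((hH.diff.differentiableOn (s := univ)).deriv isOpen_univ).differentiableAt univ_mem
  refine ⟨hd, fun e he => by rw [hH.supp e he, mul_zero], fun r hr N => ?_⟩
  set ρ := (1 - r) / 2 with hρ
  have hρ0 : 0 < ρ := by rw [hρ]; linarith
  obtain ⟨C, R, hR, hb⟩ := hH.bound (r + ρ) (by rw [hρ]; linarith) N
  refine ⟨|C| * Real.exp (|(E : ℝ) - N| * ρ) / ρ, R + ρ, by positivity, fun ζ h1 h2 => ?_⟩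
  have hS : HasDerivAt (truncSeries E h N) (truncSeries E (fun e => e * h e) N ζ) ζ := by
    unfold truncSeries
    refine HasDerivAt.fun_sum fun n _ => ?_
    have := (((hasDerivAt_id ζ).const_mul (E - n : ℂ)).cexp).const_mul (h (E - n))
    refine this.congr_deriv ?_
    simp only [id, mul_one]
    push_cast
    ring
  have hSd : Differentiable ℂ (truncSeries E h N) := by unfold truncSeries; fun_prop
  have hder : _root_.deriv (fun w => H w - truncSeries E h N w) ζ =
      _root_.deriv H ζ - truncSeries E (fun e => e * h e) N ζ := by
    rw [deriv_fun_sub (hH.diff ζ) (hSd ζ), hS.deriv]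
  rw [← hder]
  refine (Complex.norm_deriv_le_of_forall_mem_sphere_norm_le hρ0
    (C := |C| * Real.exp (|(E : ℝ) - N| * ρ) * Real.exp ((E - N) * ζ.re))
    (hH.diff.sub hSd).diffContOnCl fun w hw => ?_).trans_eq (by ring)
  have hw' : ‖w - ζ‖ = ρ := mem_sphere_iff_norm.1 hw
  have hre := (abs_re_le_norm (w - ζ)).trans_eq hw'
  have him := (abs_im_le_norm (w - ζ)).trans_eq hw'
  rw [sub_re] at hre
  rw [sub_im] at him
  have h3 := hb w (by linarith [(abs_le.1 hre).1]) (by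
    have : w.im = ζ.im + (w.im - ζ.im) := by ring
    rw [this]
    exact (abs_add_le _ _).trans (add_le_add h2 him))
  refine h3.trans ?_
  rw [mul_assoc, ← Real.exp_add]
  gcongr
  · exact le_abs_self C
  · have h4 : ((E : ℝ) - N) * (w.re - ζ.re) ≤ |(E : ℝ) - N| * ρ :=
      (le_abs_self _).trans (by rw [abs_mul]; gcongr)
    linarith

theorem HasExpansion.eq_zero (hH : HasExpansion E (fun _ => 0) h) : h = 0 := by
  have key : ∀ N : ℕ, ∀ n < N, h (E - n) = 0 := fun N => by
    induction N with
    | zero => intro n hn; omega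
    | succ N ih =>
      intro n hn
      rcases Nat.lt_succ_iff_lt_or_eq.1 hn with h1 | rfl
      · exact ih n h1
      obtain ⟨C, R, hR, hb⟩ := hH.bound 0 one_pos (n + 1)
      have h2 : Tendsto (fun x : ℝ => C * Real.exp (-x)) atTop (𝓝 0) := by
        simpa using (Real.tendsto_exp_neg_atTop_nhds_zero).const_mul C
      refine norm_le_zero_iff.1 (ge_of_tendsto h2 ?_)
      filter_upwards [eventually_ge_atTop R] with x hx
      have h3 := hb x (by simpa using hx) (by simp)
      rw [truncSeries, Finset.sum_range_succ, Finset.sum_eq_zero fun k hk => by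
        rw [ih k (Finset.mem_range.1 hk), zero_mul]] at h3
      have h4 : ((E - n : ℂ) * (x : ℂ)).re = (E - n) * x := by simp
      rw [zero_add, zero_sub, norm_neg, norm_mul, norm_exp, h4, ofReal_re] at h3
      have h5 : Real.exp ((E - (n + 1 : ℕ)) * x) = Real.exp (-x) * Real.exp ((E - n) * x) := by
        rw [← Real.exp_add]; congr 1; push_cast; ring
      rw [h5, ← mul_assoc] at h3
      exact le_of_mul_le_mul_right h3 (Real.exp_pos _)
  funext e
  rcases lt_or_ge E e with he | he
  · exact hH.supp e he
  · have := key ((E - e).toNat + 1) (E - e).toNat (by omega)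
    rwa [Int.toNat_of_nonneg (by omega), sub_sub_cancel] at this

/-! ### The conjugated equation -/

/-- The operator `p θ_z + q` conjugated by `exp (-x_c z)`. -/
def conjEuler (Y : CYFamily) (p q : ℂ) (H : ℂ → ℂ) : ℂ → ℂ :=
  fun ζ => p * deriv H ζ + (-(p * Y.conifold)) * (exp ζ * H ζ) + q * H ζ

theorem HasExpansion.conjEuler (hH : HasExpansion E H h) (Y : CYFamily) (p q : ℂ) :
    HasExpansion (E + 1) (Y.conjEuler p q H) (Y.conjOp p q h) := by
  have := ((hH.deriv.raise.const_mul p).add (hH.exp_mul.const_mul (-(p * Y.conifold)))).add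
    (hH.raise.const_mul q)
  refine ⟨this.diff, fun e he => ?_, fun r hr N => ?_⟩
  · have := this.supp e he
    rw [conjOp, ← this]; ring
  · have h2 : Y.conjOp p q h = fun e : ℤ =>
        p * (e * h e) + -(p * Y.conifold) * h (e - 1) + q * h e := by
      funext e; rw [conjOp]; ring
    rw [h2]
    exact this.bound r hr N

theorem eulerOp_exp_mul (Y : CYFamily) (p q : ℂ) (hH : Differentiable ℂ H) :
    eulerOp p q (fun ζ => exp (-Y.conifold * exp ζ) * H ζ) =
      fun ζ => exp (-Y.conifold * exp ζ) * Y.conjEuler p q H ζ := by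
  funext ζ
  have h1 : HasDerivAt (fun ζ => exp (-Y.conifold * exp ζ) * H ζ)
      (exp (-Y.conifold * exp ζ) * (-Y.conifold * exp ζ) * H ζ +
        exp (-Y.conifold * exp ζ) * deriv H ζ) ζ :=
    (((Complex.hasDerivAt_exp ζ).const_mul (-Y.conifold : ℂ)).cexp).mul (hH ζ).hasDerivAt
  rw [eulerOp, h1.deriv, conjEuler]
  ring

/-- The conjugated operators act on the function and on its expansion alike. `z` times three of them
and the product of the four others both have leading exponent at most `E + 4`, so the equation
yields an expansion of the zero function, and expansions are unique. -/
theorem conjOp_eq_zero_of_isLaplaceSolution (Y : CYFamily) (hH : HasExpansion E H h)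
    (hL : Y.IsLaplaceSolution fun ζ => exp (-Y.conifold * exp ζ) * H ζ) (e : ℤ) :
    ((Y.conjOp 1 1)^[3] h) (e - 1) +
      Y.prefactor * (Y.residues.foldr (fun (j : ℕ) G => Y.conjOp Y.degree j G) h) e = 0 := by
  have hf : ∀ l : List ℕ,
      HasExpansion (E + l.length) (l.foldr (fun (j : ℕ) G => Y.conjEuler Y.degree j G) H)
        (l.foldr (fun (j : ℕ) G => Y.conjOp Y.degree j G) h) ∧
      (l.foldr (fun (j : ℕ) G => eulerOp Y.degree j G)
        fun ζ => exp (-Y.conifold * exp ζ) * H ζ) = fun ζ => exp (-Y.conifold * exp ζ) *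
          (l.foldr (fun (j : ℕ) G => Y.conjEuler Y.degree j G) H) ζ := fun l => by
    induction l with
    | nil => simpa using hH
    | cons j l ih =>
      simp only [List.foldr_cons, List.length_cons]
      refine ⟨?_, ?_⟩
      · have := ih.1.conjEuler Y Y.degree j
        rw [add_assoc] at this
        exact_mod_cast this
      · rw [ih.2, eulerOp_exp_mul Y _ _ ih.1.diff]
  have h1 := hH.conjEuler Y 1 1
  have h2 := h1.conjEuler Y 1 1
  have h3 := h2.conjEuler Y 1 1
  have hlen : Y.residues.length = 4 := by cases Y <;> rfl
  obtain ⟨h4, h5⟩ := hf Y.residues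
  have hE4 : E + ((4 : ℕ) : ℤ) = E + 1 + 1 + 1 + 1 := by push_cast; ring
  rw [hlen, hE4] at h4
  have h6 := h3.exp_mul.add (h4.const_mul Y.prefactor)
  have h7 : (fun ζ => exp ζ * Y.conjEuler 1 1 (Y.conjEuler 1 1 (Y.conjEuler 1 1 H)) ζ +
      Y.prefactor * (Y.residues.foldr (fun (j : ℕ) G => Y.conjEuler Y.degree j G) H) ζ) =
      fun _ => 0 := by
    funext ζ
    have h8 := hL.2 ζ
    rw [h5, Function.iterate_succ_apply', Function.iterate_succ_apply', Function.iterate_one,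
      eulerOp_exp_mul Y _ _ hH.diff, eulerOp_exp_mul Y _ _ h1.diff,
      eulerOp_exp_mul Y _ _ h2.diff] at h8
    refine (mul_eq_zero.1 (?_ : exp (-Y.conifold * exp ζ) * _ = 0)).resolve_left (exp_ne_zero _)
    rw [← h8]
    ring
  rw [h7] at h6
  exact congrFun h6.eq_zero e

theorem tailSeries_neg (C : ℕ → ℂ) (n : ℕ) : tailSeries C (-2 - n) = C n := by
  have h1 : (-2 - (n : ℤ)) ≤ -2 := by omega
  have h2 : (-2 - (-2 - (n : ℤ))).toNat = n := by omega
  rw [tailSeries, if_pos h1, h2]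

/-- No recurrence for the Taylor coefficients of the period is needed: `exp(x_c z) f₄`, suitably
normalised, has this series as its expansion, and `f₄` solves the equation. -/
theorem isConifoldSeries_conifoldCoeff (Y : CYFamily) : Y.IsConifoldSeries Y.conifoldCoeff := by
  have hpi := Real.pi_gt_three
  refine ⟨Y.conifoldCoeff_zero, ?_⟩
  set v := Y.conifoldTaylor.coeff 1 with hv
  have hv0 : v ≠ 0 := Y.conifoldTaylor_coeff_one_ne_zero
  set H : ℂ → ℂ := fun ζ => v⁻¹ * (exp (Y.conifold * exp ζ) * Y.holF 0 Y.normConst ζ 3) with hH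
  have hd : Differentiable ℂ H := by
    have := Y.differentiable_holF 0 3
    fun_prop
  have hexp : ∀ ζ : ℂ, exp (Y.conifold * exp ζ) * exp (-Y.conifold * exp ζ) = 1 := fun ζ => by
    rw [← Complex.exp_add]; simp
  have hE : HasExpansion (-2) H (tailSeries Y.conifoldCoeff) := by
    refine ⟨hd, fun e he => if_neg (not_le.2 he), fun r hr N => ?_⟩
    obtain ⟨D, hD⟩ := Y.exists_holF_three_bound 0 (φ := 0) (by simpa using Real.pi_pos)
      (α := -1) (β := 1) (by linarith) (by linarith) N
    refine ⟨‖v⁻¹‖ * D, 0, le_rfl, fun ζ _ h2 => ?_⟩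
    have h3 := hD ζ (by linarith [(abs_le.1 h2).1]) (by linarith [(abs_le.1 h2).2])
    have h4 : H ζ - truncSeries (-2) (tailSeries Y.conifoldCoeff) N ζ =
        v⁻¹ * exp (Y.conifold * exp ζ) * (Y.holF 0 Y.normConst ζ 3 -
          ∑ n ∈ Finset.range N, Y.psiTerm 0 Y.conifoldCoeff n ζ 3) := by
      simp only [hH, mul_sub, truncSeries, tailSeries_neg, Finset.mul_sum, psiTerm_three]
      congr 1
      · ring
      · refine Finset.sum_congr rfl fun n _ => ?_
        have e : (((-2 : ℤ) : ℂ) - n) * ζ = -((n + 1 : ℕ) + 1) * ζ := by push_cast; ring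
        rw [e, conifoldCoeff]
        linear_combination (-v⁻¹ * Y.conifoldTaylor.coeff (n + 1) * (n + 1).factorial *
          exp (-((n + 1 : ℕ) + 1) * ζ)) * hexp ζ
    have h5 : ‖exp (Y.conifold * exp ζ)‖ * ‖exp (-Y.conifold * exp ζ)‖ = 1 := by
      rw [← norm_mul, hexp, norm_one]
    have h6 : Real.exp (((-2 : ℤ) - N : ℝ) * ζ.re) = Real.exp (-(N + 2) * ζ.re) := by
      congr 1; push_cast; ring
    rw [h4, norm_mul, norm_mul, h6]
    calc _ ≤ ‖v⁻¹‖ * ‖exp (Y.conifold * exp ζ)‖ *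
          (D * Real.exp (-(N + 2) * ζ.re) * ‖exp (-Y.conifold * exp ζ)‖) := by gcongr
      _ = _ := by linear_combination ‖v⁻¹‖ * D * Real.exp (-(N + 2) * ζ.re) * h5
  refine Y.conjOp_eq_zero_of_isLaplaceSolution hE ?_
  have h1 : (fun ζ => exp (-Y.conifold * exp ζ) * H ζ) =
      fun ζ => ∑ i, (v⁻¹ * Y.kernVal 0 i 3) * Y.localSol i ζ := by
    funext ζ
    simp only [hH, mul_assoc, ← Finset.mul_sum, ← holF_eq]
    linear_combination v⁻¹ * Y.holF 0 Y.normConst ζ 3 * hexp ζ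
  rw [h1]
  exact Y.isLaplaceSolution_sum Y.isLaplaceSolution_localSol _

theorem IsConifoldSeries.unique (Y : CYFamily) {C C' : ℕ → ℂ} (hC : Y.IsConifoldSeries C)
    (hC' : Y.IsConifoldSeries C') : C = C' := by
  have key : ∀ N : ℕ, ∀ n < N, C n = C' n := fun N => by
    induction N with
    | zero => intro n hn; omega
    | succ N ih =>
      intro n hn
      rcases Nat.lt_succ_iff_lt_or_eq.1 hn with h1 | rfl
      · exact ih n h1
      cases n with
      | zero => rw [hC.1, hC'.1]
      | succ n =>
        have h3 : ∀ k ≤ n, tailSeries C (-2 - k) = tailSeries C' (-2 - k) := fun k hk => by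
          rw [tailSeries_neg, tailSeries_neg, ih k (by omega)]
        have e0 : tailSeries C (-n : ℤ) = tailSeries C' (-n : ℤ) := by
          rcases lt_or_ge n 2 with h | h
          · rw [tailSeries, tailSeries, if_neg (by omega), if_neg (by omega)]
          · have := h3 (n - 2) (by omega)
            rwa [show (-2 - ((n - 2 : ℕ) : ℤ)) = -n by omega] at this
        have e1 : tailSeries C (-n - 1 : ℤ) = tailSeries C' (-n - 1 : ℤ) := by
          rcases lt_or_ge n 1 with h | h
          · rw [tailSeries, tailSeries, if_neg (by omega), if_neg (by omega)]
          · have := h3 (n - 1) (by omega)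
            rwa [show (-2 - ((n - 1 : ℕ) : ℤ)) = -n - 1 by omega] at this
        have e2 : tailSeries C (-n - 1 - 1 : ℤ) = tailSeries C' (-n - 1 - 1 : ℤ) := by
          have := h3 n le_rfl
          rwa [show (-2 - (n : ℤ)) = -n - 1 - 1 by ring] at this
        have e3 : ∀ C : ℕ → ℂ, tailSeries C (-n - 1 - 1 - 1 : ℤ) = C (n + 1) := fun C => by
          rw [← tailSeries_neg C (n + 1)]; congr 1; push_cast; ring
        -- In the coefficient of `z^{-n}` the entry `C (n + 2)` cancels because `μ d⁴ x_c = 1`. The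
        -- entry `C (n + 1)` has coefficient `x_c² (n + 1)`, so it is determined by the earlier
        -- ones.
        have h := hC.2 (-n)
        have h' := hC'.2 (-n)
        have key : (n + 1 : ℂ) * (C (n + 1) - C' (n + 1)) = 0 := by
          cases Y <;>
          · simp only [Function.iterate_succ, Function.iterate_zero, Function.comp_apply, id_eq,
              residues, List.foldr_cons, List.foldr_nil, conjOp, e0, e1, e2, e3, degree, prefactor,
              conifold] at h h'
            push_cast at h h'
            first
            | linear_combination (5 ^ 5 : ℂ) ^ 2 * (h - h')
            | linear_combination (2 ^ 4 * 3 ^ 6 : ℂ) ^ 2 * (h - h')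
            | linear_combination (2 ^ 16 : ℂ) ^ 2 * (h - h')
            | linear_combination (2 ^ 8 * 5 ^ 5 : ℂ) ^ 2 * (h - h')
        have hn : (n + 1 : ℂ) ≠ 0 := by exact_mod_cast n.succ_ne_zero
        exact sub_eq_zero.1 ((mul_eq_zero.1 key).resolve_left hn)
  funext n
  exact key (n + 1) n (Nat.lt_succ_self n)

end CYFamily

end

/-! ### Assembly of the proposition -/

theorem mainTheorem2 (Y : CYFamily) (a : ℂ) :
    ∃ (C : ℕ → ℂ) (cN : ℂ) (M₀ MCon : Matrix (Fin 4) (Fin 4) ℂ),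
      -- the formal solutions `Ψ` and their monodromy `L`
      (∀ C' : ℕ → ℂ, Y.IsConifoldSeries C' ↔ C' = C) ∧
      (∀ L : Matrix (Fin 4) (Fin 4) ℂ, Y.IsFormalMonodromy a C L ↔ L = Y.matL a) ∧
      -- the holomorphic solutions `Φ_{l+mπ}` with `Φ_{l+mπ} ∼ Ψ` on `Ξ_{l+mπ}`
      (∀ m : ℤ, (∀ k : Fin 4, Y.IsLaplaceSolution fun ζ => Y.holPhi a cN m ζ k) ∧
        Y.IsAsymptoticTo a C m (Y.holPhi a cN m)) ∧
      -- their Stokes matrices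
      (∀ Kbar K : Matrix (Fin 4) (Fin 4) ℂ,
        AreStokesMatrices (Y.holPhi a cN) (Y.matL a) Kbar K ↔ Kbar = Y.matKRbar a ∧ K = matKR) ∧
      -- the monodromy matrices of the periods about `x = 0` and `x = x_c`
      (∀ x₀ : ℝ, 0 < x₀ → x₀ < Y.conifold → ∀ M : Matrix (Fin 4) (Fin 4) ℂ,
        (HasMonodromy (circleLoop 0 x₀) (Y.periods a) M ↔ M = M₀) ∧
        (HasMonodromy (circleLoop Y.conifold x₀) (Y.periods a) M ↔ M = MCon)) ∧
      -- the relations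
      matKR = MCon ∧ Y.matKRbar a * Y.matL a = M₀ := by
  refine ⟨Y.conifoldCoeff, Y.normConst, Y.matKRbar a * Y.matL a, matKR, fun C' => ⟨fun h => ?_, ?_⟩,
    fun L => ⟨fun h => ?_, ?_⟩, fun m => ⟨fun k => ?_, ?_⟩, fun Kbar K => ?_,
    fun x₀ h0 h1 M => ⟨⟨fun h => ?_, ?_⟩, ⟨fun h => ?_, ?_⟩⟩, rfl, rfl⟩
  · exact h.unique Y Y.isConifoldSeries_conifoldCoeff
  · rintro rfl
    exact Y.isConifoldSeries_conifoldCoeff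
  · exact Y.isFormalMonodromy_unique a Y.conifoldCoeff_zero h (Y.isFormalMonodromy_matL a _)
  · rintro rfl
    exact Y.isFormalMonodromy_matL a _
  · exact Y.isLaplaceSolution_holPhi a m k
  · exact Y.isAsymptoticTo_holPhi a _ (fun _ _ hα hβ N => Y.isLittleO_holF_three a hα hβ N) m
  · exact Y.areStokesMatrices_iff a Kbar K
  · exact Y.hasMonodromy_unique a h0 h1 h (Y.hasMonodromy_zero a h0 h1)
  · rintro rfl
    exact Y.hasMonodromy_zero a h0 h1
  · exact Y.hasMonodromy_unique a h0 h1 h (Y.hasMonodromy_conifold a h0 h1)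
  · rintro rfl
    exact Y.hasMonodromy_conifold a h0 h1
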